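/- **Setting.** Let $P$ be a function that is differentiable at $1$ with $P'(1)>0$. Put $M(v)=(2\pi)^{-3/2}e^{-|v|^2/2}$, $\nu(v)=1+|v|^2$, $\mathcal L f=M^{-1/2}\,\mathrm{div}_v\big[M\nabla_v(f/\sqrt M)\big]$, $b^f(x)=\int_{\mathbb R^3} v\sqrt M f(x,v)\,dv$, $\mathbf P_0 g=\big(\int\sqrt M g\,dv\big)\sqrt M$ and $\mathbf P g=\mathbf P_0g+\big(\int v\sqrt M g\,dv\big)\cdot v\sqrt M$. Consider on $\mathbb R^3_x\times\mathbb R^3_v$ the linearized Euler–Vlasov–Fokker–Planck system $$\partial_t\varrho+\mathrm{div}\,u=0,\qquad \partial_tu+P'(1)\nabla\varrho-(b^f-u)=0,\qquad \partial_tf+v\cdot\nabla_xf-u\cdot v\sqrt M-\mathcal Lf=S_f,$$ $$S_f=\mathrm{div}_vG-\tfrac12 v\cdot G+h ,\qquad (\varrho,u,f)|_{t=0}=U_0=(\varrho_0,u_0,f_0),$$ for (real or) complex valued unknowns, where $G=G(t,x,v)$ (a vector with three components) and $h=h(t,x,v)$ are measurable, $\mathbf P_0G=0$, $\mathbf Ph=0$,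 and $\int_0^T\|(G,\nu^{-1/2}h)(s)\|_{\mathcal Z_2}^2ds<\infty$ for all $T$. Here, for $p\ge1$, $\|g\|_{Z_p}=\|g\|_{L^2_v(L^p_x)}$, $\|(\varrho,u,f)\|_{\mathcal Z_p}=\|f\|_{Z_p}+\|\varrho\|_{L^p}+\|u\|_{L^p}$ and $\|(G,\nu^{-1/2}h)\|_{\mathcal Z_p}=\|G\|_{Z_p}+\|\nu^{-1/2}h\|_{Z_p}$. The derivatives $\partial^\alpha$ are weak derivatives in $x$, and $\|\partial^\alpha U\|_{\mathcal Z_p}=\infty$ if $\partial^\alpha U$ does not exist as a locally integrable function. For every $U_0\in L^2_x\times L^2_x\times L^2_{x,v}$ and all such $G,h$ this problem has a unique solution $U=(\varrho,u,f)$ in $C([0,\infty);L^2_x\times L^2_x\times L^2_{x,v})$ in the sense of tempered distributions. Let $\mathbb A(t)U_0$ be the solution at time $t$ for $S_f=0$. Let $\int_0^t\mathbb A(t-s)(0,0,S_f(s))\,ds$ be the solution at time $t$ for $U_0=0$; it is this Bochner integral whenever $S_f\in L^1_{loc}([0,\infty);L^2_{x,v})$. For $r_0>0$ fix a smooth $\phi_0:\mathbb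 R^3\to[0,1]$ with $\phi_0(\xi)=1$ for $|\xi|\le r_0/2$ and $\phi_0(\xi)=0$ for $|\xi|>r_0$, and let $g^L=\phi_0(D_x)g$ be the low-frequency part of $g$, where $\phi_0(D_x)$ is the Fourier multiplier in $x$ with symbol $\phi_0$ (for the convention $\widehat g(\xi)=\int e^{-ix\cdot\xi}g(x)\,dx$). In particular $S_f^L=\mathrm{div}_vG^L-\frac12v\cdot G^L+h^L$. **Theorem 5.1.** The well-posedness and the identification of the Duhamel term just stated hold. Moreover, let $1\le p\le2$, let $\alpha'\le\alpha$ be multi-indices and $m=|\alpha-\alpha'|$. Then there is a constant $C$, depending only on $P'(1),p,\alpha,\alpha'$, such that for all $U_0\in L^2_x\times L^2_x\times L^2_{x,v}$, all $G,h$ as above and all $t\ge0$ $$\|\partial^\alpha\mathbb A(t)U_0\|_{\mathcal Z_2}\le C(1+t)^{-\frac32(\frac1p-\frac12)-\frac m2}\big(\|\partial^{\alpha'}U_0\|_{\mathcal Z_p}+\|\partial^\alpha U_0\|_{\mathcal Z_2}\big),$$ $$\Big\|\partial^\alpha\!\int_0^t\!\mathbb A(t-s)(0,0,S_f(s))\,ds\Big\|_{\mathcal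 Z_2}^2\le C\int_0^t(1+t-s)^{-3(\frac1p-\frac12)-m}\Big(\big\|\partial^{\alpha'}(G,\nu^{-1/2}h)(s)\big\|_{\mathcal Z_p}^2+\big\|\partial^{\alpha}(G,\nu^{-1/2}h)(s)\big\|_{\mathcal Z_2}^2\Big)ds,$$ and, with a constant $C$ that may also depend on $r_0$ and $\phi_0$, $$\|\partial^\alpha\mathbb A(t)U_0^L\|_{\mathcal Z_2}\le C(1+t)^{-\frac32(\frac1p-\frac12)-\frac m2}\,\|\partial^{\alpha'}U_0\|_{\mathcal Z_p},$$ $$\Big\|\partial^\alpha\!\int_0^t\!\mathbb A(t-s)(0,0,S^L_f(s))\,ds\Big\|_{\mathcal Z_2}^2\le C\int_0^t(1+t-s)^{-3(\frac1p-\frac12)-m}\big\|\partial^{\alpha'}(G,\nu^{-1/2}h)(s)\big\|_{\mathcal Z_p}^2\,ds .$$ -/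

import Mathlib

open MeasureTheory Set
open scoped ENNReal ContDiff SchwartzMap

noncomputable section

namespace EulerVFP

/-- Physical space and velocity space. -/
abbrev R3 := EuclideanSpace ℝ (Fin 3)

/-- Values of the fluid velocity. All unknowns are complex valued, which contains the real case. -/
abbrev C3 := EuclideanSpace ℂ (Fin 3)

/-! ### Partial derivatives and weak derivatives in the space variable -/

section Derivatives

variable {E : Type*} [NormedAddCommGroup E]

/-- The classical partial derivative in the `i`-th direction. -/
def pderiv [NormedSpace ℝ E] (i : Fin 3) (g : R3 → E) (x : R3) : E :=
  fderiv ℝ g x (EuclideanSpace.single i 1)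

/-- The classical derivative of multi-index `α`. -/
def multiDeriv [NormedSpace ℝ E] (α : Fin 3 → ℕ) (g : R3 → E) : R3 → E :=
  (pderiv 0)^[α 0] ((pderiv 1)^[α 1] ((pderiv 2)^[α 2] g))

/-- The length of a multi-index. -/
def multiLength (α : Fin 3 → ℕ) : ℕ := ∑ i, α i

/-- `w` is the weak derivative of multi-index `α` of the function `g` of `x`. -/
structure IsWeakDerivX [NormedSpace ℂ E] (α : Fin 3 → ℕ) (g w : R3 → E) : Prop where
  locInt_left : LocallyIntegrable g volume
  locInt_right : LocallyIntegrable w volume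
  integral_eq : ∀ ψ : R3 → ℂ, ContDiff ℝ ∞ ψ → HasCompactSupport ψ →
    ∫ x, multiDeriv α ψ x • g x = (-1 : ℂ) ^ multiLength α • ∫ x, ψ x • w x

/-- `w` is the weak derivative in `x` of multi-index `α` of the function `g` of `(x, v)`. -/
structure IsWeakDerivXV [NormedSpace ℂ E] (α : Fin 3 → ℕ) (g w : R3 × R3 → E) : Prop where
  locInt_left : LocallyIntegrable g volume
  locInt_right : LocallyIntegrable w volume
  integral_eq : ∀ ψ : R3 × R3 → ℂ, ContDiff ℝ ∞ ψ → HasCompactSupport ψ →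
    ∫ z : R3 × R3, multiDeriv α (fun y => ψ (y, z.2)) z.1 • g z =
      (-1 : ℂ) ^ multiLength α • ∫ z, ψ z • w z

/-- The norm of `L²_v(L^p_x)`, for real `p ≥ 1`. -/
def kineticNorm (p : ℝ) (g : R3 × R3 → E) : ℝ≥0∞ :=
  (∫⁻ v : R3, (∫⁻ x : R3, ‖g (x, v)‖ₑ ^ p) ^ (2 / p)) ^ (1 / 2 : ℝ)

/-- `‖∂^α g‖_{L^p_x}`, with value `∞` if `g` has no weak derivative `∂^α g`
(which is unique almost everywhere when it exists). -/
def derivNormX [NormedSpace ℂ E] (α : Fin 3 → ℕ) (p : ℝ) (g : R3 → E) : ℝ≥0∞ :=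
  ⨅ (w : R3 → E) (_ : IsWeakDerivX α g w), eLpNorm w (ENNReal.ofReal p) volume

/-- `‖∂_x^α g‖_{L²_v(L^p_x)}`, with value `∞` if `g` has no weak derivative `∂_x^α g`
(which is unique almost everywhere when it exists). -/
def derivNormXV [NormedSpace ℂ E] (α : Fin 3 → ℕ) (p : ℝ) (g : R3 × R3 → E) : ℝ≥0∞ :=
  ⨅ (w : R3 × R3 → E) (_ : IsWeakDerivXV α g w), kineticNorm p w

end Derivatives

/-! ### Triples `(ϱ, u, f)` -/

/-- A triple of functions `(ϱ(x), u(x), f(x, v))`. -/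
structure Fields where
  rho : R3 → ℂ
  u : R3 → C3
  f : R3 × R3 → ℂ

/-- All three components are square integrable. -/
structure Fields.IsL2 (U : Fields) : Prop where
  rho : MemLp U.rho 2 volume
  u : MemLp U.u 2 volume
  f : MemLp U.f 2 volume

/-- The Hilbertizable space `L²_x × L²_x × L²_{x,v}` in which the solutions take their values. -/
abbrev State := Lp ℂ 2 (volume : Measure R3) × Lp C3 2 (volume : Measure R3) ×
  Lp ℂ 2 (volume : Measure (R3 × R3))

/-- The triple of functions given by a state. -/
def State.toFields (U : State) : Fields := ⟨U.1, U.2.1, U.2.2⟩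

/-- `‖∂^α U‖_{𝒵_p}`: the sum of the norms of `∂^α f` in `L²_v(L^p_x)` and of
`∂^α ϱ`, `∂^α u` in `L^p_x`. -/
def Fields.derivNorm (α : Fin 3 → ℕ) (p : ℝ) (U : Fields) : ℝ≥0∞ :=
  derivNormXV α p U.f + derivNormX α p U.rho + derivNormX α p U.u

/-! ### Maxwellian, Fokker-Planck operator, macroscopic projections -/

/-- The Maxwellian `M(v) = (2π)^{-3/2} exp(-|v|²/2)`. -/
def maxwellian (v : R3) : ℝ := (2 * Real.pi) ^ (-(3 / 2) : ℝ) * Real.exp (-‖v‖ ^ 2 / 2)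

/-- `√M`. -/
def sqrtM (v : R3) : ℝ := Real.sqrt (maxwellian v)

/-- The weight `ν(v) = 1 + |v|²`. -/
def nu (v : R3) : ℝ := 1 + ‖v‖ ^ 2

/-- `ℒ q = M^{-1/2} div_v [M ∇_v (q / √M)]`. -/
def fokkerPlanck (q : R3 → ℂ) (v : R3) : ℂ :=
  (sqrtM v)⁻¹ • ∑ i, pderiv i (fun w => maxwellian w • pderiv i (fun y => (sqrtM y)⁻¹ • q y) w) v

/-- `𝐏₀ g = (∫ √M g dv) √M`, acting on each component. -/
def macroP0 {E : Type*} [NormedAddCommGroup E] [NormedSpace ℝ E] (g : R3 → E) (v : R3) : E :=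
  sqrtM v • ∫ w, sqrtM w • g w

/-- `𝐏₁ g = (∫ w √M g dw) · v √M`. -/
def macroP1 (g : R3 → ℂ) (v : R3) : ℂ :=
  ∑ i, (v i * sqrtM v) • ∫ w : R3, (w i * sqrtM w) • g w

/-- `𝐏 = 𝐏₀ + 𝐏₁`. -/
def macroP (g : R3 → ℂ) (v : R3) : ℂ := macroP0 g v + macroP1 g v

/-- The `i`-th component of the moment `b^f(x) = ∫ v √M f(x, v) dv`. -/
def bMoment (f : R3 × R3 → ℂ) (i : Fin 3) (x : R3) : ℂ :=
  ∫ v : R3, (v i * sqrtM v) • f (x, v)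

/-! ### Sources `S_f = div_v G - v·G/2 + h` -/

/-- `ν^{-1/2} h`. -/
def weighted (h : R3 × R3 → ℂ) (z : R3 × R3) : ℂ := (nu z.2 ^ (-(1 / 2) : ℝ)) • h z

/-- The norm `‖∂^α (G, ν^{-1/2} h)‖_{𝒵_p}` of a source at a fixed time. -/
def sourceDerivNorm (α : Fin 3 → ℕ) (p : ℝ) (G : R3 × R3 → C3) (h : R3 × R3 → ℂ) : ℝ≥0∞ :=
  derivNormXV α p G + derivNormXV α p (weighted h)

/-- The distribution `S_f = div_v G - v·G/2 + h` applied to the test function `g`. -/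
def sourcePairing (G : R3 × R3 → C3) (h : R3 × R3 → ℂ) (g : 𝓢(R3 × R3, ℂ)) : ℂ :=
  ∫ z : R3 × R3, (-(∑ i, G z i * pderiv i (fun w => g (z.1, w)) z.2)
    - (1 / 2) * (∑ i, (z.2 i : ℂ) * G z i) * g z + h z * g z)

/-- The sources that are considered: measurable in `(t, x, v)`, with `(G, ν^{-1/2} h)` square
integrable in `(x, v)`, locally square integrably in time, with `𝐏₀ G = 0` and `𝐏 h = 0`. -/
structure IsSource (G : ℝ → R3 × R3 → C3) (h : ℝ → R3 × R3 → ℂ) : Prop where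
  measG : AEStronglyMeasurable (fun y : ℝ × (R3 × R3) => G y.1 y.2)
    ((volume.restrict (Ioi 0)).prod volume)
  meash : AEStronglyMeasurable (fun y : ℝ × (R3 × R3) => h y.1 y.2)
    ((volume.restrict (Ioi 0)).prod volume)
  finite : ∀ T : ℝ, ∫⁻ s in Ioc 0 T,
    (kineticNorm 2 (G s) + kineticNorm 2 (weighted (h s))) ^ 2 < ⊤
  P0_G : ∀ᵐ s ∂(volume.restrict (Ioi (0 : ℝ))), ∀ᵐ x : R3, macroP0 (fun v => G s (x, v)) = 0
  P_h : ∀ᵐ s ∂(volume.restrict (Ioi (0 : ℝ))), ∀ᵐ x : R3, macroP (fun v => h s (x, v)) = 0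

/-! ### The linearized system -/

/-- `U ∈ C([0,∞); L²)` is the solution, in the sense of tempered distributions, of
`∂ₜϱ + div u = 0`, `∂ₜu + c∇ϱ - (b - u) = 0`,
`∂ₜf + v·∇f - u·v√M - ℒf = div_v G - v·G/2 + h` with initial data `U₀`. -/
structure IsWeakSolution (c : ℝ) (U₀ : Fields) (G : ℝ → R3 × R3 → C3) (h : ℝ → R3 × R3 → ℂ)
    (U : ℝ → State) : Prop where
  cont : ContinuousOn U (Ici 0)
  mass : ∀ t : ℝ, 0 ≤ t → ∀ ψ : 𝓢(R3, ℂ),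
    ∫ x, (U t).toFields.rho x * ψ x = (∫ x, U₀.rho x * ψ x) +
      ∫ s in (0 : ℝ)..t, ∫ x, ∑ i, (U s).toFields.u x i * pderiv i ψ x
  momentum : ∀ t : ℝ, 0 ≤ t → ∀ (i : Fin 3) (ψ : 𝓢(R3, ℂ)),
    ∫ x, (U t).toFields.u x i * ψ x = (∫ x, U₀.u x i * ψ x) +
      ∫ s in (0 : ℝ)..t, ((c : ℂ) * (∫ x, (U s).toFields.rho x * pderiv i ψ x) +
        ∫ x, (bMoment (U s).toFields.f i x - (U s).toFields.u x i) * ψ x)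
  kinetic : ∀ t : ℝ, 0 ≤ t → ∀ g : 𝓢(R3 × R3, ℂ),
    ∫ z, (U t).toFields.f z * g z = (∫ z, U₀.f z * g z) +
      ∫ s in (0 : ℝ)..t,
        ((∫ z : R3 × R3, (U s).toFields.f z *
            ((∑ i, (z.2 i : ℂ) * pderiv i (fun y => g (y, z.2)) z.1) +
              fokkerPlanck (fun w => g (z.1, w)) z.2)) +
          (∫ z : R3 × R3, (∑ i, (U s).toFields.u z.1 i * (z.2 i : ℂ)) * (sqrtM z.2 : ℂ) * g z) +
          sourcePairing (G s) (h s) g)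

open Classical in
/-- The solution of the Cauchy problem with data `U₀` and source `div_v G - v·G/2 + h`. -/
def solution (c : ℝ) (U₀ : Fields) (G : ℝ → R3 × R3 → C3) (h : ℝ → R3 × R3 → ℂ) (t : ℝ) : State :=
  if H : ∃ U : ℝ → State, IsWeakSolution c U₀ G h U then Classical.choose H t else 0

/-- The solution operator `𝔸(t)` of the system without source. -/
def solutionOperator (c t : ℝ) (U₀ : Fields) : State := solution c U₀ 0 0 t

/-- The Duhamel term `∫₀ᵗ 𝔸(t-s)(0, 0, S_f(s)) ds`, `S_f = div_v G - v·G/2 + h`: the solution with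
this source and zero initial data. It has a meaning also where the distribution `S_f(s)` is not
a square integrable function. -/
def duhamel (c : ℝ) (G : ℝ → R3 × R3 → C3) (h : ℝ → R3 × R3 → ℂ) (t : ℝ) : State :=
  solution c ⟨0, 0, 0⟩ G h t

/-! ### Low frequencies -/

/-- The cut-off functions of radius `r₀`. -/
structure IsLowFreqCutoff (r₀ : ℝ) (φ : R3 → ℝ) : Prop where
  smooth : ContDiff ℝ ∞ φ
  nonneg : ∀ ξ, 0 ≤ φ ξ
  le_one : ∀ ξ, φ ξ ≤ 1
  eq_one : ∀ ξ, ‖ξ‖ ≤ r₀ / 2 → φ ξ = 1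
  eq_zero : ∀ ξ, r₀ < ‖ξ‖ → φ ξ = 0

/-- The inverse Fourier transform `(2π)^{-3} ∫ e^{i x·ξ} φ(ξ) dξ` of the cut-off function. -/
def lowFreqKernel (φ : R3 → ℝ) (x : R3) : ℂ :=
  ((2 * Real.pi) ^ 3 : ℝ)⁻¹ • ∫ ξ : R3, Complex.exp (Complex.I * (inner ℝ x ξ : ℝ)) * (φ ξ : ℂ)

section LowFreq

variable {E : Type*} [NormedAddCommGroup E] [NormedSpace ℂ E]

/-- `φ(D_x) g` for a function of `x`: the convolution with the inverse Fourier transform of `φ`. -/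
def lowFreqX (φ : R3 → ℝ) (g : R3 → E) (x : R3) : E :=
  ∫ y, lowFreqKernel φ (x - y) • g y

/-- `φ(D_x) g` for a function of `(x, v)`. -/
def lowFreqXV (φ : R3 → ℝ) (g : R3 × R3 → E) (z : R3 × R3) : E :=
  lowFreqX φ (fun y => g (y, z.2)) z.1

end LowFreq

/-- `U^L = φ(D_x) U`. -/
def Fields.lowFreq (φ : R3 → ℝ) (U : Fields) : Fields :=
  ⟨lowFreqX φ U.rho, lowFreqX φ U.u, lowFreqXV φ U.f⟩

/-- The decay factor `(1+t)^{-(3/2)(1/p-1/2)-m/2}`. -/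
def decayRate (p : ℝ) (m : ℕ) (t : ℝ) : ℝ :=
  (1 + t) ^ (-(3 / 2) * (1 / p - 1 / 2) - (m : ℝ) / 2)

end EulerVFP

end

open EulerVFP

noncomputable section Development

namespace EulerVFP

open Filter Topology
open scoped FourierTransform LineDeriv Real
open Complex (I add_re conjCLE conj_conj conj_ofNat conj_ofReal continuous_ofReal norm_I norm_real
  ofRealCLM ofReal_zero reCLM re_sum real_smul sub_re)
open ContinuousLinearMap (adjoint comp_apply fst id_apply smulRight_apply snd star_eq_adjoint
  toSpanSingleton toSpanSingleton_apply)
open ENNReal (mul_lt_top mul_ne_top ofReal ofReal_add ofReal_le_ofReal ofReal_mul ofReal_ne_top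
  ofReal_ofNat ofReal_one ofReal_pow ofReal_sum_of_nonneg pow_lt_top pow_ne_top rpow_mul
  rpow_natCast rpow_ne_top_of_nonneg rpow_one)
open EuclideanSpace (inner_single_left norm_sq_eq proj single)
open Finset (abs_sum_le_sum_abs card_univ mem_filter mul_sum prod_congr single_le_sum smul_sum
  sum_add_distrib sum_congr sum_const sum_eq_zero sum_image sum_ite_eq sum_le_sum sum_mul
  sum_neg_distrib)
open Fintype (card card_fin sum_option sum_sum_type)
open Function (HasTemperateGrowth comp_def injective_id iterate_succ_apply uncurry)
open RCLike (inner_apply)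
open Real (exp exp_add exp_pos norm_eq_abs rpow_add sq_sqrt sqrt_pos)
open SchwartzMap (fourierInv_coe lineDerivOp_apply_eq_fderiv smulLeftCLM smulLeftCLM_apply_apply
  toLpCLM_apply)
open Submodule (span subset_span)
open Sum (inl inr)
open WithLp (toLp toLp_snd)
open intervalIntegral (integral_mono_on integral_of_le)

/-! The unknowns are expanded in Hermite functions of `v` and Fourier transformed in `x`. At every
frequency `ζ` the system becomes an evolution on the fiber `Fib` (density, velocity and Hermite
coefficients); `semig` is the limit of the flows `flow` of the truncated generators `gen`, and its
decay comes from an energy with the compensating form `comp`. Taking all frequencies together gives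
`evol` on `Spec`, with the Duhamel terms `duh` and `duhZ`; `toS` and `ofSpec` translate between
`State` and `Spec`. Uniqueness is `zero_isWeakNull`. -/

local notation "vol" => (volume : Measure R3)

variable {E : Type*} [NormedAddCommGroup E]

local notation "ℓ" => multiLength

abbrev TX := 𝓢(R3, ℂ)

abbrev TXV := 𝓢(R3 × R3, ℂ)

abbrev Lx (E : Type*) [NormedAddCommGroup E] := Lp E 2 vol

/-! ### The fiber space: fluid variables and Hermite coefficients at one frequency -/

abbrev MI := Fin 3 → ℕ

abbrev HSeq := lp (fun _ : MI => ℂ) 2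

abbrev FFib := EuclideanSpace ℂ (Option (Fin 3))

abbrev Fib := WithLp 2 (FFib × HSeq)

def dir (j : Fin 3) : MI := Pi.single j 1

def miLE (N : ℕ) : Finset MI :=
  (Fintype.piFinset fun _ => Finset.range (N + 1)).filter fun k => ℓ k ≤ N

lemma mem_miLE : k ∈ miLE N ↔ ℓ k ≤ N := by
  simp only [miLE, mem_filter, Fintype.mem_piFinset, Finset.mem_range, and_iff_right_iff_imp]
  intro h j
  have : k j ≤ ℓ k := single_le_sum (fun _ _ => Nat.zero_le _) (Finset.mem_univ j)
  omega

lemma len_add (k l : MI) : ℓ (k + l) = ℓ k + ℓ l := by simp [multiLength, sum_add_distrib]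

@[simp]
lemma len_dir (j : Fin 3) : ℓ (dir j) = 1 := by simp [multiLength, dir]

lemma sub_add_dir (h : k j ≠ 0) : k - dir j + dir j = k := by
  ext i
  by_cases hi : i = j
  · subst hi; simp [dir]; omega
  · simp [dir, hi]

lemma add_sub_dir (k j) : k + dir j - dir j = k := by
  ext i
  simp

lemma len_sub_dir (h : k j ≠ 0) : ℓ (k - dir j) + 1 = ℓ k := by
  conv_rhs => rw [← sub_add_dir h, len_add, len_dir]

lemma dir_injective : Function.Injective dir := by
  intro i j h
  by_contra hij
  have := congrFun h i
  simp [dir, hij] at this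

def coordCLM (k : MI) : HSeq →L[ℂ] ℂ := innerSL ℂ (lp.single 2 k (1 : ℂ))

@[simp]
lemma coordCLM_ap (k y) : coordCLM k y = y k := by simp [coordCLM, lp.inner_single_left]

lemma norm_coord_le (k : MI) (y : HSeq) : ‖y k‖ ≤ ‖y‖ := lp.norm_apply_le_norm (by simp) y k

lemma in_single_one (y) (k : MI) : inner ℂ y (lp.single 2 k (1 : ℂ)) = (starRingEnd ℂ) (y k) := by
  simp [lp.inner_single_right]

def shft (F : Finset MI) (w : MI → ℝ) (σ : MI → MI) : HSeq →L[ℂ] HSeq :=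
  ∑ k ∈ F, ((w k : ℂ) • coordCLM (σ k)).smulRight (lp.single 2 k (1 : ℂ))

lemma shft_ap' (F w σ y) : shft F w σ y = ∑ k ∈ F, ((w k) * y (σ k)) • (lp.single 2 k (1 : ℂ)) := by
  simp [shft]

lemma shft_ap (F w σ y k) : shft F w σ y k = if k ∈ F then (w k) * y (σ k) else 0 := by
  rw [shft_ap', lp.coeFn_sum, Finset.sum_apply]
  simp only [lp.coeFn_smul, Pi.smul_apply, lp.single_apply, Pi.single_apply, smul_eq_mul,
    mul_ite, mul_one, mul_zero, sum_ite_eq]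

lemma inner_shft (F : Finset MI) (w : MI → ℝ) (σ : MI → MI) (z y : HSeq) :
    inner ℂ z (shft F w σ y) = ∑ k ∈ F, (starRingEnd ℂ) (z k) * ((w k : ℂ) * y (σ k)) := by
  rw [shft_ap', inner_sum]
  refine sum_congr rfl fun k _ => ?_
  rw [inner_smul_right, in_single_one]
  ring

def trOp (N : ℕ) : HSeq →L[ℂ] HSeq := shft (miLE N) 1 id

def rais (N : ℕ) (j : Fin 3) : HSeq →L[ℂ] HSeq :=
  shft (miLE N) (fun k => √(k j)) (fun k => k - dir j)

def lowr (N : ℕ) (j : Fin 3) : HSeq →L[ℂ] HSeq :=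
  shft ((miLE N).filter fun k => ℓ k + 1 ≤ N) (fun k => √(k j + 1)) (fun k => k + dir j)

def numOp (N : ℕ) : HSeq →L[ℂ] HSeq := shft ((miLE N).filter fun k => 2 ≤ ℓ k) (fun k => ℓ k) id

lemma trOp_ap (N y k) : trOp N y k = if ℓ k ≤ N then y k else 0 := by simp [trOp, shft_ap, mem_miLE]

lemma rais_ap (N j y k) : rais N j y k = if ℓ k ≤ N then (√(k j) : ℂ) * y (k - dir j) else 0 := by
  simp [rais, shft_ap, mem_miLE]

lemma lowr_ap (N : ℕ) (j : Fin 3) (y : HSeq) (k : MI) :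
    lowr N j y k = if ℓ k + 1 ≤ N then (√(k j + 1) : ℂ) * y (k + dir j) else 0 := by
  rw [lowr, shft_ap]
  congr 1
  simp only [mem_filter, mem_miLE, eq_iff_iff]
  omega

lemma numOp_ap (N y k) : numOp N y k = if ℓ k ≤ N ∧ 2 ≤ ℓ k then (ℓ k) * y k else 0 := by
  simp [numOp, shft_ap, mem_miLE]

lemma inner_rais (N : ℕ) (j : Fin 3) (z y : HSeq) :
    inner ℂ z (rais N j y) = inner ℂ (lowr N j z) y := by
  rw [← inner_conj_symm (lowr N j z), rais, inner_shft, lowr, inner_shft, map_sum]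
  simp
  symm
  apply Finset.sum_of_injOn (fun k => k + dir j)
  · intro a _ b _ h; simpa using h
  · intro k hk; simp at hk; simp [mem_miLE, len_add, hk.2]
  · intro k hk hk'
    have : k j = 0 := by
      by_contra h
      apply hk'; refine ⟨k - dir j, ?_, sub_add_dir h⟩; have := len_sub_dir h
      rw [mem_miLE] at hk; simp only [Finset.coe_filter, mem_ofPred_eq, mem_miLE]
      omega
    simp [this]
  · intro k _; have h1 : ((k + dir j) j : ℝ) = k j + 1 := by simp [dir]
    simp only [add_sub_dir, h1]
    ring

/-! ### The truncated generator -/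

def fluidCLM : Fib →L[ℂ] FFib := WithLp.fstL 2 ℂ FFib HSeq

def hCLM : Fib →L[ℂ] HSeq := WithLp.sndL 2 ℂ FFib HSeq

def pCLM : FFib × HSeq →L[ℂ] Fib := (WithLp.prodContinuousLinearEquiv 2 ℂ FFib HSeq).symm

def fluC (o : Option (Fin 3)) : Fib →L[ℂ] ℂ := (proj o).comp fluidCLM

def hCo (k : MI) : Fib →L[ℂ] ℂ := (coordCLM k).comp hCLM

@[simp] theorem fluidCLM_ap (w : Fib) : fluidCLM w = w.fst := rfl
@[simp] theorem hermCLM_apply (w : Fib) : hCLM w = w.snd := rfl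
@[simp] theorem pairCLM_apply (w : FFib × HSeq) : pCLM w = toLp 2 w := rfl
@[simp] theorem fluidCoord_apply (o) (w : Fib) : fluC o w = w.fst o := rfl
@[simp] theorem hermCoord_apply (k) (w : Fib) : hCo k w = w.snd k := by simp [hCo]

def slip (j : Fin 3) : Fib := pCLM (single (some j) 1, - lp.single 2 (dir j) (1 : ℂ))

def coll (N : ℕ) : Fib →L[ℂ] Fib := -(∑ j, (innerSL ℂ (slip j)).smulRight (slip j)) -
    (pCLM.comp (ContinuousLinearMap.inr ℂ _ _)).comp ((numOp N).comp hCLM)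

def strm (κ : ℝ) (N : ℕ) (j : Fin 3) : Fib →L[ℂ] Fib :=
  pCLM.comp (((κ : ℂ) • ((fluC (some j)).smulRight (single none (1 : ℂ)) +
    (fluC none).smulRight (single (some j) (1 : ℂ)))).prod
    ((rais N j + lowr N j).comp hCLM))

def gen (κ : ℝ) (N : ℕ) (ζ : R3) : Fib →L[ℂ] Fib := coll N - I • ∑ j, (ζ j : ℂ) • strm κ N j

lemma in_fib (z w : Fib) : inner ℂ z w = inner ℂ z.fst w.fst + inner ℂ z.snd w.snd := rfl

lemma inner_slip (j) (w : Fib) : inner ℂ (slip j) w = w.fst (some j) - w.snd (dir j) := by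
  rw [in_fib]
  simp [slip, lp.inner_single_left, inner_single_left, sub_eq_add_neg]

lemma coll_ap (N w) : coll N w = -(∑ j, (w.fst (some j) - w.snd (dir j)) • slip j) -
      pCLM (0, numOp N w.snd) := by
  simp [coll, -WithLp.prod_inner_apply, inner_slip]

lemma inner_numOp (N z w) : inner ℂ z (numOp N w) = inner ℂ (numOp N z) w := by
  rw [← inner_conj_symm (numOp N z), numOp, inner_shft, inner_shft, map_sum]
  refine sum_congr rfl fun k _ => ?_
  simp
  ring

lemma inner_coll (N) (z w : Fib) : inner ℂ z (coll N w) = -(∑ j, (w.fst (some j) - w.snd (dir j)) *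
      (starRingEnd ℂ) (z.fst (some j) - z.snd (dir j))) - inner ℂ z.snd (numOp N w.snd) := by
  have h1 : inner ℂ z (pCLM (0, numOp N w.snd)) = inner ℂ z.snd (numOp N w.snd) := by
    rw [in_fib]; simp
  have h2 j : inner ℂ z ((w.fst (some j) - w.snd (dir j)) • slip j) =
      (w.fst (some j) - w.snd (dir j)) *
      (starRingEnd ℂ) (z.fst (some j) - z.snd (dir j)) := by
    rw [inner_smul_right, ← inner_conj_symm, inner_slip]
  rw [coll_ap, inner_sub_right, inner_neg_right, inner_sum, h1]
  simp_rw [h2]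

lemma coll_symm (N z w) : inner ℂ z (coll N w) = inner ℂ (coll N z) w := by
  rw [← inner_conj_symm (coll N z), inner_coll, inner_coll, inner_numOp, map_sub,
    inner_conj_symm, map_neg, map_sum]
  simp [mul_comm]

lemma strm_fst (κ : ℝ) (N : ℕ) (j : Fin 3) (w : Fib) :
    (strm κ N j w).fst = (κ : ℂ) • (w.fst (some j) • single none (1 : ℂ) +
      w.fst none • single (some j) (1 : ℂ)) := rfl

lemma strm_snd (κ : ℝ) (N : ℕ) (j : Fin 3) (w : Fib) :
    (strm κ N j w).snd = rais N j w.snd + lowr N j w.snd := rfl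

lemma strm_symm (κ : ℝ) (N : ℕ) (j : Fin 3) (z w : Fib) :
    inner ℂ z (strm κ N j w) = inner ℂ (strm κ N j z) w := by
  have h : inner ℂ z.snd (lowr N j w.snd) = inner ℂ (rais N j z.snd) w.snd := by
    rw [← inner_conj_symm, ← inner_rais, inner_conj_symm]
  rw [in_fib, in_fib, strm_snd, strm_snd, strm_fst, strm_fst,
    inner_add_right, inner_add_left, h, inner_rais]
  simp only [inner_add_left, inner_add_right, inner_smul_left, inner_smul_right, inner_single_left,
    EuclideanSpace.inner_single_right, conj_ofReal, map_one, one_mul]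
  ring

lemma gen_ap (κ N) (ζ : R3) (w : Fib) :
    gen κ N ζ w = coll N w - I • ∑ j, (ζ j : ℂ) • strm κ N j w := by
  simp [gen]

lemma inner_gen (κ N) (ζ : R3) (z w : Fib) :
    inner ℂ z (gen κ N ζ w) = inner ℂ (gen κ N (-ζ) z) w := by
  simp only [gen_ap, inner_sub_left, inner_sub_right,
    inner_smul_left, inner_smul_right, inner_sum, sum_inner, coll_symm, strm_symm]
  simp [-WithLp.prod_inner_apply]

def diss (N : ℕ) (w : Fib) : ℝ := ∑ j, ‖w.fst (some j) - w.snd (dir j)‖ ^ 2 +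
    ∑ k ∈ (miLE N).filter (fun k => 2 ≤ ℓ k), (ℓ k : ℝ) * ‖w.snd k‖ ^ 2

lemma re_inner_coll (N w) : (inner ℂ w (coll N w)).re = - diss N w := by
  rw [inner_coll, diss, numOp, inner_shft, sub_re, Complex.neg_re, re_sum, re_sum, neg_add']
  refine congrArg₂ _ (congrArg _ ?_) ?_
  · refine sum_congr rfl fun j _ => ?_
    rw [Complex.mul_conj', ← Complex.ofReal_pow, Complex.ofReal_re]
  · refine sum_congr rfl fun k _ => ?_
    rw [mul_left_comm, id, Complex.conj_mul', ← Complex.ofReal_pow, ← Complex.ofReal_mul,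
      Complex.ofReal_re]

lemma re_inner_gen (κ N) (ζ : R3) (w : Fib) : (inner ℂ w (gen κ N ζ w)).re = - diss N w := by
  have h j : (inner ℂ w (strm κ N j w)).im = 0 := by
    rw [← Complex.conj_eq_iff_im, inner_conj_symm, strm_symm]
  rw [gen_ap, inner_sub_right, inner_smul_right, inner_sum, sub_re, re_inner_coll]
  have h' j : (inner ℂ w ((ζ j : ℂ) • strm κ N j w)).im = 0 := by
    rw [inner_smul_right, Complex.im_ofReal_mul, h, mul_zero]
  rw [Complex.I_mul_re, Complex.im_sum, sum_eq_zero fun j _ => h' j]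
  simp

lemma diss_nn (N : ℕ) (w : Fib) : 0 ≤ diss N w := by
  unfold diss
  positivity

lemma gen_fst (κ N ζ w) (o : Option (Fin 3)) :
    (gen κ N ζ w).fst o = -(∑ j, (w.fst (some j) - w.snd (dir j)) * (slip j).fst o) -
      I * ∑ j, (ζ j) * (strm κ N j w).fst o := by
  have : (gen κ N ζ w).fst o = fluC o (gen κ N ζ w) := rfl
  rw [this, gen_ap, coll_ap]
  simp only [map_sub, map_neg, map_sum, map_smul]
  simp

lemma gen_snd (κ N ζ w k) :
    (gen κ N ζ w).snd k = -(∑ j, (w.fst (some j) - w.snd (dir j)) * (slip j).snd k) -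
      numOp N w.snd k - I * ∑ j, (ζ j) * (strm κ N j w).snd k := by
  have : (gen κ N ζ w).snd k = hCo k (gen κ N ζ w) := by simp
  rw [this, gen_ap, coll_ap]
  simp only [map_sub, map_neg, map_sum, map_smul]
  simp

lemma slip_fst (j) (o : Option (Fin 3)) : (slip j).fst o = if o = some j then 1 else 0 := by
  simp [slip]

lemma slip_snd (j k) : (slip j).snd k = if k = dir j then -1 else 0 := by
  simp only [slip, pairCLM_apply, toLp_snd, lp.coeFn_neg, Pi.neg_apply,
    lp.single_apply, Pi.single_apply]
  split_ifs <;> simp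

lemma gen_fl_none (κ N ζ w) : (gen κ N ζ w).fst none = -I * (κ * ∑ j, ζ j * w.fst (some j)) := by
  rw [gen_fst]
  simp [slip_fst, strm_fst, mul_sum]
  refine sum_congr rfl fun j _ => ?_
  ring

lemma gen_fl_some (κ N ζ w j) : (gen κ N ζ w).fst (some j) = -I * (κ * (ζ j * w.fst none)) +
      (w.snd (dir j) - w.fst (some j)) := by
  rw [gen_fst]
  simp [slip_fst, strm_fst]
  ring

lemma gen_herm (κ N ζ w k) :
    (gen κ N ζ w).snd k = -I * ∑ j, ζ j * (rais N j w.snd k + lowr N j w.snd k) +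
      (∑ j, if k = dir j then w.fst (some j) - w.snd (dir j) else 0) -
      numOp N w.snd k := by
  rw [gen_snd]
  simp only [slip_snd, strm_snd, lp.coeFn_add, Pi.add_apply, mul_ite, mul_neg, mul_one,
    mul_zero, ← sum_neg_distrib]
  rw [show ∀ a b c d : ℂ, a = d → a - b - c = -c + d - b by intros; subst_vars; ring, neg_mul]
  refine sum_congr rfl fun j _ => ?_
  split_ifs <;> simp

/-! ### The truncated flow -/

lemma hda_norm_sq [InnerProductSpace ℂ E] {w} {w' : E} {t : ℝ} (h : HasDerivAt w w' t) :
    HasDerivAt (fun s => ‖w s‖ ^ 2) (2 * (inner ℂ (w t) w').re) t := by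
  have h1 := reCLM.hasFDerivAt.comp_hasDerivAt t (h.inner ℂ h)
  have h2 : (fun s => ‖w s‖ ^ 2) = reCLM ∘ fun s => inner ℂ (w s) (w s) := by
    ext s; simp only [Function.comp, Complex.reCLM_apply]; rw [inner_self_eq_norm_sq_to_K]
    norm_cast
  rw [h2]
  refine h1.congr_deriv ?_
  change (inner ℂ (w t) w' + inner ℂ w' (w t)).re = _
  rw [add_re, ← inner_conj_symm w', Complex.conj_re]
  ring

def trF (N : ℕ) : Fib →L[ℂ] Fib := pCLM.comp (fluidCLM.prod ((trOp N).comp hCLM))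

@[simp] theorem trF_fst (N : ℕ) (w : Fib) : (trF N w).fst = w.fst := rfl
lemma truncFib_snd N w : (trF N w).snd = trOp N w.snd := rfl

lemma trF_snd_ap (N : ℕ) (w : Fib) (k : MI) : (trF N w).snd k = if ℓ k ≤ N then w.snd k else 0 := by
  rw [truncFib_snd, trOp_ap]

lemma fib_ext {z w : Fib} (h1 : z.fst = w.fst) (h2 : ∀ k, z.snd k = w.snd k) : z = w := by
  have h3 := lp.ext (funext h2)
  exact (WithLp.ofLp_injective 2) (Prod.ext h1 h3)

lemma fib_nsq (w : Fib) : ‖w‖ ^ 2 = ‖w.fst‖ ^ 2 + ‖w.snd‖ ^ 2 := WithLp.prod_norm_sq_eq_of_L2 w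

lemma hSeq_hasSum_norm_sq (y : HSeq) : HasSum (fun k => ‖y k‖ ^ 2) (‖y‖ ^ 2) := by
  have := lp.hasSum_norm (p := 2) (by simp) y
  simpa using this

lemma norm_trOp_le (N : ℕ) (y : HSeq) : ‖trOp N y‖ ≤ ‖y‖ := by
  refine (sq_le_sq₀ (norm_nonneg _) (norm_nonneg _)).1 ?_
  refine hasSum_le (fun k => ?_) (hSeq_hasSum_norm_sq _) (hSeq_hasSum_norm_sq _)
  rw [trOp_ap]
  split_ifs <;> simp

lemma tt_trOp (y) : Tendsto (fun N => trOp N y) atTop (𝓝 y) := by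
  have h := lp.hasSum_single (p := 2) (by simp) y
  have hm : Tendsto miLE atTop atTop := by
    refine tendsto_atTop_finset_of_monotone ?_ fun k => ⟨ℓ k, by simp [mem_miLE]⟩
    intro a b hab k hk; rw [mem_miLE] at *; omega
  refine (h.comp hm).congr fun N => ?_
  simp only [Function.comp, trOp, shft_ap', Pi.one_apply, Complex.ofReal_one, one_mul, id]
  refine sum_congr rfl fun k _ => ?_
  ext l
  simp [lp.single_apply, Pi.single_apply]

lemma norm_trF_le (N : ℕ) (w : Fib) : ‖trF N w‖ ≤ ‖w‖ := by
  refine (sq_le_sq₀ (norm_nonneg _) (norm_nonneg _)).1 ?_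
  rw [fib_nsq, fib_nsq w, trF_fst, truncFib_snd]
  gcongr
  exact norm_trOp_le N _

lemma tt_trF (w) : Tendsto (fun N => trF N w) atTop (𝓝 w) := by
  have : Tendsto (fun N => pCLM (w.fst, trOp N w.snd)) atTop (𝓝 (pCLM (w.fst, w.snd))) :=
    (pCLM.continuous.tendsto _).comp (tendsto_const_nhds.prodMk_nhds (tt_trOp w.snd))
  exact this

lemma trF_symm (N : ℕ) (z w : Fib) : inner ℂ z (trF N w) = inner ℂ (trF N z) w := by
  rw [in_fib, in_fib, trF_fst, trF_fst, truncFib_snd, truncFib_snd,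
    ← inner_conj_symm (trOp N z.snd), trOp, inner_shft, inner_shft, map_sum]
  congr 1
  refine sum_congr rfl fun k _ => ?_
  simp
  ring

lemma gen_snd_lt (κ) (hN : 1 ≤ N) (ζ w) (hk : N < ℓ k) : (gen κ N ζ w).snd k = 0 := by
  have h j : k ≠ dir j := by
    rintro rfl; rw [len_dir] at hk; omega
  rw [gen_herm, numOp_ap]
  simp only [rais_ap, lowr_ap]
  rw [if_neg (by omega)]
  simp [h, show ¬ ℓ k ≤ N by omega, show ¬ ℓ k + 1 ≤ N by omega]

def propag (κ : ℝ) (N : ℕ) (ζ : R3) (t : ℝ) : Fib →L[ℂ] Fib := NormedSpace.exp ((t : ℂ) • gen κ N ζ)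

def flow (κ : ℝ) (N : ℕ) (ζ : R3) (t : ℝ) : Fib →L[ℂ] Fib := (propag κ N ζ t).comp (trF N)

lemma hda_flow (κ N ζ t x) :
    HasDerivAt (fun s => flow κ N ζ s x) (gen κ N ζ (flow κ N ζ t x)) t := by
  have h := (hasDerivAt_exp_smul_const' (𝕂 := ℂ) (gen κ N ζ) t).scomp t
    (ofRealCLM.hasDerivAt (x := t))
  have h2 := (((ContinuousLinearMap.apply ℂ Fib (trF N x)).hasFDerivAt
    (x := NormedSpace.exp (t • gen κ N ζ))).restrictScalars ℝ).comp_hasDerivAt t h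
  simp at h2
  exact h2

lemma flow_zero (κ N ζ x) : flow κ N ζ 0 x = trF N x := by
  have h : ((0 : ℝ) : ℂ) • gen κ N ζ = 0 := by
    ext; simp
  rw [flow, propag, h, NormedSpace.exp_zero]
  rfl

lemma flow_snd_lt (κ) (hN : 1 ≤ N) (ζ t x) (hk : N < ℓ k) : (flow κ N ζ t x).snd k = 0 := by
  have h s : HasDerivAt (fun s => (flow κ N ζ s x).snd k) 0 s := by
    have := ((hCo k).hasFDerivAt.restrictScalars ℝ).comp_hasDerivAt s (hda_flow κ N ζ s x)
    have e : (hCo k).restrictScalars ℝ (gen κ N ζ (flow κ N ζ s x)) = 0 := by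
      rw [ContinuousLinearMap.coe_restrictScalars', hermCoord_apply, gen_snd_lt κ hN ζ _ hk]
    rw [e] at this
    exact this.congr_of_eventuallyEq (.of_forall fun s => by simp)
  have := is_const_of_deriv_eq_zero (fun s => (h s).differentiableAt) (fun s => (h s).deriv) t 0
  rw [this, flow_zero, trF_snd_ap, if_neg (by omega)]

lemma hda_norm_sq_flow (κ N) (ζ : R3) (t : ℝ) (x : Fib) :
    HasDerivAt (fun s => ‖flow κ N ζ s x‖ ^ 2) (-2 * diss N (flow κ N ζ t x)) t := by
  refine (hda_norm_sq (hda_flow κ N ζ t x)).congr_deriv ?_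
  rw [re_inner_gen]
  ring

lemma antitone_hda {g g' : ℝ → ℝ} (h : ∀ t, HasDerivAt g (g' t) t)
    (h' : ∀ t, g' t ≤ 0) : Antitone g :=
  antitone_of_deriv_nonpos (fun t => (h t).differentiableAt) fun t => by
    rw [(h t).deriv]; exact h' t

lemma norm_flow_le (κ N) (ζ : R3) {t : ℝ} (ht : 0 ≤ t) (x : Fib) : ‖flow κ N ζ t x‖ ≤ ‖x‖ := by
  have := antitone_hda (fun s => hda_norm_sq_flow κ N ζ s x)
    (fun s => by have := diss_nn N (flow κ N ζ s x); linarith) ht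
  simp only [flow_zero] at this
  exact ((sq_le_sq₀ (norm_nonneg _) (norm_nonneg _)).1 this).trans (norm_trF_le N x)

lemma flow_symm (κ) {N} (hN : 1 ≤ N) (ζ : R3) (t : ℝ) (x y : Fib) :
    inner ℂ y (flow κ N ζ t x) = inner ℂ (flow κ N (-ζ) t y) x := by
  have htr η s z : trF N (flow κ N η s z) = flow κ N η s z := by
    refine fib_ext rfl fun k => ?_; rw [trF_snd_ap]; split_ifs with h
    · rfl
    · rw [flow_snd_lt κ hN _ _ _ (not_le.1 h)]
  have hadj : adjoint (propag κ N ζ t) = propag κ N (-ζ) t := by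
    have hg : adjoint (gen κ N ζ) = gen κ N (-ζ) := by
      symm; rw [ContinuousLinearMap.eq_adjoint_iff]; intro z w; rw [inner_gen]
    rw [propag, ← star_eq_adjoint, NormedSpace.star_exp, star_smul,
      star_eq_adjoint, hg, propag, Complex.star_def,
      conj_ofReal]
  rw [← htr, trF_symm, flow, comp_apply, ← ContinuousLinearMap.adjoint_inner_left, hadj, trF_symm]
  exact congrArg (fun z => inner ℂ z x) (htr (-ζ) t y)

/-! ### Convergence of the truncated flows -/

lemma norm_inner_rais_sub_le (hN : 2 ≤ N) (hNM : N ≤ M) (j v y) (hy : ∀ k, N < ℓ k → y.snd k = 0) :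
    ‖inner ℂ v.snd (rais M j y.snd) - inner ℂ v.snd (rais N j y.snd)‖ ≤
      (diss M v + diss N y) / (2 * √N) := by
  have hN0 : 0 < √N := sqrt_pos.2 (by exact_mod_cast (by omega : 0 < N))
  rcases eq_or_lt_of_le hNM with rfl | hlt
  · simp; have := diss_nn N v; have := diss_nn N y; positivity
  set F := (miLE N).filter fun k => ℓ k = N with hF
  have hsum : inner ℂ v.snd (rais M j y.snd) - inner ℂ v.snd (rais N j y.snd) =
      ∑ k ∈ F, (starRingEnd ℂ) (√(k j + 1) * v.snd (k + dir j)) * y.snd k := by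
    have h L : inner ℂ v.snd (rais L j y.snd) = ∑ k ∈ (miLE L).filter (fun k => ℓ k + 1 ≤ L),
          (starRingEnd ℂ) (√(k j + 1) * v.snd (k + dir j)) * y.snd k := by
      rw [inner_rais, ← inner_conj_symm, lowr, inner_shft, map_sum]
      refine sum_congr rfl fun k _ => ?_; simp; ring
    rw [h, h, sub_eq_iff_eq_add, ← Finset.sum_union]
    · symm; apply Finset.sum_subset
      · intro k
        simp only [hF, Finset.mem_union, mem_filter, mem_miLE]
        omega
      · intro k; simp only [hF, Finset.mem_union, mem_filter, mem_miLE]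
        intro h1 h2
        rw [hy k (by omega), mul_zero]
    · rw [Finset.disjoint_left]; intro k; simp only [hF, mem_filter, mem_miLE]
      omega
  have hterm k (hk : k ∈ F) : ‖(starRingEnd ℂ) (√(k j + 1) * v.snd (k + dir j)) * y.snd k‖ ≤
        ((ℓ (k + dir j) : ℝ) * ‖v.snd (k + dir j)‖ ^ 2 + (ℓ k) * ‖y.snd k‖ ^ 2) / (2 * √N) := by
    have hk' := (mem_filter.1 hk).2
    rw [hk', norm_mul, RCLike.norm_conj, norm_mul, norm_real, norm_eq_abs,
      abs_of_nonneg (Real.sqrt_nonneg _), le_div_iff₀ (by positivity)]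
    have h1 : (k j : ℝ) + 1 ≤ ℓ (k + dir j) := by
      have : k j ≤ ℓ k := single_le_sum (fun _ _ => Nat.zero_le _) (Finset.mem_univ j)
      rw [len_add, len_dir]; exact_mod_cast (by omega)
    have h2 : (√(k j + 1)) ^ 2 = (k j : ℝ) + 1 := sq_sqrt (by positivity)
    have h3 : (√N : ℝ) ^ 2 = N := sq_sqrt (by positivity)
    have h4 := mul_le_mul_of_nonneg_right h1 (sq_nonneg ‖v.snd (k + dir j)‖)
    rw [← h2] at h4
    nlinarith [sq_nonneg (√(k j + 1) * ‖v.snd (k + dir j)‖ - √N * ‖y.snd k‖)]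
  rw [hsum]
  refine (norm_sum_le _ _).trans ((sum_le_sum hterm).trans ?_)
  rw [← Finset.sum_div, sum_add_distrib]
  gcongr
  · rw [diss]; refine le_add_of_nonneg_of_le (by positivity) ?_
    have := Finset.sum_map F (addRightEmbedding (dir j)) (fun k => (ℓ k : ℝ) * ‖v.snd k‖ ^ 2)
    simp only [addRightEmbedding_apply] at this; rw [← this]
    refine Finset.sum_le_sum_of_subset_of_nonneg ?_ fun _ _ _ => by positivity
    intro k
    simp only [Finset.mem_map, hF, mem_filter, mem_miLE, addRightEmbedding_apply]
    rintro ⟨l, hl, rfl⟩; rw [len_add, len_dir]; omega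
  · rw [diss]; refine le_add_of_nonneg_of_le (by positivity) ?_
    refine Finset.sum_le_sum_of_subset_of_nonneg ?_ fun _ _ _ => by positivity
    intro k; simp only [hF, mem_filter, mem_miLE]; omega

lemma re_inner_gen_sub_le (κ) {N M} (hN : 2 ≤ N) (hNM : N ≤ M) (ζ : R3) (v y : Fib)
    (hy : ∀ k, N < ℓ k → y.snd k = 0) :
    (inner ℂ (v - y) (gen κ M ζ y - gen κ N ζ y)).re ≤
      (∑ j, |ζ j|) * ((diss M v + diss N y) / (2 * √N)) := by
  have h1 : gen κ M ζ y - gen κ N ζ y =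
      -I • ∑ j, (ζ j : ℂ) • pCLM (0, rais M j y.snd - rais N j y.snd) := by
    apply fib_ext
    · ext o
      have e1 : (gen κ M ζ y - gen κ N ζ y).fst o = (gen κ M ζ y).fst o - (gen κ N ζ y).fst o := rfl
      have e2 : ∀ w : Fib, w.fst o = fluC o w := fun _ => rfl; rw [e1, e2 (_ • _)]
      simp only [map_smul, map_sum]
      cases o <;> simp [gen_fl_none, gen_fl_some]
    · intro k
      have e1 : (gen κ M ζ y - gen κ N ζ y).snd k = (gen κ M ζ y).snd k - (gen κ N ζ y).snd k := rfl
      have e2 : ∀ w : Fib, w.snd k = hCo k w := fun _ => by simp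
      have e3 : numOp M y.snd k = numOp N y.snd k := by
        rw [numOp_ap, numOp_ap]
        by_cases hk : ℓ k ≤ N
        · simp [hk, hk.trans hNM]
        · simp [hk, hy k (not_le.1 hk)]
      have e4 j : lowr M j y.snd k = lowr N j y.snd k := by
        rw [lowr_ap, lowr_ap]
        by_cases hk : ℓ k + 1 ≤ N
        · rw [if_pos hk, if_pos (hk.trans hNM)]
        · rw [if_neg hk, hy, mul_zero, ite_self]; rw [len_add, len_dir]
          omega
      rw [e1, e2 (_ • _), gen_herm, gen_herm, e3]; simp only [map_smul, map_sum, e4]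
      simp only [hermCoord_apply, pairCLM_apply, toLp_snd, lp.coeFn_sub, Pi.sub_apply,
        smul_eq_mul, mul_add, mul_sub, sum_add_distrib, Finset.sum_sub_distrib]
      ring
  have h2 j : inner ℂ y.snd (rais M j y.snd) = inner ℂ y.snd (rais N j y.snd) := by
    rw [rais, rais, inner_shft, inner_shft]; symm; apply Finset.sum_subset
    · intro k; simp only [mem_miLE]; omega
    · intro k; simp only [mem_miLE]; intro _ hk; rw [hy k (by omega)]
      simp
  have h3 j : inner ℂ (v - y) (pCLM (0, rais M j y.snd - rais N j y.snd)) =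
      inner ℂ v.snd (rais M j y.snd) - inner ℂ v.snd (rais N j y.snd) := by
    have : (v - y).snd = v.snd - y.snd := rfl; rw [in_fib, this]
    simp only [pairCLM_apply, WithLp.toLp_fst, toLp_snd, inner_zero_right, zero_add,
      inner_sub_left, inner_sub_right, h2]
    ring
  rw [h1, inner_smul_right, inner_sum, sum_mul]
  refine (Complex.re_le_norm _).trans ?_
  rw [norm_mul, norm_neg, norm_I, one_mul]
  refine (norm_sum_le _ _).trans (sum_le_sum fun j _ => ?_)
  rw [inner_smul_right, norm_mul, h3, norm_real, norm_eq_abs]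
  gcongr
  exact norm_inner_rais_sub_le hN hNM j v y hy

lemma norm_sq_flow_sub_le (κ) (hN : 2 ≤ N) (hNM : N ≤ M) (ζ : R3) {t : ℝ} (ht : 0 ≤ t) (x : Fib) :
    ‖flow κ M ζ t x - flow κ N ζ t x‖ ^ 2 ≤
      ‖trF M x - trF N x‖ ^ 2 + (∑ j, |ζ j|) / √N * ‖x‖ ^ 2 := by
  have hN0 : 0 < √N := sqrt_pos.2 (by exact_mod_cast (by omega : 0 < N))
  set c := (∑ j, |ζ j|) / (2 * √N) with hc
  have hc0 : 0 ≤ c := by positivity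
  have hW s := hda_norm_sq ((hda_flow κ M ζ s x).sub (hda_flow κ N ζ s x))
  have hg s := (hW s).add
    (((hda_norm_sq_flow κ M ζ s x).add (hda_norm_sq_flow κ N ζ s x)).const_mul c)
  have hanti := antitone_hda hg (fun s => ?_) ht
  · simp only [Pi.add_apply, Pi.sub_apply, flow_zero] at hanti
    have h1 : ‖trF M x‖ ^ 2 + ‖trF N x‖ ^ 2 ≤ 2 * ‖x‖ ^ 2 := by
      have := pow_le_pow_left₀ (norm_nonneg _) (norm_trF_le M x) 2
      have := pow_le_pow_left₀ (norm_nonneg _) (norm_trF_le N x) 2; linarith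
    have h2 : 0 ≤ c * (‖flow κ M ζ t x‖ ^ 2 + ‖flow κ N ζ t x‖ ^ 2) := by positivity
    have h3 := mul_le_mul_of_nonneg_left h1 hc0
    have h4 : (∑ j, |ζ j|) / √N * ‖x‖ ^ 2 = c * (2 * ‖x‖ ^ 2) := by
      rw [hc]; field_simp
    rw [h4]; linarith
  · set v := flow κ M ζ s x; set y := flow κ N ζ s x
    have h1 := re_inner_gen_sub_le κ hN hNM ζ v y (fun k hk => flow_snd_lt κ (by omega) ζ s x hk)
    have h2 := re_inner_gen κ M ζ (v - y); have h3 := diss_nn M (v - y)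
    have h4 : gen κ M ζ v - gen κ N ζ y = gen κ M ζ (v - y) + (gen κ M ζ y - gen κ N ζ y) := by
      rw [map_sub]; abel
    simp only [Pi.sub_apply]
    change 2 * (inner ℂ (v - y) (gen κ M ζ v - gen κ N ζ y)).re + _ ≤ 0
    rw [h4, inner_add_right, add_re, h2]
    have h5 : (∑ j, |ζ j|) * ((diss M v + diss N y) / (2 * √N)) = c * (diss M v + diss N y) := by
      rw [hc]; ring
    rw [h5] at h1; linarith

/-! ### The limit of the truncated flows -/

lemma tt_const_div_sqrt (c) : Tendsto (fun N : ℕ => c / √(N)) atTop (𝓝 0) :=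
  tendsto_const_nhds.div_atTop (Real.tendsto_sqrt_atTop.comp tendsto_natCast_atTop_atTop)

lemma cauchySeq_flow (κ ζ) (ht : 0 ≤ t) (x) : CauchySeq fun N => flow κ N ζ t x := by
  have h1 := (tt_trF x).cauchySeq
  rw [Metric.cauchySeq_iff'] at h1 ⊢
  intro ε hε
  obtain ⟨N₁, hN₁⟩ := Metric.cauchySeq_iff.1 (tt_trF x).cauchySeq (ε / 2) (by positivity)
  obtain ⟨N₂, hN₂⟩ := ((tt_const_div_sqrt ((∑ j, |ζ j|) * ‖x‖ ^ 2)).eventually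
    (gt_mem_nhds (show 0 < ε ^ 2 / 2 by positivity))).exists_forall_of_atTop
  refine ⟨max 2 (max N₁ N₂), fun M hM => ?_⟩
  set N := max 2 (max N₁ N₂)
  have h2 := norm_sq_flow_sub_le κ (le_max_left 2 _) hM ζ ht x
  have h3 := hN₁ M (by omega) N (by omega)
  have h4 := hN₂ N (by omega)
  rw [dist_eq_norm] at h3 ⊢
  refine lt_of_pow_lt_pow_left₀ 2 hε.le (h2.trans_lt ?_)
  have h5 := pow_lt_pow_left₀ h3 (norm_nonneg _) two_ne_zero
  rw [div_mul_eq_mul_div]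
  nlinarith

lemma ex_lim_flow (κ ζ t) :
    ∃ T : Fib →L[ℂ] Fib, ∀ x, Tendsto (fun N => flow κ N ζ |t| x) atTop (𝓝 (T x)) := by
  choose f hf using fun x => cauchySeq_tendsto_of_complete (cauchySeq_flow κ ζ (abs_nonneg t) x)
  exact ⟨continuousLinearMapOfTendsto (fun N => flow κ N ζ |t|) (tendsto_pi_nhds.2 hf), hf⟩

def semig (κ : ℝ) (ζ : R3) (t : ℝ) : Fib →L[ℂ] Fib := (ex_lim_flow κ ζ t).choose

lemma tt_flow_abs (κ ζ t x) : Tendsto (fun N => flow κ N ζ |t| x) atTop (𝓝 (semig κ ζ t x)) :=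
  (ex_lim_flow κ ζ t).choose_spec x

lemma tt_flow (κ ζ) (ht : 0 ≤ t) (x) :
    Tendsto (fun N => flow κ N ζ t x) atTop (𝓝 (semig κ ζ t x)) := by
  simpa only [abs_of_nonneg ht] using tt_flow_abs κ ζ t x

lemma norm_semig_le (κ : ℝ) (ζ : R3) (t : ℝ) (x : Fib) : ‖semig κ ζ t x‖ ≤ ‖x‖ :=
  le_of_tendsto (tt_flow_abs κ ζ t x).norm (.of_forall fun N => norm_flow_le κ N ζ (abs_nonneg t) x)

lemma semig_symm (κ ζ t x y) : inner ℂ y (semig κ ζ t x) = inner ℂ (semig κ (-ζ) t y) x := by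
  have h1 : Tendsto (fun N => inner ℂ y (flow κ N ζ |t| x)) atTop
      (𝓝 (inner ℂ y (semig κ ζ t x))) := tendsto_const_nhds.inner (tt_flow_abs κ ζ t x)
  have h2 : Tendsto (fun N => inner ℂ (flow κ N (-ζ) |t| y) x) atTop
      (𝓝 (inner ℂ (semig κ (-ζ) t y) x)) := (tt_flow_abs κ (-ζ) t y).inner tendsto_const_nhds
  refine tendsto_nhds_unique (h1.congr' ?_) h2
  filter_upwards [eventually_ge_atTop 1] with N hN
  exact flow_symm κ hN ζ _ x y

lemma norm_sq_semig_sub_flow_le (κ) (hN : 2 ≤ N) (ζ t x) : ‖semig κ ζ t x - flow κ N ζ |t| x‖ ^ 2 ≤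
      ‖x - trF N x‖ ^ 2 + (∑ j, |ζ j|) / √N * ‖x‖ ^ 2 := by
  refine le_of_tendsto_of_tendsto (((tt_flow_abs κ ζ t x).sub_const _).norm.pow 2)
    ((((tt_trF x).sub_const _).norm.pow 2).add_const _) ?_
  filter_upwards [eventually_ge_atTop N] with M hM
  exact norm_sq_flow_sub_le κ hN hM ζ (abs_nonneg t) x

lemma cont_flow (κ N) : Continuous fun z : (R3 × ℝ) × Fib => flow κ N z.1.1 z.1.2 z.2 := by
  have h1 : Continuous fun ζ : R3 => gen κ N ζ := by
    unfold gen; fun_prop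
  have h2 : Continuous fun z : R3 × ℝ => propag κ N z.1 z.2 := by
    unfold propag
    have he : Continuous (NormedSpace.exp : (Fib →L[ℂ] Fib) → Fib →L[ℂ] Fib) :=
      continuous_iff_continuousAt.2 fun x => (NormedSpace.exp_analytic (𝕂 := ℂ) x).continuousAt
    refine he.comp ?_
    exact (continuous_ofReal.comp continuous_snd).smul (h1.comp continuous_fst)
  exact (h2.comp continuous_fst).clm_apply ((trF N).continuous.comp continuous_snd)

lemma cont_semig (κ ζ x) : Continuous fun t => semig κ ζ t x := by
  have h : TendstoUniformly (fun N t => flow κ N ζ |t| x) (fun t => semig κ ζ t x) atTop := by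
    rw [Metric.tendstoUniformly_iff]; intro ε hε
    have h1 : Tendsto (fun N : ℕ => ‖x - trF N x‖ ^ 2 + (∑ j, |ζ j|) / √N * ‖x‖ ^ 2)
        atTop (𝓝 (‖x - x‖ ^ 2 + 0 * ‖x‖ ^ 2)) :=
      ((((tt_trF x).const_sub x).norm.pow 2).add ((tt_const_div_sqrt _).mul_const _))
    have h2 := h1.eventually (gt_mem_nhds (show _ < ε ^ 2 by simp; positivity))
    filter_upwards [h2, eventually_ge_atTop 2] with N hN hN2 t; rw [dist_eq_norm]
    exact lt_of_pow_lt_pow_left₀ 2 hε.le ((norm_sq_semig_sub_flow_le κ hN2 ζ t x).trans_lt hN)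
  refine h.continuous (Frequently.of_forall fun N => ?_)
  exact (cont_flow κ N).comp ((continuous_const.prodMk continuous_abs).prodMk continuous_const)

lemma aesm_flow {α : Type*} [MeasurableSpace α] {μ : Measure α} (κ) (N : ℕ)
    {ζ : α → R3} {t : α → ℝ} {X : α → Fib} (hζ : Measurable ζ) (ht : Measurable t)
    (hX : AEStronglyMeasurable X μ) :
    AEStronglyMeasurable (fun a => flow κ N (ζ a) (t a) (X a)) μ :=
  Continuous.comp_aestronglyMeasurable (g := fun z : (R3 × ℝ) × Fib => flow κ N z.1.1 z.1.2 z.2)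
    (f := fun a => ((ζ a, t a), X a)) (cont_flow κ N)
    ((hζ.prodMk ht).aestronglyMeasurable.prodMk hX)

lemma aesm_semig {α : Type*} [MeasurableSpace α] {μ : Measure α} (κ : ℝ)
    {ζ : α → R3} {t : α → ℝ} {X : α → Fib} (hζ : Measurable ζ) (ht : Measurable t)
    (hX : AEStronglyMeasurable X μ) :
    AEStronglyMeasurable (fun a => semig κ (ζ a) (t a) (X a)) μ :=
  aestronglyMeasurable_of_tendsto_ae atTop
    (fun N => aesm_flow κ N hζ (continuous_abs.measurable.comp ht) hX)
    (.of_forall fun a => tt_flow_abs κ (ζ a) (t a) (X a))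

def IsGen (κ : ℝ) (ζ : R3) (y y' : Fib) : Prop := Tendsto (fun N => gen κ N ζ y) atTop (𝓝 y')

lemma inner_semig_eq_int (h : IsGen κ (-ζ) y y') (ht : 0 ≤ t) (x) :
    inner ℂ y (semig κ ζ t x) = inner ℂ y x + ∫ s in (0)..t, inner ℂ y' (semig κ ζ s x) := by
  have h1 N : inner ℂ y (flow κ N ζ t x) = inner ℂ y (trF N x) +
      ∫ s in (0)..t, inner ℂ (gen κ N (-ζ) y) (flow κ N ζ s x) := by
    have hd s : HasDerivAt (fun s => inner ℂ y (flow κ N ζ s x))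
        (inner ℂ (gen κ N (-ζ) y) (flow κ N ζ s x)) s := by
      have := (((innerSL ℂ y).hasFDerivAt (x := flow κ N ζ s x)).restrictScalars ℝ).comp_hasDerivAt
        s (hda_flow κ N ζ s x)
      refine this.congr_deriv ?_; rw [← inner_gen]; rfl
    have hc : Continuous fun s => inner ℂ (gen κ N (-ζ) y) (flow κ N ζ s x) :=
      continuous_const.inner ((cont_flow κ N).comp
        ((continuous_const.prodMk continuous_id).prodMk continuous_const))
    rw [intervalIntegral.integral_eq_sub_of_hasDerivAt (fun s _ => hd s)
      (hc.intervalIntegrable _ _), flow_zero]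
    ring
  refine tendsto_nhds_unique (tendsto_const_nhds.inner (tt_flow κ ζ ht x)) ?_
  simp only [h1]
  refine (tendsto_const_nhds.inner (tt_trF x)).add ?_
  obtain ⟨C, hC⟩ := h.norm.bddAbove_range
  refine intervalIntegral.tendsto_integral_filter_of_dominated_convergence
    (fun _ => C * ‖x‖) ?_ ?_ ?_ ?_
  · refine .of_forall fun N => Continuous.aestronglyMeasurable ?_
    exact continuous_const.inner ((cont_flow κ N).comp
        ((continuous_const.prodMk continuous_id).prodMk continuous_const))
  · refine .of_forall fun N => .of_forall fun s hs => ?_; rw [uIoc_of_le ht] at hs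
    refine (norm_inner_le_norm _ _).trans ?_
    exact mul_le_mul (hC ⟨N, rfl⟩) (norm_flow_le κ N ζ hs.1.le x) (norm_nonneg _)
      ((norm_nonneg _).trans (hC ⟨N, rfl⟩))
  · exact intervalIntegrable_const
  · refine .of_forall fun s hs => ?_; rw [uIoc_of_le ht] at hs
    exact h.inner (tt_flow κ ζ hs.1.le x)

/-! ### Hypocoercivity -/

def mom (l j : Fin 3) (w : Fib) : ℂ := (√((dir j l : ℝ) + 1) : ℂ) * w.snd (dir j + dir l)

def sGr (ζ : R3) (l j : Fin 3) (w : Fib) : ℂ := ζ j * w.snd (dir l) + ζ l * w.snd (dir j)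

def thirdFlux (N : ℕ) (ζ : R3) (l j : Fin 3) (w : Fib) : ℂ :=
  (√((dir j l : ℝ) + 1) : ℂ) * ∑ m, ζ m * lowr N m w.snd (dir j + dir l)

def mRest (ζ : R3) (j : Fin 3) (w : Fib) : ℂ :=
  -I * (∑ l, ζ l * mom l j w) + (w.fst (some j) - w.snd (dir j))

lemma gen_density (κ) (hN : 2 ≤ N) (ζ w) : (gen κ N ζ w).snd 0 = -I * ∑ j, ζ j * w.snd (dir j) := by
  have h0 : ℓ 0 = 0 := by simp [multiLength]
  have h1 j : 0 ≠ dir j := by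
    intro h; have := congrArg ℓ h; simp [h0] at this
  rw [gen_herm, numOp_ap]
  simp only [rais_ap, lowr_ap, h0, h1]
  simp [show 1 ≤ N by omega]

lemma gen_momentum (κ) (hN : 2 ≤ N) (ζ w j) :
    (gen κ N ζ w).snd (dir j) = -I * (ζ j * w.snd 0) + mRest ζ j w := by
  have h1 l : rais N l w.snd (dir j) = if l = j then w.snd 0 else 0 := by
    rw [rais_ap, len_dir, if_pos (by omega)]; split_ifs with h
    · subst h; have : dir l - dir l = 0 := by ext; simp
      simp [dir]
    · simp [dir, h]
  have h2 l : lowr N l w.snd (dir j) = mom l j w := by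
    rw [lowr_ap, len_dir, if_pos (by omega)]; rfl
  rw [gen_herm, numOp_ap, mRest]
  simp only [h1, h2, len_dir, dir_injective.eq_iff, mul_add, sum_add_distrib]
  simp
  ring

lemma gen_mom (κ) (hN : 2 ≤ N) (ζ w l j) : mom l j (gen κ N ζ w) =
      -I * sGr ζ l j w - 2 * mom l j w - I * thirdFlux N ζ l j w := by
  have hl : ℓ (dir j + dir l) = 2 := by rw [len_add, len_dir, len_dir]
  have h0 m : dir j + dir l ≠ dir m := by
    intro h; have := congrArg ℓ h; simp [hl] at this
  have h1 m : (√((dir j l) + 1) : ℂ) * rais N m w.snd (dir j + dir l) =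
      (if m = j then w.snd (dir l) else 0) + (if m = l then w.snd (dir j) else 0) := by
    rw [rais_ap, hl, if_pos hN]
    by_cases hmj : m = j
    · subst hmj
      have e : dir m + dir l - dir m = dir l := by rw [add_comm, add_sub_dir]
      rw [e]
      by_cases hml : m = l
      · subst hml
        have : (√(1 + 1) : ℂ) * (√(1 + 1) : ℂ) = 2 := by
          rw [← Complex.ofReal_mul, Real.mul_self_sqrt (by norm_num)]; norm_num
        simp only [dir, Pi.add_apply, Pi.single_eq_same, Nat.cast_one, Nat.cast_add, if_true]
        rw [← mul_assoc, this]; ring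
      · have hlm : l ≠ m := fun h => hml h.symm; simp [dir, hml, hlm]
    · by_cases hml : m = l
      · subst hml
        rw [add_sub_dir]
        simp [dir, hmj]
      · simp [dir, hmj, hml]
  have h2 : (√((dir j l) + 1) : ℂ) * ∑ m, ζ m * (rais N m w.snd (dir j + dir l)) = sGr ζ l j w := by
    have : ∀ m, (√((dir j l) + 1) : ℂ) * ((ζ m) * (rais N m w.snd (dir j + dir l))) = (ζ m) *
        ((if m = j then w.snd (dir l) else 0) + (if m = l then w.snd (dir j) else 0)) := by
      intro m; rw [← h1]; ring
    rw [mul_sum, sum_congr rfl fun m _ => this m]; simp [mul_add, sum_add_distrib, sGr]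
  rw [mom, gen_herm, numOp_ap, hl, if_pos ⟨hN, le_rfl⟩, thirdFlux, ← h2]
  simp only [h0, mom, mul_add, sum_add_distrib]
  simp
  ring

lemma norm_sq_coord_le_diss (h2 : 2 ≤ ℓ k) (hk : ℓ k ≤ N)
    (w : Fib) : (ℓ k : ℝ) * ‖w.snd k‖ ^ 2 ≤ diss N w := by
  refine le_add_of_nonneg_of_le (by positivity) ?_
  exact single_le_sum (f := fun k => (ℓ k) * ‖w.snd k‖ ^ 2)
    (fun _ _ => by positivity) (mem_filter.2 ⟨mem_miLE.2 hk, h2⟩)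

lemma slip_le_diss (N w) : ∑ j, ‖w.fst (some j) - w.snd (dir j)‖ ^ 2 ≤ diss N w :=
  le_add_of_nonneg_right (by positivity)

lemma slip_single_le_diss (N w j) : ‖w.fst (some j) - w.snd (dir j)‖ ^ 2 ≤ diss N w :=
  (single_le_sum (f := fun j => ‖w.fst (some j) - w.snd (dir j)‖ ^ 2)
    (fun _ _ => by positivity) (Finset.mem_univ j)).trans (slip_le_diss N w)

lemma dir_le_one (j l : Fin 3) : (dir j l : ℝ) ≤ 1 := by
  unfold dir
  by_cases h : l = j
  · subst h; simp
  · simp [h]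

lemma norm_sq_mom_le (hN : 2 ≤ N) (l j : Fin 3) (w : Fib) : ‖mom l j w‖ ^ 2 ≤ diss N w := by
  have hl : ℓ (dir j + dir l) = 2 := by rw [len_add, len_dir, len_dir]
  have h := norm_sq_coord_le_diss (k := dir j + dir l) hl.ge (hl.le.trans hN) w
  rw [hl] at h
  rw [mom, norm_mul, mul_pow, norm_real, norm_eq_abs, sq_abs, sq_sqrt (by positivity)]
  refine le_trans ?_ h
  have := dir_le_one j l
  gcongr
  push_cast
  linarith

lemma norm_sq_sum_mul_le (ζ : R3) {x : Fin 3 → ℂ} :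
    ‖∑ m, (ζ m : ℂ) * x m‖ ^ 2 ≤ ‖ζ‖ ^ 2 * ∑ m, ‖x m‖ ^ 2 := by
  have h1 : ‖∑ m, (ζ m) * x m‖ ≤ ∑ m, |ζ m| * ‖x m‖ := by
    refine (norm_sum_le _ _).trans_eq (sum_congr rfl fun m _ => ?_)
    rw [norm_mul, norm_real, norm_eq_abs]
  have h2 := pow_le_pow_left₀ (norm_nonneg _) h1 2
  refine h2.trans ((Finset.sum_mul_sq_le_sq_mul_sq _ _ _).trans_eq ?_)
  rw [norm_sq_eq]
  simp

lemma norm_sq_flux_le {N : ℕ} (ζ : R3) (l j : Fin 3) (w : Fib) :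
    ‖thirdFlux N ζ l j w‖ ^ 2 ≤ 6 * ‖ζ‖ ^ 2 * diss N w := by
  have hl : ℓ (dir j + dir l) = 2 := by rw [len_add, len_dir, len_dir]
  have h m : ‖lowr N m w.snd (dir j + dir l)‖ ^ 2 ≤ diss N w := by
    rw [lowr_ap, hl]; split_ifs with hN
    · have h3 : ℓ (dir j + dir l + dir m) = 3 := by rw [len_add, hl, len_dir]
      have h := norm_sq_coord_le_diss (N := N) (k := dir j + dir l + dir m) (by omega) (by omega) w
      rw [h3] at h
      rw [norm_mul, mul_pow, norm_real, norm_eq_abs, sq_abs, sq_sqrt (by positivity)]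
      refine le_trans ?_ h; have h1 := dir_le_one j m; have h2 := dir_le_one l m
      gcongr; rw [Pi.add_apply]; push_cast; linarith
    · simpa using diss_nn N w
  rw [thirdFlux, norm_mul, mul_pow, norm_real, norm_eq_abs, sq_abs, sq_sqrt (by positivity)]
  have h1 := norm_sq_sum_mul_le ζ (x := fun m => lowr N m w.snd (dir j + dir l))
  have h2 : ∑ m, ‖lowr N m w.snd (dir j + dir l)‖ ^ 2 ≤ 3 * diss N w := by
    refine (sum_le_sum fun m _ => h m).trans_eq ?_; simp
  have h3 := dir_le_one j l
  calc _ ≤ 2 * (‖ζ‖ ^ 2 * (3 * diss N w)) := by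
        refine mul_le_mul (by linarith) (h1.trans ?_) (by positivity) (by norm_num)
        gcongr
    _ = _ := by ring

lemma norm_sq_mRest_le {N : ℕ} (hN : 2 ≤ N) (ζ : R3) (j : Fin 3) (w : Fib) :
    ‖mRest ζ j w‖ ^ 2 ≤ 8 * (1 + ‖ζ‖ ^ 2) * diss N w := by
  have h1 := norm_sq_sum_mul_le ζ (x := fun l => mom l j w)
  have h2 : ∑ l, ‖mom l j w‖ ^ 2 ≤ 3 * diss N w := by
    refine (sum_le_sum fun l _ => norm_sq_mom_le hN l j w).trans_eq ?_
    simp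
  have h3 := slip_single_le_diss N w j
  have h4 : ‖mRest ζ j w‖ ≤ ‖∑ l, (ζ l) * mom l j w‖ + ‖w.fst (some j) - w.snd (dir j)‖ := by
    rw [mRest]; refine (norm_add_le _ _).trans_eq ?_; simp
  have h5 := pow_le_pow_left₀ (norm_nonneg _) h4 2
  have h6 := mul_le_mul_of_nonneg_left h2 (sq_nonneg ‖ζ‖)
  have h7 := diss_nn N w
  have h8 : 0 ≤ ‖ζ‖ ^ 2 * diss N w := by positivity
  nlinarith [sq_nonneg (‖∑ l, (ζ l) * mom l j w‖ - ‖w.fst (some j) - w.snd (dir j)‖)]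

def compA (ζ : R3) (w v : Fib) : ℝ := ∑ j, ∑ l, inner ℝ (I * sGr ζ l j w) (mom l j v)

def compB (ζ : R3) (w v : Fib) : ℝ := ∑ j, inner ℝ (I * (ζ j * w.snd 0)) (v.snd (dir j))

def compC (ζ : R3) (w v : Fib) : ℝ := ∑ j, inner ℝ (I * (ζ j * w.fst none)) (v.fst (some j))

lemma real_inner_le_quarter (x y : ℂ) : inner ℝ x y ≤ ‖x‖ ^ 2 / 4 + ‖y‖ ^ 2 := by
  have := real_inner_le_norm x y
  nlinarith [sq_nonneg (‖x‖ / 2 - ‖y‖)]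

lemma inner_I_mul_neg_I_mul (x) : inner ℝ (I * x) (-I * x) = -‖x‖ ^ 2 := by
  rw [neg_mul, inner_neg_right, real_inner_self_eq_norm_sq, norm_mul, norm_I, one_mul]

lemma sum_inner_gradient (ζ : R3) (x : Fin 3 → ℂ) :
    ∑ j, inner ℝ (I * (ζ j * (-I * ∑ l, ζ l * x l))) (x j) = ‖∑ l, (ζ l : ℂ) * x l‖ ^ 2 := by
  set S := ∑ l, (ζ l) * x l with hS
  rw [← real_inner_self_eq_norm_sq]
  conv_rhs => rw [hS, inner_sum]
  refine sum_congr rfl fun j _ => ?_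
  have h1 : I * (ζ j * (-I * S)) = (ζ j) • S := by
    rw [real_smul]
    linear_combination (-(ζ j) * S) * Complex.I_sq
  rw [h1, ← hS, ← real_smul, inner_smul_left, inner_smul_right]
  rfl

lemma norm_sq_gradient (ζ : R3) (x : ℂ) : ∑ j, ‖(ζ j : ℂ) * x‖ ^ 2 = ‖ζ‖ ^ 2 * ‖x‖ ^ 2 := by
  rw [norm_sq_eq, sum_mul]
  refine sum_congr rfl fun j _ => ?_
  rw [norm_mul, norm_real, mul_pow]

lemma compB_gen_le (κ : ℝ) {N : ℕ} (hN : 2 ≤ N) (ζ : R3) (w : Fib) :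
    compB ζ (gen κ N ζ w) w + compB ζ w (gen κ N ζ w) ≤
      -(3 / 4) * (‖ζ‖ ^ 2 * ‖w.snd 0‖ ^ 2) + ‖ζ‖ ^ 2 * ∑ j, ‖w.snd (dir j)‖ ^ 2 +
        24 * (1 + ‖ζ‖ ^ 2) * diss N w := by
  have h1 : compB ζ (gen κ N ζ w) w ≤ ‖ζ‖ ^ 2 * ∑ j, ‖w.snd (dir j)‖ ^ 2 := by
    rw [compB, gen_density κ hN, sum_inner_gradient ζ (fun j => w.snd (dir j))]
    exact norm_sq_sum_mul_le ζ
  have h2 : compB ζ w (gen κ N ζ w) ≤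
      ∑ j, (-(3 / 4) * ‖(ζ j) * w.snd 0‖ ^ 2 + 8 * (1 + ‖ζ‖ ^ 2) * diss N w) := by
    refine sum_le_sum fun j _ => ?_
    rw [gen_momentum κ hN, inner_add_right, inner_I_mul_neg_I_mul]
    have h3 := real_inner_le_quarter (I * (ζ j * w.snd 0)) (mRest ζ j w)
    have h4 := norm_sq_mRest_le hN ζ j w; rw [norm_mul I, norm_I, one_mul] at h3
    linarith
  rw [sum_add_distrib, ← mul_sum, norm_sq_gradient] at h2
  simp at h2
  push_cast at h2
  linarith

lemma ap_le_len (l : MI) (i : Fin 3) : l i ≤ ℓ l :=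
  single_le_sum (f := l) (fun _ _ => Nat.zero_le _) (Finset.mem_univ i)

lemma zero_len (h : ℓ k = 0) : k = 0 :=
  funext fun i => Nat.le_zero.1 ((ap_le_len k i).trans h.le)

lemma eq_zero_or_dir (h : ℓ k < 2) : k = 0 ∨ ∃ i, k = dir i := by
  by_cases h0 : ℓ k = 0
  · exact Or.inl (zero_len h0)
  · obtain ⟨i, hi⟩ : ∃ i, k i ≠ 0 := by
      by_contra! hk
      simp [multiLength, hk] at h0
    have h1 := len_sub_dir hi; refine Or.inr ⟨i, ?_⟩
    rw [← sub_add_dir hi, zero_len (k := k - dir i) (by omega), zero_add]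

lemma sum_fluid_le (w : Fib) : ∑ j, ‖w.fst (some j)‖ ^ 2 ≤
    2 * ∑ j, ‖w.snd (dir j)‖ ^ 2 + 2 * ∑ j, ‖w.fst (some j) - w.snd (dir j)‖ ^ 2 := by
  rw [mul_sum, mul_sum, ← sum_add_distrib]
  refine sum_le_sum fun j _ => ?_
  have := norm_add_le (w.snd (dir j)) (w.fst (some j) - w.snd (dir j))
  rw [add_sub_cancel] at this
  have := pow_le_pow_left₀ (norm_nonneg _) this 2
  nlinarith [sq_nonneg (‖w.snd (dir j)‖ - ‖w.fst (some j) - w.snd (dir j)‖)]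

lemma compC_gen_le {κ : ℝ} (hκ : 0 < κ) (N : ℕ) (ζ : R3) (w : Fib) :
    compC ζ (gen κ N ζ w) w + compC ζ w (gen κ N ζ w) ≤
      -(κ / 2) * (‖ζ‖ ^ 2 * ‖w.fst none‖ ^ 2) + 2 * κ * (‖ζ‖ ^ 2 * ∑ j, ‖w.snd (dir j)‖ ^ 2) +
        (2 * κ + 1 / (2 * κ)) * (1 + ‖ζ‖ ^ 2) * diss N w := by
  have hD := slip_le_diss N w
  have hD0 := diss_nn N w
  have h1 : compC ζ (gen κ N ζ w) w ≤ κ * (‖ζ‖ ^ 2 *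
      (2 * ∑ j, ‖w.snd (dir j)‖ ^ 2 + 2 * diss N w)) := by
    have e1 : compC ζ (gen κ N ζ w) w = κ * ‖∑ j, (ζ j) * w.fst (some j)‖ ^ 2 := by
      rw [← sum_inner_gradient ζ (fun j => w.fst (some j)), mul_sum, compC]
      refine sum_congr rfl fun j _ => ?_; rw [gen_fl_none, ← real_inner_smul_left]
      congr 1; rw [real_smul]; ring
    have e2 := norm_sq_sum_mul_le ζ (x := fun j => w.fst (some j))
    have e3 := sum_fluid_le w; rw [e1]; gcongr; refine e2.trans ?_
    gcongr; linarith
  have h2 : compC ζ w (gen κ N ζ w) ≤ ∑ j, (-(κ / 2) * ‖(ζ j) * w.fst none‖ ^ 2 +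
        1 / (2 * κ) * ‖w.fst (some j) - w.snd (dir j)‖ ^ 2) := by
    refine sum_le_sum fun j _ => ?_
    have e1 : -I * (κ * (ζ j * w.fst none)) = κ • (-I * (ζ j * w.fst none)) := by
      rw [real_smul]; ring
    rw [gen_fl_some, inner_add_right, e1, real_inner_smul_right, inner_I_mul_neg_I_mul]
    have h3 := real_inner_le_norm (I * (ζ j * w.fst none)) (w.snd (dir j) - w.fst (some j))
    rw [norm_mul I, norm_I, one_mul, norm_sub_rev] at h3; set X := ‖(ζ j) * w.fst none‖
    set Y := ‖w.fst (some j) - w.snd (dir j)‖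
    have h4 : X * Y ≤ κ / 2 * X ^ 2 + 1 / (2 * κ) * Y ^ 2 := by
      have : κ / 2 * X ^ 2 + 1 / (2 * κ) * Y ^ 2 - X * Y = (κ * X - Y) ^ 2 / (2 * κ) := by
        field_simp; ring
      have : 0 ≤ (κ * X - Y) ^ 2 / (2 * κ) := by positivity
      linarith
    linarith
  rw [sum_add_distrib, ← mul_sum, norm_sq_gradient, ← mul_sum] at h2
  have h5 : 1 / (2 * κ) * ∑ j, ‖w.fst (some j) - w.snd (dir j)‖ ^ 2 ≤
      1 / (2 * κ) * diss N w := by gcongr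
  have h6 : 0 ≤ 1 / (2 * κ) * (‖ζ‖ ^ 2 * diss N w) := by positivity
  have h7 : 0 ≤ κ * diss N w := by positivity
  nlinarith

lemma sum_norm_sq_sGr (ζ w) :
    2 * (‖ζ‖ ^ 2 * ∑ j, ‖w.snd (dir j)‖ ^ 2) ≤ ∑ j, ∑ l, ‖sGr ζ l j w‖ ^ 2 := by
  have h : ∑ j, ∑ l, ‖sGr ζ l j w‖ ^ 2 = 2 * (‖ζ‖ ^ 2 * ∑ j, ‖w.snd (dir j)‖ ^ 2) +
      2 * ‖∑ j, (ζ j) * w.snd (dir j)‖ ^ 2 := by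
    simp only [sGr, norm_sq_eq, Fin.sum_univ_three, Complex.sq_norm,
      Complex.normSq_apply, add_re, Complex.add_im, Complex.re_ofReal_mul,
      Complex.im_ofReal_mul, norm_eq_abs, sq_abs]
    ring
  rw [h]
  linarith [sq_nonneg ‖∑ j, (ζ j) * w.snd (dir j)‖]

lemma abs_le_norm (ζ : R3) (j : Fin 3) : |ζ j| ≤ ‖ζ‖ := by simpa using PiLp.norm_apply_le ζ j

lemma compA_gen_le (κ : ℝ) (hN : 2 ≤ N) (ζ : R3) (w : Fib) (hδ : 0 < δ) :
    compA ζ (gen κ N ζ w) w + compA ζ w (gen κ N ζ w) ≤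
      -(3 / 2) * (‖ζ‖ ^ 2 * ∑ j, ‖w.snd (dir j)‖ ^ 2) + 3 * δ * (‖ζ‖ ^ 2 * ‖w.snd 0‖ ^ 2) +
        (198 + 9 / δ) * (1 + ‖ζ‖ ^ 2) * diss N w := by
  have hD0 := diss_nn N w
  have h1 : compA ζ w (gen κ N ζ w) ≤
      ∑ j, ∑ l, (-(3 / 4) * ‖sGr ζ l j w‖ ^ 2 + 12 * (1 + ‖ζ‖ ^ 2) * diss N w) := by
    refine sum_le_sum fun j _ => sum_le_sum fun l _ => ?_
    have e1 : mom l j (gen κ N ζ w) = -I * sGr ζ l j w +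
        -(2 * mom l j w + I * thirdFlux N ζ l j w) := by
      rw [gen_mom κ hN]; ring
    rw [e1, inner_add_right, inner_I_mul_neg_I_mul]
    have h3 := real_inner_le_quarter (I * sGr ζ l j w) (-(2 * mom l j w + I * thirdFlux N ζ l j w))
    rw [norm_mul I, norm_I, one_mul, norm_neg] at h3
    have h4 := norm_add_le (2 * mom l j w) (I * thirdFlux N ζ l j w)
    rw [norm_mul, norm_mul I, norm_I, one_mul, Complex.norm_ofNat] at h4
    have h5 := pow_le_pow_left₀ (norm_nonneg _) h4 2; have h6 := norm_sq_mom_le hN l j w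
    have h7 := norm_sq_flux_le (N := N) ζ l j w
    nlinarith [sq_nonneg (2 * ‖mom l j w‖ - ‖thirdFlux N ζ l j w‖)]
  have h2 : compA ζ (gen κ N ζ w) w ≤ ∑ j, ∑ l : Fin 3, (δ * ‖(ζ j) * w.snd 0‖ ^ 2 +
        (10 + 1 / δ) * (1 + ‖ζ‖ ^ 2) * diss N w) := by
    refine sum_le_sum fun j _ => sum_le_sum fun l _ => ?_; have hθ := norm_sq_mom_le hN l j w
    have hel := norm_sq_mRest_le hN ζ l w; have hej := norm_sq_mRest_le hN ζ j w
    have hζj := pow_le_pow_left₀ (abs_nonneg _) (abs_le_norm ζ j) 2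
    have hζl := pow_le_pow_left₀ (abs_nonneg _) (abs_le_norm ζ l) 2
    have hn : ‖sGr ζ l j (gen κ N ζ w)‖ ≤ 2 * |ζ l| * ‖(ζ j) * w.snd 0‖ +
        |ζ j| * ‖mRest ζ l w‖ + |ζ l| * ‖mRest ζ j w‖ := by
      have : sGr ζ l j (gen κ N ζ w) = -(2 * I) * (ζ l * (ζ j * w.snd 0)) +
          ζ j * mRest ζ l w + ζ l * mRest ζ j w := by
        rw [sGr, gen_momentum κ hN, gen_momentum κ hN]; ring
      rw [this]; refine (norm_add₃_le).trans_eq ?_; simp; ring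
    refine (real_inner_le_norm _ _).trans ?_; rw [norm_mul I, norm_I, one_mul]
    refine (mul_le_mul_of_nonneg_right hn (norm_nonneg _)).trans ?_
    set X := ‖(ζ j) * w.snd 0‖; set T := ‖mom l j w‖; set El := ‖mRest ζ l w‖
    set Ej := ‖mRest ζ j w‖; set D := diss N w
    have a1 : 2 * |ζ l| * X * T ≤ δ * X ^ 2 + 1 / δ * (‖ζ‖ ^ 2 * D) := by
      have b1 : δ * X ^ 2 + 1 / δ * (|ζ l| ^ 2 * T ^ 2) - 2 * |ζ l| * X * T =
          (δ * X - |ζ l| * T) ^ 2 / δ := by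
        field_simp; ring
      have b2 : 0 ≤ (δ * X - |ζ l| * T) ^ 2 / δ := by positivity
      have b3 : 1 / δ * (|ζ l| ^ 2 * T ^ 2) ≤ 1 / δ * (‖ζ‖ ^ 2 * D) := by gcongr
      linarith
    have a2 : |ζ j| * El * T ≤ 5 * (1 + ‖ζ‖ ^ 2) * D := by
      have b1 : |ζ j| ^ 2 * T ^ 2 ≤ ‖ζ‖ ^ 2 * D := by gcongr
      nlinarith [sq_nonneg (|ζ j| * T - El)]
    have a3 : |ζ l| * Ej * T ≤ 5 * (1 + ‖ζ‖ ^ 2) * D := by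
      have b1 : |ζ l| ^ 2 * T ^ 2 ≤ ‖ζ‖ ^ 2 * D := by gcongr
      nlinarith [sq_nonneg (|ζ l| * T - Ej)]
    have a4 : 1 / δ * (‖ζ‖ ^ 2 * D) ≤ 1 / δ * ((1 + ‖ζ‖ ^ 2) * D) := by
      gcongr; linarith
    linarith
  have h3 := sum_norm_sq_sGr ζ w
  simp only [sum_add_distrib, ← mul_sum, sum_const, card_univ,
    card_fin, nsmul_eq_mul, norm_sq_gradient] at h1 h2
  have h4 : (198 + 9 / δ) * (1 + ‖ζ‖ ^ 2) * diss N w = 3 * (3 * (12 * (1 + ‖ζ‖ ^ 2) * diss N w)) +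
      3 * (3 * ((10 + 1 / δ) * (1 + ‖ζ‖ ^ 2) * diss N w)) := by ring
  push_cast at h1 h2
  rw [h4]
  linarith

def comp (K : ℝ) (ζ : R3) (w v : Fib) : ℝ := K * compA ζ w v + compB ζ w v + compC ζ w v

def mEn (w : Fib) : ℝ := ‖w.snd 0‖ ^ 2 + ∑ j, ‖w.snd (dir j)‖ ^ 2 + ‖w.fst none‖ ^ 2

lemma mEn_nonneg (w) : 0 ≤ mEn w := by
  unfold mEn
  positivity

lemma ex_comp_gen_le (hκ : 0 < κ) : ∃ K c C, 0 < K ∧ 0 < c ∧ 0 < C ∧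
    ∀ N, 2 ≤ N → ∀ (ζ) (w), comp K ζ (gen κ N ζ w) w + comp K ζ w (gen κ N ζ w) ≤
      -(c * (‖ζ‖ ^ 2 * mEn w)) + C * ((1 + ‖ζ‖ ^ 2) * diss N w) := by
  set K := 1 + 2 * κ with hK
  have hK0 : 0 < K := by positivity
  refine ⟨K, min (1 / 2) (κ / 2), K * (198 + 9 / (1 / (12 * K))) + 24 + (2 * κ + 1 / (2 * κ)), hK0,
    by positivity, by positivity, fun N hN ζ w => ?_⟩
  have hA := mul_le_mul_of_nonneg_left
    (compA_gen_le κ hN ζ w (δ := 1 / (12 * K)) (by positivity)) hK0.le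
  have hB := compB_gen_le κ hN ζ w
  have hC := compC_gen_le hκ N ζ w
  set A := ‖ζ‖ ^ 2 * ‖w.snd 0‖ ^ 2
  set B := ‖ζ‖ ^ 2 * ∑ j, ‖w.snd (dir j)‖ ^ 2
  set R := ‖ζ‖ ^ 2 * ‖w.fst none‖ ^ 2
  have hm : ‖ζ‖ ^ 2 * mEn w = A + B + R := by
    rw [mEn]; ring
  have hA' : K * (3 * (1 / (12 * K)) * A) = 1 / 4 * A := by
    field_simp; ring
  have hB0 : 0 ≤ B := by positivity
  have hA0 : 0 ≤ A := by positivity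
  have hR0 : 0 ≤ R := by positivity
  have m1 : min (1 / 2) (κ / 2) * A ≤ 1 / 2 * A := mul_le_mul_of_nonneg_right (min_le_left _ _) hA0
  have m2 : min (1 / 2) (κ / 2) * B ≤ 1 / 2 * B := mul_le_mul_of_nonneg_right (min_le_left _ _) hB0
  have m3 : min (1 / 2) (κ / 2) * R ≤ κ / 2 * R := mul_le_mul_of_nonneg_right (min_le_right _ _) hR0
  have hKB : B ≤ K * B := by
    rw [hK]; nlinarith
  rw [hm, comp, comp]
  have e : K * (-(3 / 2) * B) = -(3 / 2) * (K * B) := by ring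
  have e2 : 2 * κ * B = K * B - B := by
    rw [hK]; ring
  rw [e2] at hC
  rw [mul_add, mul_add, mul_add K (-(3 / 2) * B), hA', e] at hA
  generalize 9 / (1 / (12 * K)) = Q at *
  linarith

lemma abs_sum_inner_le (ζ : R3) {a b : Fin 3 → ℂ} {M : ℝ} (ha : ∀ j, ‖a j‖ ≤ M)
    (hb : ∀ j, ‖b j‖ ≤ M) : |∑ j, inner ℝ (I * (ζ j * a j)) (b j)| ≤ 3 * (‖ζ‖ * M ^ 2) := by
  refine (abs_sum_le_sum_abs _ _).trans ((sum_le_sum (g := fun _ => ‖ζ‖ * M ^ 2) fun j _ =>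
    (abs_real_inner_le_norm _ _).trans ?_).trans_eq (by simp))
  rw [norm_mul I, norm_I, one_mul, norm_mul, norm_real, norm_eq_abs, pow_two, ← mul_assoc]
  have := abs_le_norm ζ j
  exact mul_le_mul (mul_le_mul this (ha j) (norm_nonneg _) (norm_nonneg _)) (hb j) (norm_nonneg _)
    (mul_nonneg (norm_nonneg _) ((norm_nonneg _).trans (ha j)))

lemma abs_comp_le (hK : 0 < K) (ζ : R3) (w : Fib) :
    |comp K ζ w w| ≤ (36 * K + 6) * ((1 + ‖ζ‖ ^ 2) * ‖w‖ ^ 2) := by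
  have hs k : ‖w.snd k‖ ≤ ‖w‖ := by
    refine (norm_coord_le k _).trans ?_; refine (sq_le_sq₀ (norm_nonneg _) (norm_nonneg _)).1 ?_
    rw [fib_nsq w]; linarith [sq_nonneg ‖w.fst‖]
  have hf (o) : ‖w.fst o‖ ≤ ‖w‖ := by
    refine (PiLp.norm_apply_le _ o).trans ?_
    refine (sq_le_sq₀ (norm_nonneg _) (norm_nonneg _)).1 ?_; rw [fib_nsq w]
    linarith [sq_nonneg ‖w.snd‖]
  have hζ : ‖ζ‖ ≤ 1 + ‖ζ‖ ^ 2 := by nlinarith [sq_nonneg (‖ζ‖ - 1), sq_nonneg ‖ζ‖]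
  have hθ (l j) : ‖mom l j w‖ ≤ 2 * ‖w‖ := by
    rw [mom, norm_mul, norm_real, norm_eq_abs, abs_of_nonneg (Real.sqrt_nonneg _)]
    refine mul_le_mul ?_ (hs _) (norm_nonneg _) (by norm_num)
    refine Real.sqrt_le_iff.2 ⟨by norm_num, ?_⟩; linarith [dir_le_one j l]
  have hg (l j) : ‖sGr ζ l j w‖ ≤ 2 * (‖ζ‖ * ‖w‖) := by
    rw [sGr]; refine (norm_add_le _ _).trans ?_
    rw [norm_mul, norm_mul, norm_real, norm_real, norm_eq_abs, norm_eq_abs]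
    have := mul_le_mul (abs_le_norm ζ j) (hs (dir l)) (norm_nonneg _) (norm_nonneg _)
    have := mul_le_mul (abs_le_norm ζ l) (hs (dir j)) (norm_nonneg _) (norm_nonneg _)
    linarith
  have hA : |compA ζ w w| ≤ 36 * (‖ζ‖ * ‖w‖ ^ 2) := by
    refine (abs_sum_le_sum_abs _ _).trans ?_
    refine (sum_le_sum fun j _ => (abs_sum_le_sum_abs _ _).trans
      (sum_le_sum fun l _ => (abs_real_inner_le_norm _ _).trans
        (c := 4 * (‖ζ‖ * ‖w‖ ^ 2)) ?_)).trans_eq ?_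
    · rw [norm_mul I, norm_I, one_mul]
      refine (mul_le_mul (hg l j) (hθ l j) (norm_nonneg _) (by positivity)).trans_eq ?_
      ring
    · simp; push_cast; ring
  have hB : |compB ζ w w| ≤ 3 * (‖ζ‖ * ‖w‖ ^ 2) := abs_sum_inner_le ζ (fun _ => hs _) fun _ => hs _
  have hC : |compC ζ w w| ≤ 3 * (‖ζ‖ * ‖w‖ ^ 2) := abs_sum_inner_le ζ (fun _ => hf _) fun _ => hf _
  have h1 : |comp K ζ w w| ≤ K * |compA ζ w w| + |compB ζ w w| + |compC ζ w w| := by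
    rw [comp]; refine (abs_add_three _ _ _).trans_eq ?_; rw [abs_mul, abs_of_pos hK]
  have h2 := mul_le_mul_of_nonneg_left hA hK.le
  calc _ ≤ (36 * K + 6) * (‖ζ‖ * ‖w‖ ^ 2) := by linarith
    _ ≤ _ := by gcongr

lemma norm_sq_le_mEn (N) (w : Fib) (hw : ∀ k, N < ℓ k → w.snd k = 0) :
    ‖w‖ ^ 2 ≤ 3 * (mEn w + diss N w) := by
  have h1 : ‖w.fst‖ ^ 2 = ‖w.fst none‖ ^ 2 + ∑ j, ‖w.fst (some j)‖ ^ 2 := by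
    rw [norm_sq_eq, sum_option]
  have e3 := sum_fluid_le w
  set F := (miLE N).filter fun k => 2 ≤ ℓ k with hF
  have h2 : ‖w.snd‖ ^ 2 = ∑ k ∈ miLE N, ‖w.snd k‖ ^ 2 :=
    (hSeq_hasSum_norm_sq w.snd).unique (hasSum_sum_of_ne_finset_zero fun k hk => by
      rw [hw k (not_le.1 (mt mem_miLE.2 hk)), norm_zero, zero_pow two_ne_zero])
  rw [← Finset.sum_filter_add_sum_filter_not _ fun k => 2 ≤ ℓ k] at h2
  have h3 : ∑ k ∈ miLE N with ¬2 ≤ ℓ k, ‖w.snd k‖ ^ 2 ≤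
      ‖w.snd 0‖ ^ 2 + ∑ j, ‖w.snd (dir j)‖ ^ 2 := by
    have h0 : 0 ∉ Finset.univ.image dir := fun h => by
      obtain ⟨j, -, hj⟩ := Finset.mem_image.1 h
      simpa [multiLength, len_dir] using (len_dir j).symm.trans (congrArg ℓ hj)
    rw [← sum_image (g := dir) (f := fun k => ‖w.snd k‖ ^ 2) fun a _ b _ h => dir_injective h]
    refine (Finset.sum_le_sum_of_subset_of_nonneg (fun k hk => ?_)
      fun _ _ _ => by positivity).trans_eq (Finset.sum_insert h0)
    rcases eq_zero_or_dir (not_le.1 (mem_filter.1 hk).2) with rfl | ⟨i, rfl⟩ <;> simp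
  have h4 : ∑ k ∈ F, ‖w.snd k‖ ^ 2 ≤ ∑ k ∈ F, (ℓ k) * ‖w.snd k‖ ^ 2 := by
    refine sum_le_sum fun k hk => ?_
    have : (1 : ℝ) ≤ ℓ k := by
      have := (mem_filter.1 hk).2; exact_mod_cast (by omega)
    nlinarith [sq_nonneg ‖w.snd k‖]
  have h5 : 0 ≤ ∑ k ∈ F, (ℓ k) * ‖w.snd k‖ ^ 2 := by positivity
  have h6 : 0 ≤ ∑ j, ‖w.fst (some j) - w.snd (dir j)‖ ^ 2 := by positivity
  rw [fib_nsq, h1, h2, mEn, diss]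
  nlinarith [sq_nonneg ‖w.snd 0‖, sq_nonneg ‖w.fst none‖]

/-! ### Decay of the semigroup at one frequency -/

lemma cont_diss (N) : Continuous (diss N) := by
  have h1 : diss N = fun w => ∑ j, ‖fluC (some j) w - hCo (dir j) w‖ ^ 2 +
    ∑ k ∈ (miLE N).filter (fun k => 2 ≤ ℓ k), (ℓ k) * ‖hCo k w‖ ^ 2 := by
    ext w; simp [diss]
  rw [h1]
  fun_prop

lemma hda_clm_flow (κ N ζ t x) (L : Fib →L[ℂ] ℂ) :
    HasDerivAt (fun s => L (flow κ N ζ s x)) (L (gen κ N ζ (flow κ N ζ t x))) t := by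
  have h := ((L.hasFDerivAt (x := flow κ N ζ t x)).restrictScalars ℝ).comp_hasDerivAt t
    (hda_flow κ N ζ t x)
  exact h

lemma hda_real_inner_flow (κ N ζ t x) (L M : Fib →L[ℂ] ℂ) :
    HasDerivAt (fun s => (inner ℝ (L (flow κ N ζ s x)) (M (flow κ N ζ s x)) : ℝ))
      (inner ℝ (L (gen κ N ζ (flow κ N ζ t x))) (M (flow κ N ζ t x)) +
        inner ℝ (L (flow κ N ζ t x)) (M (gen κ N ζ (flow κ N ζ t x)))) t :=
  ((hda_clm_flow κ N ζ t x L).inner ℝ (hda_clm_flow κ N ζ t x M)).congr_deriv (add_comm _ _)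

lemma hda_comp (κ K N ζ t x) : HasDerivAt (fun s => comp K ζ (flow κ N ζ s x) (flow κ N ζ s x))
      (comp K ζ (gen κ N ζ (flow κ N ζ t x)) (flow κ N ζ t x) +
        comp K ζ (flow κ N ζ t x) (gen κ N ζ (flow κ N ζ t x))) t := by
  let sg (l j) : Fib →L[ℂ] ℂ := I • ((ζ j : ℂ) • hCo (dir l) + (ζ l : ℂ) • hCo (dir j))
  let sm (l j) : Fib →L[ℂ] ℂ := (√((dir j l) + 1) : ℂ) • hCo (dir j + dir l)
  have eA (w v : Fib) : compA ζ w v = ∑ j, ∑ l, (inner ℝ (sg l j w) (sm l j v) : ℝ) := by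
    simp only [compA, sg, sm, sGr, mom, smul_apply, add_apply, hermCoord_apply, smul_eq_mul]
  have eB (w v : Fib) : compB ζ w v = ∑ j, (inner ℝ ((I • (ζ j : ℂ) • hCo 0) w)
      (hCo (dir j) v) : ℝ) := by
    simp only [compB, smul_apply, hermCoord_apply, smul_eq_mul]
  have eC (w v : Fib) : compC ζ w v = ∑ j, (inner ℝ ((I • (ζ j : ℂ) • fluC none) w)
      (fluC (some j) v) : ℝ) := by
    simp only [compC, smul_apply, fluidCoord_apply, smul_eq_mul]
  have hA : HasDerivAt (fun s => compA ζ (flow κ N ζ s x) (flow κ N ζ s x))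
      (compA ζ (gen κ N ζ (flow κ N ζ t x)) (flow κ N ζ t x) +
        compA ζ (flow κ N ζ t x) (gen κ N ζ (flow κ N ζ t x))) t := by
    simp only [eA, ← sum_add_distrib]
    exact HasDerivAt.fun_sum fun j _ => HasDerivAt.fun_sum fun l _ =>
      hda_real_inner_flow κ N ζ t x _ _
  have hB : HasDerivAt (fun s => compB ζ (flow κ N ζ s x) (flow κ N ζ s x))
      (compB ζ (gen κ N ζ (flow κ N ζ t x)) (flow κ N ζ t x) +
        compB ζ (flow κ N ζ t x) (gen κ N ζ (flow κ N ζ t x))) t := by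
    simp only [eB, ← sum_add_distrib]
    exact HasDerivAt.fun_sum fun j _ => hda_real_inner_flow κ N ζ t x _ _
  have hC : HasDerivAt (fun s => compC ζ (flow κ N ζ s x) (flow κ N ζ s x))
      (compC ζ (gen κ N ζ (flow κ N ζ t x)) (flow κ N ζ t x) +
        compC ζ (flow κ N ζ t x) (gen κ N ζ (flow κ N ζ t x))) t := by
    simp only [eC, ← sum_add_distrib]
    exact HasDerivAt.fun_sum fun j _ => hda_real_inner_flow κ N ζ t x _ _
  refine (((hA.const_mul K).add hB).add hC).congr_deriv ?_
  simp only [comp]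
  ring

def rate (lam : ℝ) (ζ : R3) : ℝ := lam * (‖ζ‖ ^ 2 / (1 + ‖ζ‖ ^ 2))

lemma ex_flow_decay {κ} (hκ : 0 < κ) : ∃ lam : ℝ, 0 < lam ∧
    ∀ N, 2 ≤ N → ∀ (ζ) (x : Fib) (t : ℝ), 0 ≤ t → exp (rate lam ζ * t) * ‖flow κ N ζ t x‖ ^ 2 +
        ∫ s in (0)..t, exp (rate lam ζ * s) * diss N (flow κ N ζ s x) ≤ 3 * ‖x‖ ^ 2 := by
  obtain ⟨K, c, C, hK, hc, hC, hcomp⟩ := ex_comp_gen_le hκ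
  set C₂ := 36 * K + 6 with hC₂
  have hC₂0 : 0 < C₂ := by positivity
  set η := min (1 / (2 * C₂)) (1 / C) with hη
  have hη0 : 0 < η := by positivity
  have hη1 : η * C₂ ≤ 1 / 2 := by
    calc η * C₂ ≤ 1 / (2 * C₂) * C₂ := by gcongr; exact min_le_left _ _
      _ = 1 / 2 := by field_simp
  have hη2 : η * C ≤ 1 := by
    calc η * C ≤ 1 / C * C := by gcongr; exact min_le_right _ _
      _ = 1 := by field_simp
  set lam := min (1 / 9) (2 / 9 * (η * c)) with hlam
  have hlam0 : 0 < lam := by positivity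
  have hlam1 : lam ≤ 1 / 9 := min_le_left _ _
  have hlam2 : 9 * lam ≤ 2 * (η * c) := by
    have : lam ≤ 2 / 9 * (η * c) := min_le_right _ _; linarith
  refine ⟨lam, hlam0, fun N hN ζ x t ht => ?_⟩
  set q := 1 / (1 + ‖ζ‖ ^ 2) with hq
  have hq0 : 0 < q := by positivity
  have hq1 : q * (1 + ‖ζ‖ ^ 2) = 1 := by rw [hq]; field_simp
  have hqz : q * ‖ζ‖ ^ 2 ≤ 1 := by linarith
  have hr : rate lam ζ = lam * (q * ‖ζ‖ ^ 2) := by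
    rw [rate, hq]; ring
  have hE w : |η * q * comp K ζ w w| ≤ 1 / 2 * ‖w‖ ^ 2 := by
    rw [abs_mul, abs_of_pos (by positivity)]
    calc η * q * |comp K ζ w w| ≤ η * q * (C₂ * ((1 + ‖ζ‖ ^ 2) * ‖w‖ ^ 2)) := by
          gcongr; exact abs_comp_le hK ζ w
      _ = η * C₂ * (q * (1 + ‖ζ‖ ^ 2)) * ‖w‖ ^ 2 := by ring
      _ ≤ 1 / 2 * ‖w‖ ^ 2 := by
          rw [hq1, mul_one]; gcongr
  set w := fun s => flow κ N ζ s x with hw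
  have hwd s := hda_norm_sq_flow κ N ζ s x
  have hcd s := hda_comp κ K N ζ s x
  have hdc : Continuous fun s => exp (rate lam ζ * s) * diss N (w s) := by
    refine (by fun_prop : Continuous fun s => exp (rate lam ζ * s)).mul ?_
    exact (cont_diss N).comp ((cont_flow κ N).comp
        ((continuous_const.prodMk continuous_id).prodMk continuous_const))
  have hexp s : HasDerivAt (fun s => exp (rate lam ζ * s))
      (exp (rate lam ζ * s) * (rate lam ζ * 1)) s :=
    ((hasDerivAt_id s).const_mul (rate lam ζ)).exp
  have hder s := ((hexp s).mul ((hwd s).add ((hcd s).const_mul (η * q)))).add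
    ((intervalIntegral.integral_hasDerivAt_right (hdc.intervalIntegrable 0 s)
      (hdc.stronglyMeasurableAtFilter _ _) hdc.continuousAt).const_mul (1 / 2))
  have hanti := antitone_hda hder (fun s => ?_) ht
  · simp only [Pi.add_apply, Pi.mul_apply, flow_zero, mul_zero, Real.exp_zero, one_mul,
      intervalIntegral.integral_same, add_zero] at hanti
    have h0 := (abs_le.1 (hE (trF N x))).2; have h1 := (abs_le.1 (hE (w t))).1
    have h2 := pow_le_pow_left₀ (norm_nonneg _) (norm_trF_le N x) 2
    have h3 : 0 < exp (rate lam ζ * t) := exp_pos _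
    have h4 : exp (rate lam ζ * t) * (1 / 2 * ‖w t‖ ^ 2) ≤ exp (rate lam ζ * t) *
        (‖w t‖ ^ 2 + η * q * comp K ζ (w t) (w t)) := by
      gcongr; linarith
    simp at h4 hanti ⊢; linarith
  · have h1 := hcomp N hN ζ (w s)
    have h2 := norm_sq_le_mEn N (w s) fun k hk => flow_snd_lt κ (by omega) ζ s x hk
    have h3 := (abs_le.1 (hE (w s))).2; have hD0 := diss_nn N (w s)
    have hM0 := mEn_nonneg (w s); simp only [Pi.add_apply]
    change _ * (‖w s‖ ^ 2 + η * q * comp K ζ (w s) (w s)) + exp (rate lam ζ * s) *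
      (-2 * diss N (w s) + η * q * (comp K ζ (gen κ N ζ (w s)) (w s) +
        comp K ζ (w s) (gen κ N ζ (w s)))) + 1 / 2 * (exp (rate lam ζ * s) * diss N (w s)) ≤ 0
    set D := diss N (w s); set Mm := mEn (w s); set Q := q * ‖ζ‖ ^ 2 with hQ
    have hQ0 : 0 ≤ Q := by positivity
    have k1 : η * q * (comp K ζ (gen κ N ζ (w s)) (w s) + comp K ζ (w s) (gen κ N ζ (w s))) ≤
        -(η * c * (Q * Mm)) + D := by
      calc _ ≤ η * q * (-(c * (‖ζ‖ ^ 2 * Mm)) + C * ((1 + ‖ζ‖ ^ 2) * D)) := by gcongr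
        _ = -(η * c * (Q * Mm)) + η * C * (q * (1 + ‖ζ‖ ^ 2)) * D := by
            rw [hQ]; ring
        _ ≤ _ := by
            rw [hq1, mul_one]; have := mul_le_mul_of_nonneg_right hη2 hD0
            linarith
    have k2 : rate lam ζ * (‖w s‖ ^ 2 + η * q * comp K ζ (w s) (w s)) ≤
        η * c * (Q * Mm) + 1 / 2 * D := by
      have e1 : 0 ≤ lam * Q := by positivity
      calc _ ≤ lam * Q * (3 / 2 * (3 * (Mm + D))) := by
            rw [hr]; gcongr; linarith
        _ = 9 * lam / 2 * (Q * Mm) + 9 * lam / 2 * Q * D := by ring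
        _ ≤ η * c * (Q * Mm) + 1 / 2 * 1 * D := by
            gcongr
            · linarith
            · linarith
        _ = _ := by ring
    have h3 : 0 < exp (rate lam ζ * s) := exp_pos _
    have k3 : rate lam ζ * (‖w s‖ ^ 2 + η * q * comp K ζ (w s) (w s)) +
        (-2 * D + η * q * (comp K ζ (gen κ N ζ (w s)) (w s) + comp K ζ (w s) (gen κ N ζ (w s)))) +
        1 / 2 * D ≤ 0 := by linarith
    have k4 := mul_le_mul_of_nonneg_left k3 h3.le; rw [mul_zero] at k4
    linarith

def hOp (K : ℕ) : HSeq →L[ℂ] HSeq := shft ((miLE K).filter fun k => 2 ≤ ℓ k) (fun k => √(ℓ k)) id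

lemma hOp_ap (K : ℕ) (y : HSeq) (k : MI) : hOp K y k = if ℓ k ≤ K ∧ 2 ≤ ℓ k then (√(ℓ k) : ℂ) * y k
      else 0 := by
  simp [hOp, shft_ap, mem_miLE]

lemma inner_hOp (K : ℕ) (y z : HSeq) : inner ℂ z (hOp K y) = inner ℂ (hOp K z) y := by
  rw [← inner_conj_symm (hOp K z), hOp, inner_shft, inner_shft, map_sum]
  refine sum_congr rfl fun k _ => ?_
  simp
  ring

lemma norm_sq_hOp_le (hKN : K ≤ N) (w : Fib) : ‖hOp K w.snd‖ ^ 2 ≤ diss N w := by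
  have h1 : ‖hOp K w.snd‖ ^ 2 = ∑ k ∈ (miLE K).filter (fun k => 2 ≤ ℓ k),
      (ℓ k) * ‖w.snd k‖ ^ 2 := by
    have h2 := hSeq_hasSum_norm_sq (hOp K w.snd); refine h2.unique (?_)
    have h3 : ∑ k ∈ (miLE K).filter (fun k => 2 ≤ ℓ k), (ℓ k) * ‖w.snd k‖ ^ 2 =
        ∑ k ∈ (miLE K).filter (fun k => 2 ≤ ℓ k), ‖hOp K w.snd k‖ ^ 2 := by
      refine sum_congr rfl fun k hk => ?_; rw [mem_filter, mem_miLE] at hk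
      rw [hOp_ap, if_pos hk, norm_mul, mul_pow, norm_real, norm_eq_abs, sq_abs,
        sq_sqrt (by positivity)]
    rw [h3]; refine hasSum_sum_of_ne_finset_zero fun k hk => ?_; rw [mem_filter, mem_miLE] at hk
    rw [hOp_ap, if_neg hk]; simp
  rw [h1]
  refine le_add_of_nonneg_of_le (by positivity) ?_
  refine Finset.sum_le_sum_of_subset_of_nonneg ?_ fun _ _ _ => by positivity
  intro k
  simp only [mem_filter, mem_miLE]
  omega

lemma rate_nonneg (h : 0 < lam) (ζ) : 0 ≤ rate lam ζ := by
  unfold rate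
  positivity

lemma exists_semig_decay (hκ : 0 < κ) : ∃ lam, 0 < lam ∧ ∀ (ζ) (x) (t), 0 ≤ t → ∀ K,
      exp (rate lam ζ * t) * ‖semig κ ζ t x‖ ^ 2 +
        ∫ s in (0)..t, exp (rate lam ζ * s) * ‖hOp K (semig κ ζ s x).snd‖ ^ 2 ≤ 3 * ‖x‖ ^ 2 := by
  obtain ⟨lam, hlam, h⟩ := ex_flow_decay hκ
  refine ⟨lam, hlam, fun ζ x t ht K => ?_⟩
  have hcont N : Continuous fun s => flow κ N ζ s x := (cont_flow κ N).comp
        ((continuous_const.prodMk continuous_id).prodMk continuous_const)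
  have hh w : hOp K w.snd = (hOp K).comp hCLM w := rfl
  have hlim : Tendsto (fun N => exp (rate lam ζ * t) * ‖flow κ N ζ t x‖ ^ 2 +
        ∫ s in (0)..t, exp (rate lam ζ * s) * ‖hOp K (flow κ N ζ s x).snd‖ ^ 2) atTop
      (𝓝 (exp (rate lam ζ * t) * ‖semig κ ζ t x‖ ^ 2 +
        ∫ s in (0)..t, exp (rate lam ζ * s) * ‖hOp K (semig κ ζ s x).snd‖ ^ 2)) := by
    refine (((tt_flow κ ζ ht x).norm.pow 2).const_mul _).add ?_; simp only [hh]
    refine intervalIntegral.tendsto_integral_filter_of_dominated_convergence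
      (fun s => exp (rate lam ζ * s) * (‖(hOp K).comp hCLM‖ * ‖x‖) ^ 2) ?_ ?_ ?_ ?_
    · refine .of_forall fun N => Continuous.aestronglyMeasurable ?_
      exact (by fun_prop : Continuous fun s => exp (rate lam ζ * s)).mul
        ((((hOp K).comp hCLM).continuous.comp (hcont N)).norm.pow 2)
    · refine .of_forall fun N => .of_forall fun s hs => ?_; rw [uIoc_of_le ht] at hs
      rw [norm_eq_abs, abs_of_nonneg (by positivity)]
      gcongr; refine (((hOp K).comp hCLM).le_opNorm _).trans ?_; gcongr
      exact norm_flow_le κ N ζ hs.1.le x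
    · exact Continuous.intervalIntegrable (by fun_prop) _ _
    · refine .of_forall fun s hs => ?_; rw [uIoc_of_le ht] at hs
      exact ((((hOp K).comp hCLM).continuous.tendsto _).comp
        (tt_flow κ ζ hs.1.le x)).norm.pow 2 |>.const_mul _
  refine le_of_tendsto hlim ?_
  filter_upwards [eventually_ge_atTop (max 2 K)] with N hN
  refine le_trans ?_ (h N ((le_max_left _ _).trans hN) ζ x t ht)
  gcongr
  refine integral_mono_on ht ?_ ?_ fun s _ => ?_
  · refine Continuous.intervalIntegrable ?_ _ _
    exact (by fun_prop : Continuous fun s => exp (rate lam ζ * s)).mul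
        ((((hOp K).comp hCLM).continuous.comp (hcont N)).norm.pow 2)
  · refine Continuous.intervalIntegrable ?_ _ _
    exact (by fun_prop : Continuous fun s => exp (rate lam ζ * s)).mul
        ((cont_diss N).comp (hcont N))
  · gcongr; exact norm_sq_hOp_le ((le_max_right _ _).trans hN) _

/-! ### Square integrable functions of the frequency -/

abbrev Spec := Lx Fib

section L2

variable {α E : Type*} [MeasurableSpace α] {μ : Measure α} [NormedAddCommGroup E]

lemma eLpNorm_two_sq (f : α → E) : eLpNorm f 2 μ ^ 2 = ∫⁻ a, ‖f a‖ₑ ^ 2 ∂μ := by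
  rw [eLpNorm_eq_lintegral_rpow_enorm_toReal (by simp) (by simp)]
  rw [← rpow_natCast, ← rpow_mul]
  simp

lemma en_sq_Lp (f : Lp E 2 μ) : ‖f‖ₑ ^ 2 = ∫⁻ a, ‖f a‖ₑ ^ 2 ∂μ := by
  rw [Lp.enorm_def, eLpNorm_two_sq]

lemma memLp_two_lint {f : α → E} (hf : AEStronglyMeasurable f μ)
    (h : ∫⁻ a, ‖f a‖ₑ ^ 2 ∂μ < ⊤) : MemLp f 2 μ := by
  refine ⟨hf, ?_⟩
  rw [← eLpNorm_two_sq] at h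
  by_contra hne
  rw [not_lt, top_le_iff] at hne
  simp [hne] at h

lemma MemLp.lintegral_sq_lt_top {f : α → E} (hf : MemLp f 2 μ) : ∫⁻ a, ‖f a‖ₑ ^ 2 ∂μ < ⊤ := by
  rw [← eLpNorm_two_sq]
  exact pow_lt_top hf.2

end L2

lemma meas_scaled (η : ℝ) : Measurable fun ξ : R3 => η • ξ := measurable_const_smul η

lemma memLp_semig (κ η t : ℝ) (X : Spec) : MemLp (fun ξ => semig κ (η • ξ) t (X ξ)) 2 :=
  (Lp.memLp X).of_le (aesm_semig κ (meas_scaled η) measurable_const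
    (Lp.aestronglyMeasurable X)) (.of_forall fun ξ => norm_semig_le κ _ _ _)

def evol (κ η t : ℝ) : Spec →L[ℂ] Spec := LinearMap.mkContinuous
    { toFun := fun X => MemLp.toLp (fun ξ => semig κ (η • ξ) t (X ξ)) (memLp_semig κ η t X)
      map_add' := fun X Y => by
        rw [← MemLp.toLp_add]
        refine MemLp.toLp_congr _ _ ?_
        filter_upwards [Lp.coeFn_add X Y] with ξ h
        rw [h]
        simp
      map_smul' := fun c X => by
        rw [RingHom.id_apply, ← MemLp.toLp_const_smul]
        refine MemLp.toLp_congr _ _ ?_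
        filter_upwards [Lp.coeFn_smul c X] with ξ h
        rw [h]
        simp } 1 fun X => by
    rw [one_mul]
    refine Lp.norm_le_norm_of_ae_le ?_
    filter_upwards [(memLp_semig κ η t X).coeFn_toLp] with ξ h
    change ‖MemLp.toLp (fun ξ => semig κ (η • ξ) t (X ξ)) (memLp_semig κ η t X) ξ‖ ≤ _
    rw [h]
    exact norm_semig_le κ _ _ _

lemma evol_ae (κ η t : ℝ) (X : Spec) : ∀ᵐ ξ, evol κ η t X ξ = semig κ (η • ξ) t (X ξ) :=
  (memLp_semig κ η t X).coeFn_toLp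

lemma norm_evol_le (κ η t X) : ‖evol κ η t X‖ ≤ ‖X‖ := by
  refine Lp.norm_le_norm_of_ae_le ?_
  filter_upwards [evol_ae κ η t X] with ξ h
  rw [h]
  exact norm_semig_le κ _ _ _

lemma inner_congr_ae {E F : Type*} [NormedAddCommGroup E] [InnerProductSpace ℂ E]
    [NormedAddCommGroup F] [InnerProductSpace ℂ F] {X Y : Lx E} {X' Y' : Lx F}
    (h : ∀ᵐ ξ, inner ℂ (X ξ) (Y ξ) = inner ℂ (X' ξ) (Y' ξ)) : inner ℂ X Y = inner ℂ X' Y' := by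
  rw [L2.inner_def, L2.inner_def]
  exact integral_congr_ae h

lemma evol_symm (κ η t : ℝ) (X Y : Spec) :
    inner ℂ Y (evol κ η t X) = inner ℂ (evol κ (-η) t Y) X := by
  refine inner_congr_ae ?_
  filter_upwards [evol_ae κ η t X, evol_ae κ (-η) t Y] with ξ h1 h2
  rw [h1, h2, semig_symm, neg_smul]

lemma cont_evol_ap (κ η) (X : Spec) : Continuous fun t => evol κ η t X := by
  rw [continuous_iff_continuousAt]
  intro t₀
  rw [ContinuousAt, tendsto_iff_edist_tendsto_0]
  have h1 t : edist (evol κ η t X) (evol κ η t₀ X) ^ 2 =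
      ∫⁻ ξ, ‖semig κ (η • ξ) t (X ξ) - semig κ (η • ξ) t₀ (X ξ)‖ₑ ^ 2 := by
    rw [edist_eq_enorm_sub, en_sq_Lp]; refine lintegral_congr_ae ?_
    filter_upwards [evol_ae κ η t X, evol_ae κ η t₀ X,
      Lp.coeFn_sub (evol κ η t X) (evol κ η t₀ X)] with ξ h1 h2 h3
    rw [h3, Pi.sub_apply, h1, h2]
  have hm t := aesm_semig κ (meas_scaled η) (measurable_const (a := t)) (Lp.aestronglyMeasurable X)
  have h2 : Tendsto (fun t => ∫⁻ ξ, ‖semig κ (η • ξ) t (X ξ) - semig κ (η • ξ) t₀ (X ξ)‖ₑ ^ 2)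
      (𝓝 t₀) (𝓝 (∫⁻ _ : R3, 0)) := by
    refine tendsto_lintegral_filter_of_dominated_convergence' (fun ξ => (2 * ‖X ξ‖ₑ) ^ 2) ?_ ?_ ?_ ?_
    · exact .of_forall fun t => ((hm t).sub (hm t₀)).enorm.pow_const 2
    · refine .of_forall fun t => .of_forall fun ξ => ?_; gcongr; refine (enorm_sub_le).trans ?_
      rw [two_mul]
      exact add_le_add (enorm_le_iff_norm_le.2 (norm_semig_le κ _ _ _))
        (enorm_le_iff_norm_le.2 (norm_semig_le κ _ _ _))
    · simp only [mul_pow]; rw [lintegral_const_mul' _ _ (by simp)]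
      exact (mul_lt_top (by simp) (MemLp.lintegral_sq_lt_top (Lp.memLp X))).ne
    · refine .of_forall fun ξ => ?_
      have := ((ENNReal.continuous_pow 2).comp ((cont_semig κ (η • ξ) (X ξ)).sub
        (continuous_const (y := semig κ (η • ξ) t₀ (X ξ)))).enorm).tendsto t₀
      simpa [comp_def] using this
  simp only [← h1, lintegral_zero] at h2
  have h3 := (ENNReal.continuous_rpow_const (y := 1 / 2)).tendsto 0 |>.comp h2
  simp only [one_div, comp_def] at h3
  rw [ENNReal.zero_rpow_of_pos (by norm_num)] at h3
  refine h3.congr fun t => ?_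
  rw [← rpow_natCast, ← rpow_mul]
  simp

lemma cont_evol (κ η) : Continuous fun z : ℝ × Spec => evol κ η z.1 z.2 := by
  rw [continuous_iff_continuousAt]
  intro ⟨t₀, X₀⟩
  rw [ContinuousAt, tendsto_iff_norm_sub_tendsto_zero]
  have h1 : Tendsto (fun z : ℝ × Spec => ‖z.2 - X₀‖ + ‖evol κ η z.1 X₀ - evol κ η t₀ X₀‖)
      (𝓝 (t₀, X₀)) (𝓝 0) := by
    have hc : Continuous fun z : ℝ × Spec => ‖z.2 - X₀‖ + ‖evol κ η z.1 X₀ - evol κ η t₀ X₀‖ :=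
      (continuous_snd.sub continuous_const).norm.add
        ((((cont_evol_ap κ η X₀).comp continuous_fst)).sub continuous_const).norm
    simpa using hc.tendsto (t₀, X₀)
  refine squeeze_zero (fun _ => norm_nonneg _) (fun z => ?_) h1
  have : evol κ η z.1 z.2 - evol κ η t₀ X₀ =
      evol κ η z.1 (z.2 - X₀) + (evol κ η z.1 X₀ - evol κ η t₀ X₀) := by
    rw [map_sub]; abel
  simp only [this]
  exact (norm_add_le _ _).trans (add_le_add_left (norm_evol_le κ η _ _) _)

def IsGenL2 (κ η : ℝ) (Y Y' : Spec) : Prop := ∀ᵐ ξ : R3, IsGen κ (-(η • ξ)) (Y ξ) (Y' ξ)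

lemma inner_evol_eq_int (h : IsGenL2 κ η Y Y') {t : ℝ} (ht : 0 ≤ t) (X : Spec) :
    inner ℂ Y (evol κ η t X) = inner ℂ Y X + ∫ s in (0)..t, inner ℂ Y' (evol κ η s X) := by
  have hsw : ∫ s in (0)..t, inner ℂ Y' (evol κ η s X) =
      ∫ ξ, ∫ s in (0)..t, inner ℂ (Y' ξ) (semig κ (η • ξ) s (X ξ)) := by
    have hint : Integrable (uncurry fun s ξ =>
        inner ℂ (Y' ξ) (semig κ (η • ξ) s (X ξ)))
        ((volume.restrict (Ioc 0 t)).prod volume) := by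
      have hb : Integrable (fun z : ℝ × R3 => ‖Y' z.2‖ * ‖X z.2‖)
          ((volume.restrict (Ioc 0 t)).prod volume) := by
        have h0 := (Lp.memLp Y').norm.integrable_mul (Lp.memLp X).norm
        simpa using (integrable_const 1 (μ := volume.restrict (Ioc 0 t))).mul_prod h0
      refine hb.mono' ?_ (.of_forall fun z => ?_)
      · refine AEStronglyMeasurable.inner (Lp.aestronglyMeasurable Y').comp_snd ?_
        exact aesm_semig κ ((meas_scaled η).comp measurable_snd)
          measurable_fst (Lp.aestronglyMeasurable X).comp_snd
      · refine (norm_inner_le_norm _ _).trans ?_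
        exact mul_le_mul_of_nonneg_left (norm_semig_le κ _ _ _) (norm_nonneg _)
    simp only [integral_of_le ht]; rw [← integral_integral_swap hint]
    refine integral_congr_ae (.of_forall fun s => ?_); dsimp only
    rw [L2.inner_def]; refine integral_congr_ae ?_; filter_upwards [evol_ae κ η s X] with ξ h1
    rw [h1]
  have h2 : (fun ξ => inner ℂ (Y ξ) (evol κ η t X ξ)) =ᵐ[volume] fun ξ => inner ℂ (Y ξ) (X ξ) +
      ∫ s in (0)..t, inner ℂ (Y' ξ) (semig κ (η • ξ) s (X ξ)) := by
    filter_upwards [h, evol_ae κ η t X] with ξ h1 h2; rw [h2, inner_semig_eq_int h1 ht]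
  have h3 : Integrable (fun ξ => ∫ s in (0)..t, inner ℂ (Y' ξ) (semig κ (η • ξ) s (X ξ))) := by
    have := ((L2.integrable_inner (𝕜 := ℂ) Y (evol κ η t X)).congr h2).sub
      (L2.integrable_inner (𝕜 := ℂ) Y X)
    refine this.congr (.of_forall fun ξ => ?_); simp
  rw [L2.inner_def, integral_congr_ae h2, hsw, L2.inner_def, ← integral_add
    (L2.integrable_inner (𝕜 := ℂ) Y X) h3]

/-! ### Duhamel's formula -/

def duh (κ η : ℝ) (S : ℝ → Spec) (t : ℝ) : Spec := ∫ s in (0)..t, evol κ η (t - s) (S s)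

def IsL1Loc (S : ℝ → Spec) : Prop := ∀ T : ℝ, 0 ≤ T → IntervalIntegrable S volume 0 T

lemma aesm_evol (κ η) {α : Type*} [MeasurableSpace α] {μ : Measure α}
    {τ : α → ℝ} {S : α → Spec} (hτ : AEStronglyMeasurable τ μ) (hS : AEStronglyMeasurable S μ) :
    AEStronglyMeasurable (fun a => evol κ η (τ a) (S a)) μ :=
  Continuous.comp_aestronglyMeasurable (f := fun a => (τ a, S a))
    (g := fun z : ℝ × Spec => evol κ η z.1 z.2) (cont_evol κ η) (hτ.prodMk hS)

lemma ii_evol {κ η S} (hS : IsL1Loc S) (τ : ℝ → ℝ) (hτ : Measurable τ) {t : ℝ} (ht : 0 ≤ t) :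
    IntervalIntegrable (fun s => evol κ η (τ s) (S s)) volume 0 t := by
  have h := hS t ht
  rw [intervalIntegrable_iff_integrableOn_Ioc_of_le ht] at h ⊢
  exact h.norm.mono' (aesm_evol κ η hτ.aestronglyMeasurable
    h.aestronglyMeasurable) (.of_forall fun s => norm_evol_le κ η _ _)

lemma contOn_duh {κ η} {S : ℝ → Spec} (hS : IsL1Loc S) : ContinuousOn (duh κ η S) (Ici 0) := by
  intro t₀ ht₀
  have ht₀ : 0 ≤ t₀ := ht₀
  have hT : 0 ≤ t₀ + 1 := by linarith
  have hSi := (intervalIntegrable_iff_integrableOn_Ioc_of_le hT).1 (hS _ hT)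
  have heq : ∀ t ∈ Ici 0 ∩ Iic (t₀ + 1), duh κ η S t =
      ∫ s in Ioc 0 (t₀ + 1), (Iic t).indicator (fun s => evol κ η (t - s) (S s)) s := by
    intro t ht
    rw [duh, integral_of_le ht.1, integral_indicator measurableSet_Iic,
      Measure.restrict_restrict measurableSet_Iic]
    congr 2; ext s; simp
    exact ⟨fun h => ⟨h.2, h.1, h.2.trans ht.2⟩, fun h => ⟨h.2.1, h.1⟩⟩
  have hnhds : Ici 0 ∩ Iic (t₀ + 1) ∈ 𝓝[Ici 0] t₀ :=
    inter_mem self_mem_nhdsWithin (mem_nhdsWithin_of_mem_nhds (Iic_mem_nhds (by linarith)))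
  refine ContinuousWithinAt.congr_of_eventuallyEq ?_
    (eventually_of_mem hnhds fun t ht => heq t ht) (heq t₀ ⟨ht₀, by simp⟩)
  refine continuousWithinAt_of_dominated (bound := fun s => ‖S s‖) ?_ ?_ hSi.norm ?_
  · refine .of_forall fun t => AEStronglyMeasurable.indicator ?_ measurableSet_Iic
    exact aesm_evol κ η (by fun_prop) hSi.aestronglyMeasurable
  · refine .of_forall fun t => .of_forall fun s => ?_
    refine (norm_indicator_le_norm_self _ _).trans (norm_evol_le κ η _ _)
  · have hne : ∀ᵐ s ∂(volume.restrict (Ioc 0 (t₀ + 1))), s ≠ t₀ :=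
      ae_restrict_of_ae (by simp [ae_iff])
    filter_upwards [hne] with s hs; refine ContinuousAt.continuousWithinAt ?_
    rcases lt_or_gt_of_ne hs with h | h
    · have hc : Continuous fun t => evol κ η (t - s) (S s) :=
        (cont_evol_ap κ η (S s)).comp (continuous_id.sub continuous_const)
      refine hc.continuousAt.congr ?_; filter_upwards [Ioi_mem_nhds h] with t ht
      rw [indicator_of_mem (mem_Iic.2 (le_of_lt (mem_Ioi.1 ht)))]
    · refine (continuousAt_const (y := 0)).congr ?_; filter_upwards [Iio_mem_nhds h] with t ht
      rw [indicator_of_notMem (notMem_Iic.2 (mem_Iio.1 ht))]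

lemma inner_duh (hS : IsL1Loc S) (ht : 0 ≤ t) (Y : Spec) :
    inner ℂ Y (duh κ η S t) = ∫ s in (0)..t, inner ℂ Y (evol κ η (t - s) (S s)) :=
  ((innerSL ℂ Y).intervalIntegral_comp_comm (ii_evol hS (fun s => t - s) (by fun_prop) ht)).symm

lemma inner_duh_eq_int {κ η Y Y'} (h : IsGenL2 κ η Y Y') {S : ℝ → Spec}
    (hS : IsL1Loc S) {t : ℝ} (ht : 0 ≤ t) :
    inner ℂ Y (duh κ η S t) = (∫ s in (0)..t, inner ℂ Y' (duh κ η S s)) +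
      ∫ s in (0)..t, inner ℂ Y (S s) := by
  have hSi := (intervalIntegrable_iff_integrableOn_Ioc_of_le ht).1 (hS _ ht)
  set Q : ℝ → ℝ → ℂ := fun s r => (Iic r).indicator (fun s => inner ℂ Y' (evol κ η (r - s) (S s))) s
  have hint : Integrable (uncurry Q)
      ((volume.restrict (Ioc 0 t)).prod (volume.restrict (Ioc 0 t))) := by
    have hb : Integrable (fun z : ℝ × ℝ => ‖Y'‖ * ‖S z.1‖)
        ((volume.restrict (Ioc 0 t)).prod (volume.restrict (Ioc 0 t))) :=
      (hSi.norm.comp_fst _).const_mul _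
    refine hb.mono' ?_ (.of_forall fun z => ?_)
    · have h1 : AEStronglyMeasurable (fun z : ℝ × ℝ => inner ℂ Y' (evol κ η (z.2 - z.1) (S z.1)))
          ((volume.restrict (Ioc 0 t)).prod (volume.restrict (Ioc 0 t))) :=
        AEStronglyMeasurable.inner aestronglyMeasurable_const
          (aesm_evol κ η (by fun_prop) hSi.aestronglyMeasurable.comp_fst)
      have h2 := h1.indicator (measurableSet_le measurable_fst measurable_snd)
      refine h2.congr (.of_forall fun z => ?_)
      simp only [indicator, uncurry, Q, mem_Iic, mem_ofPred_eq]
    · simp only [uncurry, Q]; refine (norm_indicator_le_norm_self _ _).trans ?_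
      refine (norm_inner_le_norm _ _).trans ?_
      exact mul_le_mul_of_nonneg_left (norm_evol_le κ η _ _) (norm_nonneg _)
  have hleft : ∀ s ∈ Ioc 0 t, inner ℂ Y (evol κ η (t - s) (S s)) =
      inner ℂ Y (S s) + ∫ r in Ioc 0 t, Q s r := by
    intro s hs; rw [inner_evol_eq_int h (by linarith [hs.2])]; congr 1
    have h1 := intervalIntegral.integral_comp_sub_right (a := s) (b := t)
      (fun r => inner ℂ Y' (evol κ η r (S s))) s
    rw [sub_self] at h1; rw [← h1, integral_of_le hs.2]
    have h2 : (fun r => Q s r) = (Ici s).indicator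
        (fun r => inner ℂ Y' (evol κ η (r - s) (S s))) := by
      funext r; simp only [Q, indicator, mem_Iic, mem_Ici]
    rw [h2, integral_indicator measurableSet_Ici, Measure.restrict_restrict measurableSet_Ici,
      ← integral_Icc_eq_integral_Ioc]
    congr 2; ext r; simp only [mem_inter_iff, mem_Ici, mem_Ioc, mem_Icc]
    exact ⟨fun hr => ⟨hr.1, hs.1.trans_le hr.1, hr.2⟩, fun hr => ⟨hr.1, hr.2.2⟩⟩
  have hright : ∀ r ∈ Ioc 0 t, inner ℂ Y' (duh κ η S r) = ∫ s in Ioc 0 t, Q s r := by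
    intro r hr; rw [inner_duh hS hr.1.le, integral_of_le hr.1.le]
    simp only [Q]
    rw [integral_indicator measurableSet_Iic, Measure.restrict_restrict measurableSet_Iic]
    congr 2; ext s; simp only [mem_inter_iff, mem_Iic, mem_Ioc]
    exact ⟨fun h => ⟨h.2, h.1, h.2.trans hr.2⟩, fun h => ⟨h.2.1, h.1⟩⟩
  have hp : Integrable (fun s => ∫ r in Ioc 0 t, Q s r) (volume.restrict (Ioc 0 t)) :=
    hint.integral_prod_left
  rw [inner_duh hS ht]
  simp only [integral_of_le ht]
  rw [setIntegral_congr_fun measurableSet_Ioc hleft, setIntegral_congr_fun measurableSet_Ioc hright,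
    integral_add ?_ hp, integral_integral_swap hint, add_comm]
  exact (innerSL ℂ Y).integrable_comp hSi

/-! ### Multipliers -/

section SpecOp

variable {E : Type*} [NormedAddCommGroup E] [NormedSpace ℂ E]

lemma memLp_specOp (T : R3 → E →L[ℂ] E)
    (hm : ∀ X : Lp E 2 (volume), AEStronglyMeasurable fun ξ => T ξ (X ξ))
    (hb : ∀ ξ w, ‖T ξ w‖ ≤ C * ‖w‖) (X : Lp E 2 (volume)) :
    MemLp (fun ξ => T ξ (X ξ)) 2 :=
  (Lp.memLp X).of_le_mul (hm X) (.of_forall fun ξ => hb ξ (X ξ))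

variable (T : R3 → E →L[ℂ] E)
  (hm : ∀ X : Lx E, AEStronglyMeasurable fun ξ => T ξ (X ξ))
  {C : ℝ} (hb : ∀ ξ w, ‖T ξ w‖ ≤ C * ‖w‖)

def specOp : Lx E →L[ℂ] Lx E :=
  LinearMap.mkContinuous
    { toFun := fun X => (memLp_specOp T hm hb X).toLp _
      map_add' := fun X Y => by
        rw [← MemLp.toLp_add]
        refine MemLp.toLp_congr _ _ ?_
        filter_upwards [Lp.coeFn_add X Y] with ξ h
        rw [h]
        simp
      map_smul' := fun c X => by
        rw [RingHom.id_apply, ← MemLp.toLp_const_smul]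
        refine MemLp.toLp_congr _ _ ?_
        filter_upwards [Lp.coeFn_smul c X] with ξ h
        rw [h]
        simp } C fun X => by
    refine Lp.norm_le_mul_norm_of_ae_le_mul ?_
    filter_upwards [(memLp_specOp T hm hb X).coeFn_toLp] with ξ h
    change ‖MemLp.toLp (fun ξ => T ξ (X ξ)) (memLp_specOp T hm hb X) ξ‖ ≤ _
    rw [h]
    exact hb ξ (X ξ)

lemma specOp_ae (X : Lp E 2 (volume)) : ∀ᵐ ξ, specOp T hm hb X ξ = T ξ (X ξ) :=
  (memLp_specOp T hm hb X).coeFn_toLp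

def mulL (m : R3 → ℝ) (hm : Measurable m) (C : ℝ) (hb : ∀ ξ, |m ξ| ≤ C) : Lx E →L[ℂ] Lx E :=
  specOp (fun ξ => (m ξ : ℂ) • .id ℂ E)
    (fun X => (Complex.measurable_ofReal.comp hm).aestronglyMeasurable.smul
      (Lp.aestronglyMeasurable X)) (C := C) fun ξ w => by
    change ‖(m ξ : ℂ) • w‖ ≤ _
    rw [norm_smul, norm_real]
    exact mul_le_mul_of_nonneg_right (hb ξ) (norm_nonneg _)

lemma mulL_ae (hm : Measurable m) (hb : ∀ ξ, |m ξ| ≤ C)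
    (X : Lx E) : ∀ᵐ ξ, mulL m hm C hb X ξ = (m ξ : ℂ) • X ξ :=
  specOp_ae _ _ _ X

end SpecOp

lemma en_sq_mulL (hm : Measurable m) (hb : ∀ ξ, |m ξ| ≤ C) (X : Spec) :
    ‖mulL m hm C hb X‖ₑ ^ 2 = ∫⁻ ξ, ofReal (m ξ ^ 2) * ‖X ξ‖ₑ ^ 2 := by
  rw [en_sq_Lp]
  refine lintegral_congr_ae ?_
  filter_upwards [mulL_ae hm hb X] with ξ h
  rw [h, enorm_smul, mul_pow, ← ofReal_norm (m ξ : ℂ), norm_real, norm_eq_abs, ← ofReal_pow (abs_nonneg _), sq_abs]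

lemma mulL_symm (hm : Measurable m) (hb : ∀ ξ, |m ξ| ≤ C) (X Y : Spec) :
    inner ℂ Y (mulL m hm C hb X) = inner ℂ (mulL m hm C hb Y) X := by
  refine inner_congr_ae ?_
  filter_upwards [mulL_ae hm hb X, mulL_ae hm hb Y] with ξ h1 h2
  rw [h1, h2, inner_smul_left, inner_smul_right, conj_ofReal]

/-! ### Sources with a loss of half a derivative -/

def hFib (K : ℕ) : Fib →L[ℂ] Fib := pCLM.comp (ContinuousLinearMap.prod 0 ((hOp K).comp hCLM))

lemma hFib_fst (K : ℕ) (w : Fib) : (hFib K w).fst = 0 := rfl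
lemma halfFib_snd K w : (hFib K w).snd = hOp K w.snd := rfl

lemma inner_hFib (K : ℕ) (z w : Fib) : inner ℂ z (hFib K w) = inner ℂ (hOp K z.snd) w.snd := by
  rw [in_fib, hFib_fst, halfFib_snd, inner_zero_right, zero_add, inner_hOp]

lemma inner_hFib_left (K : ℕ) (z w : Fib) : inner ℂ (hFib K z) w = inner ℂ (hOp K z.snd) w.snd := by
  rw [in_fib, hFib_fst, halfFib_snd, inner_zero_left, zero_add]

def halfL (K : ℕ) : Spec →L[ℂ] Spec := (hFib K).compLpL 2 volume

def truncL (K : ℕ) : Spec →L[ℂ] Spec := (trF K).compLpL 2 volume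

lemma halfL_ae (K : ℕ) (X : Spec) : ∀ᵐ ξ, halfL K X ξ = hFib K (X ξ) := (hFib K).coeFn_compLpL X

lemma truncL_ae (K : ℕ) (X : Spec) : ∀ᵐ ξ, truncL K X ξ = trF K (X ξ) := (trF K).coeFn_compLpL X

lemma halfL_symm (K : ℕ) (X Y : Spec) : inner ℂ Y (halfL K X) = inner ℂ (halfL K Y) X := by
  refine inner_congr_ae ?_
  filter_upwards [halfL_ae K X, halfL_ae K Y] with ξ h1 h2
  rw [h1, h2, inner_hFib, inner_hFib_left]

lemma norm_truncL_le (K X) : ‖truncL K X‖ ≤ ‖X‖ := by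
  refine Lp.norm_le_norm_of_ae_le ?_
  filter_upwards [truncL_ae K X] with ξ h
  rw [h]
  exact norm_trF_le K _

lemma tt_truncL (X : Spec) : Tendsto (fun K => truncL K X) atTop (𝓝 X) := by
  rw [tendsto_iff_edist_tendsto_0]
  have h1 K : edist (truncL K X) X ^ 2 = ∫⁻ ξ, ‖trF K (X ξ) - X ξ‖ₑ ^ 2 := by
    rw [edist_eq_enorm_sub, en_sq_Lp]; refine lintegral_congr_ae ?_
    filter_upwards [truncL_ae K X, Lp.coeFn_sub (truncL K X) X] with ξ h1 h2
    rw [h2, Pi.sub_apply, h1]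
  have h2 : Tendsto (fun K => ∫⁻ ξ, ‖trF K (X ξ) - X ξ‖ₑ ^ 2) atTop (𝓝 (∫⁻ _ : R3, 0)) := by
    refine tendsto_lintegral_of_dominated_convergence' (fun ξ => (2 * ‖X ξ‖ₑ) ^ 2) ?_ ?_ ?_ ?_
    · exact fun K => (((trF K).continuous.comp_aestronglyMeasurable
        (Lp.aestronglyMeasurable X)).sub (Lp.aestronglyMeasurable X)).enorm.pow_const 2
    · refine fun K => .of_forall fun ξ => ?_; refine pow_le_pow_left' (enorm_sub_le.trans ?_) 2
      rw [two_mul]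
      exact add_le_add_left (enorm_le_iff_norm_le.2 (norm_trF_le _ _)) _
    · simp only [mul_pow]; rw [lintegral_const_mul' _ _ (by simp)]
      exact (mul_lt_top (by simp) (MemLp.lintegral_sq_lt_top (Lp.memLp X))).ne
    · refine .of_forall fun ξ => ?_; have h3 := ((tt_trF (X ξ)).sub_const (X ξ)).enorm
      have := ((ENNReal.continuous_pow 2).tendsto _).comp h3
      simpa [comp_def] using this
  simp only [← h1, lintegral_zero] at h2
  have h3 := (ENNReal.continuous_rpow_const (y := 1 / 2)).tendsto 0 |>.comp h2
  simp only [one_div, comp_def] at h3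
  rw [ENNReal.zero_rpow_of_pos (by norm_num)] at h3
  refine h3.congr fun t => ?_
  rw [← rpow_natCast, ← rpow_mul]
  simp

lemma hFib_sub_trF {K L : ℕ} (h : K ≤ L) (w : Fib) :
    hFib L (w - trF K w) = hFib L w - hFib K w := by
  refine fib_ext (by simp [hFib_fst]) fun k => ?_
  simp only [halfFib_snd, WithLp.sub_snd, map_sub]
  rw [lp.coeFn_sub, lp.coeFn_sub, Pi.sub_apply, Pi.sub_apply, hOp_ap, hOp_ap, hOp_ap, trF_snd_ap]
  split_ifs with h1 h2 h3 h4 <;> first | omega | simp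

lemma halfL_sub_truncL (h : K ≤ L) (X) : halfL L (X - truncL K X) = halfL L X - halfL K X := by
  refine Lp.ext ?_
  filter_upwards [halfL_ae L (X - truncL K X), halfL_ae L X, halfL_ae K X, truncL_ae K X,
    Lp.coeFn_sub X (truncL K X), Lp.coeFn_sub (halfL L X) (halfL K X)] with ξ h1 h2 h3 h4 h5 h6
  rw [h1, h6, h5, Pi.sub_apply, Pi.sub_apply, h2, h3, h4, hFib_sub_trF h]

structure IsL2Loc (Z : ℝ → Spec) : Prop where
  meas : AEStronglyMeasurable Z (volume.restrict (Ioi 0))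
  finite : ∀ T : ℝ, ∫⁻ s in Ioc 0 T, ‖Z s‖ₑ ^ 2 < ⊤

lemma IsL2Loc.aesm (hZ : IsL2Loc Z) (T : ℝ) : AEStronglyMeasurable Z (volume.restrict (Ioc 0 T)) :=
  hZ.meas.mono_measure (Measure.restrict_mono Ioc_subset_Ioi_self le_rfl)

lemma IsL2Loc.isL1Loc {Z} (hZ : IsL2Loc Z) : IsL1Loc Z := by
  intro T hT
  rw [intervalIntegrable_iff_integrableOn_Ioc_of_le hT]
  have := memLp_two_lint (hZ.aesm T) (hZ.finite T)
  exact this.integrable (by norm_num)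

lemma IsL2Loc.comp {Z : ℝ → Spec} (hZ : IsL2Loc Z) (B : Spec →L[ℂ] Spec) :
    IsL2Loc fun s => B (Z s) where
  meas := B.continuous.comp_aestronglyMeasurable hZ.meas
  finite T := by
    refine lt_of_le_of_lt (lintegral_mono (g := fun s => ‖B‖ₑ ^ 2 * ‖Z s‖ₑ ^ 2) fun s => ?_) ?_
    · change _ ≤ ‖B‖ₑ ^ 2 * ‖Z s‖ₑ ^ 2
      rw [← mul_pow]
      exact pow_le_pow_left' (B.le_opENorm _) 2
    · rw [lintegral_const_mul' _ _ (by simp)]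
      exact mul_lt_top (by simp) (hZ.finite T)

/-! ### The bound of the Duhamel term -/

def HasDecay (κ lam : ℝ) : Prop := ∀ (ζ : R3) (x : Fib) (t : ℝ), 0 ≤ t → ∀ K : ℕ,
    exp (rate lam ζ * t) * ‖semig κ ζ t x‖ ^ 2 +
      ∫ s in (0)..t, exp (rate lam ζ * s) * ‖hOp K (semig κ ζ s x).snd‖ ^ 2 ≤
      3 * ‖x‖ ^ 2

lemma rate_neg (lam ζ) : rate lam (-ζ) = rate lam ζ := by simp [rate]

lemma HasDecay.norm_sq_le (h : HasDecay κ lam) (ζ x)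
    (ht : 0 ≤ t) : ‖semig κ ζ t x‖ ^ 2 ≤ 3 * exp (-(rate lam ζ * t)) * ‖x‖ ^ 2 := by
  have h1 := h ζ x t ht 0
  have h2 : 0 ≤ ∫ s in (0)..t, exp (rate lam ζ * s) * ‖hOp 0 (semig κ ζ s x).snd‖ ^ 2 :=
    intervalIntegral.integral_nonneg ht fun s _ => by positivity
  have h3 : exp (rate lam ζ * t) * ‖semig κ ζ t x‖ ^ 2 ≤ 3 * ‖x‖ ^ 2 := by linarith
  have h4 := mul_le_mul_of_nonneg_left h3 (exp_pos (-(rate lam ζ * t))).le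
  rw [← mul_assoc, ← exp_add] at h4
  simp at h4
  linarith

lemma cont_hOp_semig (κ ζ x K) : Continuous fun s => hOp K (semig κ ζ s x).snd :=
  ((hOp K).comp hCLM).continuous.comp (cont_semig κ ζ x)

lemma HasDecay.lintegral_le (h : HasDecay κ lam) (ζ x) (ht : 0 ≤ t) (K) :
    ∫⁻ s in Ioc 0 t, ofReal (exp (rate lam ζ * (t - s)) *
      ‖hOp K (semig κ (-ζ) (t - s) x).snd‖ ^ 2) ≤ 3 * ‖x‖ₑ ^ 2 := by
  have hc : Continuous fun s => exp (rate lam ζ * (t - s)) *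
      ‖hOp K (semig κ (-ζ) (t - s) x).snd‖ ^ 2 :=
    (by fun_prop : Continuous fun s => exp (rate lam ζ * (t - s))).mul
      (((cont_hOp_semig κ (-ζ) x K).comp (continuous_const.sub continuous_id)).norm.pow 2)
  rw [← ofReal_integral_eq_lintegral_ofReal (hc.integrableOn_Ioc)
    (.of_forall fun s => by positivity), ← integral_of_le ht]
  rw [intervalIntegral.integral_comp_sub_left (fun s => exp (rate lam ζ * s) *
      ‖hOp K (semig κ (-ζ) s x).snd‖ ^ 2) t, sub_self, sub_zero]
  have h1 := h (-ζ) x t ht K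
  rw [rate_neg] at h1
  have h2 : 3 * ‖x‖ₑ ^ 2 = ofReal (3 * ‖x‖ ^ 2) := by
    rw [ofReal_mul (by norm_num), ofReal_pow (norm_nonneg _), ofReal_norm]
    simp
  rw [h2]
  refine ofReal_le_ofReal ?_
  have : 0 ≤ exp (rate lam ζ * t) * ‖semig κ (-ζ) t x‖ ^ 2 := by positivity
  linarith

lemma en_inner_le_weighted [InnerProductSpace ℂ E] (a b : E) (r : ℝ) :
    ‖inner ℂ a b‖ₑ ≤ ofReal (6⁻¹ * (exp r * ‖a‖ ^ 2)) + ofReal (3 / 2 * (exp (-r) * ‖b‖ ^ 2)) := by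
  rw [← ofReal_add (by positivity) (by positivity), ← ofReal_norm]
  refine ofReal_le_ofReal ((norm_inner_le_norm a b).trans ?_)
  have h1 : exp r = exp (r / 2) ^ 2 := by
    rw [← Real.exp_nat_mul]; congr 1; push_cast; ring
  have h2 : exp (-r) = exp (-(r / 2)) ^ 2 := by
    rw [← Real.exp_nat_mul]; congr 1; push_cast; ring
  have h3 : exp (r / 2) * exp (-(r / 2)) = 1 := by
    rw [← exp_add]; simp
  rw [h1, h2]
  have h4 : ‖a‖ * ‖b‖ = (exp (r / 2) * ‖a‖) * (exp (-(r / 2)) * ‖b‖) := by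
    calc ‖a‖ * ‖b‖ = (exp (r / 2) * exp (-(r / 2))) * (‖a‖ * ‖b‖) := by rw [h3, one_mul]
      _ = _ := by ring
  rw [h4]
  nlinarith [sq_nonneg (exp (r / 2) * ‖a‖ - 3 * (exp (-(r / 2)) * ‖b‖))]

lemma lint_mulL_duh_le (h : HasDecay κ lam)
    (hm : Measurable m) {C : ℝ} (hb : ∀ ξ, |m ξ| ≤ C) (K : ℕ) {Z : ℝ → Spec} (hZ : IsL2Loc Z)
    {t : ℝ} (ht : 0 ≤ t) :
    ‖mulL m hm C hb (duh κ η (fun s => halfL K (Z s)) t)‖ₑ ^ 2 ≤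
      3 * ∫⁻ s in Ioc 0 t, ∫⁻ ξ, ofReal (m ξ ^ 2) *
        ofReal (exp (-(rate lam (η • ξ) * (t - s)))) * ‖Z s ξ‖ₑ ^ 2 := by
  set X := duh κ η (fun s => halfL K (Z s)) t with hX
  set Y := mulL m hm C hb X with hY
  set B := ∫⁻ s in Ioc 0 t, ∫⁻ ξ, ofReal (m ξ ^ 2) *
        ofReal (exp (-(rate lam (η • ξ) * (t - s)))) * ‖Z s ξ‖ₑ ^ 2
  set a : ℝ → R3 → ℝ≥0∞ := fun s ξ => ofReal (6⁻¹ * (exp (rate lam (η • ξ) * (t - s)) *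
    ‖hOp K (semig κ (-(η • ξ)) (t - s) (Y ξ)).snd‖ ^ 2)) with ha
  have hpt s : ‖inner ℂ (mulL m hm C hb Y) (evol κ η (t - s) (halfL K (Z s)))‖ₑ ≤
      (∫⁻ ξ, a s ξ) + 3 / 2 * ∫⁻ ξ, ofReal (m ξ ^ 2) *
        ofReal (exp (-(rate lam (η • ξ) * (t - s)))) * ‖Z s ξ‖ₑ ^ 2 := by
    rw [evol_symm, halfL_symm, L2.inner_def, ← lintegral_const_mul' _ _ (by finiteness)]
    refine (enorm_integral_le_lintegral_enorm _).trans ?_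
    have hmeas : AEMeasurable (fun ξ => a s ξ) vol := by
      refine (AEMeasurable.const_mul (AEMeasurable.mul ?_ ?_) _).ennreal_ofReal
      · have : Measurable fun ξ : R3 => exp (rate lam (η • ξ) * (t - s)) := by
          unfold rate; fun_prop
        exact this.aemeasurable
      · have h1 := aesm_semig κ (meas_scaled η).neg
          (measurable_const (a := t - s)) (Lp.aestronglyMeasurable Y)
        exact ((((hOp K).comp hCLM).continuous.comp_aestronglyMeasurable
          h1).norm.pow 2).aemeasurable
    rw [← lintegral_add_left' hmeas]; refine lintegral_mono_ae ?_
    filter_upwards [halfL_ae K (evol κ (-η) (t - s) (mulL m hm C hb Y)),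
      evol_ae κ (-η) (t - s) (mulL m hm C hb Y), mulL_ae hm hb Y] with ξ h1 h2 h3
    rw [h1, h2, h3, inner_hFib_left, neg_smul]
    have h4 : inner ℂ (hOp K (semig κ (-(η • ξ)) (t - s) ((m ξ : ℂ) • Y ξ)).snd) (Z s ξ).snd =
        inner ℂ (hOp K (semig κ (-(η • ξ)) (t - s) (Y ξ)).snd) ((m ξ : ℂ) • (Z s ξ).snd) := by
      rw [map_smul, WithLp.smul_snd, map_smul, inner_smul_left, inner_smul_right, conj_ofReal]
    rw [h4]
    refine (en_inner_le_weighted _ _ (rate lam (η • ξ) * (t - s))).trans ?_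
    refine add_le_add le_rfl ?_
    rw [ofReal_mul (by norm_num), norm_smul, norm_real, mul_pow, norm_eq_abs, sq_abs,
      ofReal_mul (exp_pos _).le, ofReal_mul (sq_nonneg _)]
    have h6 : ofReal (3 / 2) = 3 / 2 := by
      rw [ENNReal.ofReal_div_of_pos (by norm_num)]; simp
    have h7 : ofReal (‖(Z s ξ).snd‖ ^ 2) ≤ ‖Z s ξ‖ₑ ^ 2 := by
      rw [← ofReal_norm, ← ofReal_pow (norm_nonneg _)]; refine ofReal_le_ofReal ?_
      rw [fib_nsq]; nlinarith [sq_nonneg ‖(Z s ξ).fst‖]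
    rw [h6, ← mul_assoc (ofReal (exp _)), mul_comm (ofReal (exp _))]
    gcongr
  have hprod : AEMeasurable (uncurry a) ((volume.restrict (Ioc 0 t)).prod vol) := by
    refine (AEMeasurable.const_mul (AEMeasurable.mul ?_ ?_) _).ennreal_ofReal
    · have : Measurable fun z : ℝ × R3 => exp (rate lam (η • z.2) * (t - z.1)) := by
        unfold rate; fun_prop
      exact this.aemeasurable
    · have h1 := aesm_semig (μ := (volume.restrict (Ioc 0 t)).prod vol)
        (ζ := fun z : ℝ × R3 => -(η • z.2)) (t := fun z : ℝ × R3 => t - z.1) (X := fun z => Y z.2) κ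
        ((meas_scaled η).comp measurable_snd).neg (measurable_const.sub measurable_fst)
        (Lp.aestronglyMeasurable Y).comp_snd
      exact ((((hOp K).comp hCLM).continuous.comp_aestronglyMeasurable h1).norm.pow 2).aemeasurable
  have hA : ∫⁻ s in Ioc 0 t, ∫⁻ ξ, a s ξ ≤ 2⁻¹ * ‖Y‖ₑ ^ 2 := by
    rw [lintegral_lintegral_swap hprod, en_sq_Lp, ← lintegral_const_mul' _ _ (by simp)]
    refine lintegral_mono fun ξ => ?_; simp only [ha]
    simp_rw [ofReal_mul (p := (6⁻¹)) (by norm_num)]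
    rw [lintegral_const_mul' _ _ (by simp)]
    refine (mul_le_mul_right (h.lintegral_le (η • ξ) (Y ξ) ht K) _).trans ?_
    rw [← mul_assoc]; refine mul_le_mul_left (le_of_eq ?_) _
    rw [ENNReal.ofReal_inv_of_pos (by norm_num)]
    have : (ofReal 6) = 2 * 3 := by
      rw [show (6 : ℝ) = 2 * 3 by norm_num, ofReal_mul (by norm_num)]
      simp
    rw [this, ENNReal.mul_inv (by simp) (by simp), mul_assoc, ENNReal.inv_mul_cancel (by simp)
      (by simp), mul_one]
  have hmeasA : AEMeasurable (fun s => ∫⁻ ξ, a s ξ) (volume.restrict (Ioc 0 t)) :=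
    hprod.lintegral_prod_right'
  have hmain : ‖Y‖ₑ ^ 2 ≤ 2⁻¹ * ‖Y‖ₑ ^ 2 + 3 / 2 * B := by
    have h1 : ‖Y‖ₑ ^ 2 = ‖inner ℂ (mulL m hm C hb Y) X‖ₑ := by
      rw [← mulL_symm, ← hY, inner_self_eq_norm_sq_to_K, enorm_pow]
      congr 1; rw [enorm_eq_iff_norm_eq]; simp
    rw [hX, inner_duh (hZ.comp _).isL1Loc ht, integral_of_le ht] at h1
    refine h1.le.trans ?_
    refine (enorm_integral_le_lintegral_enorm _).trans ((lintegral_mono hpt).trans ?_)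
    rw [lintegral_add_left' hmeasA, lintegral_const_mul' _ _ (by finiteness)]
    gcongr
  have hfin : ‖Y‖ₑ ^ 2 ≠ ⊤ := by simp
  have h2 : 2⁻¹ * ‖Y‖ₑ ^ 2 ≤ 3 / 2 * B := by
    have h3 : ‖Y‖ₑ ^ 2 = 2⁻¹ * ‖Y‖ₑ ^ 2 + 2⁻¹ * ‖Y‖ₑ ^ 2 := by
      rw [← add_mul, ENNReal.inv_two_add_inv_two, one_mul]
    rw [h3] at hmain; have h4 : 2⁻¹ * ‖Y‖ₑ ^ 2 ≠ ⊤ := by finiteness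
    have h5 : 2⁻¹ * (2⁻¹ * ‖Y‖ₑ ^ 2 + 2⁻¹ * ‖Y‖ₑ ^ 2) = 2⁻¹ * ‖Y‖ₑ ^ 2 := by rw [← h3]
    rw [h5] at hmain; exact (ENNReal.add_le_add_iff_left h4).1 hmain
  calc ‖Y‖ₑ ^ 2 = 2 * (2⁻¹ * ‖Y‖ₑ ^ 2) := by
        rw [← mul_assoc, ENNReal.mul_inv_cancel (by simp) (by simp), one_mul]
    _ ≤ 2 * (3 / 2 * B) := by gcongr
    _ = 3 * B := by
        rw [← mul_assoc, ENNReal.mul_div_cancel (by simp) (by simp)]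

lemma en_sq_duh_le (hl : 0 < lam) (h : HasDecay κ lam) (K) (hZ : IsL2Loc Z) (ht : 0 ≤ t) :
    ‖duh κ η (fun s => halfL K (Z s)) t‖ₑ ^ 2 ≤ 3 * ∫⁻ s in Ioc 0 t, ‖Z s‖ₑ ^ 2 := by
  have h1 := lint_mulL_duh_le (η := η) h (measurable_const (a := 1)) (C := 1) (by simp) K hZ ht
  rw [en_sq_mulL] at h1
  simp at h1
  rw [← en_sq_Lp] at h1
  refine h1.trans ?_
  refine mul_le_mul_right (setLIntegral_mono' measurableSet_Ioc fun s hs => ?_) _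
  rw [en_sq_Lp]
  refine lintegral_mono fun ξ => ?_
  refine mul_le_of_le_one_left' ?_
  rw [ENNReal.ofReal_le_one]
  refine Real.exp_le_one_iff.2 ?_
  have := mul_nonneg (rate_nonneg hl (η • ξ)) (sub_nonneg.2 hs.2)
  linarith

/-! ### The limit of the Duhamel terms -/

def duhZ (κ η : ℝ) (Z : ℝ → Spec) (t : ℝ) : Spec :=
  limUnder atTop fun K => duh κ η (fun s => halfL K (Z s)) t

lemma IsL1Loc.duh_sub (hS : IsL1Loc S) (hS' : IsL1Loc S')
    (ht : 0 ≤ t) : duh κ η S t - duh κ η S' t = duh κ η (fun s => S s - S' s) t := by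
  rw [duh, duh, duh, ← intervalIntegral.integral_sub (ii_evol hS (fun s => t - s) (by fun_prop) ht)
    (ii_evol hS' (fun s => t - s) (by fun_prop) ht)]
  simp

lemma tt_lint_sub_truncL (hZ : IsL2Loc Z) (T : ℝ) :
    Tendsto (fun K => ∫⁻ s in Ioc 0 T, ‖Z s - truncL K (Z s)‖ₑ ^ 2) atTop (𝓝 0) := by
  rw [show 0 = ∫⁻ _ in Ioc 0 T, 0 by simp]
  refine tendsto_lintegral_of_dominated_convergence' (fun s => (2 * ‖Z s‖ₑ) ^ 2) ?_ ?_ ?_ ?_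
  · exact fun K => ((hZ.aesm T).sub
      ((truncL K).continuous.comp_aestronglyMeasurable (hZ.aesm T))).enorm.pow_const 2
  · refine fun K => .of_forall fun s => ?_; refine pow_le_pow_left' (enorm_sub_le.trans ?_) 2
    rw [two_mul]
    exact add_le_add_right (enorm_le_iff_norm_le.2 (norm_truncL_le _ _)) _
  · simp only [mul_pow]; rw [lintegral_const_mul' _ _ (by simp)]
    exact (mul_lt_top (by simp) (hZ.finite T)).ne
  · refine .of_forall fun s => ?_; have h3 := ((tt_truncL (Z s)).const_sub (Z s)).enorm
    have := ((ENNReal.continuous_pow 2).tendsto _).comp h3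
    simpa [comp_def] using this

lemma uniformCauchySeqOn_duh (hl : 0 < lam) (h : HasDecay κ lam) (hZ : IsL2Loc Z) (T : ℝ) :
    UniformCauchySeqOn (fun (K : ℕ) t => duh κ η (fun s => halfL K (Z s)) t) atTop (Icc 0 T) := by
  have hkey : ∀ K L : ℕ, K ≤ L → ∀ t ∈ Icc 0 T,
      edist (duh κ η (fun s => halfL K (Z s)) t) (duh κ η (fun s => halfL L (Z s)) t) ^ 2 ≤
        3 * ∫⁻ s in Ioc 0 T, ‖Z s - truncL K (Z s)‖ₑ ^ 2 := by
    intro K L hKL t ht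
    rw [edist_comm, edist_eq_enorm_sub, IsL1Loc.duh_sub (hZ.comp _).isL1Loc (hZ.comp _).isL1Loc ht.1]
    simp_rw [← halfL_sub_truncL hKL]
    have h2 := en_sq_duh_le (η := η) hl h L
      (hZ.comp (ContinuousLinearMap.id ℂ Spec - truncL K)) ht.1
    simp only [sub_apply, id_apply] at h2; refine h2.trans ?_; gcongr
    exact ht.2
  rw [Metric.uniformCauchySeqOn_iff]
  intro ε hε
  have hlim := ENNReal.Tendsto.const_mul (tt_lint_sub_truncL hZ T) (a := 3) (Or.inr (by simp))
  rw [mul_zero] at hlim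
  obtain ⟨K₀, hK₀⟩ := eventually_atTop.1 ((tendsto_order.1 hlim).2
    (ofReal ε ^ 2) (by have := ENNReal.ofReal_pos.2 hε; positivity))
  refine ⟨K₀, fun K hK L hL t ht => ?_⟩
  rcases le_total K L with hKL | hKL
  · rw [← edist_lt_ofReal]
    exact lt_of_not_ge fun hge => absurd (pow_le_pow_left' hge 2)
      (not_le.2 ((hkey K L hKL t ht).trans_lt (hK₀ K hK)))
  · rw [dist_comm, ← edist_lt_ofReal]
    exact lt_of_not_ge fun hge => absurd (pow_le_pow_left' hge 2)
      (not_le.2 ((hkey L K hKL t ht).trans_lt (hK₀ L hL)))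

lemma tt_duhZ (hl : 0 < lam) (h : HasDecay κ lam) (hZ : IsL2Loc Z) (ht : 0 ≤ t) :
    Tendsto (fun K : ℕ => duh κ η (fun s => halfL K (Z s)) t) atTop (𝓝 (duhZ κ η Z t)) :=
  ((uniformCauchySeqOn_duh hl h hZ t).cauchy_map ⟨ht, le_rfl⟩).le_nhds_lim

lemma ttUniformlyOn_duhZ (hl : 0 < lam) (h : HasDecay κ lam) (hZ : IsL2Loc Z) (T : ℝ) :
    TendstoUniformlyOn (fun (K : ℕ) t => duh κ η (fun s => halfL K (Z s)) t) (duhZ κ η Z) atTop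
      (Icc 0 T) :=
  (uniformCauchySeqOn_duh hl h hZ T).tendstoUniformlyOn_of_tendsto fun _ ht => tt_duhZ hl h hZ ht.1

lemma contOn_duhZ (hl : 0 < lam) (h : HasDecay κ lam)
    (hZ : IsL2Loc Z) : ContinuousOn (duhZ κ η Z) (Ici 0) := by
  intro t ht
  have ht := ht
  have h1 : ContinuousOn (duhZ κ η Z) (Icc 0 (t + 1)) :=
    (ttUniformlyOn_duhZ hl h hZ (t + 1)).continuousOn (Frequently.of_forall fun K =>
      (contOn_duh (hZ.comp (halfL K)).isL1Loc).mono Icc_subset_Ici_self)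
  refine (h1 t ⟨ht, by linarith⟩).mono_of_mem_nhdsWithin ?_
  have : Icc 0 (t + 1) = Ici 0 ∩ Iic (t + 1) := rfl
  rw [this]
  exact inter_mem self_mem_nhdsWithin (mem_nhdsWithin_of_mem_nhds (Iic_mem_nhds (by linarith)))

lemma lint_duhZ_le_bdd (hl : 0 < lam) (h : HasDecay κ lam)
    (hm : Measurable m) (hb : ∀ ξ, |m ξ| ≤ C) (hZ : IsL2Loc Z)
    (ht : 0 ≤ t) :
    ∫⁻ ξ, ofReal (m ξ ^ 2) * ‖duhZ κ η Z t ξ‖ₑ ^ 2 ≤ 3 * ∫⁻ s in Ioc 0 t, ∫⁻ ξ, ofReal (m ξ ^ 2) *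
        ofReal (exp (-(rate lam (η • ξ) * (t - s)))) * ‖Z s ξ‖ₑ ^ 2 := by
  rw [← en_sq_mulL hm hb]
  have h1 := ((mulL m hm C hb).continuous.tendsto _).comp (tt_duhZ (η := η) hl h hZ ht)
  have h2 := ((ENNReal.continuous_pow 2).tendsto _).comp h1.enorm
  exact le_of_tendsto' h2 fun K => lint_mulL_duh_le h hm hb K hZ ht

lemma lint_duhZ_le (hl : 0 < lam) (h : HasDecay κ lam)
    (hm : Measurable m) (hZ : IsL2Loc Z) (ht : 0 ≤ t) :
    ∫⁻ ξ, ofReal (m ξ ^ 2) * ‖duhZ κ η Z t ξ‖ₑ ^ 2 ≤ 3 * ∫⁻ s in Ioc 0 t, ∫⁻ ξ, ofReal (m ξ ^ 2) *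
        ofReal (exp (-(rate lam (η • ξ) * (t - s)))) * ‖Z s ξ‖ₑ ^ 2 := by
  have hmeas n : Measurable fun ξ => min |m ξ| n := hm.abs.min measurable_const
  have hbd (n : ℕ) ξ : |min |m ξ| n| ≤ n := by
    rw [abs_of_nonneg (by positivity)]; exact min_le_right _ _
  have hle (n : ℕ) ξ : min |m ξ| n ^ 2 ≤ m ξ ^ 2 := by
    rw [← sq_abs (m ξ)]; exact pow_le_pow_left₀ (by positivity) (min_le_left _ _) 2
  have hlim : Tendsto (fun n : ℕ => ∫⁻ ξ, ofReal (min |m ξ| n ^ 2) *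
      ‖duhZ κ η Z t ξ‖ₑ ^ 2) atTop (𝓝 (∫⁻ ξ, ofReal (m ξ ^ 2) * ‖duhZ κ η Z t ξ‖ₑ ^ 2)) := by
    refine lintegral_tendsto_of_tendsto_of_monotone (fun n => ?_) ?_ ?_
    · exact ((hmeas n).pow_const 2).ennreal_ofReal.aemeasurable.mul
        ((Lp.aestronglyMeasurable (duhZ κ η Z t)).enorm.pow_const 2)
    · refine .of_forall fun ξ n n' hn => ?_; dsimp only; gcongr
    · refine .of_forall fun ξ => tendsto_const_nhds.congr' ?_
      obtain ⟨n₀, hn₀⟩ := exists_nat_ge |m ξ|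
      filter_upwards [eventually_ge_atTop n₀] with n hn
      rw [min_eq_left (hn₀.trans (by exact_mod_cast hn)), sq_abs]
  refine le_of_tendsto' hlim fun n => (lint_duhZ_le_bdd hl h (hmeas n) (hbd n) hZ ht).trans ?_
  refine mul_le_mul_right (lintegral_mono fun s => lintegral_mono fun ξ => ?_) _
  gcongr ofReal ?_ * _ * _
  exact hle n ξ

lemma inner_duhZ_eq_int (hl : 0 < lam) (h : HasDecay κ lam)
    (hY : IsGenL2 κ η Y Y') (hYh : Tendsto (fun K => halfL K Y) atTop (𝓝 Yh))
    (hZ : IsL2Loc Z) (ht : 0 ≤ t) :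
    inner ℂ Y (duhZ κ η Z t) = (∫ s in (0)..t, inner ℂ Y' (duhZ κ η Z s)) +
      ∫ s in (0)..t, inner ℂ Yh (Z s) := by
  have hZi := hZ.isL1Loc t ht
  have h1 : Tendsto (fun K => inner ℂ Y (duh κ η (fun s => halfL K (Z s)) t)) atTop
      (𝓝 (inner ℂ Y (duhZ κ η Z t))) := tendsto_const_nhds.inner (tt_duhZ hl h hZ ht)
  have h3 : Tendsto (fun K => ∫ s in (0)..t, inner ℂ Y (halfL K (Z s))) atTop
      (𝓝 (∫ s in (0)..t, inner ℂ Yh (Z s))) := by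
    simp_rw [halfL_symm]
    have h4 V : ∫ s in (0)..t, inner ℂ V (Z s) = inner ℂ V (∫ s in (0)..t, Z s) :=
      (innerSL ℂ V).intervalIntegral_comp_comm hZi
    simp_rw [h4]
    exact hYh.inner tendsto_const_nhds
  have h2 : Tendsto (fun K => ∫ s in (0)..t, inner ℂ Y' (duh κ η (fun s => halfL K (Z s)) s))
      atTop (𝓝 (∫ s in (0)..t, inner ℂ Y' (duhZ κ η Z s))) := by
    obtain ⟨M, hM⟩ : ∃ M : ℝ, ∀ K : ℕ, ∀ s ∈ Icc 0 t, ‖duh κ η (fun s => halfL K (Z s)) s‖ ≤ M := by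
      refine ⟨(3 * ∫⁻ s in Ioc 0 t, ‖Z s‖ₑ ^ 2).toReal + 1, fun K s hs => ?_⟩
      have h5 : ‖duh κ η (fun s => halfL K (Z s)) s‖ₑ ^ 2 ≤ 3 * ∫⁻ s in Ioc 0 t, ‖Z s‖ₑ ^ 2 := by
        refine (en_sq_duh_le hl h K hZ hs.1).trans ?_; gcongr; exact hs.2
      have h6 := ENNReal.toReal_mono (mul_lt_top (by simp) (hZ.finite t)).ne h5
      rw [ENNReal.toReal_pow, toReal_enorm] at h6
      nlinarith [norm_nonneg (duh κ η (fun s => halfL K (Z s)) s)]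
    refine intervalIntegral.tendsto_integral_filter_of_dominated_convergence
      (fun _ => ‖Y'‖ * M) ?_ ?_ intervalIntegrable_const ?_
    · refine .of_forall fun K => ?_; rw [uIoc_of_le ht]
      have h7 : ContinuousOn (fun s => inner ℂ Y' (duh κ η (fun s => halfL K (Z s)) s))
          (Ioc 0 t) := ContinuousOn.inner (𝕜 := ℂ) continuousOn_const
        ((contOn_duh (hZ.comp (halfL K)).isL1Loc).mono fun s hs => hs.1.le)
      exact h7.aestronglyMeasurable measurableSet_Ioc
    · refine .of_forall fun K => .of_forall fun s hs => ?_; rw [uIoc_of_le ht] at hs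
      exact (norm_inner_le_norm _ _).trans
        (mul_le_mul_of_nonneg_left (hM K s ⟨hs.1.le, hs.2⟩) (norm_nonneg _))
    · refine .of_forall fun s hs => ?_; rw [uIoc_of_le ht] at hs
      exact tendsto_const_nhds.inner (tt_duhZ hl h hZ hs.1.le)
  refine tendsto_nhds_unique h1 ((h2.add h3).congr fun K => ?_)
  exact (inner_duh_eq_int hY (hZ.comp (halfL K)).isL1Loc ht).symm

lemma duhZ_eq_duh {κ lam η} (hl : 0 < lam) (h : HasDecay κ lam) {Z S}
    (hZ : IsL2Loc Z) (hS : IsL1Loc S)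
    (hZS : ∀ᵐ s ∂(volume.restrict (Ioi (0 : ℝ))), ∀ K, 1 ≤ K → halfL K (Z s) = truncL K (S s))
    {t : ℝ} (ht : 0 ≤ t) : duhZ κ η Z t = duh κ η S t := by
  refine tendsto_nhds_unique (tt_duhZ hl h hZ ht) ?_
  have h1 : (fun K => duh κ η (fun s => truncL K (S s)) t) =ᶠ[atTop]
      fun K => duh κ η (fun s => halfL K (Z s)) t := by
    filter_upwards [eventually_ge_atTop 1] with K hK
    rw [duh, duh, integral_of_le ht, integral_of_le ht]; refine integral_congr_ae ?_
    filter_upwards [ae_restrict_of_ae_restrict_of_subset Ioc_subset_Ioi_self hZS] with s hs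
    rw [hs K hK]
  refine Tendsto.congr' h1 ?_
  have hSi := hS t ht
  refine intervalIntegral.tendsto_integral_filter_of_dominated_convergence
    (fun s => ‖S s‖) ?_ ?_ hSi.norm ?_
  · refine .of_forall fun K => ?_; rw [uIoc_of_le ht]
    rw [intervalIntegrable_iff_integrableOn_Ioc_of_le ht] at hSi
    exact aesm_evol κ η (by fun_prop)
      ((truncL K).continuous.comp_aestronglyMeasurable hSi.aestronglyMeasurable)
  · exact .of_forall fun K => .of_forall fun s _ =>
      (norm_evol_le κ η _ _).trans (norm_truncL_le _ _)
  · exact .of_forall fun s _ => ((evol κ η (t - s)).continuous.tendsto _).comp (tt_truncL (S s))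

/-! ### Basis vectors of the fibers and test families -/

abbrev FibIdx := Option (Fin 3) ⊕ MI

def bas : FibIdx → Fib
  | inl o => toLp 2 (single o (1 : ℂ), 0)
  | inr k => toLp 2 (0, lp.single 2 k (1 : ℂ))

def fco : FibIdx → Fib → ℂ
  | inl o => fun w => w.fst o
  | inr k => fun w => w.snd k

lemma inner_bas (b) (w : Fib) : inner ℂ (bas b) w = fco b w := by
  rcases b with o | k
  · rw [in_fib]; simp [bas, fco, inner_single_left]
  · rw [in_fib]
    change inner ℂ 0 w.fst + inner ℂ (lp.single 2 k 1) w.snd = w.snd k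
    rw [inner_zero_left, zero_add, ← inner_conj_symm, in_single_one, conj_conj]

lemma fib_ext_coord {z w : Fib} (h : ∀ b, fco b z = fco b w) : z = w := by
  refine fib_ext ?_ fun k => h (inr k)
  ext o
  exact h (inl o)

def tst (b : FibIdx) (ψ : TX) : Spec := ((toSpanSingleton ℂ (bas b)).compLpL 2 volume) (ψ.toLp 2)

lemma tst_ae (b ψ) : ∀ᵐ ξ, tst b ψ ξ = ψ ξ • bas b := by
  filter_upwards [(toSpanSingleton ℂ (bas b)).coeFn_compLpL
    (ψ.toLp 2), ψ.coeFn_toLp 2 volume] with ξ h1 h2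
  rw [tst, h1, h2, toSpanSingleton_apply]

lemma li_Lp_two {E F : Type*} [NormedAddCommGroup F] [NormedSpace ℝ F]
    [NormedAddCommGroup E] [MeasurableSpace F] [BorelSpace F] [FiniteDimensional ℝ F]
    {μ} [IsLocallyFiniteMeasure μ] {f : F → E} (hf : MemLp f 2 μ) :
    LocallyIntegrable f μ := hf.locallyIntegrable (by norm_num)

lemma spec_eq_zero {X : Spec} (h : ∀ b ψ, inner ℂ (tst b ψ) X = 0) : X = 0 := by
  have h1 : ∀ b, ∀ᵐ ξ, inner ℂ (bas b) (X ξ) = 0 := by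
    intro b
    refine ae_eq_zero_of_integral_contDiff_smul_eq_zero
      (li_Lp_two ((Lp.memLp X).const_inner (𝕜 := ℂ) (bas b))) fun g hg hc => ?_
    have hg' := ofRealCLM.contDiff.comp hg; have hc' := hc.comp_left ofReal_zero
    rw [← h b (hc'.toSchwartzMap hg'), L2.inner_def]; refine integral_congr_ae ?_
    filter_upwards [tst_ae b (hc'.toSchwartzMap hg')] with ξ h2; rw [h2, inner_smul_left]
    change g ξ • inner ℂ _ _ = (starRingEnd ℂ) (g ξ) * inner ℂ _ _
    rw [conj_ofReal, real_smul]
  rw [Lp.eq_zero_iff_ae_eq_zero]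
  filter_upwards [ae_all_iff.2 h1] with ξ h2
  refine fib_ext_coord fun b => ?_
  rw [← inner_bas, h2 b, ← inner_bas, Pi.zero_apply, inner_zero_right]

def idxDeg : FibIdx → ℕ
  | inl _ => 0
  | inr k => ℓ k

lemma trF_trF (N) (w : Fib) : trF N (trF N w) = trF N w := by
  refine fib_ext rfl fun k => ?_
  simp only [trF_snd_ap]
  split_ifs <;> rfl

lemma trF_bas (N) (b : FibIdx) : trF N (bas b) = if idxDeg b ≤ N then bas b else 0 := by
  rcases b with o | k
  · rw [idxDeg, if_pos (Nat.zero_le _)]; refine fib_ext rfl fun k => ?_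
    rw [trF_snd_ap]
    simp [bas]
  · rw [idxDeg]; refine fib_ext ?_ fun k' => ?_
    · rw [trF_fst]
      split_ifs <;> rfl
    · rw [trF_snd_ap]
      by_cases hk : k' = k
      · subst hk; split_ifs <;> simp
      · have h0 : (bas (inr k)).snd k' = 0 := by simp [bas, hk]
        rw [h0, ite_self]
        split_ifs
        · exact h0.symm
        · rfl

lemma gen_eq_trunc (κ) (hN : L + 1 ≤ N) (ζ : R3) {y : Fib}
    (hy : trF L y = y) : gen κ N ζ y = gen κ (L + 1) ζ y := by
  have hz k (hk : L < ℓ k) : y.snd k = 0 := by rw [← hy, trF_snd_ap, if_neg (by omega)]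
  refine fib_ext ?_ fun k => ?_
  · ext o; rcases o with _ | j
    · rw [gen_fl_none, gen_fl_none]
    · rw [gen_fl_some, gen_fl_some]
  · rw [gen_herm, gen_herm]; congr 2
    · congr 1
      refine sum_congr rfl fun j _ => ?_
      rw [rais_ap, rais_ap, lowr_ap, lowr_ap]
      have h1 : ℓ k ≤ L + 1 ∨ y.snd (k - dir j) = 0 ∨ k j = 0 := by
        by_cases hk : ℓ k ≤ L + 1
        · exact Or.inl hk
        · by_cases hj : k j = 0
          · exact Or.inr (Or.inr hj)
          · refine Or.inr (Or.inl (hz _ ?_)); have := len_sub_dir hj; omega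
      have h2 : ℓ k + 1 ≤ L + 1 ∨ y.snd (k + dir j) = 0 := by
        by_cases hk : ℓ k + 1 ≤ L + 1
        · exact Or.inl hk
        · refine Or.inr (hz _ ?_); rw [len_add, len_dir]; omega
      congr 2
      · rcases h1 with h1 | h1 | h1
        · rw [if_pos h1, if_pos (by omega)]
        · simp [h1]
        · simp [h1]
      · rcases h2 with h2 | h2
        · rw [if_pos h2, if_pos (by omega)]
        · simp [h2]
    · rw [numOp_ap, numOp_ap]
      by_cases hk : ℓ k ≤ L
      · congr 1; simp; omega
      · simp [hz k (by omega)]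

lemma isGen_trunc (κ ζ) (hy : trF L y = y) : IsGen κ ζ y (gen κ (L + 1) ζ y) := by
  refine tendsto_const_nhds.congr' ?_
  filter_upwards [eventually_ge_atTop (L + 1)] with N hN
  rw [gen_eq_trunc κ hN ζ hy]

/-! ### The energy flux between the levels -/

lemma norm_sq_trF_sub (N) (w : Fib) :
    ‖trF (N + 1) w - trF N w‖ ^ 2 = ‖trF (N + 1) w‖ ^ 2 - ‖trF N w‖ ^ 2 := by
  have h1 : trF N (trF (N + 1) w) = trF N w := by
    refine fib_ext rfl fun k => ?_; simp only [trF_snd_ap]; split_ifs <;> first | rfl | omega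
  have h2 : inner ℂ (trF (N + 1) w - trF N w) (trF N w) = 0 := by
    rw [trF_symm, map_sub, h1, trF_trF, sub_self, inner_zero_left]
  have h3 : trF (N + 1) w = (trF (N + 1) w - trF N w) + trF N w := by abel
  have h4 := norm_add_sq_eq_norm_sq_add_norm_sq_of_inner_eq_zero _ _ h2
  rw [← h3] at h4
  nlinarith

lemma sum_norm_sq_le_injective (y : HSeq) (F : Finset MI)
    (hσ : Function.Injective σ) : ∑ k ∈ F, ‖y (σ k)‖ ^ 2 ≤ ‖y‖ ^ 2 := by
  rw [← sum_image (f := fun k => ‖y k‖ ^ 2) (fun a _ b _ h => hσ h)]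
  exact sum_le_hasSum _ (fun _ _ => by positivity) (hSeq_hasSum_norm_sq y)

lemma norm_inner_gen_sub_le (κ : ℝ) (hN : 1 ≤ N) (ζ : R3) (w : Fib) :
    ‖inner ℂ (trF (N + 1) w) (gen κ (N + 2) ζ (w - trF (N + 1) w))‖ ≤
      (∑ j, |ζ j|) * (√(N + 2) * (‖trF (N + 1) w - trF N w‖ ^ 2 +
        ‖trF (N + 2) w - trF (N + 1) w‖ ^ 2)) := by
  set v := w - trF (N + 1) w with hv
  set a := trF (N + 1) w - trF N w with ha
  set b := trF (N + 2) w - trF (N + 1) w with hb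
  have hvs k : v.snd k = if ℓ k ≤ N + 1 then 0 else w.snd k := by
    have : v.snd k = w.snd k - (trF (N + 1) w).snd k := rfl; rw [this, trF_snd_ap]
    split_ifs <;> simp
  have has k : a.snd k = if ℓ k = N + 1 then w.snd k else 0 := by
    have : a.snd k = (trF (N + 1) w).snd k - (trF N w).snd k := rfl
    rw [this, trF_snd_ap, trF_snd_ap]; split_ifs <;> first | omega | simp
  have hbs k : b.snd k = if ℓ k = N + 2 then w.snd k else 0 := by
    have : b.snd k = (trF (N + 2) w).snd k - (trF (N + 1) w).snd k := rfl
    rw [this, trF_snd_ap, trF_snd_ap]; split_ifs <;> first | omega | simp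
  have hvf : v.fst = 0 := by
    have : v.fst = w.fst - (trF (N + 1) w).fst := rfl; rw [this, trF_fst, sub_self]
  have hvu j : v.snd (dir j) = 0 := by rw [hvs, if_pos (by rw [len_dir]; omega)]
  have hgf : (gen κ (N + 2) ζ v).fst = 0 := by
    ext o; rcases o with _ | j
    · rw [gen_fl_none, hvf]; simp
    · rw [gen_fl_some, hvf, hvu]; simp
  have hgs k (hk : ℓ k ≤ N + 1) : (gen κ (N + 2) ζ v).snd k =
      -I * ∑ j, ζ j * (√(k j + 1) * b.snd (k + dir j)) := by
    rw [gen_herm, numOp_ap, hvs k, if_pos hk]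
    simp only [hvf, hvu, mul_zero, ite_self, sub_zero, PiLp.zero_apply, Finset.sum_const_zero,
      add_zero]
    congr 1; refine sum_congr rfl fun j _ => ?_; congr 1
    rw [rais_ap, lowr_ap, if_pos (by omega), if_pos (by omega), hvs, hvs, hbs, len_add, len_dir]
    have h1 : ℓ (k - dir j) ≤ N + 1 := by
      by_cases hj : k j = 0
      · have : k - dir j = k := by
          funext i
          by_cases hij : i = j
          · subst hij; simp [hj]
          · simp [dir, hij]
        rwa [this]
      · have := len_sub_dir hj; omega
    rw [if_pos h1, mul_zero, zero_add]; split_ifs <;> first | rfl | omega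
  have hin : inner ℂ (trF (N + 1) w) (gen κ (N + 2) ζ v) =
      ∑ k ∈ miLE (N + 1), inner ℂ (a.snd k) ((gen κ (N + 2) ζ v).snd k) := by
    rw [in_fib, hgf, inner_zero_right, zero_add, lp.inner_eq_tsum, tsum_eq_sum]
    · refine sum_congr rfl fun k hk => ?_; rw [mem_miLE] at hk
      rw [hgs k hk, trF_snd_ap, has, if_pos hk]
      by_cases hk' : ℓ k = N + 1
      · rw [if_pos hk']
      · have : ∀ j, b.snd (k + dir j) = 0 := fun j => by
          rw [hbs, len_add, len_dir, if_neg (by omega)]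
        simp [this]
    · intro k hk; rw [mem_miLE] at hk; rw [trF_snd_ap, if_neg hk, inner_zero_left]
  rw [hin]
  calc ‖∑ k ∈ miLE (N + 1), inner ℂ (a.snd k) ((gen κ (N + 2) ζ v).snd k)‖
      ≤ ∑ k ∈ miLE (N + 1), ∑ j, |ζ j| * (√(N + 2) *
          (‖a.snd k‖ ^ 2 + ‖b.snd (k + dir j)‖ ^ 2)) := by
        refine norm_sum_le_of_le _ fun k hk => ?_; rw [mem_miLE] at hk
        rw [hgs k hk]; refine (norm_inner_le_norm _ _).trans ?_
        rw [norm_mul, norm_neg, norm_I, one_mul]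
        refine (mul_le_mul_of_nonneg_left (norm_sum_le _ _) (norm_nonneg _)).trans ?_
        rw [mul_sum]; refine sum_le_sum fun j _ => ?_
        rw [norm_mul, norm_mul, norm_real, norm_real, norm_eq_abs,
          norm_eq_abs, abs_of_nonneg (Real.sqrt_nonneg _)]
        have h1 : √((k j) + 1) ≤ √(N + 2) := by
          refine Real.sqrt_le_sqrt ?_
          have h2 : k j ≤ ℓ k :=
            single_le_sum (f := fun i => k i) (fun _ _ => Nat.zero_le _) (Finset.mem_univ j)
          have h3 : k j + 1 ≤ N + 2 := by omega
          exact_mod_cast h3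
        have h4 : ‖a.snd k‖ * ‖b.snd (k + dir j)‖ ≤ ‖a.snd k‖ ^ 2 + ‖b.snd (k + dir j)‖ ^ 2 := by
          nlinarith [sq_nonneg (‖a.snd k‖ - ‖b.snd (k + dir j)‖), sq_nonneg ‖a.snd k‖,
            sq_nonneg ‖b.snd (k + dir j)‖]
        calc ‖a.snd k‖ * (|ζ j| * (√((k j) + 1) * ‖b.snd (k + dir j)‖))
            = |ζ j| * (√((k j) + 1) * (‖a.snd k‖ * ‖b.snd (k + dir j)‖)) := by ring
          _ ≤ _ := by gcongr
    _ = ∑ j, |ζ j| * (√(N + 2) * (∑ k ∈ miLE (N + 1), ‖a.snd k‖ ^ 2 +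
          ∑ k ∈ miLE (N + 1), ‖b.snd (k + dir j)‖ ^ 2)) := by
        rw [Finset.sum_comm]; refine sum_congr rfl fun j _ => ?_
        rw [← mul_sum, ← mul_sum, sum_add_distrib]
    _ ≤ ∑ j, |ζ j| * (√(N + 2) * (‖a‖ ^ 2 + ‖b‖ ^ 2)) := by
        refine sum_le_sum fun j _ => ?_
        have h1 := sum_norm_sq_le_injective a.snd (miLE (N + 1)) injective_id
        have h2 := sum_norm_sq_le_injective b.snd (miLE (N + 1)) (add_left_injective (dir j))
        have h3 : ‖a.snd‖ ^ 2 ≤ ‖a‖ ^ 2 := by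
          rw [fib_nsq a]; nlinarith [sq_nonneg ‖a.fst‖]
        have h4 : ‖b.snd‖ ^ 2 ≤ ‖b‖ ^ 2 := by
          rw [fib_nsq b]; nlinarith [sq_nonneg ‖b.fst‖]
        gcongr
        · exact h1.trans h3
        · exact h2.trans h4
    _ = _ := by rw [sum_mul]

lemma re_inner_trF_gen_le (κ) (hN : 1 ≤ N) (ζ w) :
    (inner ℂ (trF (N + 1) w) (trF (N + 1) (gen κ (N + 2) ζ w))).re ≤
      (∑ j, |ζ j|) * (√(N + 2) * (‖trF (N + 1) w - trF N w‖ ^ 2 +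
        ‖trF (N + 2) w - trF (N + 1) w‖ ^ 2)) := by
  rw [trF_symm, trF_trF]
  have h1 : gen κ (N + 2) ζ w = gen κ (N + 2) ζ (trF (N + 1) w) +
      gen κ (N + 2) ζ (w - trF (N + 1) w) := by rw [← map_add]; simp
  rw [h1, inner_add_right, add_re, re_inner_gen]
  have h2 := (Complex.re_le_norm _).trans (norm_inner_gen_sub_le κ hN ζ w)
  linarith [diss_nn (N + 2) (trF (N + 1) w)]

/-! ### Uniqueness for the weak problem in frequency -/

def wt (ξ : R3) : ℝ := (1 + ‖ξ‖ ^ 2) ^ (-1 : ℝ)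

lemma wt_pos (ξ) : 0 < wt ξ := by
  unfold wt
  positivity

lemma wt_eq (ξ) : wt ξ = (1 + ‖ξ‖ ^ 2)⁻¹ := Real.rpow_neg_one _

lemma wt_le_one (ξ) : wt ξ ≤ 1 := by
  rw [wt_eq]
  exact inv_le_one_of_one_le₀ (by nlinarith [sq_nonneg ‖ξ‖])

lemma abs_wt_le (ξ) : |wt ξ| ≤ 1 := by
  rw [abs_of_pos (wt_pos ξ)]
  exact wt_le_one ξ

lemma wt_mul_norm_le (ξ) : wt ξ * ‖ξ‖ ≤ 1 := by
  rw [wt_eq, inv_mul_le_one₀ (by positivity)]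
  nlinarith [sq_nonneg (‖ξ‖ - 1)]

lemma meas_wt : Measurable wt := by
  unfold wt
  fun_prop

def weightSchw : TX →L[ℝ] TX := smulLeftCLM ℂ wt

lemma weightSchw_ap (ψ ξ) : weightSchw ψ ξ = wt ξ • ψ ξ :=
  smulLeftCLM_apply_apply (Function.hasTemperateGrowth_one_add_norm_sq_rpow R3 (-1)) ψ ξ

lemma norm_gen_le (κ N) : ∃ C : ℝ, 0 ≤ C ∧ ∀ (ζ : R3) (w : Fib),
    ‖gen κ N ζ w‖ ≤ C * (1 + ‖ζ‖) * ‖w‖ := by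
  refine ⟨‖coll N‖ + ∑ j, ‖strm κ N j‖, by positivity, fun ζ w => ?_⟩
  have hj j : ‖(ζ j : ℂ) • strm κ N j w‖ ≤ ‖ζ‖ * (‖strm κ N j‖ * ‖w‖) := by
    rw [norm_smul, norm_real]
    exact mul_le_mul (PiLp.norm_apply_le ζ j) ((strm κ N j).le_opNorm w) (norm_nonneg _)
      (norm_nonneg _)
  calc ‖gen κ N ζ w‖ ≤ ‖coll N w‖ + ‖∑ j, (ζ j : ℂ) • strm κ N j w‖ := by
        rw [gen_ap]; refine (norm_sub_le _ _).trans ?_; rw [norm_smul, norm_I, one_mul]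
    _ ≤ ‖coll N‖ * ‖w‖ + ∑ j, ‖ζ‖ * (‖strm κ N j‖ * ‖w‖) := by
        refine add_le_add ((coll N).le_opNorm w) ((norm_sum_le _ _).trans ?_)
        exact sum_le_sum fun j _ => hj j
    _ = ‖coll N‖ * ‖w‖ + ‖ζ‖ * ((∑ j, ‖strm κ N j‖) * ‖w‖) := by
        rw [← mul_sum, ← sum_mul]
    _ ≤ _ := by
        have h1 : 0 ≤ ‖coll N‖ * ‖w‖ * ‖ζ‖ := by positivity
        have h2 : 0 ≤ (∑ j, ‖strm κ N j‖) * ‖w‖ := by positivity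
        nlinarith

def wGenFib (κ η : ℝ) (N : ℕ) (ξ : R3) : Fib →L[ℂ] Fib :=
  wt ξ • (trF (N + 1)).comp (gen κ (N + 2) (η • ξ))

lemma aesm_wGenFib (κ η : ℝ) (N : ℕ) (X : Spec) :
    AEStronglyMeasurable (fun ξ => wGenFib κ η N ξ (X ξ)) vol := by
  have h : AEStronglyMeasurable (fun ξ : R3 => ∑ j, (((η • ξ) j : ℝ) : ℂ) •
      strm κ (N + 2) j (X ξ)) volume := by
    refine Finset.aestronglyMeasurable_fun_sum _ fun j _ => AEStronglyMeasurable.smul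
      (f := fun ξ : R3 => (((η • ξ) j : ℝ) : ℂ)) ?_
      ((strm κ (N + 2) j).continuous.comp_aestronglyMeasurable (Lp.aestronglyMeasurable X))
    exact (by fun_prop : Continuous fun ξ : R3 => (((η • ξ) j : ℝ) : ℂ)).aestronglyMeasurable
  have hg := (((coll _).continuous.comp_aestronglyMeasurable (Lp.aestronglyMeasurable X)).sub
      (h.const_smul I)).congr
      (.of_forall fun ξ => (gen_ap κ (N + 2) (η • ξ) (X ξ)).symm)
  exact meas_wt.aestronglyMeasurable.smul ((trF (N + 1)).continuous.comp_aestronglyMeasurable hg)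

lemma norm_wGenFib_le (κ η : ℝ) (N : ℕ) (ξ : R3) (w : Fib) :
    ‖wGenFib κ η N ξ w‖ ≤ (norm_gen_le κ (N + 2)).choose * (1 + |η|) * ‖w‖ := by
  obtain ⟨hC, h⟩ := (norm_gen_le κ (N + 2)).choose_spec
  set C := (norm_gen_le κ (N + 2)).choose
  change ‖wt ξ • trF (N + 1) (gen κ (N + 2) (η • ξ) w)‖ ≤ _
  rw [norm_smul, norm_eq_abs, abs_of_pos (wt_pos ξ)]
  have h1 := (norm_trF_le (N + 1) _).trans (h (η • ξ) w)
  have h2 : wt ξ * (1 + ‖η • ξ‖) ≤ 1 + |η| := by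
    rw [norm_smul, norm_eq_abs]
    have := mul_le_mul_of_nonneg_left (wt_mul_norm_le ξ) (abs_nonneg η)
    nlinarith [wt_le_one ξ]
  calc wt ξ * ‖trF (N + 1) (gen κ (N + 2) (η • ξ) w)‖
      ≤ wt ξ * (C * (1 + ‖η • ξ‖) * ‖w‖) := mul_le_mul_of_nonneg_left h1 (wt_pos ξ).le
    _ = C * (wt ξ * (1 + ‖η • ξ‖)) * ‖w‖ := by ring
    _ ≤ _ := by gcongr

def wGen (κ η : ℝ) (N : ℕ) : Spec →L[ℂ] Spec := specOp (wGenFib κ η N) (aesm_wGenFib κ η N)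
    (norm_wGenFib_le κ η N)

lemma wGen_ae (κ η N X) : ∀ᵐ ξ, wGen κ η N X ξ = wt ξ • trF (N + 1) (gen κ (N + 2) (η • ξ) (X ξ)) :=
  specOp_ae _ _ _ X

def wTrunc (N : ℕ) : Spec →L[ℂ] Spec := (mulL wt meas_wt 1 abs_wt_le).comp (truncL N)

lemma wTrunc_ae (N X) : ∀ᵐ ξ, wTrunc N X ξ = wt ξ • trF N (X ξ) := by
  filter_upwards [mulL_ae meas_wt abs_wt_le (truncL N X), truncL_ae N X] with ξ h1 h2
  rw [wTrunc, comp_apply, h1, h2]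
  exact Complex.coe_smul _ _

lemma inner_tst_wTrunc (N b ψ X) : inner ℂ (tst b ψ) (wTrunc N X) =
      if idxDeg b ≤ N then inner ℂ (tst b (weightSchw ψ)) X else 0 := by
  have h0 : inner ℂ (tst b ψ) (wTrunc N X) = ∫ ξ, inner ℂ ((wt ξ • ψ ξ) • trF N (bas b)) (X ξ) := by
    rw [L2.inner_def]; refine integral_congr_ae ?_
    filter_upwards [tst_ae b ψ, wTrunc_ae N X] with ξ h1 h2
    rw [h1, h2, inner_smul_right_eq_smul, inner_smul_left, trF_symm, inner_smul_left]
    simp only [real_smul, map_mul, conj_ofReal, mul_assoc]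
  rw [h0, trF_bas]
  split_ifs with hb
  · rw [L2.inner_def]; refine integral_congr_ae ?_
    filter_upwards [tst_ae b (weightSchw ψ)] with ξ h1
    rw [h1, weightSchw_ap]
  · simp

def IsWeakNull (κ η : ℝ) (W : ℝ → Spec) : Prop :=
  ∀ (b : FibIdx) (ψ : TX), ∃ Y' : Spec, IsGenL2 κ η (tst b ψ) Y' ∧
    ∀ t, 0 ≤ t → inner ℂ (tst b ψ) (W t) = ∫ s in (0)..t, inner ℂ Y' (W s)

lemma wTrunc_eq_int (hc : ContinuousOn W (Ici 0)) (hW : IsWeakNull κ η W) (N) (ht : 0 ≤ t) :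
    wTrunc (N + 1) (W t) = ∫ s in (0)..t, wGen κ η N (W s) := by
  have hint : IntervalIntegrable (fun s => wGen κ η N (W s)) volume 0 t := by
    refine ContinuousOn.intervalIntegrable ?_; rw [uIcc_of_le ht]
    exact (wGen κ η N).continuous.comp_continuousOn (hc.mono Icc_subset_Ici_self)
  rw [← sub_eq_zero]
  refine spec_eq_zero fun b ψ => ?_
  rw [inner_sub_right, sub_eq_zero]
  have h1 : inner ℂ (tst b ψ) (∫ s in (0)..t, wGen κ η N (W s)) =
      ∫ s in (0)..t, inner ℂ (tst b ψ) (wGen κ η N (W s)) :=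
    ((innerSL ℂ (tst b ψ)).intervalIntegral_comp_comm hint).symm
  rw [h1, inner_tst_wTrunc]
  have h2 X : inner ℂ (tst b ψ) (wGen κ η N X) = ∫ ξ, inner ℂ
      (gen κ (N + 2) (-(η • ξ)) ((wt ξ • ψ ξ) • trF (N + 1) (bas b))) (X ξ) := by
    rw [L2.inner_def]; refine integral_congr_ae ?_
    filter_upwards [tst_ae b ψ, wGen_ae κ η N X] with ξ h1 h2
    rw [h1, h2, inner_smul_right_eq_smul, inner_smul_left, trF_symm, inner_gen, map_smul,
      inner_smul_left]
    simp only [real_smul, map_mul, conj_ofReal, mul_assoc]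
  split_ifs with hb
  · obtain ⟨Y', hY', hid⟩ := hW b (weightSchw ψ); rw [hid t ht]
    congr 1
    funext s; rw [h2, L2.inner_def]; refine integral_congr_ae ?_
    filter_upwards [hY', tst_ae b (weightSchw ψ)] with ξ h3 h4
    have h5 : IsGen κ (-(η • ξ)) (tst b (weightSchw ψ) ξ)
        (gen κ (N + 2) (-(η • ξ)) (tst b (weightSchw ψ) ξ)) := by
      refine isGen_trunc κ _ ?_; rw [h4, map_smul, trF_bas, if_pos hb]
    rw [tendsto_nhds_unique h3 h5, trF_bas, if_pos hb, h4, weightSchw_ap]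
  · rw [trF_bas, if_neg hb] at h2; simp at h2; simp only [h2]; simp

def levL (N : ℕ) : Spec →L[ℂ] Spec := truncL (N + 1) - truncL N

lemma levL_ae (N X) : ∀ᵐ ξ, levL N X ξ = trF (N + 1) (X ξ) - trF N (X ξ) := by
  filter_upwards [truncL_ae (N + 1) X, truncL_ae N X,
    Lp.coeFn_sub (truncL (N + 1) X) (truncL N X)] with ξ h1 h2 h3
  rw [levL, sub_apply, h3, Pi.sub_apply, h1, h2]

lemma nsq_Lp {α E : Type*} [MeasurableSpace α] {μ : Measure α} [NormedAddCommGroup E]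
    [InnerProductSpace ℂ E] (X : Lp E 2 μ) : ‖X‖ ^ 2 = ∫ a, ‖X a‖ ^ 2 ∂μ := by
  have h := inner_self_eq_norm_sq_to_K (𝕜 := ℂ) X
  rw [L2.inner_def] at h
  simp_rw [inner_self_eq_norm_sq_to_K] at h
  have h2 : ((∫ a, ‖X a‖ ^ 2 ∂μ : ℝ) : ℂ) = ((‖X‖ ^ 2 : ℝ) : ℂ) := by
    rw [← integral_complex_ofReal]; push_cast; exact h
  exact (Complex.ofReal_injective h2).symm

lemma norm_sq_levL (N X) : ‖levL N X‖ ^ 2 = ‖truncL (N + 1) X‖ ^ 2 - ‖truncL N X‖ ^ 2 := by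
  rw [nsq_Lp, nsq_Lp, nsq_Lp, ← integral_sub
    ((Lp.memLp (truncL (N + 1) X)).integrable_norm_pow (by simp))
    ((Lp.memLp (truncL N X)).integrable_norm_pow (by simp))]
  refine integral_congr_ae ?_
  filter_upwards [levL_ae N X, truncL_ae (N + 1) X, truncL_ae N X] with ξ h1 h2 h3
  rw [h1, h2, h3, norm_sq_trF_sub]

lemma re_inner_wGen_le (κ η) {N} (hN : 1 ≤ N) (X) : (inner ℂ (wTrunc (N + 1) X) (wGen κ η N X)).re ≤
      3 * |η| * √(N + 2) * (‖levL N X‖ ^ 2 + ‖levL (N + 1) X‖ ^ 2) := by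
  have hI1 := (Lp.memLp (levL N X)).integrable_norm_pow (by simp)
  have hI2 := (Lp.memLp (levL (N + 1) X)).integrable_norm_pow (by simp)
  rw [L2.inner_def, nsq_Lp, nsq_Lp, ← integral_add hI1 hI2, ← integral_const_mul]
  have hre := integral_re (𝕜 := ℂ) (L2.integrable_inner (𝕜 := ℂ) (wTrunc (N + 1) X) (wGen κ η N X))
  simp only [RCLike.re_to_complex] at hre
  rw [← hre]
  refine integral_mono_ae (L2.integrable_inner (𝕜 := ℂ) (wTrunc (N + 1) X) (wGen κ η N X)).re
    ((hI1.add hI2).const_mul _) ?_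
  filter_upwards [levL_ae N X, levL_ae (N + 1) X, wTrunc_ae (N + 1) X,
    wGen_ae κ η N X] with ξ h1 h2 h3 h4
  change (inner ℂ (wTrunc (N + 1) X ξ) (wGen κ η N X ξ)).re ≤
    3 * |η| * √(N + 2) * (‖levL N X ξ‖ ^ 2 + ‖levL (N + 1) X ξ‖ ^ 2)
  rw [h1, h2, h3, h4, inner_smul_left_eq_smul, inner_smul_right_eq_smul, Complex.smul_re,
    Complex.smul_re, smul_eq_mul, smul_eq_mul]
  have h5 := re_inner_trF_gen_le κ hN (η • ξ) (X ξ)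
  set A := ‖trF (N + 1) (X ξ) - trF N (X ξ)‖ ^ 2 + ‖trF (N + 2) (X ξ) - trF (N + 1) (X ξ)‖ ^ 2
  have hA : 0 ≤ A := by positivity
  have h6 : ∑ j, |(η • ξ) j| ≤ 3 * (|η| * ‖ξ‖) := by
    have : ∀ j ∈ Finset.univ, |(η • ξ) j| ≤ |η| * ‖ξ‖ := fun j _ => by
      have := PiLp.norm_apply_le (η • ξ) j
      rwa [norm_smul, norm_eq_abs, norm_eq_abs] at this
    refine (Finset.sum_le_card_nsmul _ _ _ this).trans ?_; simp
  have hd := wt_pos ξ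
  have h7 : wt ξ * (wt ξ * ∑ j, |(η • ξ) j|) ≤ 3 * |η| := by
    have h8 : wt ξ * ∑ j, |(η • ξ) j| ≤ 3 * |η| := by
      calc wt ξ * ∑ j, |(η • ξ) j| ≤ wt ξ * (3 * (|η| * ‖ξ‖)) := by gcongr
        _ = 3 * |η| * (wt ξ * ‖ξ‖) := by ring
        _ ≤ 3 * |η| * 1 := by gcongr; exact wt_mul_norm_le ξ
        _ = _ := mul_one _
    have h9 : 0 ≤ wt ξ * ∑ j, |(η • ξ) j| := by positivity
    calc _ ≤ 1 * (wt ξ * ∑ j, |(η • ξ) j|) := by gcongr; exact wt_le_one ξ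
      _ ≤ _ := by linarith
  calc wt ξ * (wt ξ * (inner ℂ (trF (N + 1) (X ξ))
        (trF (N + 1) (gen κ (N + 2) (η • ξ) (X ξ)))).re)
      ≤ wt ξ * (wt ξ * ((∑ j, |(η • ξ) j|) * (√(N + 2) * A))) := by gcongr
    _ = (wt ξ * (wt ξ * ∑ j, |(η • ξ) j|)) * (√(N + 2) * A) := by ring
    _ ≤ (3 * |η|) * (√(N + 2) * A) := by gcongr
    _ = _ := by ring

lemma zero_le_sqrt (ha : 0 ≤ a) (hc : Summable c)
    (h : ∀ N : ℕ, 1 ≤ N → a ≤ C * √(N + 2) * (c N + c (N + 1))) : a = 0 := by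
  by_contra hne
  have hpos := lt_of_le_of_ne ha (Ne.symm hne)
  have hs := (((summable_nat_add_iff 1).2 hc).add ((summable_nat_add_iff 2).2 hc)).mul_left C
  have hs2 : Summable fun N : ℕ => a * (1 / ((N + 3 : ℕ) : ℝ)) := by
    refine Summable.of_nonneg_of_le (fun N => by positivity) (fun N => ?_) hs
    have h1 := h (N + 1) (by omega); have h2 : 0 < √(N + 3) := by positivity
    have h3 : √(N + 3) ≤ N + 3 := Real.sqrt_le_iff.2
      ⟨by positivity, by nlinarith [N.cast_nonneg (α := ℝ)]⟩
    push_cast at h1 ⊢; rw [show (N : ℝ) + 1 + 2 = N + 3 by ring] at h1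
    have h4 : a / √(N + 3) ≤ C * (c (N + 1) + c (N + 1 + 1)) := by
      rw [div_le_iff₀ h2]; linarith
    refine le_trans ?_ h4; rw [mul_one_div]; gcongr
  have hs3 := (summable_mul_left_iff hne).1 hs2
  exact Real.not_summable_one_div_natCast ((summable_nat_add_iff 3).1 hs3)

lemma norm_sq_wTrunc_le (hc : ContinuousOn W (Ici 0))
    (hW : IsWeakNull κ η W) (ht : 0 ≤ t) {V : ℝ → Spec} (hVc : Continuous V)
    (hVW : ∀ {s : ℝ}, 0 ≤ s → V s = W s) (N : ℕ) (hN : 1 ≤ N) :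
    ‖wTrunc (N + 1) (W t)‖ ^ 2 ≤ 6 * |η| * √(N + 2) *
      ((∫ s in (0)..t, ‖levL N (V s)‖ ^ 2) + ∫ s in (0)..t, ‖levL (N + 1) (V s)‖ ^ 2) := by
  have hlc N : Continuous fun s => ‖levL N (V s)‖ ^ 2 := ((levL N).continuous.comp hVc).norm.pow 2
  set A : ℝ → Spec := fun r => ∫ s in (0)..r, wGen κ η N (V s) with hA
  have hgc := (wGen κ η N).continuous.comp hVc
  have hAd r : HasDerivAt A (wGen κ η N (V r)) r :=
    intervalIntegral.integral_hasDerivAt_right (hgc.intervalIntegrable _ _)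
      hgc.stronglyMeasurable.stronglyMeasurableAtFilter hgc.continuousAt
  have hAW {r : ℝ} (hr : 0 ≤ r) : A r = wTrunc (N + 1) (W r) := by
    rw [wTrunc_eq_int hc hW N hr, hA]; refine intervalIntegral.integral_congr fun s hs => ?_
    rw [uIcc_of_le hr] at hs; simp only [hVW hs.1]
  have hAc := continuous_iff_continuousAt.2 fun r => (hAd r).continuousAt
  have hdc : Continuous fun s => 2 * (inner ℂ (A s) (wGen κ η N (V s))).re :=
    continuous_const.mul (Complex.continuous_re.comp (hAc.inner hgc))
  have h1 := intervalIntegral.integral_eq_sub_of_hasDerivAt (a := 0) (b := t)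
    (fun s _ => hda_norm_sq (hAd s)) (hdc.intervalIntegrable _ _)
  have hA0 : A 0 = 0 := by simp [hA]
  rw [hA0, norm_zero, zero_pow two_ne_zero, sub_zero, hAW ht] at h1
  rw [← h1]
  have h2 : 6 * |η| * √(N + 2) * ((∫ s in (0)..t, ‖levL N (V s)‖ ^ 2) +
      ∫ s in (0)..t, ‖levL (N + 1) (V s)‖ ^ 2) = ∫ s in (0)..t,
      6 * |η| * √(N + 2) * (‖levL N (V s)‖ ^ 2 + ‖levL (N + 1) (V s)‖ ^ 2) := by
    rw [intervalIntegral.integral_const_mul, intervalIntegral.integral_add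
      ((hlc N).intervalIntegrable _ _) ((hlc (N + 1)).intervalIntegrable _ _)]
  rw [h2]
  refine integral_mono_on ht (hdc.intervalIntegrable _ _)
    ((continuous_const.mul ((hlc N).add (hlc (N + 1)))).intervalIntegrable _ _) fun s hs => ?_
  have h3 := re_inner_wGen_le κ η hN (V s)
  rw [hAW hs.1, ← hVW hs.1]
  linarith

lemma norm_wTrunc_mono {n m} (hnm : n ≤ m) (X : Spec) : ‖wTrunc n X‖ ≤ ‖wTrunc m X‖ := by
  refine Lp.norm_le_norm_of_ae_le ?_
  filter_upwards [wTrunc_ae n X, wTrunc_ae m X] with ξ h1 h2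
  rw [h1, h2, norm_smul, norm_smul]
  refine mul_le_mul_of_nonneg_left ?_ (norm_nonneg _)
  have : trF n (X ξ) = trF n (trF m (X ξ)) := by
    refine fib_ext rfl fun k => ?_; simp only [trF_snd_ap]; split_ifs <;> first | rfl | omega
  rw [this]
  exact norm_trF_le _ _

lemma truncL_eq_zero (h : ‖wTrunc N X‖ ^ 2 = 0) : truncL N X = 0 := by
  have h2 := norm_eq_zero.1 ((pow_eq_zero_iff two_ne_zero).1 h)
  rw [Lp.eq_zero_iff_ae_eq_zero] at h2 ⊢
  filter_upwards [h2, wTrunc_ae N X, truncL_ae N X] with ξ h3 h4 h5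
  rw [h3, Pi.zero_apply] at h4
  rw [h5, Pi.zero_apply]
  exact (smul_eq_zero.1 h4.symm).resolve_left (wt_pos ξ).ne'

lemma zero_isWeakNull {W : ℝ → Spec} (hc : ContinuousOn W (Ici 0))
    (hW : IsWeakNull κ η W) {t : ℝ} (ht : 0 ≤ t) : W t = 0 := by
  set V : ℝ → Spec := fun s => W (max s 0) with hV
  have hVc : Continuous V := hc.comp_continuous (by fun_prop) fun s => mem_Ici.2 (le_max_right _ _)
  have hVW {s : ℝ} (hs : 0 ≤ s) : V s = W s := by simp [hV, hs]
  set c : ℕ → ℝ := fun N => ∫ s in (0)..t, ‖levL N (V s)‖ ^ 2 with hcdef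
  have hlc N : Continuous fun s => ‖levL N (V s)‖ ^ 2 := ((levL N).continuous.comp hVc).norm.pow 2
  have hcs : Summable c := by
    refine summable_of_sum_range_le (c := ∫ s in (0)..t, ‖V s‖ ^ 2) (fun N => ?_) fun n => ?_
    · exact intervalIntegral.integral_nonneg ht fun s _ => by positivity
    · rw [← intervalIntegral.integral_finsetSum fun N _ => (hlc N).intervalIntegrable _ _]
      refine integral_mono_on ht ((continuous_finsetSum _ fun N _ => hlc N).intervalIntegrable _ _)
        ((hVc.norm.pow 2).intervalIntegrable _ _) fun s _ => ?_
      simp only [norm_sq_levL]; rw [Finset.sum_range_sub (fun N => ‖truncL N (V s)‖ ^ 2)]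
      have := norm_truncL_le n (V s); have h2 : ‖truncL n (V s)‖ ^ 2 ≤ ‖V s‖ ^ 2 := by gcongr
      linarith [sq_nonneg ‖truncL 0 (V s)‖]
  have hzero N : truncL N (W t) = 0 := by
    have h1 : ‖wTrunc N (W t)‖ ^ 2 = 0 := by
      refine zero_le_sqrt (C := 6 * |η| * √(N + 1)) (by positivity)
        ((summable_nat_add_iff N).2 hcs) fun n hn => ?_
      refine (pow_le_pow_left₀ (norm_nonneg _)
        (norm_wTrunc_mono (m := n + N + 1) (by omega) _) 2).trans
        ((norm_sq_wTrunc_le hc hW ht hVc hVW (n + N) (by omega)).trans ?_)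
      have hnn m : 0 ≤ c m := intervalIntegral.integral_nonneg ht fun s _ => by positivity
      have h2 : √(((n + N : ℕ) : ℝ) + 2) ≤ √(N + 1) * √(n + 2) := by
        rw [← Real.sqrt_mul (by positivity)]; refine Real.sqrt_le_sqrt ?_
        push_cast
        nlinarith [mul_nonneg (N.cast_nonneg (α := ℝ)) (n.cast_nonneg (α := ℝ)),
          N.cast_nonneg (α := ℝ)]
      have h3 : n + 1 + N = n + N + 1 := by omega
      rw [h3]
      have h4 := mul_le_mul_of_nonneg_left h2 (by positivity : 0 ≤ 6 * |η|)
      refine mul_le_mul_of_nonneg_right (h4.trans (le_of_eq (by ring))) (add_nonneg (hnn _) (hnn _))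
    exact truncL_eq_zero h1
  refine tendsto_nhds_unique (tt_truncL (W t)) ?_
  simp only [hzero]
  exact tendsto_const_nhds

/-! ### Gaussians as Schwartz functions -/

lemma ex_pow_mul_exp_neg_sq_le (hb : 0 < b) (M) :
    ∃ C, ∀ r, 0 ≤ r → (1 + r) ^ M * exp (-(b * r ^ 2)) ≤ C := by
  refine ⟨M.factorial * exp (1 + 1 / (4 * b)), fun r hr => ?_⟩
  have h1 : (1 + r) ^ M ≤ M.factorial * exp (1 + r) := by
    have := Real.pow_div_factorial_le_exp (1 + r) (by linarith) M
    rw [div_le_iff₀ (by positivity)] at this; linarith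
  have h2 : 1 + r + -(b * r ^ 2) ≤ 1 + 1 / (4 * b) := by
    have h3 : r - b * r ^ 2 ≤ 1 / (4 * b) := by
      rw [le_div_iff₀ (by positivity)]; nlinarith [sq_nonneg (2 * b * r - 1)]
    linarith
  calc (1 + r) ^ M * exp (-(b * r ^ 2))
      ≤ (M.factorial * exp (1 + r)) * exp (-(b * r ^ 2)) := by gcongr
    _ = M.factorial * exp (1 + r + -(b * r ^ 2)) := by rw [exp_add (1 + r), mul_assoc]
    _ ≤ _ := by gcongr

def gaussReal (b : ℝ) (hb : 0 < b) : 𝓢(R3, ℝ) where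
  toFun v := exp (-(b * ‖v‖ ^ 2))
  smooth' := Real.contDiff_exp.comp (contDiff_const.mul (contDiff_norm_sq ℝ)).neg
  decay' k n := by
    have ht : (fun v : R3 => -(b * ‖v‖ ^ 2)).HasTemperateGrowth :=
      ((HasTemperateGrowth.const b).mul (Function.hasTemperateGrowth_norm_sq R3)).neg
    obtain ⟨m, C₀, hC₀, hd⟩ := ht.norm_iteratedFDeriv_le_uniform n
    obtain ⟨C₁, hC₁⟩ := ex_pow_mul_exp_neg_sq_le hb (k + m * n)
    refine ⟨n.factorial * (1 + C₀) ^ n * C₁, fun v => ?_⟩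
    have hone : (1 : ℝ) ≤ (1 + ‖v‖) ^ m := one_le_pow₀ (by linarith [norm_nonneg v])
    have h1 : ‖iteratedFDeriv ℝ n (exp ∘ fun v : R3 => -(b * ‖v‖ ^ 2)) v‖ ≤
        n.factorial * exp (-(b * ‖v‖ ^ 2)) * ((1 + C₀) * (1 + ‖v‖) ^ m) ^ n := by
      refine norm_iteratedFDeriv_comp_le (N := ⊤) Real.contDiff_exp
        ((contDiff_const.mul (contDiff_norm_sq ℝ)).neg) le_top v (fun i _ => ?_) fun i hi hin => ?_
      · rw [norm_iteratedFDeriv_eq_norm_iteratedDeriv, iteratedDeriv_eq_iterate,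
          Real.iter_deriv_exp, norm_eq_abs, abs_of_pos (exp_pos _)]
      · have hD : 1 ≤ (1 + C₀) * (1 + ‖v‖) ^ m := by nlinarith
        calc _ ≤ C₀ * (1 + ‖v‖) ^ m := hd i hin v
          _ ≤ (1 + C₀) * (1 + ‖v‖) ^ m := by gcongr; linarith
          _ ≤ _ := le_self_pow₀ hD (by omega)
    calc ‖v‖ ^ k * ‖iteratedFDeriv ℝ n (fun v : R3 => exp (-(b * ‖v‖ ^ 2))) v‖
        ≤ (1 + ‖v‖) ^ k * (n.factorial * exp (-(b * ‖v‖ ^ 2)) *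
            ((1 + C₀) * (1 + ‖v‖) ^ m) ^ n) := by
          gcongr
          · linarith
          · exact h1
      _ = n.factorial * (1 + C₀) ^ n * ((1 + ‖v‖) ^ (k + m * n) * exp (-(b * ‖v‖ ^ 2))) := by
          rw [mul_pow, pow_add, pow_mul]
          ring
      _ ≤ _ := by
          gcongr
          exact hC₁ _ (norm_nonneg v)

lemma gaussReal_ap (b) (hb : 0 < b) (v) : gaussReal b hb v = exp (-(b * ‖v‖ ^ 2)) := rfl

lemma sqrtM_eq (v) : sqrtM v = √((2 * π) ^ (-(3 / 2) : ℝ)) * exp (-(1 / 4 * ‖v‖ ^ 2)) := by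
  rw [sqrtM, maxwellian, Real.sqrt_mul (by positivity)]
  congr 1
  rw [show -‖v‖ ^ 2 / 2 = -(1 / 4 * ‖v‖ ^ 2) + -(1 / 4 * ‖v‖ ^ 2) by ring, exp_add,
    Real.sqrt_mul_self (exp_pos _).le]

lemma sqrtM_pos (v) : 0 < sqrtM v := by
  rw [sqrtM_eq]
  positivity

lemma sqrtM_sq (v) : sqrtM v ^ 2 = maxwellian v := by
  rw [sqrtM, sq_sqrt]
  unfold maxwellian
  positivity

lemma int_maxwellian : ∫ v : R3, maxwellian v = 1 := by
  unfold maxwellian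
  rw [integral_const_mul]
  have h := GaussianFourier.integral_rexp_neg_mul_sq_norm (V := R3) (b := 1 / 2) (by norm_num)
  have h2 : (fun v : R3 => exp (-‖v‖ ^ 2 / 2)) = fun v => exp (-(1 / 2) * ‖v‖ ^ 2) := by
    funext v; congr 1; ring
  rw [h2, h, finrank_euclideanSpace_fin, show π / (1 / 2) = 2 * π by ring,
    ← rpow_add (by positivity)]
  norm_num

/-! ### Hermite functions in one variable -/

lemma derivative_hermite_succ (n) :
    (Polynomial.hermite (n + 1)).derivative = (n + 1 : ℤ) • Polynomial.hermite n := by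
  induction n with
  | zero => simp [Polynomial.hermite_zero]
  | succ n ih =>
    rw [Polynomial.hermite_succ (n + 1), Polynomial.derivative_sub, Polynomial.derivative_mul,
      Polynomial.derivative_X, ih, Polynomial.derivative_smul, Polynomial.hermite_succ n]
    simp; ring

def hPoly (n : ℕ) (s : ℝ) : ℝ := (√(n.factorial))⁻¹ * Polynomial.aeval s (Polynomial.hermite n)

lemma hPoly_zero (s) : hPoly 0 s = 1 := by simp [hPoly]

lemma sqrt_factorial_succ (n : ℕ) : √((n + 1).factorial) = √(n + 1 : ℝ) * √(n.factorial) := by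
  rw [Nat.factorial_succ, ← Real.sqrt_mul (by positivity)]
  push_cast
  rfl

lemma hda_hPoly (n s) : HasDerivAt (hPoly n) (√n * hPoly (n - 1) s) s := by
  have h := (Polynomial.hasDerivAt_aeval (Polynomial.hermite n) s).const_mul (√(n.factorial))⁻¹
  refine h.congr_deriv ?_
  rcases n with _ | n
  · simp
  · rw [derivative_hermite_succ, hPoly, Nat.add_sub_cancel, sqrt_factorial_succ]
    push_cast
    have h1 : √(n + 1) ≠ 0 := by positivity
    have h2 : √(n + 1) * √(n + 1) = n + 1 := Real.mul_self_sqrt (by positivity)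
    have h3 : √n.factorial ≠ 0 := by positivity
    simp only [zsmul_eq_mul]; field_simp; push_cast; rw [pow_two, h2, map_mul]
    simp

lemma mul_hPoly (n s) : s * hPoly n s = √n * hPoly (n - 1) s + √(n + 1 : ℝ) * hPoly (n + 1) s := by
  have h0 : s * Polynomial.aeval s (Polynomial.hermite n) =
      Polynomial.aeval s (Polynomial.hermite n).derivative +
        Polynomial.aeval s (Polynomial.hermite (n + 1)) := by
    rw [Polynomial.hermite_succ]; simp
  have h1 := (hda_hPoly n s).unique
      ((Polynomial.hasDerivAt_aeval (Polynomial.hermite n) s).const_mul (√(n.factorial))⁻¹)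
  have h2 : √(n + 1) * hPoly (n + 1) s =
      (√(n.factorial))⁻¹ * Polynomial.aeval s (Polynomial.hermite (n + 1)) := by
    rw [hPoly, sqrt_factorial_succ]; have h1 : √(n + 1) ≠ 0 := by positivity
    have h3 : √n.factorial ≠ 0 := by positivity
    field_simp
  rw [h1, h2, ← mul_add, ← h0, hPoly]
  ring

lemma htg_hPoly (n) : (hPoly n).HasTemperateGrowth := by
  have : hPoly n = fun s => (√(n.factorial))⁻¹ * ∑ i ∈ Finset.range
      ((Polynomial.hermite n).natDegree + 1), ((Polynomial.hermite n).coeff i : ℝ) * s ^ i := by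
    funext s; rw [hPoly, Polynomial.aeval_eq_sum_range]; simp
  rw [this]
  refine (HasTemperateGrowth.const _).mul (HasTemperateGrowth.sum fun i _ => ?_)
  exact (HasTemperateGrowth.const _).mul (HasTemperateGrowth.id'.pow i)

/-! ### Hermite functions in the velocity variable -/

def hPr (k : MI) (v : R3) : ℝ := ∏ j, hPoly (k j) (v j)

lemma htg_coord (j) : (fun v : R3 => v j).HasTemperateGrowth := (proj (𝕜 := ℝ) j).hasTemperateGrowth

lemma htg_hPr (k) : (hPr k).HasTemperateGrowth := by
  have : hPr k = fun v => hPoly (k 0) (v 0) * hPoly (k 1) (v 1) * hPoly (k 2) (v 2) := by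
    funext v; rw [hPr, Fin.prod_univ_three]
  rw [this]
  exact (((htg_hPoly _).comp (htg_coord 0)).mul ((htg_hPoly _).comp (htg_coord 1))).mul
    ((htg_hPoly _).comp (htg_coord 2))

def hermR (k : MI) : 𝓢(R3, ℝ) := smulLeftCLM ℝ (fun v => √((2 * π) ^ (-(3 / 2) : ℝ)) * hPr k v)
    (gaussReal (1 / 4) (by norm_num))

lemma hermR_ap (k v) : hermR k v = hPr k v * sqrtM v := by
  have h : (fun v => √((2 * π) ^ (-(3 / 2) : ℝ)) * hPr k v).HasTemperateGrowth :=
    (HasTemperateGrowth.const _).mul (htg_hPr k)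
  rw [hermR, smulLeftCLM_apply_apply h, gaussReal_ap, sqrtM_eq, smul_eq_mul]
  ring

lemma hermR_zero (v) : hermR 0 v = sqrtM v := by
  rw [hermR_ap, hPr]
  simp [hPoly_zero]

lemma hPr_eq (k j v) : hPr k v = hPoly (k j) (v j) * ∏ i ∈ Finset.univ.erase j, hPoly (k i) (v i) :=
  (Finset.mul_prod_erase Finset.univ _ (Finset.mem_univ j)).symm

lemma prod_erase_congr {k l : MI} {j : Fin 3} (h : ∀ i, i ≠ j → k i = l i) {v w : R3}
    (hv : ∀ i, i ≠ j → v i = w i) :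
    ∏ i ∈ Finset.univ.erase j, hPoly (k i) (v i) = ∏ i ∈ Finset.univ.erase j, hPoly (l i) (w i) :=
  prod_congr rfl fun i hi => by rw [h i (Finset.ne_of_mem_erase hi),
    hv i (Finset.ne_of_mem_erase hi)]

lemma sub_dir_ap_ne (k) {i j} (h : i ≠ j) : (k - dir j) i = k i := by simp [dir, h]

lemma add_dir_ap_ne (k) {i j} (h : i ≠ j) : (k + dir j) i = k i := by simp [dir, h]

lemma sub_dir_ap_self (k j) : (k - dir j) j = k j - 1 := by simp [dir]

lemma add_dir_ap_self (k j) : (k + dir j) j = k j + 1 := by simp [dir]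

lemma cmul_hermR (k : MI) (j : Fin 3) (v : R3) : v j * hermR k v = √(k j) * hermR (k - dir j) v +
      √(k j + 1 : ℝ) * hermR (k + dir j) v := by
  simp only [hermR_ap, hPr_eq _ j]
  rw [prod_erase_congr (fun i h => sub_dir_ap_ne k h) (fun _ _ => rfl),
    prod_erase_congr (fun i h => add_dir_ap_ne k h) (fun _ _ => rfl),
    sub_dir_ap_self, add_dir_ap_self]
  have h := mul_hPoly (k j) (v j)
  linear_combination (∏ i ∈ Finset.univ.erase j, hPoly (k i) (v i)) * sqrtM v * h

lemma ldo_hermR (k : MI) (j : Fin 3) (v : R3) : (∂_{single j (1 : ℝ)} (hermR k)) v =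
      √(k j) * hermR (k - dir j) v - 1 / 2 * (v j * hermR k v) := by
  rw [SchwartzMap.lineDerivOp_apply]
  refine HasLineDerivAt.lineDeriv ?_
  set e : R3 := single j 1
  have hev s : (v + s • e) j = v j + s := by simp [e]
  have hev' (s : ℝ) i (hi : i ≠ j) : (v + s • e) i = v i := by simp [e, hi]
  set R := ∏ i ∈ Finset.univ.erase j, hPoly (k i) (v i)
  set c := √((2 * π) ^ (-(3 / 2) : ℝ))
  have hfun : (fun s : ℝ => hermR k (v + s • e)) = fun s => hPoly (k j) (v j + s) * R *
      (c * exp (-(1 / 4 * (‖v‖ ^ 2 + 2 * s * v j + s ^ 2)))) := by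
    funext s
    rw [hermR_ap, hPr_eq _ j, hev, prod_erase_congr (fun _ _ => rfl) (hev' s), sqrtM_eq]
    congr 4
    rw [norm_add_sq_real, inner_smul_right, norm_smul, EuclideanSpace.inner_single_right]
    simp [e]; ring
  rw [HasLineDerivAt, hfun]
  have h1 : HasDerivAt (fun s : ℝ => hPoly (k j) (v j + s)) (√(k j) * hPoly (k j - 1) (v j)) 0 := by
    have := HasDerivAt.comp_const_add (v j) 0 (by simpa using hda_hPoly (k j) (v j + 0))
    simpa using this
  have h2 : HasDerivAt (fun s : ℝ => exp (-(1 / 4 * (‖v‖ ^ 2 + 2 * s * v j + s ^ 2))))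
      (exp (-(1 / 4 * ‖v‖ ^ 2)) * (-(1 / 2 * v j))) 0 := by
    have h3 : HasDerivAt (fun s : ℝ => -(1 / 4 * (‖v‖ ^ 2 + 2 * s * v j + s ^ 2)))
        (-(1 / 2 * v j)) 0 := by
      have h4 := (((((hasDerivAt_id 0).const_mul 2).mul_const (v j)).const_add (‖v‖ ^ 2)).add
        ((hasDerivAt_id 0).pow 2)).const_mul (1 / 4) |>.neg
      refine h4.congr_deriv ?_; simp; ring
    have := h3.exp; simpa using this
  refine ((h1.mul_const R).mul (h2.const_mul c)).congr_deriv ?_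
  simp only [add_zero, mul_zero, zero_mul, zero_pow two_ne_zero]
  rw [hermR_ap, hermR_ap, hPr_eq _ j, hPr_eq k j,
    prod_erase_congr (fun i h => sub_dir_ap_ne k h) (fun _ _ => rfl),
    sub_dir_ap_self, sqrtM_eq]
  ring

/-! ### Orthonormality -/

def gram (k l : MI) : ℝ := ∫ v, hermR k v * hermR l v

lemma intg_mul_schw {D : Type*} [NormedAddCommGroup D] [NormedSpace ℝ D]
    [MeasurableSpace D] [BorelSpace D] [SecondCountableTopology D] {μ : Measure D}
    [μ.HasTemperateGrowth] (f g : 𝓢(D, ℝ)) :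
    Integrable (fun v => f v * g v) μ :=
  (f.memLp 2 μ).integrable_mul (g.memLp 2 μ)

lemma gram_comm (k l) : gram k l = gram l k := by simp only [gram, mul_comm]

lemma gram_raise (k l) (j : Fin 3) :
    √(k j + 1 : ℝ) * gram (k + dir j) l = √(l j) * gram k (l - dir j) := by
  have h1 := SchwartzMap.integral_mul_lineDerivOp_right_eq_neg_left (μ := volume) (hermR k)
    (hermR l) (single j 1)
  simp only [ldo_hermR, cmul_hermR] at h1
  have hint (a b) := intg_mul_schw (μ := volume) (hermR a) (hermR b)
  have e1 : ∀ v, hermR k v * (√(l j) * hermR (l - dir j) v -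
      1 / 2 * (√(l j) * hermR (l - dir j) v + √(l j + 1) * hermR (l + dir j) v)) =
      1 / 2 * √(l j) * (hermR k v * hermR (l - dir j) v) -
        1 / 2 * √(l j + 1) * (hermR k v * hermR (l + dir j) v) := fun v => by ring
  have e2 : ∀ v, (√(k j) * hermR (k - dir j) v -
      1 / 2 * (√(k j) * hermR (k - dir j) v + √(k j + 1) * hermR (k + dir j) v)) *
      hermR l v = 1 / 2 * √(k j) * (hermR (k - dir j) v * hermR l v) -
        1 / 2 * √(k j + 1) * (hermR (k + dir j) v * hermR l v) := fun v => by ring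
  simp only [e1, e2] at h1
  rw [integral_sub ((hint _ _).const_mul _) ((hint _ _).const_mul _),
    integral_sub ((hint _ _).const_mul _) ((hint _ _).const_mul _)] at h1
  simp only [integral_const_mul] at h1
  have h2 : ∫ v, v j * hermR k v * hermR l v = ∫ v, hermR k v * (v j * hermR l v) := by
    congr 1; funext v; ring
  simp only [cmul_hermR, add_mul, mul_add] at h2
  have e3 : ∀ v, √(k j) * hermR (k - dir j) v * hermR l v +
      √(k j + 1) * hermR (k + dir j) v * hermR l v =
      √(k j) * (hermR (k - dir j) v * hermR l v) +
      √(k j + 1) * (hermR (k + dir j) v * hermR l v) := fun v => by ring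
  have e4 : ∀ v, hermR k v * (√(l j) * hermR (l - dir j) v) +
      hermR k v * (√(l j + 1) * hermR (l + dir j) v) =
      √(l j) * (hermR k v * hermR (l - dir j) v) +
      √(l j + 1) * (hermR k v * hermR (l + dir j) v) := fun v => by ring
  simp only [e3, e4] at h2
  rw [integral_add ((hint _ _).const_mul _) ((hint _ _).const_mul _),
    integral_add ((hint _ _).const_mul _) ((hint _ _).const_mul _)] at h2
  simp only [integral_const_mul] at h2
  simp only [gram]
  linarith

lemma gram_zero : gram 0 0 = 1 := by
  simp only [gram, hermR_zero, ← pow_two, sqrtM_sq, int_maxwellian]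

lemma gram_eq (k l) : gram k l = if k = l then 1 else 0 := by
  induction h : ℓ k generalizing k l with
  | zero =>
    have hk : k = 0 := by
      funext i; have := (Finset.sum_eq_zero_iff.1 h) i (Finset.mem_univ i)
      simpa using this
    subst hk; split_ifs with hl
    · rw [← hl, gram_zero]
    · obtain ⟨j, hj⟩ : ∃ j, l j ≠ 0 := by
        by_contra! hcon
        exact hl (funext fun j => (hcon j).symm)
      have h2 := gram_raise (l - dir j) 0 j; rw [sub_add_dir hj, gram_comm l 0] at h2
      simp only [Pi.zero_apply, Nat.cast_zero, Real.sqrt_zero, zero_mul] at h2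
      exact (mul_eq_zero.1 h2).resolve_left (by positivity)
  | succ n ih =>
    obtain ⟨j, hj⟩ : ∃ j, k j ≠ 0 := by
      by_contra! hcon
      have : ℓ k = 0 := sum_eq_zero fun i _ => hcon i; omega
    have h2 := gram_raise (k - dir j) l j
    rw [sub_add_dir hj, ih (k - dir j) _ (by
      have := len_sub_dir hj; omega)] at h2
    have hpos : 0 < √(((k - dir j) j : ℝ) + 1) := by positivity
    by_cases hl : l j = 0
    · rw [hl] at h2; simp only [Nat.cast_zero, Real.sqrt_zero, zero_mul] at h2
      rw [(mul_eq_zero.1 h2).resolve_left hpos.ne', if_neg]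
      rintro rfl; exact hj hl
    · by_cases hkl : k = l
      · subst hkl
        rw [if_pos rfl, mul_one, sub_dir_ap_self, Nat.cast_sub (by omega)] at h2
        simp at h2
        have hpos' : 0 < √(k j) := sqrt_pos.2 (by exact_mod_cast Nat.pos_of_ne_zero hj)
        rw [if_pos rfl]; exact mul_left_cancel₀ hpos'.ne' (h2.trans (mul_one _).symm)
      · rw [if_neg, mul_zero] at h2
        · rw [(mul_eq_zero.1 h2).resolve_left hpos.ne', if_neg hkl]
        · intro h3; apply hkl; rw [← sub_add_dir hj, h3, sub_add_dir hl]

/-! ### Complex Hermite functions and their completeness -/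

def hermS (k : MI) : TX := (hermR k).postcompCLM ofRealCLM

lemma hermS_ap (k v) : hermS k v = (hermR k v) := rfl

lemma hermS_zero (v) : hermS 0 v = (sqrtM v) := by rw [hermS_ap, hermR_zero]

lemma conj_hermS (k v) : (starRingEnd ℂ) (hermS k v) = hermS k v := conj_ofReal _

lemma cmul_hermS (k j v) : (v j) * hermS k v = (√(k j) : ℂ) * hermS (k - dir j) v +
      (√(k j + 1 : ℝ) : ℂ) * hermS (k + dir j) v := by
  simp only [hermS_ap]
  exact_mod_cast congrArg Complex.ofReal (cmul_hermR k j v)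

lemma hermS_dir (j v) : hermS (dir j) v = (v j) * (sqrtM v) := by
  have h := cmul_hermS 0 j v
  rw [hermS_zero] at h
  simpa using h.symm

lemma hfda_ofReal_comp {D : Type*} [NormedAddCommGroup D] [NormedSpace ℝ D] (f : 𝓢(D, ℝ)) (v) :
    HasFDerivAt (fun v => (f v : ℂ)) (ofRealCLM.comp (fderiv ℝ f v)) v :=
  ofRealCLM.hasFDerivAt.comp v (f.hasFDerivAt v)

lemma ldo_hermS (k) (j : Fin 3) (v : R3) : (∂_{single j (1 : ℝ)} (hermS k)) v = (1 / 2 : ℂ) *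
      ((√(k j) : ℂ) * hermS (k - dir j) v - (√(k j + 1 : ℝ) : ℂ) * hermS (k + dir j) v) := by
  have h0 : (∂_{single j (1 : ℝ)} (hermS k)) v = ((∂_{single j (1 : ℝ)} (hermR k) v : ℝ) : ℂ) := by
    rw [lineDerivOp_apply_eq_fderiv, lineDerivOp_apply_eq_fderiv]
    have := (hfda_ofReal_comp (hermR k) v).fderiv
    change fderiv ℝ (fun v => (hermR k v : ℂ)) v _ = _; rw [this]
    rfl
  rw [h0, ldo_hermR, cmul_hermR]
  simp only [hermS_ap]
  push_cast
  ring

lemma memLp_hS (k : MI) : MemLp (fun v => hermS k v) 2 := (hermS k).memLp 2 volume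

lemma int_hermS_mul (k l) : ∫ v, hermS k v * hermS l v = if k = l then 1 else 0 := by
  have : ∀ v, hermS k v * hermS l v = ((hermR k v * hermR l v : ℝ) : ℂ) := fun v => by
    rw [hermS_ap, hermS_ap, Complex.ofReal_mul]
  simp only [this, integral_complex_ofReal]
  have h := gram_eq k l
  rw [gram] at h
  rw [h]
  split_ifs <;> simp

lemma ae_zero_four_eq_zero {f : R3 → ℂ} (hf : Integrable f) (h : ∀ w, 𝓕 f w = 0) :
    ∀ᵐ v, f v = 0 := by
  refine ae_eq_zero_of_integral_contDiff_smul_eq_zero hf.locallyIntegrable fun g hg hc => ?_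
  have hg' := ofRealCLM.contDiff.comp hg
  have hc' := hc.comp_left ofReal_zero
  set G : TX := hc'.toSchwartzMap hg'
  set G' : TX := 𝓕⁻ G with hG'
  have h1 := VectorFourier.integral_fourierIntegral_smul_eq_flip (L := innerₗ R3) (f := ⇑G')
    (g := f) (μ := volume) (ν := volume) Real.continuous_fourierChar continuous_inner
    G'.integrable hf
  have h2 : VectorFourier.fourierIntegral Real.fourierChar volume (innerₗ R3) ⇑G' = G := by
    have : 𝓕 G' = G := FourierTransform.fourier_fourierInv_eq G
    exact congrArg (fun F : TX => (F : R3 → ℂ)) this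
  have h3 : VectorFourier.fourierIntegral Real.fourierChar volume (innerₗ R3).flip f = 0 := by
    rw [flip_innerₗ]; exact funext h
  rw [h2, h3] at h1
  simp at h1
  rw [← h1]
  rfl

lemma mem_span_hermS_pow (w : R3) (n) : (fun v : R3 => ((∑ j, v j * w j : ℝ) : ℂ) ^ n *
    (sqrtM v)) ∈ span ℂ (range fun k : MI => fun v : R3 => hermS k v) := by
  set S := span ℂ (range fun k : MI => fun v : R3 => hermS k v)
  have hcoord : ∀ q ∈ S, ∀ j : Fin 3, (fun v : R3 => (v j) * q v) ∈ S := by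
    intro q hq j
    induction hq using Submodule.span_induction with
    | mem q hq =>
      obtain ⟨k, rfl⟩ := hq; have := funext fun v => cmul_hermS k j v
      dsimp only; rw [this]
      exact S.add_mem (S.smul_mem _ (subset_span ⟨_, rfl⟩)) (S.smul_mem _ (subset_span ⟨_, rfl⟩))
    | zero =>
      have : (fun v : R3 => (v j) * (0 : R3 → ℂ) v) = 0 := by
        funext v; simp
      rw [this]; exact S.zero_mem
    | add p q _ _ hp hq =>
      convert S.add_mem hp hq using 1
      funext v; simp [mul_add]
    | smul c q _ hq =>
      convert S.smul_mem c hq using 1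
      funext v; simp; ring
  induction n with
  | zero =>
    refine subset_span ⟨0, ?_⟩; funext v; simp [hermS_zero]
  | succ n ih =>
    have : (fun v : R3 => ((∑ j, v j * w j : ℝ) : ℂ) ^ (n + 1) * (sqrtM v)) =
        ∑ j, (w j : ℂ) • fun v : R3 => (v j : ℂ) *
          (((∑ j, v j * w j : ℝ) : ℂ) ^ n * (sqrtM v : ℂ)) := by
      funext v; rw [Finset.sum_apply]; simp only [Pi.smul_apply, smul_eq_mul]
      rw [pow_succ', Complex.ofReal_sum, mul_assoc, sum_mul]; refine sum_congr rfl fun j _ => ?_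
      push_cast; ring
    rw [this]; exact S.sum_mem fun j _ => S.smul_mem _ (hcoord _ ih j)

lemma memLp_sqrtM_mul_exp (c) : MemLp (fun v : R3 => sqrtM v * exp (c * ‖v‖)) 2 := by
  have hg := (gaussReal (1 / 8) (by norm_num)).memLp 2 vol
  have hcont : Continuous fun v : R3 => sqrtM v * exp (c * ‖v‖) := by
    have := funext fun v => (hermR_zero v).symm; rw [this]
    exact (hermR 0).continuous.mul (by fun_prop)
  refine hg.of_le_mul (c := √((2 * π) ^ (-(3 / 2) : ℝ)) * exp (2 * c ^ 2))
    hcont.aestronglyMeasurable (.of_forall fun v => ?_)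
  rw [gaussReal_ap, sqrtM_eq, norm_eq_abs, abs_of_pos (by positivity), norm_eq_abs,
    abs_of_pos (exp_pos _), mul_assoc, mul_assoc, ← exp_add, ← exp_add]
  refine mul_le_mul_of_nonneg_left (Real.exp_le_exp.2 ?_) (Real.sqrt_nonneg _)
  nlinarith [sq_nonneg (‖v‖ - 4 * c)]

lemma herm_complete {f : R3 → ℂ} (hf : MemLp f 2)
    (h : ∀ k, ∫ v, hermS k v * f v = 0) : ∀ᵐ v, f v = 0 := by
  have hspan : ∀ q ∈ span ℂ (range fun k : MI => fun v : R3 => hermS k v),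
      Integrable (fun v => q v * f v) volume ∧ ∫ v, q v * f v = 0 := by
    intro q hq
    induction hq using Submodule.span_induction with
    | mem q hq =>
      obtain ⟨k, rfl⟩ := hq; exact ⟨(memLp_hS k).integrable_mul hf, h k⟩
    | zero => simp
    | add p q _ _ hp hq =>
      have : (fun v => (p + q) v * f v) = fun v => p v * f v + q v * f v :=
        funext fun v => by simp [add_mul]
      rw [this]
      exact ⟨hp.1.add hq.1, by rw [integral_add hp.1 hq.1, hp.2, hq.2, add_zero]⟩
    | smul c q _ hq =>
      have : (fun v => (c • q) v * f v) = fun v => c * (q v * f v) :=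
        funext fun v => by simp [mul_assoc]
      rw [this]
      exact ⟨hq.1.const_mul c, by rw [integral_const_mul, hq.2, mul_zero]⟩
  have hsm : MemLp (fun v : R3 => (sqrtM v : ℂ)) 2 := by simpa [hermS_zero] using memLp_hS 0
  have hint : Integrable (fun v => (sqrtM v) * f v) volume := hsm.integrable_mul hf
  have hF : ∀ᵐ v, (sqrtM v) * f v = 0 := by
    refine ae_zero_four_eq_zero hint fun w => ?_; rw [Real.fourier_eq']
    set c : ℂ := -(2 * π * I)
    have hterm n : Integrable (fun v : R3 => c ^ n / n.factorial *
        (((∑ j, v j * w j : ℝ) : ℂ) ^ n * (sqrtM v) * f v)) volume ∧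
        ∫ v : R3, c ^ n / n.factorial * (((∑ j, v j * w j : ℝ) : ℂ) ^ n * (sqrtM v) * f v) = 0 := by
      have := hspan _ (mem_span_hermS_pow w n)
      exact ⟨this.1.const_mul _, by rw [integral_const_mul, this.2, mul_zero]⟩
    have hinner v : inner ℝ v w = ∑ j, v j * w j := by
      rw [PiLp.inner_apply]; refine sum_congr rfl fun j _ => ?_; simp [mul_comm]
    have hsum := hasSum_integral_of_dominated_convergence (μ := volume)
      (F := fun n v => c ^ n / n.factorial * (((∑ j, v j * w j : ℝ) : ℂ) ^ n * (sqrtM v) * f v))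
      (f := fun v => Complex.exp (((-2 * π * inner ℝ v w : ℝ) : ℂ) * I) • ((sqrtM v : ℂ) * f v))
      (fun n v => (2 * π * ‖w‖ * ‖v‖) ^ n / n.factorial * (sqrtM v * ‖f v‖))
      (fun n => (hterm n).1.aestronglyMeasurable) ?_ ?_ ?_ ?_
    · simp only [(hterm _).2] at hsum; exact hsum.unique hasSum_zero
    · refine fun n => .of_forall fun v => ?_
      have h1 : |∑ j, v j * w j| ≤ ‖w‖ * ‖v‖ := by
        rw [← hinner, mul_comm]; exact abs_real_inner_le_norm v w
      have h2 : ‖c‖ = 2 * π := by simp [c, abs_of_pos Real.pi_pos]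
      rw [norm_mul, norm_div, norm_pow, h2, norm_mul, norm_mul, norm_pow, norm_real,
        norm_real, norm_eq_abs, norm_eq_abs, abs_of_pos (sqrtM_pos v),
        Complex.norm_natCast]
      calc (2 * π) ^ n / n.factorial * (|∑ j, v j * w j| ^ n * sqrtM v * ‖f v‖)
          ≤ (2 * π) ^ n / n.factorial * ((‖w‖ * ‖v‖) ^ n * sqrtM v * ‖f v‖) := by
            have := sqrtM_pos v; gcongr
        _ = _ := by
            rw [mul_assoc (2 * π), mul_pow (2 * π)]; ring
    · refine .of_forall fun v => Summable.mul_right _ ?_; exact Real.summable_pow_div_factorial _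
    · have h1 : (fun v : R3 => ∑' n : ℕ, (2 * π * ‖w‖ * ‖v‖) ^ n / n.factorial *
          (sqrtM v * ‖f v‖)) = fun v => (sqrtM v * exp (2 * π * ‖w‖ * ‖v‖)) * ‖f v‖ := by
        funext v
        have := NormedSpace.expSeries_div_hasSum_exp (2 * π * ‖w‖ * ‖v‖)
        rw [← Real.exp_eq_exp_ℝ] at this; rw [tsum_mul_right, this.tsum_eq]
        ring
      rw [h1]; exact (memLp_sqrtM_mul_exp _).integrable_mul hf.norm
    · refine .of_forall fun v => ?_
      have h1 := NormedSpace.expSeries_div_hasSum_exp (((-2 * π * inner ℝ v w : ℝ) : ℂ) * I)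
      rw [← Complex.exp_eq_exp_ℂ] at h1; have h2 := h1.mul_right ((sqrtM v : ℂ) * f v)
      rw [smul_eq_mul]; refine h2.congr_fun ?_; intro n; rw [hinner]
      have : ((-2 * π * ∑ j, v j * w j : ℝ) : ℂ) * I = c * ((∑ j, v j * w j : ℝ) : ℂ) := by
        simp; ring
      rw [this, mul_pow]; ring
  filter_upwards [hF] with v hv
  exact (mul_eq_zero.1 hv).resolve_left (by exact_mod_cast (sqrtM_pos v).ne')

/-! ### Tensor products of Schwartz functions -/

lemma norm_ifd_comp_clm_le {D E F : Type*} [NormedAddCommGroup D] [NormedSpace ℝ D]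
    [NormedAddCommGroup E] [NormedSpace ℝ E] [NormedAddCommGroup F] [NormedSpace ℝ F]
    (f : 𝓢(E, F)) (L : D →L[ℝ] E) (hL : ‖L‖ ≤ 1) (i z) :
    ‖iteratedFDeriv ℝ i (fun z => f (L z)) z‖ ≤ ‖iteratedFDeriv ℝ i f (L z)‖ := by
  have h := L.iteratedFDeriv_comp_right (n := i) (f.smooth i) z le_rfl
  change ‖iteratedFDeriv ℝ i (f ∘ L) z‖ ≤ _
  rw [h]
  refine (ContinuousMultilinearMap.norm_compContinuousLinearMap_le _ _).trans ?_
  rw [Finset.prod_const]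
  exact mul_le_of_le_one_right (norm_nonneg _) (pow_le_one₀ (norm_nonneg _) hL)

def tnS (f g : TX) : TXV where
  toFun z := f z.1 * g z.2
  smooth' := (f.smooth'.comp contDiff_fst).mul (g.smooth'.comp contDiff_snd)
  decay' k n := by
    choose Cf hf using fun p : ℕ × ℕ => f.decay' p.1 p.2
    choose Cg hg using fun p : ℕ × ℕ => g.decay' p.1 p.2
    refine ⟨∑ i ∈ Finset.range (n + 1), (n.choose i : ℝ) *
      (Cf (k, i) * Cg (0, n - i) + Cf (0, i) * Cg (k, n - i)), fun z => ?_⟩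
    have h1 := norm_iteratedFDeriv_mul_le (𝕜 := ℝ) (N := (⊤ : ℕ∞)) (n := n)
      (f.smooth'.comp contDiff_fst) (g.smooth'.comp contDiff_snd) z (by exact_mod_cast le_top)
    refine (mul_le_mul_of_nonneg_left h1 (by positivity)).trans ?_
    rw [mul_sum]
    refine sum_le_sum fun i _ => ?_
    have hA : ‖iteratedFDeriv ℝ i (fun z : R3 × R3 => f z.1) z‖ ≤ ‖iteratedFDeriv ℝ i f z.1‖ :=
      norm_ifd_comp_clm_le f (fst ℝ R3 R3) (ContinuousLinearMap.norm_fst_le ℝ R3 R3) i z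
    have hB : ‖iteratedFDeriv ℝ (n - i) (fun z : R3 × R3 => g z.2) z‖ ≤
        ‖iteratedFDeriv ℝ (n - i) g z.2‖ :=
      norm_ifd_comp_clm_le g (snd ℝ R3 R3) (ContinuousLinearMap.norm_snd_le ℝ R3 R3) (n - i) z
    have hz : ‖z‖ ^ k ≤ ‖z.1‖ ^ k + ‖z.2‖ ^ k := by
      rcases max_cases ‖z.1‖ ‖z.2‖ with h | h <;> rw [Prod.norm_def, h.1] <;>
        linarith [pow_nonneg (norm_nonneg z.1) k, pow_nonneg (norm_nonneg z.2) k]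
    have hf1 : ‖z.1‖ ^ k * ‖iteratedFDeriv ℝ i f z.1‖ ≤ Cf (k, i) := hf (k, i) z.1
    have hf0 : ‖iteratedFDeriv ℝ i f z.1‖ ≤ Cf (0, i) := by
      rw [← one_mul ‖_‖]
      exact hf (0, i) z.1
    have hg1 : ‖z.2‖ ^ k * ‖iteratedFDeriv ℝ (n - i) g z.2‖ ≤ Cg (k, n - i) := hg (k, n - i) z.2
    have hg0 : ‖iteratedFDeriv ℝ (n - i) g z.2‖ ≤ Cg (0, n - i) := by
      rw [← one_mul ‖_‖]
      exact hg (0, n - i) z.2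
    calc ‖z‖ ^ k * ((n.choose i : ℝ) * ‖iteratedFDeriv ℝ i (fun z : R3 × R3 => f z.1) z‖ *
          ‖iteratedFDeriv ℝ (n - i) (fun z : R3 × R3 => g z.2) z‖)
        ≤ (‖z.1‖ ^ k + ‖z.2‖ ^ k) * ((n.choose i : ℝ) * ‖iteratedFDeriv ℝ i f z.1‖ *
          ‖iteratedFDeriv ℝ (n - i) g z.2‖) := by gcongr
      _ = (n.choose i : ℝ) * ((‖z.1‖ ^ k * ‖iteratedFDeriv ℝ i f z.1‖) *
            ‖iteratedFDeriv ℝ (n - i) g z.2‖ + ‖iteratedFDeriv ℝ i f z.1‖ *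
            (‖z.2‖ ^ k * ‖iteratedFDeriv ℝ (n - i) g z.2‖)) := by ring
      _ ≤ _ := by
          have a1 : 0 ≤ Cf (k, i) := le_trans (by positivity) hf1
          have a2 : 0 ≤ Cf (0, i) := le_trans (by positivity) hf0
          gcongr

lemma tnS_ap (f g z) : tnS f g z = f z.1 * g z.2 := rfl

/-! ### The Fourier-Hermite transform -/

abbrev L2X := Lx ℂ

abbrev L2XV := Lp ℂ 2 (volume : Measure (R3 × R3))

abbrev HL2 := Lx HSeq

lemma isHilbertSum_total {ι G H : Type*} [NormedAddCommGroup G] [InnerProductSpace ℂ G]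
    [CompleteSpace G] [NormedAddCommGroup H] [InnerProductSpace ℂ H] [CompleteSpace H]
    {A : ι → G →ₗᵢ[ℂ] H} (hA : OrthogonalFamily ℂ (fun _ => G) A)
    (hA' : ∀ x, (∀ i y, inner ℂ (A i y) x = 0) → x = 0) : IsHilbertSum ℂ (fun _ : ι => G) A := by
  refine IsHilbertSum.mk hA (top_le_iff.2 ?_)
  rw [Submodule.topologicalClosure_eq_top_iff, Submodule.eq_bot_iff]
  intro x hx
  refine hA' x fun i y => hx _ ?_
  exact Submodule.mem_iSup_of_mem i ⟨y, rfl⟩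

lemma ex_isometryEquiv_families {ι G H₁ H₂ : Type*}
    [NormedAddCommGroup G] [InnerProductSpace ℂ G] [CompleteSpace G]
    [NormedAddCommGroup H₁] [InnerProductSpace ℂ H₁] [CompleteSpace H₁]
    [NormedAddCommGroup H₂] [InnerProductSpace ℂ H₂] [CompleteSpace H₂]
    {A : ι → G →ₗᵢ[ℂ] H₁} {B : ι → G →ₗᵢ[ℂ] H₂}
    (hA : OrthogonalFamily ℂ (fun _ => G) A) (hA' : ∀ x, (∀ i y, inner ℂ (A i y) x = 0) → x = 0)
    (hB : OrthogonalFamily ℂ (fun _ => G) B) (hB' : ∀ x, (∀ i y, inner ℂ (B i y) x = 0) → x = 0) :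
    ∃ U : H₁ ≃ₗᵢ[ℂ] H₂, ∀ i y, U (A i y) = B i y := by
  classical
  have h1 := isHilbertSum_total hA hA'
  have h2 := isHilbertSum_total hB hB'
  refine ⟨h1.linearIsometryEquiv.trans h2.linearIsometryEquiv.symm, fun i y => ?_⟩
  rw [LinearIsometryEquiv.trans_apply, ← h1.linearIsometryEquiv_symm_apply_single,
    LinearIsometryEquiv.apply_symm_apply, h2.linearIsometryEquiv_symm_apply_single]

lemma lint_mul_sq_le {α : Type*} [MeasurableSpace α] {μ : Measure α} {f g : α → ℝ≥0∞}
    (hf : AEMeasurable f μ) (hg : AEMeasurable g μ) :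
    (∫⁻ a, f a * g a ∂μ) ^ 2 ≤ (∫⁻ a, f a ^ 2 ∂μ) * ∫⁻ a, g a ^ 2 ∂μ := by
  have h := ENNReal.lintegral_mul_le_Lp_mul_Lq μ Real.HolderConjugate.two_two hf hg
  refine (pow_le_pow_left' h 2).trans (le_of_eq ?_)
  rw [mul_pow, ← rpow_natCast, ← rpow_natCast, ← rpow_mul, ← rpow_mul]
  norm_num

section Tensor

variable {f : R3 → ℂ} {g : R3 → ℂ} {F : R3 × R3 → ℂ}

lemma memLp_tens (hf : MemLp f 2) (hg : MemLp g 2) :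
    MemLp (fun z : R3 × R3 => f z.1 * g z.2) 2 := by
  rw [Measure.volume_eq_prod]
  refine memLp_two_lint (hf.1.comp_fst.mul hg.1.comp_snd) ?_
  simp only [enorm_mul, mul_pow]
  rw [lintegral_prod_mul (hf.1.enorm.pow_const 2) (hg.1.enorm.pow_const 2)]
  exact mul_lt_top (MemLp.lintegral_sq_lt_top hf) (MemLp.lintegral_sq_lt_top hg)

lemma memLp_coef (hg : MemLp g 2) (hF : MemLp F 2) : MemLp (fun x => ∫ v, g v * F (x, v)) 2 := by
  rw [Measure.volume_eq_prod] at hF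
  refine memLp_two_lint (hg.1.comp_snd.mul hF.1).integral_prod_right' ?_
  have h1 : ∀ᵐ x : R3, ‖∫ v, g v * F (x, v)‖ₑ ^ 2 ≤ (∫⁻ v, ‖g v‖ₑ ^ 2) * ∫⁻ v, ‖F (x, v)‖ₑ ^ 2 := by
    filter_upwards [hF.1.prodMk_left] with x hx
    refine le_trans (pow_le_pow_left' (enorm_integral_le_lintegral_enorm _) 2) ?_
    simp; exact lint_mul_sq_le hg.1.enorm hx.enorm
  refine (lintegral_mono_ae h1).trans_lt ?_
  rw [lintegral_const_mul' _ _ (MemLp.lintegral_sq_lt_top hg).ne]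
  have h2 := MemLp.lintegral_sq_lt_top hF
  rw [lintegral_prod _ (hF.1.enorm.pow_const 2)] at h2
  exact mul_lt_top (MemLp.lintegral_sq_lt_top hg) h2

lemma int_tens_mul (hf : MemLp f 2) (hg : MemLp g 2) (hF : MemLp F 2) :
    ∫ z : R3 × R3, f z.1 * g z.2 * F z = ∫ x, f x * ∫ v, g v * F (x, v) := by
  have h := (memLp_tens hf hg).integrable_mul hF
  rw [Measure.volume_eq_prod] at h ⊢
  refine (integral_prod _ h).trans ?_
  refine integral_congr_ae (.of_forall fun x => ?_)
  simp only [mul_assoc, Pi.mul_apply]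
  exact integral_const_mul _ _

end Tensor

def embL (k : MI) : L2X →ₗ[ℂ] L2XV where
  toFun ψ := (memLp_tens (Lp.memLp ψ) (memLp_hS k)).toLp _
  map_add' ψ φ := by
    rw [← MemLp.toLp_add]
    refine MemLp.toLp_congr _ _ ?_
    rw [Measure.volume_eq_prod]
    filter_upwards [Measure.quasiMeasurePreserving_fst.ae (Lp.coeFn_add ψ φ)] with z h
    rw [h, Pi.add_apply, add_mul]
    rfl
  map_smul' c ψ := by
    rw [RingHom.id_apply, ← MemLp.toLp_const_smul]
    refine MemLp.toLp_congr _ _ ?_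
    rw [Measure.volume_eq_prod]
    filter_upwards [Measure.quasiMeasurePreserving_fst.ae (Lp.coeFn_smul c ψ)] with z h
    rw [h, Pi.smul_apply, smul_eq_mul, mul_assoc]
    rfl

lemma embL_ae (k) (ψ : L2X) : ∀ᵐ z, embL k ψ z = ψ z.1 * hermS k z.2 :=
  (memLp_tens (Lp.memLp ψ) (memLp_hS k)).coeFn_toLp

def hCoef (k : MI) (f : L2XV) : L2X := (memLp_coef (memLp_hS k) (Lp.memLp f)).toLp _

lemma hCoef_ae (k) (f : L2XV) : ∀ᵐ x, hCoef k f x = ∫ v, hermS k v * f (x, v) :=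
  (memLp_coef (memLp_hS k) (Lp.memLp f)).coeFn_toLp

lemma inner_embL (k : MI) (ψ : L2X) (f : L2XV) : inner ℂ (embL k ψ) f = inner ℂ ψ (hCoef k f) := by
  have h1 : inner ℂ (embL k ψ) f = ∫ z : R3 × R3, (starRingEnd ℂ) (ψ z.1) * hermS k z.2 * f z := by
    rw [L2.inner_def]; refine integral_congr_ae ?_; filter_upwards [embL_ae k ψ] with z h
    rw [h, inner_apply, map_mul, conj_hermS, mul_comm]
  rw [h1, int_tens_mul (f := fun x => (starRingEnd ℂ) (ψ x)) (Lp.memLp ψ).star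
    (memLp_hS k) (Lp.memLp f), L2.inner_def]
  refine integral_congr_ae ?_
  filter_upwards [hCoef_ae k f] with x h
  rw [h, inner_apply, mul_comm]

lemma hCoef_embL (k l ψ) : hCoef k (embL l ψ) = if k = l then ψ else 0 := by
  refine Lp.ext ?_
  have h0 := embL_ae l ψ
  filter_upwards [hCoef_ae k (embL l ψ), Measure.ae_ae_of_ae_prod h0,
    Lp.coeFn_zero ℂ 2 vol] with x h1 h2 h3
  rw [h1]
  have : ∀ᵐ v, hermS k v * embL l ψ (x, v) = ψ x * (hermS k v * hermS l v) := by
    filter_upwards [h2] with v hv; rw [hv]; ring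
  rw [integral_congr_ae this, integral_const_mul, int_hermS_mul]
  split_ifs
  · rw [mul_one]
  · rw [mul_zero, h3, Pi.zero_apply]

def emb (k : MI) : L2X →ₗᵢ[ℂ] L2XV :=
  (embL k).isometryOfInner fun ψ φ => by rw [inner_embL, hCoef_embL, if_pos rfl]

lemma emb_ae (k ψ) : ∀ᵐ z, emb k ψ z = ψ z.1 * hermS k z.2 := embL_ae k ψ

lemma inner_emb (k ψ f) : inner ℂ (emb k ψ) f = inner ℂ ψ (hCoef k f) := inner_embL k ψ f

lemma orthogonalFamily_emb : OrthogonalFamily ℂ (fun _ : MI => L2X) emb := by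
  intro k l h ψ φ
  rw [inner_emb]
  change inner ℂ ψ (hCoef k (embL l φ)) = 0
  rw [hCoef_embL, if_neg h, inner_zero_right]

lemma zero_inner_emb {f : L2XV} (h : ∀ k ψ, inner ℂ (emb k ψ) f = 0) : f = 0 := by
  have h1 (k : MI) : hCoef k f = 0 := by
    have := h k (hCoef k f)
    rwa [inner_emb, inner_self_eq_zero] at this
  have h2 : ∀ᵐ x, ∀ k, ∫ v, hermS k v * f (x, v) = 0 := by
    rw [ae_all_iff]; intro k
    filter_upwards [hCoef_ae k f, Lp.coeFn_zero ℂ 2 vol] with x h3 h4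
    rw [← h3, h1 k, h4, Pi.zero_apply]
  have hf : MemLp f 2 ((vol).prod volume) := Lp.memLp f
  have h3 := MemLp.lintegral_sq_lt_top hf
  rw [lintegral_prod _ (hf.1.enorm.pow_const 2)] at h3
  have h4 : ∀ᵐ x, ∫⁻ v, ‖f (x, v)‖ₑ ^ 2 = 0 := by
    filter_upwards [h2, hf.1.prodMk_left, ae_lt_top' (hf.1.enorm.pow_const 2).lintegral_prod_right'
      h3.ne] with x h5 h6 h7
    rw [lintegral_eq_zero_iff' (h6.enorm.pow_const 2)]
    filter_upwards [herm_complete (memLp_two_lint h6 h7) h5] with v hv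
    simp [hv]
  rw [← enorm_eq_zero, ← sq_eq_zero_iff, en_sq_Lp]
  refine (lintegral_prod _ (hf.1.enorm.pow_const 2)).trans ?_
  rw [lintegral_congr_ae h4, lintegral_zero]

def coL (k : MI) : HL2 →L[ℂ] L2X := (coordCLM k).compLpL 2 volume

lemma coL_ae (k : MI) (X : HL2) : ∀ᵐ ξ, coL k X ξ = X ξ k := by
  filter_upwards [(coordCLM k).coeFn_compLpL X] with ξ h
  rw [coL, h, coordCLM_ap]

def lvlL (k : MI) : L2X →L[ℂ] HL2 := (toSpanSingleton ℂ (lp.single 2 k (1 : ℂ))).compLpL 2 volume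

lemma lvlL_ae (k : MI) (φ : L2X) : ∀ᵐ ξ, lvlL k φ ξ = φ ξ • lp.single 2 k (1 : ℂ) := by
  filter_upwards [(toSpanSingleton ℂ
    (lp.single (E := fun _ : MI => ℂ) 2 k 1)).coeFn_compLpL φ] with ξ h
  rw [lvlL, h, toSpanSingleton_apply]

lemma inner_lvlL (k) (φ : L2X) (X : HL2) : inner ℂ (lvlL k φ) X = inner ℂ φ (coL k X) := by
  refine inner_congr_ae ?_
  filter_upwards [lvlL_ae k φ, coL_ae k X] with ξ h1 h2
  rw [h1, h2, inner_smul_left, ← inner_conj_symm, in_single_one, conj_conj, inner_apply, mul_comm]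

lemma coL_lvlL (k l φ) : coL k (lvlL l φ) = if k = l then φ else 0 := by
  refine Lp.ext ?_
  filter_upwards [coL_ae k (lvlL l φ), lvlL_ae l φ, Lp.coeFn_zero ℂ 2 vol] with ξ h1 h2 h3
  rw [h1, h2]
  split_ifs with h
  · subst h; simp
  · rw [h3]; simp [h]

lemma hermL2_ext {X Y} (h : ∀ k, coL k X = coL k Y) : X = Y := by
  refine Lp.ext ?_
  filter_upwards [ae_all_iff.2 fun k => coL_ae k X, ae_all_iff.2 fun k => coL_ae k Y] with ξ h1 h2
  refine lp.ext (funext fun k => ?_)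
  rw [← h1 k, h k, h2 k]

def levelF (k : MI) : L2X →ₗᵢ[ℂ] HL2 := ((lvlL k).toLinearMap.isometryOfInner fun ψ φ => by
    change inner ℂ (lvlL k ψ) (lvlL k φ) = _
    rw [inner_lvlL, coL_lvlL, if_pos rfl]).comp
    (Lp.fourierTransformₗᵢ R3 ℂ).toLinearIsometry

lemma levelF_ap (k ψ) : levelF k ψ = lvlL k (𝓕 ψ) := rfl

lemma ex_hermF : ∃ U : L2XV ≃ₗᵢ[ℂ] HL2, ∀ k ψ, U (emb k ψ) = levelF k ψ := by
  refine ex_isometryEquiv_families orthogonalFamily_emb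
    (fun f h => zero_inner_emb h) ?_ fun X h => ?_
  · intro k l h ψ φ
    rw [levelF_ap, levelF_ap, inner_lvlL, coL_lvlL, if_neg h, inner_zero_right]
  · refine hermL2_ext fun k => ?_; have := h k (𝓕⁻ (coL k X))
    rw [levelF_ap, FourierTransform.fourier_fourierInv_eq, inner_lvlL, inner_self_eq_zero] at this
    rw [this, map_zero]

def hermF : L2XV ≃ₗᵢ[ℂ] HL2 := ex_hermF.choose

lemma hermF_emb (k ψ) : hermF (emb k ψ) = lvlL k (𝓕 ψ) := ex_hermF.choose_spec k ψ

lemma inner_hermF (f g : L2XV) : inner ℂ (hermF f) (hermF g) = inner ℂ f g :=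
  LinearIsometryEquiv.inner_map_map _ _ _

lemma coL_hermF (k : MI) (f : L2XV) : coL k (hermF f) = 𝓕 (hCoef k f) := by
  refine ext_inner_left ℂ fun φ => ?_
  have h : φ = 𝓕 (𝓕⁻ φ) := (FourierTransform.fourier_fourierInv_eq φ).symm
  rw [h, ← inner_lvlL, ← hermF_emb, inner_hermF, inner_emb, Lp.inner_fourier_eq]

/-! ### Measurability of curves of square integrable functions -/

lemma meas_forall_dist {α H : Type*} [MeasurableSpace α] [PseudoMetricSpace H]
    [SecondCountableTopology H] [MeasurableSpace H] [BorelSpace H] {F : α → H}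
    (h : ∀ x, Measurable fun a => dist (F a) x) : Measurable F := by
  refine measurable_of_isOpen fun O hO => ?_
  obtain ⟨D, hD, hDd⟩ := TopologicalSpace.exists_countable_dense H
  have hO' : F ⁻¹' O = ⋃ x ∈ D, ⋃ q : ℚ, ⋃ _ : Metric.ball x q ⊆ O, {a | dist (F a) x < q} := by
    ext a; simp; refine ⟨fun ha => ?_, fun ⟨x, _, q, hq, hd⟩ => hq hd⟩
    obtain ⟨ε, hε, hb⟩ := Metric.isOpen_iff.1 hO _ ha
    obtain ⟨q, hq0, hqε⟩ := exists_rat_btwn (half_pos hε)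
    obtain ⟨x, hx, hxd⟩ := hDd.exists_dist_lt (F a) hq0; refine ⟨x, hx, q, fun y hy => hb ?_, hxd⟩
    rw [Metric.mem_ball] at hy ⊢; linarith [dist_triangle_right y (F a) x]
  rw [hO']
  refine MeasurableSet.biUnion hD fun x _ => MeasurableSet.iUnion fun q =>
    MeasurableSet.iUnion fun _ => measurableSet_lt (h x) measurable_const

open Classical in
/-- The class of a function in `L²`, zero if it is not square integrable. -/
def cls (f : R3 × R3 → ℂ) : L2XV := if h : MemLp f 2 then h.toLp f else 0

lemma cls_ae {f} (h : MemLp f 2) : ∀ᵐ z, cls f z = f z := by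
  rw [cls, dif_pos h]
  exact h.coeFn_toLp

lemma aesm_cls {R : ℝ → R3 × R3 → ℂ} {μ} [SFinite μ]
    (hR : AEStronglyMeasurable (fun y : ℝ × (R3 × R3) => R y.1 y.2) (μ.prod volume)) :
    AEStronglyMeasurable (fun s => cls (R s)) μ := by
  let _ : MeasurableSpace ↥L2XV := borel _
  have _ : BorelSpace ↥L2XV := ⟨rfl⟩
  have _ : Fact ((2 : ℝ≥0∞) ≠ ⊤) := ⟨by simp⟩
  have _ : MeasureTheory.IsSeparable (volume : Measure (R3 × R3)) := isSeparable_of_sigmaFinite _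
  set R' := hR.mk _
  have hR' := hR.stronglyMeasurable_mk
  have hs s : StronglyMeasurable fun z => R' (s, z) := hR'.comp_measurable measurable_prodMk_left
  have hm : MeasurableSet {s | ∫⁻ z, ‖R' (s, z)‖ₑ ^ 2 < ⊤} :=
    measurableSet_lt ((hR'.enorm.pow_const 2).lintegral_prod_right') measurable_const
  have hiff s : MemLp (fun z => R' (s, z)) 2 ↔ ∫⁻ z, ‖R' (s, z)‖ₑ ^ 2 < ⊤ :=
    ⟨fun h => MemLp.lintegral_sq_lt_top h, fun h => memLp_two_lint (hs s).aestronglyMeasurable h⟩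
  have hmeas : Measurable fun s => cls fun z => R' (s, z) := by
    refine meas_forall_dist fun x => ?_; have hx := (Lp.stronglyMeasurable x)
    have heq : (fun s => dist (cls fun z => R' (s, z)) x) = fun s =>
        if s ∈ {s | ∫⁻ z, ‖R' (s, z)‖ₑ ^ 2 < ⊤} then
          ((∫⁻ z, ‖R' (s, z) - x z‖ₑ ^ 2) ^ (1 / 2 : ℝ)).toReal else dist 0 x := by
      funext s; split_ifs with h
      · have h1 := (hiff s).2 h
        have h2 : edist (cls fun z => R' (s, z)) x ^ 2 = ∫⁻ z, ‖R' (s, z) - x z‖ₑ ^ 2 := by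
          rw [edist_eq_enorm_sub, en_sq_Lp]; refine lintegral_congr_ae ?_
          filter_upwards [Lp.coeFn_sub (cls fun z => R' (s, z)) x, cls_ae h1] with z h3 h4
          rw [h3, Pi.sub_apply, h4]
        rw [← h2, ← rpow_natCast, ← rpow_mul, dist_edist]; norm_num
      · rw [cls, dif_neg fun h1 => h ((hiff s).1 h1)]
    rw [heq]; refine Measurable.ite hm ?_ measurable_const
    refine ((Measurable.lintegral_prod_right' (f := fun y : ℝ × (R3 × R3) =>
      ‖R' (y.1, y.2) - x y.2‖ₑ ^ 2) ?_).pow_const _).ennreal_toReal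
    exact ((hR'.sub (hx.comp_measurable measurable_snd)).enorm).pow_const 2
  have := hmeas.stronglyMeasurable.aestronglyMeasurable (μ := μ)
  refine this.congr ?_
  filter_upwards [Measure.ae_ae_of_ae_prod hR.ae_eq_mk] with s h
  have h1 : (fun z => R s z) =ᵐ[volume] fun z => R' (s, z) := h
  by_cases h2 : MemLp (R s) 2
  · rw [cls, cls, dif_pos h2, dif_pos ((memLp_congr_ae h1).1 h2)]
    exact MemLp.toLp_congr _ _ h1.symm
  · rw [cls, cls, dif_neg h2, dif_neg fun h3 => h2 ((memLp_congr_ae h1).2 h3)]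

/-! ### Weak derivatives and the Fourier transform -/

def symb (α : MI) (ξ : R3) : ℂ := ∏ i, (2 * π * I * ξ i) ^ α i

def schwD (α : MI) (ψ : TX) : TX := (fun φ : TX => ∂_{single (0 : Fin 3) (1 : ℝ)} φ)^[α 0]
    ((fun φ : TX => ∂_{single (1 : Fin 3) (1 : ℝ)} φ)^[α 1]
      ((fun φ : TX => ∂_{single (2 : Fin 3) (1 : ℝ)} φ)^[α 2] ψ))

lemma pd_schw (i) (ψ : TX) (x : R3) : pderiv i ψ x = (∂_{single i (1 : ℝ)} ψ) x :=
  (lineDerivOp_apply_eq_fderiv _ _ _).symm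

lemma md_schw (α) (ψ : TX) : multiDeriv α ψ = schwD α ψ := by
  have h i n (ψ : TX) : (pderiv i)^[n] ψ = ((fun φ : TX => ∂_{single i (1 : ℝ)} φ)^[n] ψ : TX) := by
    induction n generalizing ψ with
    | zero => rfl
    | succ n ih =>
      rw [iterate_succ_apply, iterate_succ_apply, ← ih]; congr 1
  rw [multiDeriv, h, h, h]
  rfl

lemma cont_symb (α) : Continuous (symb α) := by
  unfold symb
  fun_prop

lemma htg_symb (α) : (symb α).HasTemperateGrowth := by
  have h : ∀ i : Fin 3, (fun ξ : R3 => (2 * π * I * ξ i)).HasTemperateGrowth := by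
    intro i; have h1 := (proj (𝕜 := ℝ) i).hasTemperateGrowth
    have h2 := (ofRealCLM.comp (proj (𝕜 := ℝ) i)).hasTemperateGrowth
    exact (HasTemperateGrowth.const _).mul h2
  have : symb α = fun ξ => (2 * π * I * ξ 0) ^ α 0 *
      (2 * π * I * ξ 1) ^ α 1 * (2 * π * I * ξ 2) ^ α 2 := by
    funext ξ; simp [symb, Fin.prod_univ_three]
  rw [this]
  exact (((h 0).pow _).mul ((h 1).pow _)).mul ((h 2).pow _)

lemma in_single_right (i) (ξ : R3) : inner ℝ ξ (single i (1 : ℝ)) = ξ i := by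
  rw [EuclideanSpace.inner_single_right]
  simp

lemma four_ldo_ap (i) (ψ : TX) (ξ : R3) : (𝓕 (∂_{single i (1 : ℝ)} ψ) : TX) ξ =
      (2 * π * I * ξ i) * (𝓕 ψ : TX) ξ := by
  rw [SchwartzMap.fourier_lineDerivOp_eq, smul_apply,
    smulLeftCLM_apply_apply (by fun_prop), in_single_right, smul_eq_mul,
    real_smul]
  ring

lemma finv_ldo_ap (i) (ψ : TX) (ξ : R3) : (𝓕⁻ (∂_{single i (1 : ℝ)} ψ) : TX) ξ =
      -(2 * π * I * ξ i) * (𝓕⁻ ψ : TX) ξ := by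
  rw [SchwartzMap.fourierInv_lineDerivOp_eq, smul_apply,
    smulLeftCLM_apply_apply (by fun_prop), in_single_right, smul_eq_mul,
    real_smul]
  ring

lemma finv_schwD (α) (ψ : TX) (ξ : R3) : (𝓕⁻ (schwD α ψ) : TX) ξ =
      (-1) ^ ℓ α * (symb α ξ * (𝓕⁻ ψ : TX) ξ) := by
  have h i n ψ : (𝓕⁻ ((fun φ : TX => ∂_{single i (1 : ℝ)} φ)^[n] ψ) : TX) ξ =
        (-(2 * π * I * ξ i)) ^ n * (𝓕⁻ ψ) ξ := by
    induction n generalizing ψ with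
    | zero => simp
    | succ n ih => rw [iterate_succ_apply, ih, finv_ldo_ap]; ring
  rw [schwD, h, h, h, multiLength, symb, Fin.prod_univ_three, Fin.sum_univ_three, neg_pow,
    neg_pow (2 * π * I * (ξ 1)), neg_pow (2 * π * I * (ξ 2))]
  ring

lemma int_four_mul_Lp (θ : TX) (a : L2X) : ∫ x, (𝓕 θ : TX) x * a x = ∫ ξ, θ ξ * (𝓕 a : L2X) ξ := by
  have h := congrArg (fun T => T θ) (Lp.fourier_toTemperedDistribution_eq a)
  simp at h
  exact h

lemma intg_schw_mul (θ : TX) (a : L2X) : Integrable fun x => θ x * a x :=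
  (θ.memLp 2 volume).integrable_mul (Lp.memLp a)

lemma int_four_mul_L1 (θ : TX) (hw : Integrable w) :
    ∫ x, (𝓕 θ : TX) x * w x = ∫ ξ, θ ξ * 𝓕 w ξ := by
  have h1 := VectorFourier.integral_fourierIntegral_smul_eq_flip (L := innerₗ R3) (f := ⇑θ)
    (g := w) (μ := volume) (ν := volume) Real.continuous_fourierChar continuous_inner
    θ.integrable hw
  rw [flip_innerₗ] at h1
  exact h1

lemma norm_four_le (w : R3 → ℂ) (ξ) : ‖𝓕 w ξ‖ ≤ ∫ x, ‖w x‖ :=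
  VectorFourier.norm_fourierIntegral_le_integral_norm _ _ _ _ _

lemma cont_four {w : R3 → ℂ} (hw : Integrable w) : Continuous (𝓕 w) :=
  VectorFourier.fourierIntegral_continuous Real.continuous_fourierChar continuous_inner hw

lemma ae_zero_int_finv_mul {D : R3 → ℂ} (hint : ∀ θ : TX, Integrable fun ξ => θ ξ * D ξ)
    (h : ∀ ψ : TX, HasCompactSupport ψ → ∫ ξ, (𝓕⁻ ψ : TX) ξ * D ξ = 0) :
    ∀ᵐ ξ, D ξ = 0 := by
  have hinv (ψ : TX) ξ : (𝓕⁻ ψ) ξ =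
      ∫ x, Complex.exp (((2 * π * inner ℝ x ξ : ℝ) : ℂ) * I) * ψ x := by
    rw [fourierInv_coe, Real.fourierInv_eq']; rfl
  have key (ψ : R3 → ℂ) (hψ : ContDiff ℝ (⊤ : ℕ∞) ψ) (hc : HasCompactSupport ψ) :
      ∀ᵐ ξ, (𝓕⁻ (hc.toSchwartzMap hψ) : TX) ξ * D ξ = 0 := by
    refine ae_zero_four_eq_zero (hint _) fun a => ?_
    have hψ' : ContDiff ℝ (⊤ : ℕ∞) fun x => ψ (x + a) := hψ.comp (contDiff_id.add contDiff_const)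
    have hc' := hc.comp_homeomorph (Homeomorph.addRight a)
    rw [Real.fourier_eq', ← h (hc'.toSchwartzMap hψ') hc']
    refine integral_congr_ae (.of_forall fun ξ => ?_); dsimp only
    rw [smul_eq_mul, ← mul_assoc, hinv, hinv]; congr 1
    rw [← integral_const_mul, ← integral_add_right_eq_self _ a]
    refine integral_congr_ae (.of_forall fun x => ?_); change _ * (_ * ψ (x + a)) = _ * ψ (x + a)
    rw [← mul_assoc, ← Complex.exp_add, inner_add_left, real_inner_comm ξ a]
    congr 2; push_cast; ring
  refine measure_null_of_locally_null _ fun ξ₀ _ => ?_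
  let b : ContDiffBump (0 : R3) := default
  set ψ : R3 → ℂ := fun x => Complex.exp (((-2 * π * inner ℝ x ξ₀ : ℝ) : ℂ) * I) * (b x : ℂ)
  have hψ : ContDiff ℝ (⊤ : ℕ∞) ψ := by
    refine ContDiff.mul (Complex.contDiff_exp.comp (ContDiff.mul ?_ contDiff_const)) ?_
    · exact ofRealCLM.contDiff.comp (contDiff_const.mul (contDiff_id.inner ℝ contDiff_const))
    · exact ofRealCLM.contDiff.comp b.contDiff
  have hc : HasCompactSupport ψ :=
    (b.hasCompactSupport.comp_left (g := fun r : ℝ => (r : ℂ)) ofReal_zero).mul_left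
  have h0 : (𝓕⁻ (hc.toSchwartzMap hψ) : TX) ξ₀ ≠ 0 := by
    rw [hinv]
    have : ∀ x, Complex.exp (((2 * π * inner ℝ x ξ₀ : ℝ) : ℂ) * I) *
        hc.toSchwartzMap hψ x = (b x : ℂ) := fun x => by
      have hx : hc.toSchwartzMap hψ x = ψ x := rfl; rw [hx]; simp only [ψ]
      rw [← mul_assoc, ← Complex.exp_add]
      have : ((2 * π * inner ℝ x ξ₀ : ℝ) : ℂ) * I +
        ((-2 * π * inner ℝ x ξ₀ : ℝ) : ℂ) * I = 0 := by push_cast; ring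
      rw [this, Complex.exp_zero, one_mul]
    simp only [this, integral_complex_ofReal]; exact_mod_cast b.integral_pos.ne'
  refine ⟨{ξ | (𝓕⁻ (hc.toSchwartzMap hψ) : TX) ξ ≠ 0 ∧ D ξ ≠ 0}, ?_, ?_⟩
  · have h1 : {ξ | (𝓕⁻ (hc.toSchwartzMap hψ) : TX) ξ ≠ 0} ∈ 𝓝 ξ₀ :=
      ((𝓕⁻ (hc.toSchwartzMap hψ) : TX).continuous.continuousAt).eventually_ne h0
    filter_upwards [mem_nhdsWithin_of_mem_nhds h1, self_mem_nhdsWithin] with ξ h2 h3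
    exact ⟨h2, h3⟩
  · have := key ψ hψ hc; rw [ae_iff] at this; refine measure_mono_null (fun ξ hξ => ?_) this
    exact mul_ne_zero hξ.1 hξ.2

lemma int_schwD_mul (α : MI) (ψ : TX) (a : L2X) : ∫ x, schwD α ψ x * a x = (-1) ^ ℓ α *
      ∫ ξ, (𝓕⁻ ψ : TX) ξ * (symb α ξ * (𝓕 a : L2X) ξ) := by
  have h : schwD α ψ = 𝓕 (𝓕⁻ (schwD α ψ)) := (FourierTransform.fourier_fourierInv_eq _).symm
  rw [h, int_four_mul_Lp, ← integral_const_mul]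
  refine integral_congr_ae (.of_forall fun ξ => ?_)
  dsimp only
  rw [finv_schwD]
  ring

lemma symb_mul_four_eq {α : MI} {a w₂ : L2X} {w₁ : R3 → ℂ} (h₁ : Integrable w₁)
    (h : ∀ ψ : TX, HasCompactSupport ψ → ∫ x, schwD α ψ x * a x =
      (-1) ^ ℓ α * ∫ x, ψ x * (w₁ x + w₂ x)) :
    ∀ᵐ ξ, symb α ξ * (𝓕 a : L2X) ξ = 𝓕 w₁ ξ + (𝓕 w₂ : L2X) ξ := by
  have hi1 (θ : TX) : Integrable fun ξ => θ ξ * (symb α ξ * (𝓕 a) ξ) := by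
    have := intg_schw_mul (smulLeftCLM ℂ (symb α) θ) (𝓕 a)
    refine this.congr (.of_forall fun ξ => ?_); dsimp only
    rw [smulLeftCLM_apply_apply (htg_symb α), smul_eq_mul]; ring
  have hi2 (θ : TX) : Integrable fun ξ => θ ξ * 𝓕 w₁ ξ :=
    θ.integrable.mul_bdd (c := ∫ x, ‖w₁ x‖) (cont_four h₁).aestronglyMeasurable
      (.of_forall fun ξ => norm_four_le w₁ ξ)
  have hi3 θ := intg_schw_mul θ (𝓕 w₂)
  have hD : ∀ᵐ ξ, symb α ξ * (𝓕 a) ξ - (𝓕 w₁ ξ + (𝓕 w₂) ξ) = 0 := by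
    refine ae_zero_int_finv_mul (fun θ => ?_) fun ψ hψ => ?_
    · simp only [mul_sub, mul_add]; exact (hi1 θ).sub ((hi2 θ).add (hi3 θ))
    · simp only [mul_sub, mul_add]
      have e := integral_sub (hi1 (𝓕⁻ ψ)) ((hi2 (𝓕⁻ ψ)).add (hi3 (𝓕⁻ ψ)))
      simp only [Pi.add_apply] at e
      rw [e, integral_add (hi2 _) (hi3 _), ← int_four_mul_Lp, ← int_four_mul_L1 _ h₁,
        FourierTransform.fourier_fourierInv_eq]
      have h2 := h ψ hψ
      have hb : Integrable fun x => ψ x * w₁ x := by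
        refine (h₁.bdd_mul (c := SchwartzMap.seminorm ℝ 0 0 ψ) ψ.continuous.aestronglyMeasurable
          (.of_forall fun x => ψ.norm_le_seminorm ℝ x))
      rw [int_schwD_mul] at h2; simp only [mul_add] at h2
      rw [integral_add hb (intg_schw_mul ψ w₂)] at h2
      rw [mul_left_cancel₀ (pow_ne_zero _ (by norm_num)) h2, sub_self]
  filter_upwards [hD] with ξ hξ
  exact sub_eq_zero.1 hξ

lemma int_schwD_mul_four {a w : L2X} (h : ∀ᵐ ξ, (𝓕 w : L2X) ξ = symb α ξ * (𝓕 a : L2X) ξ) (ψ : TX) :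
    ∫ x, schwD α ψ x * a x = (-1) ^ ℓ α * ∫ x, ψ x * w x := by
  have h1 : ψ = 𝓕 (𝓕⁻ ψ) := (FourierTransform.fourier_fourierInv_eq _).symm
  rw [int_schwD_mul]
  conv_rhs => rw [h1, int_four_mul_Lp]
  congr 1
  refine integral_congr_ae ?_
  filter_upwards [h] with ξ hξ
  rw [hξ]

instance isAddHaarMeasure_volume_prod : (volume : Measure (R3 × R3)).IsAddHaarMeasure := by
  rw [Measure.volume_eq_prod]
  infer_instance

/-! ### Operators on Schwartz functions of `(x, v)` -/

def dX (j : Fin 3) (q : TXV) : TXV := ∂_{((single j (1 : ℝ), 0) : R3 × R3)} q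

def dV (j : Fin 3) (q : TXV) : TXV := ∂_{((0, single j (1 : ℝ)) : R3 × R3)} q

def mV (j : Fin 3) (q : TXV) : TXV := smulLeftCLM ℂ (fun z : R3 × R3 => (z.2 j : ℂ)) q

def annS (j : Fin 3) (q : TXV) : TXV := dV j q + (1 / 2 : ℂ) • mV j q

def creS (j : Fin 3) (q : TXV) : TXV := dV j q - (1 / 2 : ℂ) • mV j q

def fpS (q : TXV) : TXV := ∑ j, creS j (annS j q)

def trS (q : TXV) : TXV := ∑ j, mV j (dX j q)

lemma htg_coordV (j) : (fun z : R3 × R3 => (z.2 j : ℂ)).HasTemperateGrowth :=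
  (ofRealCLM.comp ((proj (𝕜 := ℝ) j).comp (snd ℝ R3 R3))).hasTemperateGrowth

lemma mV_ap (j q z) : mV j q z = z.2 j * q z := by
  rw [mV, smulLeftCLM_apply_apply (htg_coordV j), smul_eq_mul]

lemma annS_ap (j q z) : annS j q z = dV j q z + 1 / 2 * (z.2 j * q z) := by
  rw [annS, add_apply, smul_apply, mV_ap, smul_eq_mul]

lemma creS_ap (j q z) : creS j q z = dV j q z - 1 / 2 * (z.2 j * q z) := by
  rw [creS, sub_apply, smul_apply, mV_ap, smul_eq_mul]

lemma hfda_slice_left (q : TXV) (z) : HasFDerivAt (fun y => q (y, z.2))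
      ((fderiv ℝ q z).comp (ContinuousLinearMap.inl ℝ R3 R3)) z.1 :=
  (q.hasFDerivAt z).comp z.1 (hasFDerivAt_prodMk_left z.1 z.2)

lemma hfda_slice_right (q : TXV) (z) : HasFDerivAt (fun w => q (z.1, w))
      ((fderiv ℝ q z).comp (ContinuousLinearMap.inr ℝ R3 R3)) z.2 :=
  (q.hasFDerivAt z).comp z.2 (hasFDerivAt_prodMk_right z.1 z.2)

lemma dX_ap (j : Fin 3) (q z) : dX j q z = pderiv j (fun y => q (y, z.2)) z.1 := by
  rw [dX, lineDerivOp_apply_eq_fderiv, pderiv, (hfda_slice_left q z).fderiv]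
  rfl

lemma dV_ap (j : Fin 3) (q z) : dV j q z = pderiv j (fun w => q (z.1, w)) z.2 := by
  rw [dV, lineDerivOp_apply_eq_fderiv, pderiv, (hfda_slice_right q z).fderiv]
  rfl

lemma hfda_sqrtM (v) : HasFDerivAt sqrtM (fderiv ℝ (hermR 0) v) v := by
  have := funext fun v => (hermR_zero v).symm
  rw [this]
  exact (hermR 0).hasFDerivAt v

lemma fderiv_sqrtM (v j) : fderiv ℝ (hermR 0) v (single j 1) = -(1 / 2 * (v j * sqrtM v)) := by
  have := ldo_hermR 0 j v
  rw [lineDerivOp_apply_eq_fderiv] at this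
  rw [this, hermR_zero]
  simp

lemma pd_inv_sqrtM_smul (q : TXV) (x v j) :
    pderiv j (fun y => (sqrtM y)⁻¹ • q (x, y)) v = (sqrtM v)⁻¹ • annS j q (x, v) := by
  have h0 := (sqrtM_pos v).ne'
  have h1 := ((hasFDerivAt_inv h0).comp v (hfda_sqrtM v)).smul (hfda_slice_right q (x, v))
  refine (congrArg (fun L => L (single j 1)) h1.fderiv).trans ?_
  rw [annS_ap, dV_ap, pderiv, (hfda_slice_right q (x, v)).fderiv]
  simp only [add_apply, smul_apply, smulRight_apply, comp_apply, fderiv_sqrtM, Function.comp_apply]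
  rw [smul_add, add_right_inj]
  simp
  have : (sqrtM v) ≠ 0 := by exact_mod_cast h0
  field_simp

lemma pd_sqrtM_smul (q : TXV) (x v j) :
    pderiv j (fun y => sqrtM y • q (x, y)) v = sqrtM v • creS j q (x, v) := by
  have h1 := (hfda_sqrtM v).smul (hfda_slice_right q (x, v))
  refine (congrArg (fun L => L (single j 1)) h1.fderiv).trans ?_
  rw [creS_ap, dV_ap, pderiv, (hfda_slice_right q (x, v)).fderiv]
  simp only [add_apply, smul_apply, smulRight_apply, comp_apply, fderiv_sqrtM]
  rw [sub_eq_add_neg, smul_add, add_right_inj]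
  simp
  ring

lemma fpS_ap (q z) : fpS q z = fokkerPlanck (fun w => q (z.1, w)) z.2 := by
  have h0 := (sqrtM_pos z.2).ne'
  have h1 i : pderiv i (fun w => maxwellian w •
      pderiv i (fun y => (sqrtM y)⁻¹ • q (z.1, y)) w) z.2 = sqrtM z.2 • creS i (annS i q) z := by
    rw [← pd_sqrtM_smul]; congr 1; funext w
    rw [pd_inv_sqrtM_smul, ← sqrtM_sq, smul_smul, sq, mul_assoc,
      mul_inv_cancel₀ (sqrtM_pos w).ne', mul_one]
  rw [fokkerPlanck, fpS, sum_apply]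
  simp only [h1]
  rw [← smul_sum, smul_smul, inv_mul_cancel₀ h0, one_smul]

lemma trS_ap (q z) : trS q z = ∑ j, (z.2 j : ℂ) * pderiv j (fun y => q (y, z.2)) z.1 := by
  rw [trS, sum_apply]
  exact sum_congr rfl fun j _ => by rw [mV_ap, dX_ap]

/-! ### Hermite coefficients of Schwartz functions -/

abbrev clS (q : TXV) : L2XV := q.toLp 2

lemma int_tnS_mul (ψ : TX) (k : MI) (f : L2XV) :
    ∫ z, tnS ψ (hermS k) z * f z = ∫ x, ψ x * hCoef k f x := by
  simp only [tnS_ap]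
  rw [int_tens_mul (ψ.memLp 2 volume) (memLp_hS k) (Lp.memLp f)]
  refine integral_congr_ae ?_
  filter_upwards [hCoef_ae k f] with x h
  rw [h]

lemma int_tnS_mul_schw (ψ k q) : ∫ z, tnS ψ (hermS k) z * q z = ∫ x, ψ x * hCoef k (clS q) x := by
  rw [← int_tnS_mul]
  refine integral_congr_ae ?_
  filter_upwards [q.coeFn_toLp 2 volume] with z h
  rw [h]

lemma L2X_ext {a b : L2X} (h : ∀ ψ : TX, ∫ x, ψ x * a x = ∫ x, ψ x * b x) : a = b := by
  rw [← sub_eq_zero, Lp.eq_zero_iff_ae_eq_zero]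
  refine ae_eq_zero_of_integral_contDiff_smul_eq_zero
    (li_Lp_two (Lp.memLp (a - b))) fun g hg hc => ?_
  have hg' := ofRealCLM.contDiff.comp hg
  have hc' := hc.comp_left ofReal_zero
  have h1 := h (hc'.toSchwartzMap hg')
  rw [← sub_eq_zero, ← integral_sub (intg_schw_mul _ a) (intg_schw_mul _ b)] at h1
  rw [← h1]
  refine integral_congr_ae ?_
  filter_upwards [Lp.coeFn_sub a b] with x hx
  rw [hx, Pi.sub_apply, ← mul_sub, real_smul]
  rfl

lemma intg_schw_mul_schw (θ q : TXV) : Integrable fun z => θ z * q z :=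
  (θ.memLp 2 volume).integrable_mul (q.memLp 2 volume)

lemma dX_tnS (j) (ψ φ : TX) : dX j (tnS ψ φ) = tnS (∂_{single j (1 : ℝ)} ψ) φ := by
  ext z
  rw [dX_ap, tnS_ap, ← pd_schw]
  simp only [tnS_ap, pderiv]
  have := ((ψ.hasFDerivAt z.1).mul_const' (φ z.2)).fderiv
  rw [this]
  rfl

lemma dV_tnS (j) (ψ φ : TX) : dV j (tnS ψ φ) = tnS ψ (∂_{single j (1 : ℝ)} φ) := by
  ext z
  rw [dV_ap, tnS_ap, ← pd_schw]
  simp only [tnS_ap, pderiv]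
  have := ((φ.hasFDerivAt z.2).const_mul (ψ z.1)).fderiv
  rw [this]
  rfl

lemma annS_tnS (j ψ k) : annS j (tnS ψ (hermS k)) = (√(k j) : ℂ) • tnS ψ (hermS (k - dir j)) := by
  ext z
  rw [annS_ap, dV_tnS, smul_apply]
  simp only [tnS_ap, smul_eq_mul]
  rw [ldo_hermS, mul_left_comm (z.2 j : ℂ), cmul_hermS]
  ring

lemma creS_tnS (j ψ k) :
    creS j (tnS ψ (hermS k)) = -((√(k j + 1 : ℝ) : ℂ) • tnS ψ (hermS (k + dir j))) := by
  ext z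
  rw [creS_ap, dV_tnS, neg_apply, smul_apply]
  simp only [tnS_ap, smul_eq_mul]
  rw [ldo_hermS, mul_left_comm (z.2 j : ℂ), cmul_hermS]
  ring

lemma int_mul_annS (j) (θ q : TXV) : ∫ z, θ z * annS j q z = -∫ z, creS j θ z * q z := by
  have h1 := SchwartzMap.integral_mul_lineDerivOp_right_eq_neg_left (μ := volume) θ q
    ((0, single j 1) : R3 × R3)
  have h2 z : θ z * annS j q z = θ z * dV j q z + 1 / 2 * (mV j θ z * q z) := by
    rw [annS_ap, mV_ap]; ring
  have h3 z : creS j θ z * q z = dV j θ z * q z - 1 / 2 * (mV j θ z * q z) := by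
    rw [creS_ap, mV_ap]; ring
  simp only [h2, h3]
  rw [integral_add (intg_schw_mul_schw _ _) ((intg_schw_mul_schw _ _).const_mul _),
    integral_sub (intg_schw_mul_schw _ _)
    ((intg_schw_mul_schw _ _).const_mul _)]
  simp only [dV]
  rw [h1]
  ring

lemma hCoef_annS (j : Fin 3) (k q) :
    hCoef k (clS (annS j q)) = (√(k j + 1 : ℝ) : ℂ) • hCoef (k + dir j) (clS q) := by
  refine L2X_ext fun ψ => ?_
  rw [← int_tnS_mul_schw, int_mul_annS, creS_tnS, ← integral_neg]
  have : ∀ᵐ x, ψ x * ((√(k j + 1) : ℂ) • hCoef (k + dir j) (clS q)) x =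
      (√(k j + 1) : ℂ) * (ψ x * hCoef (k + dir j) (clS q) x) := by
    filter_upwards [Lp.coeFn_smul (√(k j + 1) : ℂ) (hCoef (k + dir j) (clS q))] with x h
    rw [h, Pi.smul_apply, smul_eq_mul]; ring
  rw [integral_congr_ae this, integral_const_mul, ← int_tnS_mul_schw, ← integral_const_mul]
  refine integral_congr_ae (.of_forall fun z => ?_)
  simp
  ring

lemma hCoef_creS (j : Fin 3) (k q) :
    hCoef k (clS (creS j q)) = (-√(k j) : ℂ) • hCoef (k - dir j) (clS q) := by
  refine L2X_ext fun ψ => ?_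
  have h1 := int_mul_annS j q (tnS ψ (hermS k))
  rw [← int_tnS_mul_schw]
  have h2 : ∫ z, tnS ψ (hermS k) z * creS j q z = -∫ z, q z * annS j (tnS ψ (hermS k)) z := by
    rw [h1, neg_neg]; exact integral_congr_ae (.of_forall fun z => mul_comm _ _)
  have : ∀ᵐ x, ψ x * ((-√(k j) : ℂ) • hCoef (k - dir j) (clS q)) x =
      (-√(k j) : ℂ) * (ψ x * hCoef (k - dir j) (clS q) x) := by
    filter_upwards [Lp.coeFn_smul (-√(k j) : ℂ) (hCoef (k - dir j) (clS q))] with x h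
    rw [h, Pi.smul_apply, smul_eq_mul]; ring
  rw [h2, annS_tnS, ← integral_neg, integral_congr_ae this, integral_const_mul,
    ← int_tnS_mul_schw, ← integral_const_mul]
  refine integral_congr_ae (.of_forall fun z => ?_)
  simp
  ring

lemma schwD_dir (j ψ) : schwD (dir j) ψ = ∂_{single j (1 : ℝ)} ψ := by
  fin_cases j <;> simp [schwD, dir]

lemma symb_dir (j ξ) : symb (dir j) ξ = 2 * π * I * ξ j := by
  rw [symb, Finset.prod_eq_single j]
  · simp [dir]
  · intro i _ hi; simp [dir, hi]
  · simp

lemma int_tnS_mul_dX (j k) (ψ : TX) (q : TXV) :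
    ∫ x, (∂_{single j (1 : ℝ)} ψ) x * hCoef k (clS q) x = -∫ x, ψ x * hCoef k (clS (dX j q)) x := by
  rw [← int_tnS_mul_schw, ← int_tnS_mul_schw, ← dX_tnS]
  exact neg_eq_iff_eq_neg.1 (SchwartzMap.integral_mul_lineDerivOp_right_eq_neg_left _ _ _).symm

lemma four_hCoef_dX (j : Fin 3) (k : MI) (q : TXV) : ∀ᵐ ξ, (𝓕 (hCoef k (clS (dX j q))) : L2X) ξ =
      (2 * π * I * ξ j) * (𝓕 (hCoef k (clS q)) : L2X) ξ := by
  have h := symb_mul_four_eq (α := dir j) (a := hCoef k (clS q))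
    (w₂ := hCoef k (clS (dX j q))) (w₁ := 0) (integrable_zero _ _ _) fun ψ _ => ?_
  · filter_upwards [h] with ξ hξ; rw [symb_dir] at hξ; rw [hξ]
    have : 𝓕 (0 : R3 → ℂ) ξ = 0 := by simp [Real.fourier_eq']
    rw [this, zero_add]
  · rw [schwD_dir, len_dir, int_tnS_mul_dX]; simp

def hfS (q : TXV) : HL2 := hermF (clS q)

lemma hfS_ae (k q) : ∀ᵐ ξ, hfS q ξ k = (𝓕 (hCoef k (clS q)) : L2X) ξ := by
  filter_upwards [coL_ae k (hfS q)] with ξ h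
  rw [← h, hfS, coL_hermF]

lemma hfS_dX (j q) : ∀ᵐ ξ, hfS (dX j q) ξ = (2 * π * I * ξ j : ℂ) • hfS q ξ := by
  filter_upwards [ae_all_iff.2 fun k => hfS_ae k q, ae_all_iff.2 fun k => hfS_ae k (dX j q),
    ae_all_iff.2 fun k => four_hCoef_dX j k q] with ξ h1 h2 h3
  refine lp.ext (funext fun k => ?_)
  rw [h2, h3, lp.coeFn_smul, Pi.smul_apply, h1, smul_eq_mul]

lemma hfS_hCoef_smul (h : hCoef k (clS q) = c • hCoef l (clS r)) : ∀ᵐ ξ, hfS q ξ k = c * hfS r ξ l := by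
  have h1 := congrArg (fun a => (𝓕 a)) h
  simp at h1
  filter_upwards [hfS_ae k q, hfS_ae l r, Lp.coeFn_smul c (𝓕 (hCoef l (clS r)))] with ξ h2 h3 h4
  rw [h2, h3, h1, h4, Pi.smul_apply, smul_eq_mul]

lemma hfS_annS (j : Fin 3) (q : TXV) :
    ∀ᵐ ξ, ∀ k, hfS (annS j q) ξ k = (√(k j + 1 : ℝ) : ℂ) * hfS q ξ (k + dir j) :=
  ae_all_iff.2 fun k => hfS_hCoef_smul (hCoef_annS j k q)

lemma hfS_creS (j : Fin 3) (q : TXV) :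
    ∀ᵐ ξ, ∀ k, hfS (creS j q) ξ k = (-√(k j) : ℂ) * hfS q ξ (k - dir j) :=
  ae_all_iff.2 fun k => hfS_hCoef_smul (hCoef_creS j k q)

lemma hfS_add (q r) : hfS (q + r) = hfS q + hfS r := by
  rw [hfS, clS, ← toLpCLM_apply (𝕜 := ℂ), map_add, map_add]
  rfl

lemma hfS_sub (q r : TXV) : hfS (q - r) = hfS q - hfS r := by
  rw [hfS, clS, ← toLpCLM_apply (𝕜 := ℂ), map_sub, map_sub]
  rfl

lemma hfS_sum (q : Fin 3 → TXV) : hfS (∑ j, q j) = ∑ j, hfS (q j) := by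
  rw [hfS, clS, ← toLpCLM_apply (𝕜 := ℂ), map_sum, map_sum]
  rfl

lemma mV_eq (j : Fin 3) (q : TXV) : mV j q = annS j q - creS j q := by
  ext z
  rw [sub_apply, annS_ap, creS_ap, mV_ap]
  ring

/-! ### The spectral representation of states -/

def incl (b : FibIdx) : L2X →L[ℂ] Spec := (toSpanSingleton ℂ (bas b)).compLpL 2 volume

def projL (b : FibIdx) : Spec →L[ℂ] L2X := (innerSL ℂ (bas b)).compLpL 2 volume

def inclF : HL2 →L[ℂ] Spec := (pCLM.comp (ContinuousLinearMap.inr ℂ FFib HSeq)).compLpL 2 volume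

def projF : Spec →L[ℂ] HL2 := hCLM.compLpL 2 volume

lemma incl_ae (b : FibIdx) (φ : L2X) : ∀ᵐ ξ, incl b φ ξ = φ ξ • bas b := by
  filter_upwards [(toSpanSingleton ℂ (bas b)).coeFn_compLpL φ] with ξ h
  rw [incl, h, toSpanSingleton_apply]

lemma projL_ae (b X) : ∀ᵐ ξ, projL b X ξ = fco b (X ξ) := by
  filter_upwards [(innerSL ℂ (bas b)).coeFn_compLpL X] with ξ h
  rw [projL, h, innerSL_apply_apply, inner_bas]

lemma inclF_ae (Y : HL2) : ∀ᵐ ξ, inclF Y ξ = toLp 2 (0, Y ξ) :=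
  (pCLM.comp (ContinuousLinearMap.inr ℂ FFib HSeq)).coeFn_compLpL Y

lemma projF_ae (X : Spec) : ∀ᵐ ξ, projF X ξ = (X ξ).snd := hCLM.coeFn_compLpL X

lemma inner_incl (b φ X) : inner ℂ (incl b φ) X = inner ℂ φ (projL b X) := by
  refine inner_congr_ae ?_
  filter_upwards [incl_ae b φ, projL_ae b X] with ξ h1 h2
  rw [h1, h2, inner_smul_left, inner_bas, inner_apply, mul_comm]

lemma inner_inclF (Y : HL2) (X : Spec) : inner ℂ (inclF Y) X = inner ℂ Y (projF X) := by
  refine inner_congr_ae ?_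
  filter_upwards [inclF_ae Y, projF_ae X] with ξ h1 h2
  rw [h1, h2, in_fib]
  simp

lemma fco_bas (b b') : fco b (bas b') = if b = b' then 1 else 0 := by
  rcases b with o | k <;> rcases b' with o' | k'
  · simp [fco, bas]
  · simp [fco, bas]
  · simp [fco, bas]
  · simp [fco, bas, Pi.single_apply]

lemma fco_inl (o : Option (Fin 3)) (w) : fco (inl o) w = w.fst o := rfl

lemma fco_inr (k w) : fco (inr k) w = w.snd k := rfl

lemma fco_eq (b w) : fco b w = innerSL ℂ (bas b) w := by rw [innerSL_apply_apply, inner_bas]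

lemma fco_smul (b c w) : fco b (c • w) = c * fco b w := by simp only [fco_eq, map_smul, smul_eq_mul]

lemma projL_incl (b b' : FibIdx) (φ : L2X) : projL b (incl b' φ) = if b = b' then φ else 0 := by
  refine Lp.ext ?_
  filter_upwards [projL_ae b (incl b' φ), incl_ae b' φ, Lp.coeFn_zero ℂ 2 vol] with ξ h1 h2 h3
  rw [h1, h2, fco_smul, fco_bas]
  split_ifs
  · rw [mul_one]
  · rw [mul_zero, h3, Pi.zero_apply]

lemma projL_inclF (o : Option (Fin 3)) (Y : HL2) : projL (inl o) (inclF Y) = 0 := by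
  refine Lp.ext ?_
  filter_upwards [projL_ae (inl o) (inclF Y), inclF_ae Y, Lp.coeFn_zero ℂ 2 vol] with ξ h1 h2 h3
  rw [h1, h2, h3]
  simp [fco]

lemma projF_incl (o : Option (Fin 3)) (φ) : projF (incl (inl o) φ) = 0 := by
  refine Lp.ext ?_
  filter_upwards [projF_ae (incl (inl o) φ), incl_ae (inl o) φ,
    Lp.coeFn_zero HSeq 2 vol] with ξ h1 h2 h3
  rw [h1, h2, h3]
  simp [bas]

lemma projF_inclF (Y) : projF (inclF Y) = Y := by
  refine Lp.ext ?_
  filter_upwards [projF_ae (inclF Y), inclF_ae Y] with ξ h1 h2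
  rw [h1, h2]
  rfl

lemma projL_inr (k X) : projL (inr k) X = coL k (projF X) := by
  refine Lp.ext ?_
  filter_upwards [projL_ae (inr k) X, coL_ae k (projF X), projF_ae X] with ξ h1 h2 h3
  rw [h1, h2, h3]
  rfl

lemma spec_ext (h : ∀ o, projL (inl o) X = projL (inl o) X')
    (hF : projF X = projF X') : X = X' := by
  refine Lp.ext ?_
  filter_upwards [ae_all_iff.2 fun b => projL_ae b X, ae_all_iff.2 fun b => projL_ae b X']
    with ξ h1 h2
  refine fib_ext_coord fun b => ?_
  rw [← h1, ← h2]
  rcases b with o | k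
  · rw [h]
  · rw [projL_inr, projL_inr, hF]

def cU (j : Fin 3) : Lx C3 →L[ℂ] L2X := (proj (𝕜 := ℂ) j : C3 →L[ℂ] ℂ).compLpL 2 volume

def singleU (j : Fin 3) : L2X →L[ℂ] Lx C3 := (toSpanSingleton ℂ (single j (1 : ℂ))).compLpL 2 volume

lemma cU_ae (j) (u : Lp C3 2 (volume)) : ∀ᵐ x, cU j u x = u x j :=
  (proj (𝕜 := ℂ) j : C3 →L[ℂ] ℂ).coeFn_compLpL u

lemma singleU_ae (j a) : ∀ᵐ x, singleU j a x = a x • single j (1 : ℂ) := by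
  filter_upwards [(toSpanSingleton ℂ (single j (1 : ℂ))).coeFn_compLpL a] with x h
  rw [singleU, h, toSpanSingleton_apply]

lemma cU_singleU (i j a) : cU i (singleU j a) = if i = j then a else 0 := by
  refine Lp.ext ?_
  filter_upwards [cU_ae i (singleU j a), singleU_ae j a, Lp.coeFn_zero ℂ 2 vol] with ξ h1 h2 h3
  rw [h1, h2]
  split_ifs with h
  · simp [h]
  · rw [h3]; simp [h]

lemma lpC3_ext (h : ∀ j, cU j u = cU j w) : u = w := by
  refine Lp.ext ?_
  filter_upwards [ae_all_iff.2 fun j => cU_ae j u, ae_all_iff.2 fun j => cU_ae j w] with x h1 h2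
  ext j
  rw [← h1, h j, h2]

def fourL : L2X →L[ℂ] L2X := (Lp.fourierTransformₗᵢ R3 ℂ).toLinearIsometry.toContinuousLinearMap

def finvL : L2X →L[ℂ] L2X :=
  (Lp.fourierTransformₗᵢ R3 ℂ).symm.toLinearIsometry.toContinuousLinearMap

lemma fourL_finvL (a) : fourL (finvL a) = a := (Lp.fourierTransformₗᵢ R3 ℂ).apply_symm_apply a

lemma finvL_fourL (a) : finvL (fourL a) = a := (Lp.fourierTransformₗᵢ R3 ℂ).symm_apply_apply a

def toS (κ : ℝ) : State →L[ℂ] Spec := (κ : ℂ) • (incl (inl none)).comp (fourL.comp (fst ℂ _ _)) +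
    ((∑ j, (incl (inl (some j))).comp (fourL.comp (cU j))).comp ((fst ℂ _ _).comp (snd ℂ _ _)) +
    (inclF.comp (hermF.toLinearIsometry.toContinuousLinearMap)).comp ((snd ℂ _ _).comp (snd ℂ _ _)))

def ofSpec (κ : ℝ) : Spec →L[ℂ] State := ((κ : ℂ)⁻¹ • finvL.comp (projL (inl none))).prod
    ((∑ j, (singleU j).comp (finvL.comp (projL (inl (some j))))).prod
      (hermF.symm.toLinearIsometry.toContinuousLinearMap.comp projF))

lemma toS_ap (κ : ℝ) (U : State) : toS κ U = (κ : ℂ) • incl (inl none) (𝓕 U.1) +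
    (∑ j, incl (inl (some j)) (𝓕 (cU j U.2.1)) + inclF (hermF U.2.2)) := by
  simp
  rfl

lemma projL_none_toS (κ : ℝ) (U : State) :
    projL (inl none) (toS κ U) = (κ : ℂ) • (𝓕 U.1 : L2X) := by
  simp only [toS_ap, map_add, map_smul, map_sum, projL_incl, projL_inclF]
  simp

lemma projL_some_toS (κ U j) : projL (inl (some j)) (toS κ U) = 𝓕 (cU j U.2.1) := by
  simp [toS_ap, projL_incl, projL_inclF]

lemma projF_toS (κ U) : projF (toS κ U) = hermF U.2.2 := by simp [toS_ap, projF_incl, projF_inclF]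

lemma toS_ofSpec (hκ : 0 < κ) (X : Spec) : toS κ (ofSpec κ X) = X := by
  have hκ' : (κ : ℂ) ≠ 0 := by exact_mod_cast hκ.ne'
  refine spec_ext (fun o => ?_) ?_
  · rcases o with _ | j
    · rw [projL_none_toS]
      change (κ : ℂ) • fourL ((κ : ℂ)⁻¹ • finvL _) = _
      rw [map_smul, smul_smul, mul_inv_cancel₀ hκ', one_smul, fourL_finvL]
      rfl
    · rw [projL_some_toS]
      change fourL (cU j ((∑ i, (singleU i).comp (finvL.comp (projL (inl (some i))))) X)) = _
      rw [sum_apply, map_sum]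
      simp only [comp_apply, cU_singleU, sum_ite_eq, Finset.mem_univ, if_true]
      rw [fourL_finvL]
  · rw [projF_toS]; exact LinearIsometryEquiv.apply_symm_apply hermF _

lemma ofSpec_toS (hκ : 0 < κ) (U : State) : ofSpec κ (toS κ U) = U := by
  have hκ' : (κ : ℂ) ≠ 0 := by exact_mod_cast hκ.ne'
  refine Prod.ext ?_ (Prod.ext (lpC3_ext fun j => ?_) ?_)
  · change (κ : ℂ)⁻¹ • finvL (projL (inl none) (toS κ U)) = _
    rw [projL_none_toS, map_smul, smul_smul, inv_mul_cancel₀ hκ', one_smul]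
    exact finvL_fourL _
  · change cU j ((∑ i, (singleU i).comp (finvL.comp (projL (inl (some i))))) (toS κ U)) = _
    rw [sum_apply, map_sum]
    simp only [comp_apply, cU_singleU, sum_ite_eq, Finset.mem_univ, if_true, projL_some_toS]
    exact finvL_fourL _
  · change hermF.symm (projF (toS κ U)) = _; rw [projF_toS, LinearIsometryEquiv.symm_apply_apply]

/-! ### Test functions -/

lemma four_toLp_ae (φ : TX) : ∀ᵐ ξ, (𝓕 (φ.toLp 2) : L2X) ξ = (𝓕 φ : TX) ξ := by
  rw [SchwartzMap.toLp_fourier_eq]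
  exact SchwartzMap.coeFn_toLp _ 2 volume

lemma four_toLp_ldo_ae (j) (φ : TX) : ∀ᵐ ξ, (𝓕 ((∂_{single j (1 : ℝ)} φ).toLp 2) : L2X) ξ =
      (2 * π * I * ξ j) * (𝓕 (φ.toLp 2) : L2X) ξ := by
  filter_upwards [four_toLp_ae φ, four_toLp_ae (∂_{single j (1 : ℝ)} φ)] with ξ h1 h2
  rw [h1, h2, four_ldo_ap]

def massGen (κ : ℝ) (φ : TX) : Spec := ∑ j, (κ : ℂ) •
  incl (inl (some j)) (𝓕 ((∂_{single j (1 : ℝ)} φ).toLp 2))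

def momGen (κ : ℝ) (i : Fin 3) (φ : TX) : Spec := (κ : ℂ) •
  incl (inl none) (𝓕 ((∂_{single i (1 : ℝ)} φ).toLp 2)) -
  incl (inl (some i)) (𝓕 (φ.toLp 2)) + incl (inr (dir i)) (𝓕 (φ.toLp 2))

def kGen (q : TXV) : Spec :=
  inclF (hfS (trS q + fpS q)) + ∑ j, incl (inl (some j)) (coL (dir j) (hfS q))

lemma trF_zero_basis (o : Option (Fin 3)) (a : ℂ) : trF 0 (a • bas (inl o)) = a • bas (inl o) := by
  rw [map_smul, trF_bas, idxDeg, if_pos le_rfl]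

lemma gen_basis_none (κ N ζ a b) : fco b (gen κ N ζ (a • bas (inl none))) =
      ∑ j, if b = inl (some j) then -I * (κ * (ζ j * a)) else 0 := by
  have h1 o : (a • bas (inl none)).fst o = if o = none then a else 0 := by simp [bas]
  have h2 : (a • bas (inl none)).snd = 0 := by simp [bas]
  generalize a • bas (inl none) = y at h1 h2
  rcases b with (_ | i) | k
  · rw [fco_inl, gen_fl_none]; simp [h1]
  · rw [fco_inl, gen_fl_some, h1, h1, h2]; simp
  · rw [fco_inr, gen_herm, h2]; simp [h1]

lemma gen_basis_some (κ N ζ a i b) : fco b (gen κ N ζ (a • bas (inl (some i)))) =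
      (if b = inl none then -I * (κ * (ζ i * a)) else 0) -
        (if b = inl (some i) then a else 0) + if b = inr (dir i) then a else 0 := by
  have h1 o : (a • bas (inl (some i))).fst o = if o = some i then a else 0 := by simp [bas]
  have h2 : (a • bas (inl (some i))).snd = 0 := by simp [bas]
  generalize a • bas (inl (some i)) = y at h1 h2
  rcases b with (_ | j) | k
  · rw [fco_inl, gen_fl_none]; simp [h1]
  · rw [fco_inl, gen_fl_some, h1, h1, h2]; simp
  · rw [fco_inr, gen_herm, h2]
    simp only [h1, map_zero, lp.coeFn_zero, Pi.zero_apply, add_zero, mul_zero,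
      Finset.sum_const_zero, zero_add, sub_zero, Option.some.injEq]
    rw [Finset.sum_eq_single i]
    · simp
    · intro j _ hj; simp [hj]
    · simp

lemma isGenL2_incl (h : ∀ b, ∀ᵐ ξ, projL b Y ξ =
      fco b (gen κ 1 (-((2 * π) • ξ)) (a ξ • bas (inl o)))) :
    IsGenL2 κ (2 * π) (incl (inl o) a) Y := by
  filter_upwards [incl_ae (inl o) a, ae_all_iff.2 h, ae_all_iff.2 fun b => projL_ae b Y]
    with ξ h1 h2 h3
  have : Y ξ = gen κ (0 + 1) (-((2 * π) • ξ)) (a ξ • bas (inl o)) :=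
    fib_ext_coord fun b => by rw [← h3, h2]
  rw [h1, this]
  exact isGen_trunc κ _ (trF_zero_basis o _)

lemma neg_smul_coord (η) (ξ : R3) (j : Fin 3) : (-(η • ξ)) j = -(η * ξ j) := rfl

lemma isGenL2_mass (κ) (φ : TX) : IsGenL2 κ (2 * π)
    (incl (inl none) (𝓕 (φ.toLp 2))) (massGen κ φ) := by
  refine isGenL2_incl fun b => ?_
  have h1 : projL b (massGen κ φ) = ∑ j, if b = inl (some j) then (κ : ℂ) •
      (𝓕 ((∂_{single j (1 : ℝ)} φ).toLp 2) : L2X) else 0 := by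
    simp only [massGen, map_sum, map_smul, projL_incl]; refine sum_congr rfl fun j _ => ?_
    split_ifs <;> simp
  simp only [gen_basis_none]
  rw [h1]
  rcases b with (_ | i) | k
  · filter_upwards [Lp.coeFn_zero ℂ 2 vol] with ξ h; simp
  · simp only [inl.injEq, Option.some.injEq, sum_ite_eq, Finset.mem_univ, if_true]
    filter_upwards [four_toLp_ldo_ae i φ, Lp.coeFn_smul (κ : ℂ)
      (𝓕 ((∂_{single i (1 : ℝ)} φ).toLp 2))] with ξ h2 h3
    rw [h3, Pi.smul_apply, h2, smul_eq_mul, neg_smul_coord]; push_cast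
    ring
  · filter_upwards [Lp.coeFn_zero ℂ 2 vol] with ξ h; simp

lemma isGenL2_mom (κ) (i : Fin 3) (φ : TX) : IsGenL2 κ (2 * π)
    (incl (inl (some i)) (𝓕 (φ.toLp 2))) (momGen κ i φ) := by
  refine isGenL2_incl fun b => ?_
  simp only [gen_basis_some]
  simp only [momGen, map_add, map_sub, map_smul, projL_incl]
  set A : L2X := 𝓕 ((∂_{single i (1 : ℝ)} φ).toLp 2) with hA
  set B : L2X := 𝓕 (φ.toLp 2) with hB
  filter_upwards [four_toLp_ldo_ae i φ, Lp.coeFn_smul (κ : ℂ) A,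
    Lp.coeFn_zero ℂ 2 vol, Lp.coeFn_neg B] with ξ h1 h2 h3 h4
  rw [← hA, ← hB] at h1
  rcases b with (_ | j) | k
  · simp only [if_true, reduceCtorEq, if_false, sub_zero, add_zero, inl.injEq]
    rw [h2, Pi.smul_apply, h1, smul_eq_mul, neg_smul_coord]
    push_cast; ring
  · simp only [reduceCtorEq, if_false, smul_zero, add_zero, inl.injEq, zero_sub, Option.some.injEq]
    split_ifs
    · rw [h4]; rfl
    · simp
  · simp only [reduceCtorEq, if_false, smul_zero, sub_zero, zero_add]
    split_ifs
    · rfl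
    · exact h3

lemma isGen_ladder (κ ζ) {y Nm} {R L : Fin 3 → HSeq}
    (hR : ∀ j k, R j k = (√(k j) : ℂ) * y (k - dir j))
    (hL : ∀ j k, L j k = (√(k j + 1 : ℝ) : ℂ) * y (k + dir j))
    (hN : ∀ k, Nm k = (ℓ k : ℂ) * y k) {w : Fib}
    (hw : w.snd = -I • ∑ j, (ζ j : ℂ) • (R j + L j) - Nm) (hw0 : w.fst none = 0)
    (hw1 : ∀ j, w.fst (some j) = y (dir j)) :
    IsGen κ ζ (toLp 2 (0, y)) w := by
  have key N : gen κ (N + 1) ζ (toLp 2 (0, y)) = toLp 2 (w.fst,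
      -I • ∑ j, (ζ j) • (trOp (N + 1) (R j) + trOp N (L j)) - trOp (N + 1) Nm) := by
    refine fib_ext ?_ fun k => ?_
    · ext o; rcases o with _ | j
      · rw [gen_fl_none]
        simp [hw0]
      · rw [gen_fl_some]; simp [hw1]
    · rw [gen_herm]
      have h1 j : rais (N + 1) j y k = trOp (N + 1) (R j) k := by rw [rais_ap, trOp_ap, hR]
      have h2 j : lowr (N + 1) j y k = trOp N (L j) k := by
        rw [lowr_ap, trOp_ap, hL]; push_cast; exact if_congr (by omega) rfl rfl
      have h3 : (∑ j, if k = dir j then 0 - y (dir j) else 0) -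
          numOp (N + 1) y k = -trOp (N + 1) Nm k := by
        rw [numOp_ap, trOp_ap, hN]
        by_cases hk : 2 ≤ ℓ k
        · have : ∀ j, k ≠ dir j := fun j h => by
            rw [h, len_dir] at hk; omega
          simp [this, hk]
        · rw [if_neg (fun h => hk h.2), if_pos (by omega), sub_zero]
          by_cases h0 : ℓ k = 0
          · have : ∀ j, k ≠ dir j := fun j h => by
              rw [h, len_dir] at h0; omega
            simp [this, h0]
          · have h1 : ℓ k = 1 := by omega
            obtain ⟨j, hj⟩ : ∃ j, k j ≠ 0 := by
              by_contra hcon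
              push Not at hcon
              exact h0 (by simp [multiLength, hcon])
            have hkj : k = dir j := by
              have h4 := len_sub_dir hj
              have h5 : k - dir j = 0 := by
                funext i
                have : (k - dir j) i ≤ ℓ (k - dir j) := single_le_sum (f := fun i => (k - dir j) i)
                    (fun _ _ => Nat.zero_le _) (Finset.mem_univ i)
                simp only [Pi.zero_apply]; omega
              rw [← sub_add_dir hj, h5, zero_add]
            rw [h1, hkj, Finset.sum_eq_single j]
            · simp
            · intro i _ hi; rw [if_neg fun h => hi (dir_injective h).symm]
            · simp
      change -I * ∑ j, (ζ j) * (rais (N + 1) j y k + lowr (N + 1) j y k) +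
        (∑ j, if k = dir j then 0 - y (dir j) else 0) - numOp (N + 1) y k = _
      rw [add_sub_assoc, h3, ← sub_eq_add_neg]; simp only [h1, h2]; rfl
  have hlim : Tendsto (fun N => (-I • ∑ j, (ζ j) •
      (trOp (N + 1) (R j) + trOp N (L j)) - trOp (N + 1) Nm : HSeq)) atTop
      (𝓝 w.snd) := by
    have ht y : Tendsto (fun N => trOp (N + 1) y) atTop (𝓝 y) :=
      (tt_trOp y).comp (tendsto_add_atTop_nat 1)
    rw [hw]
    exact ((tendsto_finsetSum _ fun j _ =>
      ((ht (R j)).add (tt_trOp (L j))).const_smul (ζ j)).const_smul _).sub (ht Nm)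
  rw [IsGen, ← tendsto_add_atTop_iff_nat 1]
  simp only [key]
  exact (pCLM.continuous.tendsto (w.fst, w.snd)).comp (tendsto_const_nhds.prodMk_nhds hlim)

lemma hfS_number (q : TXV) :
    ∀ᵐ ξ, ∀ k, ∑ j, hfS (creS j (annS j q)) ξ k = -(ℓ k : ℂ) * hfS q ξ k := by
  filter_upwards [ae_all_iff.2 fun j => hfS_annS j q,
    ae_all_iff.2 fun j => hfS_creS j (annS j q)] with ξ h4 h8 k
  rw [multiLength, Nat.cast_sum, ← sum_neg_distrib, sum_mul]
  refine sum_congr rfl fun j _ => ?_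
  rw [h8, h4]
  by_cases hk : k j = 0
  · simp [hk]
  · have e1 : ((k - dir j) j : ℝ) + 1 = k j := by
      have : (k - dir j) j + 1 = k j := by
        simp [dir]; omega
      exact_mod_cast this
    have e2 : (√(k j) : ℂ) * (√(k j) : ℂ) = k j := by
      rw [← Complex.ofReal_mul, Real.mul_self_sqrt (by positivity), Complex.ofReal_natCast]
    rw [e1, sub_add_dir hk]
    linear_combination -hfS q ξ k * e2

lemma isGenL2_kin (κ) (q : TXV) : IsGenL2 κ (2 * π) (inclF (hfS q)) (kGen q) := by
  have hY o : ∀ᵐ ξ, (kGen q ξ).fst o = ∑ j, if o = some j then hfS q ξ (dir j) else 0 := by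
    have h1 : projL (inl o) (kGen q) = ∑ j, if o = some j then coL (dir j) (hfS q) else 0 := by
      simp only [kGen, map_add, map_sum, projL_incl, projL_inclF, zero_add, inl.injEq]
    filter_upwards [projL_ae (inl o) (kGen q), ae_all_iff.2 fun k => coL_ae k (hfS q),
      Lp.coeFn_zero ℂ 2 vol] with ξ h2 h3 h4
    have h5 : (kGen q ξ).fst o = projL (inl o) (kGen q) ξ := h2.symm
    rw [h5, h1]; rcases o with _ | i
    · simp
    · simp only [Option.some.injEq, sum_ite_eq, Finset.mem_univ, if_true, h3]
  have hF : projF (kGen q) = (∑ j, (hfS (annS j (dX j q)) - hfS (creS j (dX j q)))) +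
      ∑ j, hfS (creS j (annS j q)) := by
    simp only [kGen, map_add, map_sum, projF_incl, projF_inclF, Finset.sum_const_zero, add_zero]
    rw [hfS_add, trS, fpS, hfS_sum, hfS_sum]; simp only [mV_eq, hfS_sub]
  filter_upwards [inclF_ae (hfS q), ae_all_iff.2 hY, projF_ae (kGen q),
    ae_all_iff.2 fun j => hfS_annS j q, ae_all_iff.2 fun j => hfS_creS j q,
    ae_all_iff.2 fun j => hfS_annS j (dX j q), ae_all_iff.2 fun j => hfS_creS j (dX j q),
    hfS_number q, ae_all_iff.2 fun j => hfS_dX j q,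
    Lp.coeFn_add (∑ j, (hfS (annS j (dX j q)) - hfS (creS j (dX j q))))
      (∑ j, hfS (creS j (annS j q))),
    Lp.coeFn_finsetSum Finset.univ fun j => hfS (annS j (dX j q)) - hfS (creS j (dX j q)),
    Lp.coeFn_finsetSum Finset.univ fun j => hfS (creS j (annS j q)),
    ae_all_iff.2 fun j => Lp.coeFn_sub (hfS (annS j (dX j q))) (hfS (creS j (dX j q)))]
    with ξ h1 h2 h3 h4 h5 h6 h7 h8 h9 h10 h11 h12 h13
  have hs : (kGen q ξ).snd = (∑ j, (hfS (annS j (dX j q)) ξ - hfS (creS j (dX j q)) ξ)) +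
      ∑ j, hfS (creS j (annS j q)) ξ := by
    rw [← h3, hF, h10, Pi.add_apply, h11, h12, Finset.sum_apply, Finset.sum_apply]
    simp only [h13, Pi.sub_apply]
  rw [h1]
  refine isGen_ladder κ _ (R := fun j => -hfS (creS j q) ξ) (L := fun j => hfS (annS j q) ξ)
    (Nm := -∑ j, hfS (creS j (annS j q)) ξ) (fun j k => ?_) (fun j k => h4 j k) (fun k => ?_)
    ?_ ?_ fun j => ?_
  · rw [lp.coeFn_neg, Pi.neg_apply, h5]; ring
  · rw [lp.coeFn_neg, Pi.neg_apply, lp.coeFn_sum, Finset.sum_apply, h8, neg_mul, neg_neg]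
  · rw [hs, sub_neg_eq_add, add_left_inj, smul_sum]; refine sum_congr rfl fun j _ => ?_
    refine lp.ext (funext fun k => ?_)
    simp only [lp.coeFn_sub, lp.coeFn_smul, lp.coeFn_add, lp.coeFn_neg, Pi.sub_apply,
      Pi.smul_apply, Pi.add_apply, Pi.neg_apply, smul_eq_mul]
    rw [h6, h7, h4, h5, h9, lp.coeFn_smul, Pi.smul_apply, Pi.smul_apply, neg_smul_coord,
      smul_eq_mul, smul_eq_mul]
    push_cast; ring
  · rw [h2]; simp
  · rw [h2]; simp

/-! ### The spectral form of the linearized system -/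

def cjS {D : Type*} [NormedAddCommGroup D] [NormedSpace ℝ D] (ψ : 𝓢(D, ℂ)) : 𝓢(D, ℂ) :=
  ψ.postcompCLM (conjCLE : ℂ →L[ℝ] ℂ)

section Conj

variable {D : Type*} [NormedAddCommGroup D] [NormedSpace ℝ D]

lemma cjS_ap (ψ : 𝓢(D, ℂ)) (x) : cjS ψ x = (starRingEnd ℂ) (ψ x) := rfl

lemma cjS_cjS (ψ : 𝓢(D, ℂ)) : cjS (cjS ψ) = ψ := by
  ext x
  simp [cjS_ap]

lemma ldo_cjS (m : D) (ψ : 𝓢(D, ℂ)) : ∂_{m} (cjS ψ) = cjS (∂_{m} ψ) := by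
  ext x
  rw [cjS_ap, lineDerivOp_apply_eq_fderiv, lineDerivOp_apply_eq_fderiv]
  have h : HasFDerivAt (cjS ψ) ((conjCLE : ℂ →L[ℝ] ℂ).comp (fderiv ℝ ψ x)) x :=
    conjCLE.hasFDerivAt.comp x (ψ.hasFDerivAt x)
  rw [h.fderiv]
  rfl

lemma inner_cjS [NormedSpace ℝ E] [MeasurableSpace E]
    [BorelSpace E] [FiniteDimensional ℝ E] {μ : Measure E} [μ.HasTemperateGrowth] (ψ : 𝓢(E, ℂ))
    (a : Lp ℂ 2 μ) : inner ℂ ((cjS ψ).toLp 2 μ) a = ∫ x, a x * ψ x ∂μ := by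
  rw [L2.inner_def]
  refine integral_congr_ae ?_
  filter_upwards [(cjS ψ).coeFn_toLp 2 μ] with x h
  rw [h, cjS_ap, inner_apply, conj_conj]

end Conj

lemma mV_cjS (j g) : mV j (cjS g) = cjS (mV j g) := by
  ext z
  simp [mV_ap, cjS_ap]

lemma annS_cjS (j) (g : TXV) : annS j (cjS g) = cjS (annS j g) := by
  ext z
  rw [annS_ap, cjS_ap (annS j g), annS_ap, dV, ldo_cjS]
  simp [cjS_ap, dV, conj_ofNat]

lemma creS_cjS (j) (g : TXV) : creS j (cjS g) = cjS (creS j g) := by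
  ext z
  rw [creS_ap, cjS_ap (creS j g), creS_ap, dV, ldo_cjS]
  simp [cjS_ap, dV, conj_ofNat]

lemma fpS_cjS (g) : fpS (cjS g) = cjS (fpS g) := by
  ext z
  simp only [fpS, annS_cjS, creS_cjS, cjS_ap, sum_apply, map_sum]

lemma trS_cjS (g : TXV) : trS (cjS g) = cjS (trS g) := by
  ext z
  simp only [trS, dX, ldo_cjS, mV_cjS, cjS_ap, sum_apply, map_sum]

section Pairings

variable (κ : ℝ) (U : State)

lemma inner_mass_toS (ψ : TX) : inner ℂ (incl (inl none) (𝓕 ((cjS ψ).toLp 2))) (toS κ U) =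
      κ * ∫ x, U.toFields.rho x * ψ x := by
  rw [inner_incl, projL_none_toS, inner_smul_right, Lp.inner_fourier_eq, inner_cjS]
  rfl

lemma inner_some_toS (i) (ψ : TX) : inner ℂ (incl (inl (some i)) (𝓕 ((cjS ψ).toLp 2))) (toS κ U) =
      ∫ x, U.toFields.u x i * ψ x := by
  rw [inner_incl, projL_some_toS, Lp.inner_fourier_eq, inner_cjS]
  refine integral_congr_ae ?_
  filter_upwards [cU_ae i U.2.1] with x h
  rw [h]
  rfl

lemma intg_Lp_mul_schw (a : L2X) (ψ : TX) : Integrable fun x => a x * ψ x := by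
  simpa only [mul_comm] using intg_schw_mul ψ a

lemma intg_u_mul (i : Fin 3) (ψ : TX) : Integrable fun x => U.toFields.u x i * ψ x := by
  refine (intg_Lp_mul_schw (cU i U.2.1) ψ).congr ?_
  filter_upwards [cU_ae i U.2.1] with x h
  rw [h]
  rfl

lemma inner_massGen_toS (ψ : TX) : inner ℂ (massGen κ (cjS ψ)) (toS κ U) =
    κ * ∫ x, ∑ i, U.toFields.u x i * pderiv i ψ x := by
  simp only [pd_schw]
  rw [massGen, sum_inner, integral_finsetSum _ fun i _ => intg_u_mul U i _, mul_sum]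
  refine sum_congr rfl fun i _ => ?_
  rw [inner_smul_left, ldo_cjS, inner_some_toS, conj_ofReal]

lemma inner_herm_toS (i : Fin 3) (ψ : TX) :
    inner ℂ (incl (inr (dir i)) (𝓕 ((cjS ψ).toLp 2))) (toS κ U) =
      ∫ x, bMoment U.toFields.f i x * ψ x ∧
      Integrable fun x => bMoment U.toFields.f i x * ψ x := by
  have h : ∀ᵐ x, hCoef (dir i) U.2.2 x * ψ x = bMoment U.toFields.f i x * ψ x := by
    filter_upwards [hCoef_ae (dir i) U.2.2] with x h; rw [h, bMoment]
    congr 2; funext v; rw [hermS_dir, real_smul]; push_cast; rfl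
  refine ⟨?_, (intg_Lp_mul_schw _ ψ).congr h⟩
  rw [inner_incl, projL_inr, projF_toS, coL_hermF, Lp.inner_fourier_eq, inner_cjS]
  exact integral_congr_ae h

lemma inner_momGen_toS (i) (ψ : TX) : inner ℂ (momGen κ i (cjS ψ)) (toS κ U) =
      ((κ ^ 2 : ℝ) : ℂ) * (∫ x, U.toFields.rho x * pderiv i ψ x) +
        ∫ x, (bMoment U.toFields.f i x - U.toFields.u x i) * ψ x := by
  simp only [pd_schw, sub_mul]
  rw [momGen, inner_add_left, inner_sub_left, inner_smul_left, ldo_cjS,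
    inner_mass_toS, inner_some_toS, (inner_herm_toS κ U i ψ).1, conj_ofReal,
    integral_sub (inner_herm_toS κ U i ψ).2 (intg_u_mul U i ψ)]
  push_cast
  ring

lemma inner_kin_toS (g : TXV) : inner ℂ (inclF (hfS (cjS g))) (toS κ U) =
    ∫ z, U.toFields.f z * g z := by
  rw [inner_inclF, projF_toS, hfS, inner_hermF, clS, inner_cjS]
  rfl

lemma inner_kGen_toS (g : TXV) : inner ℂ (kGen (cjS g)) (toS κ U) =
    (∫ z : R3 × R3, U.toFields.f z * ((∑ i, (z.2 i : ℂ) * pderiv i (fun y => g (y, z.2)) z.1) +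
      fokkerPlanck (fun w => g (z.1, w)) z.2)) +
    ∫ z : R3 × R3, (∑ i, U.toFields.u z.1 i * (z.2 i : ℂ)) * (sqrtM z.2 : ℂ) * g z := by
  have h1 : trS (cjS g) + fpS (cjS g) = cjS (trS g + fpS g) := by
    ext z; rw [trS_cjS, fpS_cjS]; simp [cjS_ap]
  rw [kGen, inner_add_left, sum_inner, h1, inner_kin_toS]
  congr 1
  · refine integral_congr_ae (.of_forall fun z => ?_); dsimp only
    rw [add_apply, trS_ap, fpS_ap]
  · have h2 j : inner ℂ (incl (inl (some j)) (coL (dir j) (hfS (cjS g))))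
        (toS κ U) = ∫ z, emb (dir j) (cU j U.2.1) z * g z := by
      rw [inner_incl, projL_some_toS, hfS, coL_hermF, Lp.inner_fourier_eq,
        ← inner_conj_symm, ← inner_emb, inner_conj_symm, clS, inner_cjS]
    have h3 : ∀ᵐ z : R3 × R3, ∀ j, cU j U.2.1 z.1 = U.2.1 z.1 j :=
      ae_all_iff.2 fun j => Measure.quasiMeasurePreserving_fst.ae (cU_ae j U.2.1)
    simp only [h2]; rw [← integral_finsetSum _ fun j _ => ?_]
    · refine integral_congr_ae ?_
      filter_upwards [ae_all_iff.2 fun j => emb_ae (dir j) (cU j U.2.1), h3] with z h4 h5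
      rw [sum_mul, sum_mul]; refine sum_congr rfl fun j _ => ?_; rw [h4, h5, hermS_dir]
      change U.2.1 z.1 j * _ * _ = U.2.1 z.1 j * _ * _ * _; ring
    · exact (Lp.memLp (emb (dir j) (cU j U.2.1))).integrable_mul (g.memLp 2 volume)

end Pairings

def st (U : Fields) (h : U.IsL2) : State := (h.rho.toLp _, h.u.toLp _, h.f.toLp _)

structure IsSpecSol (κ : ℝ) (X₀ : Spec) (Q : ℝ → TXV → ℂ) (W : ℝ → Spec) : Prop where
  cont : ContinuousOn W (Ici 0)
  mass : ∀ t : ℝ, 0 ≤ t → ∀ φ : TX, inner ℂ (incl (inl none) (𝓕 (φ.toLp 2))) (W t) =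
      inner ℂ (incl (inl none) (𝓕 (φ.toLp 2))) X₀ +
      ∫ s in (0)..t, inner ℂ (massGen κ φ) (W s)
  momentum : ∀ t : ℝ, 0 ≤ t → ∀ (i : Fin 3) (φ : TX),
    inner ℂ (incl (inl (some i)) (𝓕 (φ.toLp 2))) (W t) =
      inner ℂ (incl (inl (some i)) (𝓕 (φ.toLp 2))) X₀ +
      ∫ s in (0)..t, inner ℂ (momGen κ i φ) (W s)
  kinetic : ∀ t : ℝ, 0 ≤ t → ∀ q : TXV, inner ℂ (inclF (hfS q)) (W t) = inner ℂ (inclF (hfS q)) X₀ +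
      ∫ s in (0)..t, (inner ℂ (kGen q) (W s) + Q s (cjS q))

lemma isWeakSolution_iff (hκ : 0 < κ) (h₀ : U₀.IsL2) :
    IsWeakSolution (κ ^ 2) U₀ G h U ↔ IsSpecSol κ (toS κ (st U₀ h₀))
      (fun s => sourcePairing (G s) (h s)) fun t => toS κ (U t) := by
  have hκ' : (κ : ℂ) ≠ 0 := by exact_mod_cast hκ.ne'
  have e1 (ψ : TX) : ∫ x, (st U₀ h₀).toFields.rho x * ψ x = ∫ x, U₀.rho x * ψ x := by
    refine integral_congr_ae ?_; filter_upwards [h₀.rho.coeFn_toLp] with x hx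
    change h₀.rho.toLp _ x * _ = _; rw [hx]
  have e2 i (ψ : TX) : ∫ x, (st U₀ h₀).toFields.u x i * ψ x = ∫ x, U₀.u x i * ψ x := by
    refine integral_congr_ae ?_; filter_upwards [h₀.u.coeFn_toLp] with x hx
    change h₀.u.toLp _ x i * _ = _; rw [hx]
  have e3 (g : TXV) : ∫ x, (st U₀ h₀).toFields.f x * g x = ∫ x, U₀.f x * g x := by
    refine integral_congr_ae ?_; filter_upwards [h₀.f.coeFn_toLp] with x hx
    change h₀.f.toLp _ x * _ = _; rw [hx]
  have m (t : ℝ) (ψ : TX) : (inner ℂ (incl (inl none) (𝓕 ((cjS ψ).toLp 2))) (toS κ (U t)) =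
        inner ℂ (incl (inl none) (𝓕 ((cjS ψ).toLp 2))) (toS κ (st U₀ h₀)) +
        ∫ s in (0)..t, inner ℂ (massGen κ (cjS ψ)) (toS κ (U s))) ↔
      ∫ x, (U t).toFields.rho x * ψ x = (∫ x, U₀.rho x * ψ x) +
        ∫ s in (0)..t, ∫ x, ∑ i, (U s).toFields.u x i * pderiv i ψ x := by
    simp only [inner_mass_toS, inner_massGen_toS, e1]
    rw [intervalIntegral.integral_const_mul, ← mul_add]; exact mul_right_inj' hκ'
  refine ⟨fun H => ⟨(toS κ).continuous.comp_continuousOn H.cont, fun t ht φ => ?_,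
    fun t ht i φ => ?_, fun t ht q => ?_⟩, fun H => ⟨?_, fun t ht ψ => ?_, fun t ht i ψ => ?_,
    fun t ht g => ?_⟩⟩
  · rw [← cjS_cjS φ]; exact (m t _).2 (H.mass t ht _)
  · rw [← cjS_cjS φ]; simp only [inner_some_toS, inner_momGen_toS, e2]
    exact H.momentum t ht i _
  · have h1 := H.kinetic t ht (cjS q); rw [← cjS_cjS q]
    simp only [inner_kin_toS, inner_kGen_toS, e3]
    rw [cjS_cjS (cjS q)]; exact h1
  · refine ((ofSpec κ).continuous.comp_continuousOn H.cont).congr fun t _ => ?_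
    exact (ofSpec_toS hκ _).symm
  · exact (m t _).1 (H.mass t ht _)
  · have h1 := H.momentum t ht i (cjS ψ); simp only [inner_some_toS, inner_momGen_toS, e2] at h1
    exact h1
  · have h1 := H.kinetic t ht (cjS g); simp only [inner_kin_toS, inner_kGen_toS, e3, cjS_cjS] at h1
    exact h1

structure HasSpecSource (Q : ℝ → TXV → ℂ) (Z : ℝ → Spec) : Prop where
  l2Loc : IsL2Loc Z
  eq : ∀ q : TXV, ∃ Yh : Spec, Tendsto (fun K => halfL K (inclF (hfS q))) atTop (𝓝 Yh) ∧
    ∀ᵐ s ∂(volume.restrict (Ioi (0 : ℝ))), Q s (cjS q) = inner ℂ Yh (Z s)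

lemma ii_inner_contOn (hW : ContinuousOn W (Ici 0)) (Y : Spec) (ht : 0 ≤ t) :
    IntervalIntegrable (fun s => (inner ℂ Y (W s) : ℂ)) volume 0 t := by
  refine ContinuousOn.intervalIntegrable ?_
  rw [uIcc_of_le ht]
  exact (innerSL ℂ Y).continuous.comp_continuousOn (hW.mono Icc_subset_Ici_self)

lemma HasSpecSource.intervalIntegrable (hQ : HasSpecSource Q Z) (g : TXV) (ht : 0 ≤ t) :
    IntervalIntegrable (fun s => Q s g) volume 0 t := by
  obtain ⟨Yh, _, h⟩ := hQ.eq (cjS g)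
  rw [cjS_cjS] at h
  have h1 := hQ.l2Loc.isL1Loc t ht
  rw [intervalIntegrable_iff_integrableOn_Ioc_of_le ht] at h1 ⊢
  refine ((innerSL ℂ Yh).integrable_comp h1).congr ?_
  filter_upwards [ae_restrict_of_ae_restrict_of_subset
    (show Ioc 0 t ⊆ Ioi 0 from Ioc_subset_Ioi_self) h] with s hs
  rw [hs, innerSL_apply_apply]

lemma halfL_incl (K : ℕ) (o : Option (Fin 3)) (a : L2X) : halfL K (incl (inl o) a) = 0 := by
  refine Lp.ext ?_
  filter_upwards [halfL_ae K (incl (inl o) a), incl_ae (inl o) a,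
    Lp.coeFn_zero Fib 2 vol] with ξ h1 h2 h3
  rw [h1, h2, h3, map_smul]
  have : hFib K (bas (inl o)) = 0 := fib_ext rfl fun k => by rw [halfFib_snd]; simp [bas]
  rw [this, smul_zero, Pi.zero_apply]

lemma isSpecSol_evol_add_duhZ (hl : 0 < lam) (hd : HasDecay κ lam)
    (hQ : HasSpecSource Q Z) (X₀ : Spec) :
    IsSpecSol κ X₀ Q fun t => evol κ (2 * π) t X₀ + duhZ κ (2 * π) Z t := by
  have hce : Continuous fun t => evol κ (2 * π) t X₀ := cont_evol_ap κ _ X₀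
  have hcd := contOn_duhZ (κ := κ) (η := 2 * π) hl hd hQ.l2Loc
  have main {Y Y' Yh : Spec} (hY : IsGenL2 κ (2 * π) Y Y')
      (hYh : Tendsto (fun K => halfL K Y) atTop (𝓝 Yh)) {t : ℝ} (ht : 0 ≤ t) :
      inner ℂ Y (evol κ (2 * π) t X₀ + duhZ κ (2 * π) Z t) = inner ℂ Y X₀ +
        ((∫ s in (0)..t, inner ℂ Y' (evol κ (2 * π) s X₀ + duhZ κ (2 * π) Z s)) +
        ∫ s in (0)..t, inner ℂ Yh (Z s)) := by
    rw [inner_add_right, inner_evol_eq_int hY ht, inner_duhZ_eq_int hl hd hY hYh hQ.l2Loc ht]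
    simp only [inner_add_right]
    rw [intervalIntegral.integral_add (ii_inner_contOn hce.continuousOn Y' ht)
      (ii_inner_contOn hcd Y' ht)]
    ring
  have h0 o a : Tendsto (fun K => halfL K (incl (inl o) a)) atTop (𝓝 0) := by
    simp only [halfL_incl]; exact tendsto_const_nhds
  refine ⟨hce.continuousOn.add hcd, fun t ht φ => ?_, fun t ht i φ => ?_, fun t ht q => ?_⟩
  · simpa using main (isGenL2_mass κ φ) (h0 _ _) ht
  · simpa using main (isGenL2_mom κ i φ) (h0 _ _) ht
  · obtain ⟨Yh, h1, h2⟩ := hQ.eq q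
    have hi : IntervalIntegrable (fun s => inner ℂ (kGen q)
        (evol κ (2 * π) s X₀ + duhZ κ (2 * π) Z s)) volume 0 t :=
      ii_inner_contOn (hce.continuousOn.add hcd) _ ht
    rw [main (isGenL2_kin κ q) h1 ht, intervalIntegral.integral_add hi (hQ.intervalIntegrable _ ht)]
    congr 2; rw [integral_of_le ht, integral_of_le ht]; refine integral_congr_ae ?_
    filter_upwards [ae_restrict_of_ae_restrict_of_subset
      (show Ioc 0 t ⊆ Ioi 0 from Ioc_subset_Ioi_self) h2] with s hs
    rw [hs]

lemma hfS_tnS (φ : TX) (k : MI) : hfS (tnS φ (hermS k)) = lvlL k (𝓕 (φ.toLp 2)) := by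
  rw [hfS, ← hermF_emb]
  congr 1
  refine Lp.ext ?_
  filter_upwards [(tnS φ (hermS k)).coeFn_toLp 2 volume, emb_ae k (φ.toLp 2),
    Measure.quasiMeasurePreserving_fst.ae (φ.coeFn_toLp 2 volume)] with z h1 h2 h3
  rw [h1, h2, h3, tnS_ap]

lemma inclF_lvlL (k) (a : L2X) : inclF (lvlL k a) = incl (inr k) a := by
  refine Lp.ext ?_
  filter_upwards [inclF_ae (lvlL k a), lvlL_ae k a, incl_ae (inr k) a] with ξ h1 h2 h3
  rw [h1, h2, h3]
  refine fib_ext ?_ fun l => ?_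
  · simp [bas]
  · rfl

lemma IsSpecSol.unique (hQ : ∀ g {t : ℝ}, 0 ≤ t → IntervalIntegrable (fun s => Q s g) volume 0 t)
    (h₁ : IsSpecSol κ X₀ Q W₁) (h₂ : IsSpecSol κ X₀ Q W₂) {t : ℝ} (ht : 0 ≤ t) : W₁ t = W₂ t := by
  have main {Y Y' : Spec} {t : ℝ} (ht : 0 ≤ t) {q : ℝ → ℂ} (hq : IntervalIntegrable q volume 0 t)
      (e1 : inner ℂ Y (W₁ t) = inner ℂ Y X₀ + ∫ s in (0)..t, (inner ℂ Y' (W₁ s) + q s))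
      (e2 : inner ℂ Y (W₂ t) = inner ℂ Y X₀ + ∫ s in (0)..t, (inner ℂ Y' (W₂ s) + q s)) :
      inner ℂ Y ((W₁ - W₂) t) = ∫ s in (0)..t, inner ℂ Y' ((W₁ - W₂) s) := by
    have i1 := ii_inner_contOn h₁.cont Y' ht; have i2 := ii_inner_contOn h₂.cont Y' ht
    simp only [Pi.sub_apply, inner_sub_right]
    rw [intervalIntegral.integral_sub i1 i2, e1, e2, intervalIntegral.integral_add i1 hq,
      intervalIntegral.integral_add i2 hq]
    ring
  have hψ (ψ : TX) : ∃ φ : TX, ψ.toLp 2 = 𝓕 (φ.toLp 2) :=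
    ⟨𝓕⁻ ψ, by rw [SchwartzMap.toLp_fourier_eq, FourierTransform.fourier_fourierInv_eq]⟩
  have hnull : IsWeakNull κ (2 * π) (W₁ - W₂) := by
    rintro b ψ
    change ∃ Y', IsGenL2 κ _ (incl b (ψ.toLp 2 volume)) Y' ∧ ∀ t : ℝ, 0 ≤ t →
      inner ℂ (incl b (ψ.toLp 2 volume)) _ = _
    obtain ⟨φ, hφ⟩ := hψ ψ; rw [hφ]
    have z0 t : IntervalIntegrable (fun _ => (0 : ℂ)) volume 0 t := by simp
    rcases b with (_ | i) | k
    · refine ⟨_, isGenL2_mass κ _, fun t ht => main ht (q := fun _ => 0) (z0 t) ?_ ?_⟩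
      · rw [h₁.mass t ht φ]; simp
      · rw [h₂.mass t ht φ]; simp
    · refine ⟨_, isGenL2_mom κ i _, fun t ht => main ht (q := fun _ => 0) (z0 t) ?_ ?_⟩
      · rw [h₁.momentum t ht i φ]; simp
      · rw [h₂.momentum t ht i φ]; simp only [add_zero]
    · rw [← inclF_lvlL, ← hfS_tnS]
      exact ⟨_, isGenL2_kin κ _, fun t ht =>
        main ht (hQ _ ht) (h₁.kinetic t ht _) (h₂.kinetic t ht _)⟩
  exact sub_eq_zero.1 (zero_isWeakNull (h₁.cont.sub h₂.cont) hnull ht)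

/-! ### Representation of the sources -/

lemma ex_halfShift (n : MI → ℕ) (hn : ∀ l, n l ≤ ℓ l + 1) {σ : MI → MI}
    (hσ : InjOn σ {l | n l ≠ 0}) : ∃ T : HSeq →L[ℂ] HSeq, ∀ y l,
      T y l = if 2 ≤ ℓ l then (√(n l) / √(ℓ l) : ℝ) * y (σ l) else 0 := by
  set w : MI → ℝ := fun l => if 2 ≤ ℓ l then √(n l) / √(ℓ l) else 0 with hw
  have hw2 l : w l ^ 2 ≤ 2 := by
    simp only [hw]
    split_ifs with h
    · have h1 : (2 : ℝ) ≤ ℓ l := by exact_mod_cast h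
      have h2 : (n l : ℝ) ≤ ℓ l + 1 := by exact_mod_cast hn l
      rw [div_pow, sq_sqrt (by positivity), sq_sqrt (by positivity),
        div_le_iff₀ (by linarith)]
      linarith
    · norm_num
  have hsum (y : HSeq) (F : Finset MI) :
      ∑ l ∈ F, ‖(w l : ℂ) * y (σ l)‖ ^ 2 ≤ 2 * ‖y‖ ^ 2 := by
    rw [← Finset.sum_filter_of_ne (p := fun l => n l ≠ 0) fun l _ hl h0 => hl (by simp [hw, h0])]
    have hi : InjOn σ (F.filter fun l => n l ≠ 0 : Finset MI) := fun a ha b hb h =>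
      hσ (mem_filter.1 ha).2 (mem_filter.1 hb).2 h
    calc _ ≤ ∑ l ∈ F.filter (fun l => n l ≠ 0), 2 * ‖y (σ l)‖ ^ 2 := by
          refine sum_le_sum fun l _ => ?_
          rw [norm_mul, mul_pow, norm_real, norm_eq_abs, sq_abs]
          exact mul_le_mul_of_nonneg_right (hw2 l) (by positivity)
      _ ≤ _ := by
          rw [← mul_sum, ← sum_image (f := fun k => ‖y k‖ ^ 2) hi]
          exact mul_le_mul_of_nonneg_left
            (sum_le_hasSum _ (fun _ _ => by positivity) (hSeq_hasSum_norm_sq y)) zero_le_two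
  have hm (y : HSeq) : Memℓp (fun l => (w l : ℂ) * y (σ l)) 2 :=
    memℓp_gen' (C := 2 * ‖y‖ ^ 2) fun F => by simpa using hsum y F
  let L : HSeq →ₗ[ℂ] HSeq :=
    { toFun := fun y => ⟨_, hm y⟩
      map_add' := fun y z => lp.ext (funext fun l => mul_add (w l : ℂ) (y (σ l)) (z (σ l)))
      map_smul' := fun c y => lp.ext (funext fun l => mul_left_comm (w l : ℂ) c (y (σ l))) }
  refine ⟨L.mkContinuous 2 fun y => ?_, fun y l => ?_⟩
  · refine lp.norm_le_of_forall_sum_le (by simp) (by positivity) fun F => ?_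
    have := hsum y F
    simp
    refine this.trans ?_
    nlinarith [sq_nonneg ‖y‖]
  · change (w l : ℂ) * y (σ l) = _
    simp only [hw]
    split_ifs <;> simp

abbrev SrcIdx := Fin 3 ⊕ Option (Fin 3)

def srcC (X : SrcIdx → HSeq) (l : MI) : ℂ :=
  -(∑ i, (√(l i) : ℂ) * X (inl i) (l - dir i)) + X (inr none) l +
    ∑ j, ((√(l j) : ℂ) * X (inr (some j)) (l - dir j) +
      (√(l j + 1 : ℝ) : ℂ) * X (inr (some j)) (l + dir j))

lemma injOn_sub_dir (i : Fin 3) : InjOn (fun l : MI => l - dir i) {l | l i ≠ 0} := by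
  intro a ha b hb h
  rw [← sub_add_dir ha, ← sub_add_dir hb]
  exact congrArg (· + dir i) h

lemma ex_srcOp : ∃ Θ : SrcIdx → HSeq →L[ℂ] HSeq, ∀ X l, 2 ≤ ℓ l →
    (√(ℓ l) : ℂ) * (∑ r, Θ r (X r)) l = srcC X l := by
  choose A hA using fun i : Fin 3 => ex_halfShift (fun l => l i)
    (fun l => (ap_le_len l i).trans (Nat.le_succ _)) (injOn_sub_dir i)
  choose B hB using fun i : Fin 3 => ex_halfShift (fun l => l i + 1)
    (fun l => Nat.succ_le_succ (ap_le_len l i))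
    (add_left_injective (dir i)).injOn
  obtain ⟨D, hD⟩ := ex_halfShift (fun _ => 1) (fun l => Nat.le_add_left _ _) (injective_id).injOn
  refine ⟨Sum.elim (fun i => -A i) fun o => o.elim D fun j => A j + B j, fun X l hl => ?_⟩
  have hs : (√(ℓ l) : ℂ) ≠ 0 := by
    rw [Complex.ofReal_ne_zero, Real.sqrt_ne_zero']; exact_mod_cast (by omega : 0 < ℓ l)
  simp only [sum_sum_type, sum_option, Sum.elim_inl, Sum.elim_inr, Option.elim,
    neg_apply, add_apply, lp.coeFn_add, lp.coeFn_sum, lp.coeFn_neg, Finset.sum_apply,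
    Pi.add_apply, Pi.neg_apply, hA, hB, hD, if_pos hl, srcC]
  rw [mul_add, mul_add, mul_sum, mul_sum, ← sum_neg_distrib, add_assoc]
  congr 1
  · refine sum_congr rfl fun i _ => ?_; push_cast; field_simp
  congr 1
  · push_cast; simp; field_simp
  · refine sum_congr rfl fun i _ => ?_; push_cast; field_simp

lemma hasSum_inner_ann {y a : HSeq} {i} (ha : ∀ k, a k = (√(k i + 1 : ℝ) : ℂ) * y (k + dir i)) (X) :
    HasSum (fun l => (starRingEnd ℂ) (y l) * ((√(l i) : ℂ) * X (l - dir i))) (inner ℂ a X) := by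
  rw [← (add_left_injective (dir i)).hasSum_iff]
  · refine (lp.hasSum_inner (𝕜 := ℂ) a X).congr_fun fun k => ?_
    have : ((k + dir i) i : ℝ) = k i + 1 := by simp [dir]
    simp only [Function.comp_apply, add_sub_dir, this, ha, inner_apply, map_mul, conj_ofReal]
    ring
  · intro l hl
    have h0 : l i = 0 := by
      by_contra h
      exact hl ⟨l - dir i, sub_add_dir h⟩
    simp [h0]

lemma hasSum_inner_cre {y c : HSeq} {i} (hc : ∀ k, c k = (-√(k i) : ℂ) * y (k - dir i)) (X) :
    HasSum (fun l => (starRingEnd ℂ) (y l) * -((√(l i + 1 : ℝ) : ℂ) * X (l + dir i)))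
      (inner ℂ c X) := by
  have h := lp.hasSum_inner (𝕜 := ℂ) c X
  rw [← (add_left_injective (dir i)).hasSum_iff] at h
  · refine h.congr_fun fun k => ?_; have : ((k + dir i) i : ℝ) = k i + 1 := by simp [dir]
    simp only [Function.comp_apply, hc, add_sub_dir, this, inner_apply, map_mul,
      map_neg, conj_ofReal]
    ring
  · intro l hl
    have h0 : l i = 0 := by
      by_contra h
      exact hl ⟨l - dir i, sub_add_dir h⟩
    simp [hc, h0]

lemma inner_src_eq {y hy Z : HSeq} {a c : Fin 3 → HSeq} {X : SrcIdx → HSeq}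
    (ha : ∀ i k, a i k = (√(k i + 1 : ℝ) : ℂ) * y (k + dir i))
    (hc : ∀ i k, c i k = (-√(k i) : ℂ) * y (k - dir i))
    (hlow : ∀ l, ℓ l < 2 → srcC X l = 0)
    (hZ : ∀ l, 2 ≤ ℓ l → (√(ℓ l) : ℂ) * Z l = srcC X l)
    (hh : ∀ l, hy l = if 2 ≤ ℓ l then (√(ℓ l) : ℂ) * y l else 0) :
    -(∑ i, inner ℂ (a i) (X (inl i))) + inner ℂ y (X (inr none)) +
      ∑ j, inner ℂ (a j - c j) (X (inr (some j))) = inner ℂ hy Z := by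
  have h1 : HasSum (fun l => (starRingEnd ℂ) (y l) * srcC X l)
      (-(∑ i, inner ℂ (a i) (X (inl i))) + inner ℂ y (X (inr none)) +
        ∑ j, inner ℂ (a j - c j) (X (inr (some j)))) := by
    simp only [inner_sub_left]
    refine HasSum.congr_fun (((hasSum_sum fun i _ => hasSum_inner_ann (ha i) (X (inl i))).neg.add
      (lp.hasSum_inner (𝕜 := ℂ) y (X (inr none)))).add (hasSum_sum fun j _ =>
        (hasSum_inner_ann (ha j) (X (inr (some j)))).sub
          (hasSum_inner_cre (hc j) (X (inr (some j)))))) fun l => ?_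
    simp only [srcC, inner_apply, mul_add, mul_sum, mul_neg, sub_neg_eq_add]
    ring
  refine h1.unique ?_
  refine (lp.hasSum_inner (𝕜 := ℂ) hy Z).congr_fun fun l => ?_
  rw [hh, inner_apply]
  split_ifs with h
  · rw [← hZ l h, map_mul, conj_ofReal]; ring
  · rw [hlow l (by omega)]; simp

def srcOp : SrcIdx → HSeq →L[ℂ] HSeq := ex_srcOp.choose

lemma srcOp_spec (X : SrcIdx → HSeq) (l : MI) (hl : 2 ≤ ℓ l) :
    (√(ℓ l) : ℂ) * (∑ r, srcOp r (X r)) l = srcC X l :=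
  ex_srcOp.choose_spec X l hl

def srcS (X : SrcIdx → HL2) : Spec := ∑ r, inclF ((srcOp r).compLpL 2 volume (X r))

def srcPair (q : TXV) (X : SrcIdx → HL2) : ℂ :=
  -(∑ i, inner ℂ (hfS (annS i q)) (X (inl i))) + inner ℂ (hfS q) (X (inr none)) +
    ∑ j, inner ℂ (hfS (mV j q)) (X (inr (some j)))

lemma srcS_ae (X : SrcIdx → HL2) : ∀ᵐ ξ, srcS X ξ = toLp 2 (0, ∑ r, srcOp r (X r ξ)) := by
  filter_upwards [Lp.coeFn_finsetSum Finset.univ fun r => inclF ((srcOp r).compLpL 2 volume (X r)),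
    ae_all_iff.2 fun r => inclF_ae ((srcOp r).compLpL 2 volume (X r)),
    ae_all_iff.2 fun r => (srcOp r).coeFn_compLpL (X r)] with ξ h1 h2 h3
  rw [srcS, h1, Finset.sum_apply]
  simp only [h2, h3]
  exact (map_sum (pCLM.comp (ContinuousLinearMap.inr ℂ FFib HSeq)) _ _).symm

lemma ex_srcS_le : ∃ C, 0 < C ∧ ∀ X : SrcIdx → HL2, ∀ᵐ ξ,
    ‖srcS X ξ‖ₑ ^ 2 ≤ ofReal C * ∑ r, ‖X r ξ‖ₑ ^ 2 := by
  refine ⟨1 + ∑ r, ‖srcOp r‖ ^ 2, by positivity, fun X => ?_⟩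
  filter_upwards [srcS_ae X] with ξ h
  have h0 : ‖srcS X ξ‖ ^ 2 ≤ (1 + ∑ r, ‖srcOp r‖ ^ 2) * ∑ r, ‖X r ξ‖ ^ 2 := by
    rw [h, fib_nsq]; change ‖0‖ ^ 2 + _ ≤ _; rw [norm_zero, zero_pow two_ne_zero, zero_add]
    calc ‖∑ r, srcOp r (X r ξ)‖ ^ 2 ≤ (∑ r, ‖srcOp r‖ * ‖X r ξ‖) ^ 2 :=
          pow_le_pow_left₀ (norm_nonneg _) ((norm_sum_le _ _).trans
            (sum_le_sum fun r _ => (srcOp r).le_opNorm _)) 2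
      _ ≤ (∑ r, ‖srcOp r‖ ^ 2) * ∑ r, ‖X r ξ‖ ^ 2 := Finset.sum_mul_sq_le_sq_mul_sq _ _ _
      _ ≤ _ := by gcongr; linarith
  simp only [← ofReal_norm, ← ofReal_pow (norm_nonneg _)]
  rw [← ofReal_sum_of_nonneg fun _ _ => by positivity, ← ofReal_mul (by positivity)]
  exact ofReal_le_ofReal h0

lemma ex_tt_halfL (q : TXV) : ∃ Yh : Spec, Tendsto (fun K => halfL K (inclF (hfS q))) atTop (𝓝 Yh) ∧
    ∀ X : SrcIdx → HL2, (∀ᵐ ξ, ∀ l, ℓ l < 2 → srcC (fun r => X r ξ) l = 0) →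
      srcPair q X = inner ℂ Yh (srcS X) := by
  obtain ⟨D, hD⟩ := ex_halfShift (fun _ => 1) (fun l => Nat.le_add_left _ _) (injective_id).injOn
  set Yh : Spec := inclF (D.compLpL 2 volume (-hfS (fpS q))) with hYh
  have hae : ∀ᵐ ξ, ∃ w : HSeq, Yh ξ = toLp 2 (0, w) ∧
      ∀ l, w l = if 2 ≤ ℓ l then (√(ℓ l) : ℂ) * hfS q ξ l else 0 := by
    filter_upwards [inclF_ae (D.compLpL 2 volume (-hfS (fpS q))),
      D.coeFn_compLpL (-hfS (fpS q)), Lp.coeFn_neg (hfS (fpS q)), hfS_number q,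
      Lp.coeFn_finsetSum Finset.univ fun j => hfS (creS j (annS j q))] with ξ h1 h2 h3 h4 h5
    refine ⟨_, h1, fun l => ?_⟩
    have h6 : hfS (fpS q) ξ l = -(ℓ l) * hfS q ξ l := by
      rw [← h4, fpS, hfS_sum, h5, Finset.sum_apply, lp.coeFn_sum, Finset.sum_apply]
    rw [h2, hD, h3, Pi.neg_apply, lp.coeFn_neg, Pi.neg_apply, id, h6]
    refine if_congr Iff.rfl ?_ rfl
    have e2 : (√(ℓ l) : ℂ) * (√(ℓ l) : ℂ) = ℓ l := by
      rw [← Complex.ofReal_mul, Real.mul_self_sqrt (by positivity), Complex.ofReal_natCast]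
    by_cases h0 : (√(ℓ l) : ℂ) = 0
    · simp [h0]
    · simp; field_simp
      linear_combination -hfS q ξ l * e2
  refine ⟨Yh, ?_, fun X hX => ?_⟩
  · refine (tt_truncL Yh).congr fun K => Lp.ext ?_
    filter_upwards [truncL_ae K Yh, halfL_ae K (inclF (hfS q)), inclF_ae (hfS q), hae]
      with ξ h1 h2 h3 ⟨w, h4, h5⟩
    rw [h1, h2, h3, h4]; refine fib_ext rfl fun k => ?_; rw [halfFib_snd, hOp_ap, trF_snd_ap]
    change (if _ then w k else 0) = if _ then _ * hfS q ξ k else 0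
    rw [h5]; split_ifs <;> first | rfl | omega
  · have hi (Y X : HL2) : Integrable fun ξ => (inner ℂ (Y ξ) (X ξ) : ℂ) := L2.integrable_inner Y X
    rw [srcPair]
    simp only [L2.inner_def]
    have hs {ι : Type} [Fintype ι] (Y W : ι → HL2) :
        Integrable fun ξ => (∑ i, inner ℂ (Y i ξ) (W i ξ) : ℂ) :=
      integrable_finsetSum _ fun i _ => hi _ _
    rw [← integral_finsetSum _ fun i _ => hi _ _, ← integral_finsetSum _ fun i _ => hi _ _,
      ← integral_neg]
    erw [← integral_add (hs _ _).neg (hi _ _), ← integral_add ((hs _ _).neg.add (hi _ _)) (hs _ _)]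
    refine integral_congr_ae ?_
    filter_upwards [hX, hae, srcS_ae X, ae_all_iff.2 fun j => hfS_annS j q,
      ae_all_iff.2 fun j => hfS_creS j q,
      ae_all_iff.2 fun j => Lp.coeFn_sub (hfS (annS j q)) (hfS (creS j q))]
      with ξ h1 ⟨w, h2, h3⟩ h4 h5 h6 h7
    simp only [mV_eq, hfS_sub, h7, Pi.sub_apply, Pi.add_apply, Pi.neg_apply]
    rw [h2, h4, in_fib]; change _ = inner ℂ 0 0 + _; rw [inner_zero_left, zero_add]
    exact inner_src_eq (X := fun r => X r ξ) (hy := w) h5 h6 h1 (srcOp_spec fun r => X r ξ) h3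

lemma hasSpecSource_srcS {X : ℝ → SrcIdx → HL2}
    (hX : ∀ r, AEStronglyMeasurable (fun s => X s r) (volume.restrict (Ioi 0)))
    (hfin : ∀ r (T : ℝ), ∫⁻ s in Ioc 0 T, ‖X s r‖ₑ ^ 2 < ⊤)
    (hlow : ∀ᵐ s ∂(volume.restrict (Ioi (0 : ℝ))), ∀ᵐ ξ, ∀ l, ℓ l < 2 →
      srcC (fun r => X s r ξ) l = 0)
    (hQ : ∀ᵐ s ∂(volume.restrict (Ioi (0 : ℝ))), ∀ q, Q s (cjS q) = srcPair q (X s)) :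
    HasSpecSource Q fun s => srcS (X s) := by
  refine ⟨⟨?_, fun T => ?_⟩, fun q => ?_⟩
  · exact Finset.aestronglyMeasurable_fun_sum _ fun r _ =>
      (inclF.comp ((srcOp r).compLpL 2 volume)).continuous.comp_aestronglyMeasurable (hX r)
  · obtain ⟨C, hC, h⟩ := ex_srcS_le
    have h1 s : ‖srcS (X s)‖ₑ ^ 2 ≤ ofReal C * ∑ r, ‖X s r‖ₑ ^ 2 := by
      simp only [en_sq_Lp]; refine (lintegral_mono_ae (h (X s))).trans_eq ?_
      rw [lintegral_const_mul' _ _ ofReal_ne_top, lintegral_finsetSum' _ fun r _ =>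
        (Lp.aestronglyMeasurable (X s r)).enorm.pow_const 2]
    refine (lintegral_mono h1).trans_lt ?_
    rw [lintegral_const_mul' _ _ ofReal_ne_top, lintegral_finsetSum' _ fun r _ =>
      ((hX r).mono_measure (Measure.restrict_mono Ioc_subset_Ioi_self le_rfl)).enorm.pow_const 2]
    exact mul_lt_top ENNReal.ofReal_lt_top (ENNReal.sum_lt_top.2 fun r _ => hfin r T)
  · obtain ⟨Yh, h1, h2⟩ := ex_tt_halfL q; refine ⟨Yh, h1, ?_⟩
    filter_upwards [hlow, hQ] with s h3 h4
    rw [h4, h2 _ h3]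

/-! ### Weak derivatives and the Fourier transform -/

lemma pd_const_mul (i) (c : ℂ) (g : R3 → ℂ) :
    pderiv i (fun x => c * g x) = fun x => c * pderiv i g x := by
  funext x
  have h : fderiv ℝ (c • g) x = c • fderiv ℝ g x := congrFun (fderiv_const_smul_field c) x
  exact congrArg (fun L => L (single i 1)) h

lemma md_const_mul (α) (c : ℂ) (g : R3 → ℂ) :
    multiDeriv α (fun x => c * g x) = fun x => c * multiDeriv α g x := by
  have h i n g : (pderiv i)^[n] (fun x => c * g x) = fun x => c * (pderiv i)^[n] g x := by
    induction n generalizing g with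
    | zero => rfl
    | succ n ih => rw [iterate_succ_apply, pd_const_mul, ih, iterate_succ_apply]
  simp only [multiDeriv, h]

def cutOff (n : ℕ) : ContDiffBump (0 : R3) := ⟨n + 1, n + 2, by positivity, by linarith⟩

lemma tt_int_cutOff [NormedSpace ℂ E] {F : R3 × R3 → E} (hF : Integrable F) :
    Tendsto (fun n : ℕ => ∫ z : R3 × R3, (cutOff n z.2 : ℂ) • F z) atTop (𝓝 (∫ z, F z)) := by
  refine tendsto_integral_of_dominated_convergence (fun z => ‖F z‖) (fun n => ?_) hF.norm
    (fun n => .of_forall fun z => ?_) (.of_forall fun z => ?_)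
  · exact (Continuous.aestronglyMeasurable
      (continuous_ofReal.comp ((cutOff n).continuous.comp continuous_snd))).smul hF.1
  · rw [norm_smul, norm_real, Real.norm_of_nonneg (cutOff n).nonneg]
    exact mul_le_of_le_one_left (norm_nonneg _) (cutOff n).le_one
  · refine tendsto_const_nhds.congr' ?_; obtain ⟨N, hN⟩ := exists_nat_ge ‖z.2‖
    filter_upwards [eventually_ge_atTop N] with n hn
    have := (cutOff n).one_of_mem_closedBall (by
      rw [mem_closedBall_zero_iff]
      exact (hN.trans (by exact_mod_cast hn)).trans (le_add_of_nonneg_right zero_le_one))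
    rw [this, Complex.ofReal_one, one_smul]

structure IsTensDeriv (α : MI) (g w : R3 × R3 → ℂ) : Prop where
  meas : AEStronglyMeasurable w volume
  eq : ∀ ψ φ : TX, HasCompactSupport ψ →
    Integrable (fun z => tnS (schwD α ψ) φ z * g z) → Integrable (fun z => tnS ψ φ z * w z) →
    ∫ z, tnS (schwD α ψ) φ z * g z = (-1) ^ ℓ α * ∫ z, tnS ψ φ z * w z

structure IsSchwDeriv (α : MI) (g w : R3 → ℂ) : Prop where
  meas : AEStronglyMeasurable w volume
  eq : ∀ ψ : TX, HasCompactSupport ψ → ∫ x, schwD α ψ x * g x = (-1) ^ ℓ α * ∫ x, ψ x * w x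

lemma intg_smul_L2 {X E : Type*} [MeasurableSpace X] {μ : Measure X} [NormedAddCommGroup E]
    [NormedSpace ℂ E] {f : X → ℂ} {g : X → E} (hf : MemLp f 2 μ) (hg : MemLp g 2 μ) :
    Integrable (fun x => f x • g x) μ := memLp_one_iff_integrable.1 (hg.smul hf)

section Components

variable {E : Type*} [NormedAddCommGroup E] [NormedSpace ℂ E] [CompleteSpace E] (L : E →L[ℂ] ℂ)
  {α : MI}

lemma IsWeakDerivX.comp {g w : R3 → E} (hw : IsWeakDerivX α g w) (hg : MemLp g 2) :
    IsSchwDeriv α (fun x => L (g x)) fun x => L (w x) := by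
  refine ⟨L.continuous.comp_aestronglyMeasurable hw.locInt_right.aestronglyMeasurable,
    fun ψ hψ => ?_⟩
  have h := congrArg L (hw.integral_eq ψ (ψ.smooth ⊤) hψ)
  rw [md_schw, map_smul, smul_eq_mul,
    ← L.integral_comp_comm (intg_smul_L2 ((schwD α ψ).memLp 2 volume) hg),
    ← L.integral_comp_comm
      (hw.locInt_right.integrable_smul_left_of_hasCompactSupport ψ.continuous hψ)] at h
  simpa only [map_smul, smul_eq_mul] using h

lemma IsWeakDerivXV.comp (hw : IsWeakDerivXV α g w)
    (hg : MemLp g 2) {θ : R3 → ℝ} (hθ : ContDiff ℝ ∞ θ) :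
    IsTensDeriv α (fun z => θ z.2 * L (g z)) fun z => θ z.2 * L (w z) := by
  refine ⟨(continuous_ofReal.comp (hθ.continuous.comp continuous_snd)).aestronglyMeasurable.mul
      (L.continuous.comp_aestronglyMeasurable hw.locInt_right.aestronglyMeasurable),
    fun ψ φ hψ h1 h2 => tendsto_nhds_unique (tt_int_cutOff h1)
      (((tt_int_cutOff h2).const_mul _).congr fun n => ?_)⟩
  set c : R3 → ℂ := fun v => cutOff n v * (φ v * θ v) with hc
  have hcc : HasCompactSupport c := HasCompactSupport.of_support_subset_isCompact
    (cutOff n).hasCompactSupport.isCompact fun v hv => subset_tsupport _ fun h => hv (by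
      simp only [hc, h, ofReal_zero, zero_mul])
  have hcs : ContDiff ℝ ∞ c := (ofRealCLM.contDiff.comp (cutOff n).contDiff).mul
    ((φ.smooth ⊤).mul (ofRealCLM.contDiff.comp hθ))
  have hs : ContDiff ℝ ∞ fun z : R3 × R3 => c z.2 * ψ z.1 :=
    (hcs.comp contDiff_snd).mul ((ψ.smooth ⊤).comp contDiff_fst)
  have hψc : HasCompactSupport fun z : R3 × R3 => c z.2 * ψ z.1 :=
    HasCompactSupport.of_support_subset_isCompact (hψ.isCompact.prod hcc.isCompact) fun z hz =>
      ⟨subset_tsupport _ (right_ne_zero_of_mul hz), subset_tsupport _ (left_ne_zero_of_mul hz)⟩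
  have h := hw.integral_eq _ hs hψc
  simp only [md_const_mul, md_schw] at h
  have hi : MemLp (fun z : R3 × R3 => c z.2 * schwD α ψ z.1) 2 := by
    simpa only [mul_comm] using memLp_tens ((schwD α ψ).memLp 2 volume)
      (hcs.continuous.memLp_of_hasCompactSupport hcc)
  have h' := congrArg L h
  rw [map_smul, smul_eq_mul, ← L.integral_comp_comm (intg_smul_L2 hi hg), ← L.integral_comp_comm
    (hw.locInt_right.integrable_smul_left_of_hasCompactSupport hs.continuous hψc)] at h'
  simp only [map_smul, smul_eq_mul, tnS_ap, hc] at h' ⊢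
  refine Eq.trans ?_ (h'.symm.trans ?_)
  · congr 2 with z; ring
  · congr 1 with z; ring

end Components

section SplitXV

variable {w₁ : R3 × R3 → ℂ}

lemma intg_tens_slices (h1 : AEStronglyMeasurable w₁ volume)
    (hN : ∫⁻ v, (∫⁻ x, ‖w₁ (x, v)‖ₑ) ^ 2 < ⊤) {φ} (hφ : MemLp φ 2) :
    Integrable (fun z : R3 × R3 => φ z.2 * w₁ z) := by
  rw [Measure.volume_eq_prod] at h1 ⊢
  have hm : AEStronglyMeasurable (fun z : R3 × R3 => φ z.2 * w₁ z)
    ((vol).prod volume) := hφ.1.comp_snd.mul h1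
  refine ⟨hm, ?_⟩
  rw [HasFiniteIntegral, lintegral_prod_symm _ hm.enorm]
  simp only [enorm_mul, lintegral_const_mul' _ _ enorm_ne_top]
  have h3 := lint_mul_sq_le hφ.1.enorm h1.enorm.lintegral_prod_left'
  have h4 := h3.trans_lt (mul_lt_top (MemLp.lintegral_sq_lt_top hφ) hN)
  by_contra h
  rw [not_lt, top_le_iff] at h
  rw [h] at h4
  exact absurd h4 (by simp)

lemma sum_four_coef_le (h1 : AEStronglyMeasurable w₁ volume)
    (hN : ∫⁻ v, (∫⁻ x, ‖w₁ (x, v)‖ₑ) ^ 2 < ⊤) (F ξ) :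
    ∑ k ∈ F, ‖𝓕 (fun x => ∫ v, hermS k v * w₁ (x, v)) ξ‖ₑ ^ 2 ≤ ∫⁻ v, (∫⁻ x, ‖w₁ (x, v)‖ₑ) ^ 2 := by
  set e : R3 → ℂ := fun x => Real.fourierChar (-inner ℝ x ξ) with he
  have hec : Continuous e := by
    simp only [he]; fun_prop
  have hen x : ‖e x‖ₑ = 1 := by rw [← ofReal_norm, Circle.norm_coe, ofReal_one]
  set om : R3 → ℂ := fun v => ∫ x, e x * w₁ (x, v)
  have hm := (hec.comp continuous_fst).aestronglyMeasurable.mul h1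
  have homle : ∫⁻ v, ‖om v‖ₑ ^ 2 ≤ ∫⁻ v, (∫⁻ x, ‖w₁ (x, v)‖ₑ) ^ 2 := by
    refine lintegral_mono fun v => pow_le_pow_left' ?_ 2
    refine (enorm_integral_le_lintegral_enorm _).trans_eq ?_; simp only [enorm_mul, hen, one_mul]
  have hom : MemLp om 2 := by
    refine memLp_two_lint ?_ (homle.trans_lt hN); rw [Measure.volume_eq_prod] at hm
    exact hm.prod_swap.integral_prod_right'
  have hN' : ∫⁻ v, (∫⁻ x, ‖e x * w₁ (x, v)‖ₑ) ^ 2 < ⊤ := by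
    simpa only [enorm_mul, hen, one_mul] using hN
  set o : MI → L2X := fun k => (memLp_hS k).toLp _ with ho
  have hin k f (hf : MemLp f 2) : inner ℂ (o k) (hf.toLp f) = ∫ v, hermS k v * f v := by
    rw [L2.inner_def]; refine integral_congr_ae ?_
    filter_upwards [(memLp_hS k).coeFn_toLp, hf.coeFn_toLp] with v h1 h2
    rw [h2, ho, h1, inner_apply, conj_hermS, mul_comm]
  have hon : Orthonormal ℂ o := by
    rw [orthonormal_iff_ite]; intro k l; rw [← int_hermS_mul]; exact hin k _ (memLp_hS l)
  have key k : 𝓕 (fun x => ∫ v, hermS k v * w₁ (x, v)) ξ = inner ℂ (o k) (hom.toLp om) := by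
    rw [hin, Real.fourier_eq]; have hi := intg_tens_slices hm hN' (memLp_hS k)
    simp only [Circle.smul_def, smul_eq_mul, om, ← integral_const_mul]
    rw [integral_integral_swap (f := fun v x => hermS k v * (e x * w₁ (x, v))) hi.swap]
    refine integral_congr_ae (.of_forall fun x => integral_congr_ae (.of_forall fun v => ?_))
    simp only [he]; ring
  have h := hon.sum_inner_products_le (s := F) (hom.toLp om)
  have e1 k : ‖𝓕 (fun x => ∫ v, hermS k v * w₁ (x, v)) ξ‖ₑ ^ 2 =
      ofReal (‖(inner ℂ (o k) (hom.toLp om) : ℂ)‖ ^ 2) := by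
    rw [key, ofReal_pow (norm_nonneg _), ofReal_norm]
  rw [sum_congr rfl fun k _ => e1 k, ← ofReal_sum_of_nonneg fun _ _ => by positivity]
  refine (ofReal_le_ofReal h).trans ?_
  rw [ofReal_pow (norm_nonneg _), ofReal_norm, en_sq_Lp]
  refine le_trans (lintegral_congr_ae ?_).le homle
  filter_upwards [hom.coeFn_toLp] with v hv
  rw [hv]

lemma IsTensDeriv.enorm_sub_le {g w w₂ : R3 × R3 → ℂ} (hg : MemLp g 2)
    (hw : IsTensDeriv α g w) (hsum : ∀ z, w z = w₁ z + w₂ z)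
    (h1 : AEStronglyMeasurable w₁ volume) (hN : ∫⁻ v, (∫⁻ x, ‖w₁ (x, v)‖ₑ) ^ 2 < ⊤)
    (h2 : MemLp w₂ 2) :
    ∀ᵐ ξ, ‖symb α ξ • hermF (cls g) ξ - hermF (cls w₂) ξ‖ₑ ^ 2 ≤
      ∫⁻ v, (∫⁻ x, ‖w₁ (x, v)‖ₑ) ^ 2 := by
  have hb k : Integrable fun x => ∫ v, hermS k v * w₁ (x, v) :=
    (intg_tens_slices h1 hN (memLp_hS k)).integral_prod_left
  have hk k : ∀ᵐ ξ, symb α ξ * (𝓕 (hCoef k (cls g)) : L2X) ξ =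
      𝓕 (fun x => ∫ v, hermS k v * w₁ (x, v)) ξ + (𝓕 (hCoef k (cls w₂)) : L2X) ξ := by
    refine symb_mul_four_eq (hb k) fun ψ hψ => ?_
    have hcl {f : R3 × R3 → ℂ} (hf : MemLp f 2) ψ :
        ∫ z, tnS ψ (hermS k) z * f z = ∫ x, ψ x * hCoef k (cls f) x := by
      rw [← int_tnS_mul]; refine integral_congr_ae ?_; filter_upwards [cls_ae hf] with z h
      rw [h]
    have i0 {f : R3 × R3 → ℂ} (hf : MemLp f 2) (ψ : TX) :
        Integrable fun z => tnS ψ (hermS k) z * f z :=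
      ((tnS ψ (hermS k)).memLp 2 volume).integrable_mul hf
    have i1 : Integrable fun z : R3 × R3 => ψ z.1 * (hermS k z.2 * w₁ z) := by
      have hC := ψ.toBoundedContinuousFunction.norm_coe_le_norm
      exact (intg_tens_slices h1 hN (memLp_hS k)).bdd_mul
        (ψ.continuous.comp continuous_fst).aestronglyMeasurable
        (.of_forall fun z => hC z.1)
    have e1 : ∀ z, tnS ψ (hermS k) z * w z =
        ψ z.1 * (hermS k z.2 * w₁ z) + tnS ψ (hermS k) z * w₂ z := fun z => by
      rw [hsum, tnS_ap]; ring
    have e2 : ∫ z : R3 × R3, ψ z.1 * (hermS k z.2 * w₁ z) =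
        ∫ x, ψ x * ∫ v, hermS k v * w₁ (x, v) := by
      rw [Measure.volume_eq_prod] at i1 ⊢; rw [integral_prod _ i1]; simp only [integral_const_mul]
    rw [← hcl hg, hw.eq ψ (hermS k) hψ (i0 hg _) ((i1.add (i0 h2 ψ)).congr
      (.of_forall fun z => (e1 z).symm))]
    simp only [e1, mul_add]
    rw [integral_add i1 (i0 h2 ψ), e2, hcl h2, integral_add _ (intg_schw_mul ψ _)]
    have hC := ψ.toBoundedContinuousFunction.norm_coe_le_norm
    exact (hb k).bdd_mul ψ.continuous.aestronglyMeasurable (.of_forall fun x => hC x)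
  filter_upwards [ae_all_iff.2 hk, ae_all_iff.2 fun k => coL_ae k (hermF (cls g)),
    ae_all_iff.2 fun k => coL_ae k (hermF (cls w₂))] with ξ h3 h4 h5
  set y : HSeq := symb α ξ • hermF (cls g) ξ - hermF (cls w₂) ξ with hy
  have hyk (k : MI) : y k = 𝓕 (fun x => ∫ v, hermS k v * w₁ (x, v)) ξ := by
    rw [hy, lp.coeFn_sub, lp.coeFn_smul, Pi.sub_apply, Pi.smul_apply, ← h4, ← h5,
      coL_hermF, coL_hermF, smul_eq_mul, h3]
    ring
  rw [← ofReal_norm, ← ofReal_pow (norm_nonneg _)]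
  refine ENNReal.ofReal_le_of_le_toReal ?_
  refine le_of_tendsto (hSeq_hasSum_norm_sq y) (.of_forall fun F => ?_)
  rw [← ENNReal.ofReal_le_iff_le_toReal hN.ne, ofReal_sum_of_nonneg fun _ _ => by positivity]
  refine le_trans (le_of_eq ?_) (sum_four_coef_le h1 hN F ξ)
  refine sum_congr rfl fun k _ => ?_
  rw [ofReal_pow (norm_nonneg _), ofReal_norm, hyk]

end SplitXV

lemma IsSchwDeriv.enorm_sub_le {g w w₁ w₂ : R3 → ℂ} (hg : MemLp g 2)
    (hw : IsSchwDeriv α g w) (hsum : ∀ z, w z = w₁ z + w₂ z) (h1 : Integrable w₁)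
    (h2 : MemLp w₂ 2) :
    ∀ᵐ ξ, ‖symb α ξ * (𝓕 (hg.toLp g) : L2X) ξ - (𝓕 (h2.toLp w₂) : L2X) ξ‖ₑ ^ 2 ≤
      (∫⁻ x, ‖w₁ x‖ₑ) ^ 2 := by
  have key : ∀ ψ : TX, HasCompactSupport ψ → ∫ x, schwD α ψ x * hg.toLp g x =
      (-1) ^ ℓ α * ∫ x, ψ x * (w₁ x + h2.toLp w₂ x) := fun ψ hψ => by
    refine Eq.trans ?_ ((hw.eq ψ hψ).trans ?_)
    · refine integral_congr_ae ?_; filter_upwards [hg.coeFn_toLp] with x hx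
      rw [hx]
    · congr 1; refine integral_congr_ae ?_; filter_upwards [h2.coeFn_toLp] with x hx
      rw [hx, ← hsum]
  filter_upwards [symb_mul_four_eq h1 key] with ξ h
  refine pow_le_pow_left' ?_ 2
  rw [h, add_sub_cancel_right, ← ofReal_integral_norm_eq_lintegral_enorm h1, ← ofReal_norm]
  exact ofReal_le_ofReal (norm_four_le w₁ ξ)

/-! ### Weighted frequency bounds -/

def spC (p τ : ℝ) : ℝ≥0∞ := if p = 2 then 0 else ofReal τ ^ (1 - p)

lemma spC_ne_top (hτ : 0 < τ) : spC p τ ≠ ⊤ := by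
  rw [spC]
  split_ifs
  · simp
  · exact ENNReal.rpow_ne_top_of_ne_zero (by simpa using hτ) ofReal_ne_top

def big (p τ : ℝ) (N : ℝ≥0∞) : Set ℝ≥0∞ := {y | p ≠ 2 ∧ ofReal τ * N < y}

section Splitting

variable {X : Type*} [MeasurableSpace X] {μ : Measure X} {f : X → ℝ≥0∞} {p τ : ℝ}

lemma lint_big_le (hp : 1 ≤ p) (hτ : 0 < τ) (hf : AEMeasurable f μ)
    (hN : (∫⁻ x, f x ^ p ∂μ) ^ (1 / p) ≠ ⊤) :
    ∫⁻ x, (f ⁻¹' big p τ ((∫⁻ x, f x ^ p ∂μ) ^ (1 / p))).indicator f x ∂μ ≤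
      spC p τ * (∫⁻ x, f x ^ p ∂μ) ^ (1 / p) := by
  set N := (∫⁻ x, f x ^ p ∂μ) ^ (1 / p) with hNd
  have hp0 : 0 < p := by linarith
  have hNp : ∫⁻ x, f x ^ p ∂μ = N ^ p := by
    rw [hNd, ← rpow_mul, one_div, inv_mul_cancel₀ hp0.ne', rpow_one]
  rw [spC]
  split_ifs with hp2
  · simp [big, hp2]
  have ht0 : ofReal τ ≠ 0 := by simpa using hτ
  rcases eq_or_ne N 0 with h0 | h0
  · rw [h0, mul_zero, nonpos_iff_eq_zero]
    rw [h0, ENNReal.zero_rpow_of_pos hp0, lintegral_eq_zero_iff' (hf.pow_const p)] at hNp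
    refine (lintegral_congr_ae ?_).trans lintegral_zero; filter_upwards [hNp] with x hx
    rw [Pi.zero_apply, ENNReal.rpow_eq_zero_iff_of_pos hp0] at hx
    by_cases h : x ∈ f ⁻¹' big p τ 0 <;> simp [indicator, h, hx]
  have hc : (ofReal τ * N) ^ (p - 1) ≠ 0 := by
    simp [ENNReal.rpow_eq_zero_iff, ht0, h0, hN, ENNReal.mul_eq_top]
  have hc' : (ofReal τ * N) ^ (p - 1) ≠ ⊤ :=
    rpow_ne_top_of_nonneg (by linarith) (mul_ne_top ofReal_ne_top hN)
  have h1 : (ofReal τ * N) ^ (p - 1) * ∫⁻ x, (f ⁻¹' big p τ N).indicator f x ∂μ ≤ N ^ p := by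
    rw [← hNp, ← lintegral_const_mul' _ _ hc']; refine lintegral_mono fun x => ?_
    by_cases h : x ∈ f ⁻¹' big p τ N
    · rw [indicator_of_mem h]
      calc _ ≤ f x ^ (p - 1) * f x ^ (1 : ℝ) := by
            rw [rpow_one]
            exact mul_le_mul_left (ENNReal.rpow_le_rpow h.2.le (by linarith)) _
        _ = f x ^ p := by
            rw [← ENNReal.rpow_add_of_nonneg _ _ (by linarith) zero_le_one, sub_add_cancel]
    · simp [indicator_of_notMem h]
  refine (ENNReal.mul_le_mul_iff_right hc hc').1 (h1.trans_eq ?_)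
  rw [ENNReal.mul_rpow_of_ne_top ofReal_ne_top hN]
  have e1 : ofReal τ ^ (p - 1) * ofReal τ ^ (1 - p) = 1 := by
    rw [← ENNReal.rpow_add _ _ ht0 ofReal_ne_top]; simp
  have e2 : N ^ (p - 1) * N = N ^ p := by
    conv_lhs => rw [← rpow_one N, ← rpow_mul, one_mul]
    rw [← ENNReal.rpow_add_of_nonneg _ _ (by linarith) zero_le_one, sub_add_cancel]
  rw [← e2, mul_mul_mul_comm, e1, one_mul]

lemma lint_small_le (hp : 1 ≤ p) (hp2 : p ≤ 2) (hN : (∫⁻ x, f x ^ p ∂μ) ^ (1 / p) ≠ ⊤) :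
    ∫⁻ x, (f ⁻¹' big p τ ((∫⁻ x, f x ^ p ∂μ) ^ (1 / p)))ᶜ.indicator f x ^ 2 ∂μ ≤
      ofReal τ ^ (2 - p) * ((∫⁻ x, f x ^ p ∂μ) ^ (1 / p)) ^ 2 := by
  set N := (∫⁻ x, f x ^ p ∂μ) ^ (1 / p) with hNd
  have hp0 : 0 < p := by linarith
  have hNp : ∫⁻ x, f x ^ p ∂μ = N ^ p := by
    rw [hNd, ← rpow_mul, one_div, inv_mul_cancel₀ hp0.ne', rpow_one]
  have hsq (y : ℝ≥0∞) : y ^ (2 - p) * y ^ p = y ^ 2 := by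
    rw [← ENNReal.rpow_add_of_nonneg _ _ (by linarith) hp0.le, sub_add_cancel]
    exact ENNReal.rpow_two y
  have hc' : (ofReal τ * N) ^ (2 - p) ≠ ⊤ :=
    rpow_ne_top_of_nonneg (by linarith) (mul_ne_top ofReal_ne_top hN)
  calc _ ≤ ∫⁻ x, (ofReal τ * N) ^ (2 - p) * f x ^ p ∂μ := by
        refine lintegral_mono fun x => ?_
        by_cases h : x ∈ (f ⁻¹' big p τ N)ᶜ
        · rw [indicator_of_mem h, ← hsq]; refine mul_le_mul_left ?_ _
          by_cases hp' : p = 2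
          · simp [hp']
          · exact ENNReal.rpow_le_rpow (not_lt.1 fun h' => h ⟨hp', h'⟩) (by linarith)
        · simp [indicator_of_notMem h]
    _ = _ := by
        rw [lintegral_const_mul' _ _ hc', hNp,
          ENNReal.mul_rpow_of_ne_top ofReal_ne_top hN, mul_assoc, hsq]

end Splitting

def SBd (α : MI) (p : ℝ) (Φ : R3 → ℝ≥0∞) (D : ℝ≥0∞) : Prop :=
  ∀ (τ : ℝ) (m : R3 → ℝ≥0∞) (M : ℝ≥0∞), 0 < τ → AEMeasurable m → (∀ ξ, m ξ ≤ M) → M ≠ ⊤ →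
    spC p τ ^ 2 * ∫⁻ ξ, m ξ ≠ ⊤ → ∫⁻ ξ, m ξ * (‖symb α ξ‖ₑ ^ 2 * Φ ξ) ≤
      2 * (spC p τ ^ 2 * (∫⁻ ξ, m ξ) + ofReal τ ^ (2 - p) * M) * D ^ 2

lemma lint_mul_en_sq_le {F B : R3 → E} (hm : AEMeasurable m) (hM : ∀ ξ, m ξ ≤ M) (hMt : M ≠ ⊤)
    (h1 : ∀ᵐ ξ, ‖F ξ - B ξ‖ₑ ^ 2 ≤ N₁) (hN : N₁ ≠ ⊤) (h2 : ∫⁻ ξ, ‖B ξ‖ₑ ^ 2 ≤ N₂) :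
    ∫⁻ ξ, m ξ * ‖F ξ‖ₑ ^ 2 ≤ 2 * (N₁ * (∫⁻ ξ, m ξ) + M * N₂) := by
  calc ∫⁻ ξ, m ξ * ‖F ξ‖ₑ ^ 2 ≤ ∫⁻ ξ, 2 * (N₁ * m ξ + M * ‖B ξ‖ₑ ^ 2) := by
        refine lintegral_mono_ae ?_; filter_upwards [h1] with ξ h
        have e1 : ‖F ξ‖ₑ ^ 2 ≤ 2 * (‖F ξ - B ξ‖ₑ ^ 2 + ‖B ξ‖ₑ ^ 2) := by
          refine (pow_le_pow_left' (by simpa using enorm_add_le (F ξ - B ξ) (B ξ)) 2).trans ?_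
          simpa [show (2 : ℝ) - 1 = 1 by norm_num] using ENNReal.rpow_add_le_mul_rpow_add_rpow
            ‖F ξ - B ξ‖ₑ ‖B ξ‖ₑ one_le_two
        calc _ ≤ m ξ * (2 * (N₁ + ‖B ξ‖ₑ ^ 2)) := by gcongr; exact e1.trans (by gcongr)
          _ = 2 * (N₁ * m ξ + m ξ * ‖B ξ‖ₑ ^ 2) := by ring
          _ ≤ _ := by gcongr; exact hM ξ
    _ ≤ _ := by
        rw [lintegral_const_mul' _ _ ENNReal.ofNat_ne_top, lintegral_add_left' (hm.const_mul _),
          lintegral_const_mul' _ _ hN, lintegral_const_mul' _ _ hMt]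
        gcongr

lemma le_mul_sq_iInf {ι : Sort*} {D : ι → ℝ≥0∞} (h : ∀ i, x ≤ c * D i ^ 2)
    (hc0 : c = 0 → x = 0) (hc : c ≠ ⊤) : x ≤ c * (⨅ i, D i) ^ 2 := by
  rcases eq_or_ne c 0 with h0 | h0
  · simp [hc0 h0]
  set y := (x / c) ^ (1 / 2 : ℝ) with hy
  have hy2 : y ^ 2 = x / c := by
    rw [hy, ← rpow_natCast, ← rpow_mul]; norm_num
  have h1 : y ≤ ⨅ i, D i := le_iInf fun i => by
    by_contra h2
    have h3 := ENNReal.pow_lt_pow_left two_ne_zero (not_le.1 h2); rw [hy2] at h3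
    exact absurd (ENNReal.div_le_of_le_mul' (h i)) (not_le.2 h3)
  have h2 : x = c * y ^ 2 := by rw [hy2, ENNReal.mul_div_cancel h0 hc]
  rw [h2]
  gcongr

lemma SBd.iInf {ι : Sort*} {D : ι → ℝ≥0∞}
    (h : ∀ i, D i ≠ ⊤ → SBd α p Φ (D i)) : SBd α p Φ (⨅ i, D i) := by
  intro τ m M hτ hm hM hMt hmt
  have hτ0 : ofReal τ ≠ 0 := by simpa using hτ
  have hz : 2 * (spC p τ ^ 2 * (∫⁻ ξ, m ξ) + ofReal τ ^ (2 - p) * M) = 0 →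
      ∫⁻ ξ, m ξ * (‖symb α ξ‖ₑ ^ 2 * Φ ξ) = 0 := fun h0 => by
    have h1 : M = 0 := by
      simpa [ENNReal.rpow_eq_zero_iff, hτ0] using (add_eq_zero.1 ((mul_eq_zero.1 h0).resolve_left
        two_ne_zero)).2
    have h2 ξ : m ξ = 0 := le_antisymm ((hM ξ).trans_eq h1) zero_le
    simp [h2]
  refine le_mul_sq_iInf (fun i => ?_) hz (mul_ne_top ENNReal.ofNat_ne_top
    (ENNReal.add_ne_top.2 ⟨hmt, mul_ne_top (ENNReal.rpow_ne_top_of_ne_zero hτ0 ofReal_ne_top) hMt⟩))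
  by_cases hi : D i = ⊤
  · rcases eq_or_ne (2 * (spC p τ ^ 2 * (∫⁻ ξ, m ξ) + ofReal τ ^ (2 - p) * M)) 0 with h0 | h0
    · rw [hz h0]
      exact zero_le
    · rw [hi, ENNReal.top_pow two_ne_zero, ENNReal.mul_top h0]; exact le_top
  · exact h i hi τ m M hτ hm hM hMt hmt

lemma IsSchwDeriv.specBound {α : MI} (hp : 1 ≤ p) (hp2 : p ≤ 2)
    (hg : MemLp g 2) (hw : IsSchwDeriv α g w)
    (hfin : eLpNorm w (ofReal p) volume ≠ ⊤) :
    SBd α p (fun ξ => ‖(𝓕 (hg.toLp g) : L2X) ξ‖ₑ ^ 2) (eLpNorm w (ofReal p) volume) := by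
  intro τ m M hτ hm hM hMt hmt
  have hwm := hw.meas
  have hp0 : 0 < p := by linarith
  rw [eLpNorm_eq_lintegral_rpow_enorm_toReal (by simpa using hp0) ofReal_ne_top,
    ENNReal.toReal_ofReal hp0.le] at hfin ⊢
  set N := (∫⁻ x, ‖w x‖ₑ ^ p) ^ (1 / p)
  set S : Set R3 := (fun x => ‖w x‖ₑ) ⁻¹' big p τ N with hS
  have hSm : NullMeasurableSet S := by
    by_cases h : p = 2
    · simp [hS, big, h]
    · simp only [hS, big, ne_eq, h, not_false_eq_true, true_and, preimage_ofPred_eq]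
      exact nullMeasurableSet_lt aemeasurable_const hwm.enorm
  have b1 := (lintegral_congr fun x => enorm_indicator_eq_indicator_enorm _ _).trans_le
      (lint_big_le hp hτ hwm.enorm hfin)
  have b2 : ∫⁻ x, ‖Sᶜ.indicator w x‖ₑ ^ 2 ≤ ofReal τ ^ (2 - p) * N ^ 2 :=
    (lintegral_congr fun x => congrArg (· ^ 2) (enorm_indicator_eq_indicator_enorm _ _)).trans_le
      (lint_small_le hp hp2 hfin)
  have hs := spC_ne_top (p := p) hτ
  have hτt : ofReal τ ^ (2 - p) ≠ ⊤ := rpow_ne_top_of_nonneg (by linarith) ofReal_ne_top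
  have hw2 : MemLp (Sᶜ.indicator w) 2 := memLp_two_lint (hwm.indicator₀ hSm.compl)
    (b2.trans_lt (mul_lt_top hτt.lt_top (pow_lt_top hfin.lt_top)))
  have key := hw.enorm_sub_le hg (fun z => (congrFun (indicator_self_add_compl S w) z).symm)
    ⟨hwm.indicator₀ hSm, b1.trans_lt (mul_lt_top hs.lt_top hfin.lt_top)⟩ hw2
  have hB : ∫⁻ ξ, ‖(𝓕 (hw2.toLp _) : L2X) ξ‖ₑ ^ 2 ≤ ofReal τ ^ (2 - p) * N ^ 2 := by
    rw [← en_sq_Lp, ← ofReal_norm, Lp.norm_fourier_eq, ofReal_norm, en_sq_Lp]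
    refine le_trans (lintegral_congr_ae ?_).le b2; filter_upwards [hw2.coeFn_toLp] with x hx
    rw [hx]
  have := lint_mul_en_sq_le hm hM hMt (key.mono fun ξ h => h.trans (pow_le_pow_left' b1 2))
    (pow_ne_top (mul_ne_top hs hfin)) hB
  simp only [enorm_mul, mul_pow] at this
  refine this.trans_eq ?_
  ring

lemma IsTensDeriv.specBound {α : MI} (hp : 1 ≤ p) (hp2 : p ≤ 2)
    (hg : MemLp g 2) (hw : IsTensDeriv α g w) (hfin : kineticNorm p w ≠ ⊤) :
    SBd α p (fun ξ => ‖hermF (cls g) ξ‖ₑ ^ 2) (kineticNorm p w) := by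
  intro τ m M hτ hm hM hMt hmt
  have hwm := hw.meas
  have hp0 : 0 < p := by linarith
  set N : R3 → ℝ≥0∞ := fun v => (∫⁻ x, ‖w (x, v)‖ₑ ^ p) ^ (1 / p) with hNd
  have hk : kineticNorm p w ^ 2 = ∫⁻ v, N v ^ 2 := by
    rw [kineticNorm, ← rpow_natCast, ← rpow_mul]; norm_num; refine lintegral_congr fun v => ?_
    rw [hNd, ← rpow_natCast, ← rpow_mul]; congr 1; push_cast; ring
  rw [hk]
  have hNm : AEMeasurable N volume := by
    have := hwm; rw [Measure.volume_eq_prod] at this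
    exact ((this.enorm.pow_const p).lintegral_prod_left').pow_const _
  have hNt : ∫⁻ v, N v ^ 2 ≠ ⊤ := by
    rw [← hk]; exact pow_ne_top hfin
  have hNa : ∀ᵐ v, N v ≠ ⊤ := by
    filter_upwards [ae_lt_top' (hNm.pow_const 2) hNt] with v hv h
    simp [h] at hv
  set S : Set (R3 × R3) := {z | ‖w z‖ₑ ∈ big p τ (N z.2)} with hS
  have hSm : NullMeasurableSet S := by
    by_cases h : p = 2
    · simp [hS, big, h]
    · simp only [hS, big, ne_eq, h, not_false_eq_true, true_and, mem_ofPred_eq]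
      exact nullMeasurableSet_lt
        ((hNm.comp_quasiMeasurePreserving Measure.quasiMeasurePreserving_snd).const_mul _)
        hwm.enorm
  have b1 : ∀ᵐ v, ∫⁻ x, ‖S.indicator w (x, v)‖ₑ ≤ spC p τ * N v := by
    have hsl : ∀ᵐ v, AEStronglyMeasurable (fun x => w (x, v)) volume := by
      have := hwm; rw [Measure.volume_eq_prod] at this; exact this.prod_swap.prodMk_left
    filter_upwards [hNa, hsl] with v hv hvm
    refine le_trans (le_of_eq ?_) (lint_big_le hp hτ hvm.enorm hv)
    exact lintegral_congr fun x => enorm_indicator_eq_indicator_enorm _ _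
  have b2 : ∫⁻ z, ‖Sᶜ.indicator w z‖ₑ ^ 2 ≤ ofReal τ ^ (2 - p) * ∫⁻ v, N v ^ 2 := by
    have hm2 := (hwm.indicator₀ hSm.compl).enorm.pow_const 2; rw [Measure.volume_eq_prod] at hm2 ⊢
    rw [lintegral_prod_symm _ hm2, ← lintegral_const_mul' _ _
      (rpow_ne_top_of_nonneg (by linarith) ofReal_ne_top)]
    refine lintegral_mono_ae ?_; filter_upwards [hNa] with v hv
    refine le_trans (le_of_eq ?_) (lint_small_le hp hp2 hv)
    exact lintegral_congr fun x => congrArg (· ^ 2) (enorm_indicator_eq_indicator_enorm _ _)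
  have hs := spC_ne_top (p := p) hτ
  have hτt : ofReal τ ^ (2 - p) ≠ ⊤ := rpow_ne_top_of_nonneg (by linarith) ofReal_ne_top
  have b1' : ∫⁻ v, (∫⁻ x, ‖S.indicator w (x, v)‖ₑ) ^ 2 ≤ spC p τ ^ 2 * ∫⁻ v, N v ^ 2 := by
    rw [← lintegral_const_mul' _ _ (pow_ne_top hs)]
    refine lintegral_mono_ae (b1.mono fun v h => ?_); rw [← mul_pow]
    exact pow_le_pow_left' h 2
  have hw2 := memLp_two_lint (hwm.indicator₀ hSm.compl)
    (b2.trans_lt (mul_lt_top hτt.lt_top hNt.lt_top))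
  have hfin' := mul_lt_top (pow_lt_top (n := 2) hs.lt_top) hNt.lt_top
  have key := hw.enorm_sub_le hg (fun z => (congrFun (indicator_self_add_compl S w) z).symm)
    (hwm.indicator₀ hSm) (b1'.trans_lt hfin') hw2
  have hB : ∫⁻ ξ, ‖hermF (cls (Sᶜ.indicator w)) ξ‖ₑ ^ 2 ≤ ofReal τ ^ (2 - p) * ∫⁻ v, N v ^ 2 := by
    rw [← en_sq_Lp, ← ofReal_norm, LinearIsometryEquiv.norm_map, ofReal_norm, en_sq_Lp]
    refine le_trans (lintegral_congr_ae ?_).le b2; filter_upwards [cls_ae hw2] with x hx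
    rw [hx]
  have := lint_mul_en_sq_le hm hM hMt (key.mono fun ξ h => h.trans b1') hfin'.ne hB
  simp only [enorm_smul, mul_pow] at this
  refine this.trans_eq ?_
  ring

lemma SBd.mono (h : SBd α p Φ D) (hD : D ≤ D') : SBd α p Φ D' := fun τ m M hτ hm hM hMt hmt =>
  (h τ m M hτ hm hM hMt hmt).trans (by gcongr)

section Components

variable {E : Type*} [NormedAddCommGroup E] [NormedSpace ℂ E] [CompleteSpace E] {L : E →L[ℂ] ℂ}
  {α : MI} {p : ℝ}

lemma sBd_dNormX (hp : 1 ≤ p) (hp2 : p ≤ 2) (hg : MemLp g 2)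
    (hL : ∀ y, ‖L y‖ ≤ ‖y‖) {a : L2X} (ha : ∀ᵐ x, a x = L (g x)) :
    SBd α p (fun ξ => ‖(𝓕 a : L2X) ξ‖ₑ ^ 2) (derivNormX α p g) := by
  refine SBd.iInf fun w _ => SBd.iInf fun hw hfin => ?_
  have h1 : MemLp (fun x => L (g x)) 2 := L.comp_memLp' hg
  have h2 : a = h1.toLp _ := Lp.ext (by
    filter_upwards [ha, h1.coeFn_toLp] with x e1 e2; rw [e1, e2])
  have h3 : eLpNorm (fun x => L (w x)) (ofReal p) volume ≤
    eLpNorm w (ofReal p) volume := eLpNorm_mono fun x => hL _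
  rw [h2]
  exact ((hw.comp L hg).specBound hp hp2 h1 (ne_top_of_le_ne_top hfin h3)).mono h3

lemma sBd_dNormXV (hp : 1 ≤ p) (hp2 : p ≤ 2) {g : R3 × R3 → E}
    (hg : MemLp g 2) (hL : ∀ y, ‖L y‖ ≤ ‖y‖) {θ : R3 → ℝ} (hθ : ContDiff ℝ ∞ θ)
    (hθ1 : ∀ v, |θ v| ≤ 1) {f : R3 × R3 → ℂ} (hf : MemLp f 2)
    (hfg : ∀ z, f z = θ z.2 * L (g z)) :
    SBd α p (fun ξ => ‖hermF (cls f) ξ‖ₑ ^ 2) (derivNormXV α p g) := by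
  refine SBd.iInf fun w _ => SBd.iInf fun hw hfin => ?_
  have h3 : kineticNorm p (fun z => θ z.2 * L (w z)) ≤ kineticNorm p w := by
    have h4 z : ‖(θ z.2) * L (w z)‖ₑ ≤ ‖w z‖ₑ := by
      rw [← ofReal_norm, ← ofReal_norm, norm_mul, norm_real]
      exact ofReal_le_ofReal ((mul_le_of_le_one_left (norm_nonneg _) (hθ1 z.2)).trans (hL _))
    have hp0 : 0 ≤ p := by linarith
    rw [kineticNorm, kineticNorm]; gcongr; exact h4 _
  obtain rfl : f = _ := funext hfg
  exact ((hw.comp L hg hθ).specBound hp hp2 hf (ne_top_of_le_ne_top hfin h3)).mono h3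

end Components

/-! ### Derivatives of square integrable functions -/

def dXm (α : MI) (q : TXV) : TXV := (dX 0)^[α 0] ((dX 1)^[α 1] ((dX 2)^[α 2] q))

lemma dXm_ap (α q z) : multiDeriv α (fun y => q (y, z.2)) z.1 = dXm α q z := by
  have h i n q : (pderiv i)^[n] (fun y => q (y, z.2)) = fun y => (dX i)^[n] q (y, z.2) := by
    induction n generalizing q with
    | zero => rfl
    | succ n ih =>
      rw [iterate_succ_apply, iterate_succ_apply, ← ih]; congr 1; funext y
      exact (dX_ap i q (y, z.2)).symm
  simp only [multiDeriv, h]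
  rfl

lemma dXm_cjS (α) (q : TXV) : dXm α (cjS q) = cjS (dXm α q) := by
  have h i n q : (dX i)^[n] (cjS q) = cjS ((dX i)^[n] q) :=
    ((Function.Semiconj.iterate_right (f := cjS) (ga := dX i) (gb := dX i)
      (fun q => (ldo_cjS _ q).symm) n) q).symm
  simp only [dXm, h]

lemma hfS_dXm (α q) : ∀ᵐ ξ, hfS (dXm α q) ξ = symb α ξ • hfS q ξ := by
  have h i n q : ∀ᵐ ξ, hfS ((dX i)^[n] q) ξ = (2 * π * I * ξ i) ^ n • hfS q ξ := by
    induction n generalizing q with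
    | zero => simp
    | succ n ih =>
      filter_upwards [ih (dX i q), hfS_dX i q] with ξ h1 h2
      rw [iterate_succ_apply, h1, h2, smul_smul, pow_succ]
  filter_upwards [h 0 (α 0) ((dX 1)^[α 1] ((dX 2)^[α 2] q)), h 1 (α 1) ((dX 2)^[α 2] q),
    h 2 (α 2) q] with ξ h0 h1 h2
  rw [dXm, h0, h1, h2, symb, Fin.prod_univ_three, smul_smul, smul_smul]

lemma conj_symb (α ξ) : (starRingEnd ℂ) (symb α ξ) = (-1) ^ ℓ α * symb α ξ := by
  rw [symb, multiLength, map_prod, ← Finset.prod_pow_eq_pow_sum, ← Finset.prod_mul_distrib]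
  refine prod_congr rfl fun i _ => ?_
  rw [← mul_pow]
  simp [conj_ofNat]

lemma kNorm_two_sq {g : R3 × R3 → E}
    (hg : AEStronglyMeasurable g volume) : kineticNorm 2 g ^ 2 = ∫⁻ z, ‖g z‖ₑ ^ 2 := by
  rw [Measure.volume_eq_prod] at hg ⊢
  rw [lintegral_prod_symm _ (hg.enorm.pow_const 2), kineticNorm, ← rpow_natCast, ← rpow_mul]
  norm_num

lemma memLp_symb_smul [NormedSpace ℂ E] {α}
    {X : Lp E 2 (volume)} (h : ∫⁻ ξ, ‖symb α ξ‖ₑ ^ 2 * ‖X ξ‖ₑ ^ 2 ≠ ⊤) :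
    ∃ hW : MemLp (fun ξ => symb α ξ • X ξ) 2,
      ‖hW.toLp‖ₑ ^ 2 = ∫⁻ ξ, ‖symb α ξ‖ₑ ^ 2 * ‖X ξ‖ₑ ^ 2 := by
  have h1 : ∫⁻ ξ, ‖symb α ξ • X ξ‖ₑ ^ 2 = ∫⁻ ξ, ‖symb α ξ‖ₑ ^ 2 * ‖X ξ‖ₑ ^ 2 := by
    simp only [enorm_smul, mul_pow]
  have hW : MemLp (fun ξ => symb α ξ • X ξ) 2 := memLp_two_lint
    ((cont_symb α).aestronglyMeasurable.smul (Lp.aestronglyMeasurable X))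
    (by rw [h1]; exact h.lt_top)
  refine ⟨hW, ?_⟩
  rw [en_sq_Lp, ← h1]
  refine lintegral_congr_ae ?_
  filter_upwards [hW.coeFn_toLp] with ξ e
  rw [e]

lemma dNormXV_two_sq_le (α : MI) (F : L2XV) :
    derivNormXV α 2 F ^ 2 ≤ ∫⁻ ξ, ‖symb α ξ‖ₑ ^ 2 * ‖hermF F ξ‖ₑ ^ 2 := by
  by_cases hfin : ∫⁻ ξ, ‖symb α ξ‖ₑ ^ 2 * ‖hermF F ξ‖ₑ ^ 2 = ⊤
  · rw [hfin]; exact le_top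
  obtain ⟨hW, hn⟩ := memLp_symb_smul hfin
  set w : L2XV := hermF.symm hW.toLp with hw
  have hwe : hermF w = hW.toLp := hermF.apply_symm_apply _
  have key q : ∫ z, F z * dXm α q z = (-1) ^ ℓ α * ∫ z, w z * q z := by
    rw [← inner_cjS, ← inner_cjS, ← dXm_cjS, ← inner_hermF, ← inner_hermF, hwe,
      L2.inner_def, L2.inner_def, ← integral_const_mul]
    refine integral_congr_ae ?_
    filter_upwards [hfS_dXm α (cjS q), hW.coeFn_toLp] with ξ h1 h2
    change inner ℂ (hfS (dXm α (cjS q)) ξ) _ = _ * inner ℂ (hfS (cjS q) ξ) _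
    rw [h1, h2, inner_smul_left, inner_smul_right, conj_symb, mul_assoc]
  have hd : IsWeakDerivXV α F w := ⟨(Lp.memLp F).locallyIntegrable one_le_two,
    (Lp.memLp w).locallyIntegrable one_le_two, fun ψ hψ hc => by
      have h := key (hc.toSchwartzMap hψ)
      simp only [← dXm_ap, HasCompactSupport.toSchwartzMap_toFun] at h
      simpa only [smul_eq_mul, mul_comm] using h⟩
  calc derivNormXV α 2 F ^ 2 ≤ kineticNorm 2 w ^ 2 := pow_le_pow_left' (iInf₂_le _ hd) 2
    _ = _ := by
        rw [kNorm_two_sq (Lp.aestronglyMeasurable w), ← en_sq_Lp, ← hn, ← hwe,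
          ← ofReal_norm (hermF w), hermF.norm_map w, ofReal_norm]

lemma ex_weakDeriv {α : MI} {a : L2X}
    (hfin : ∫⁻ ξ, ‖symb α ξ‖ₑ ^ 2 * ‖(𝓕 a : L2X) ξ‖ₑ ^ 2 ≠ ⊤) : ∃ w : L2X,
    (∀ ψ : TX, ∫ x, schwD α ψ x * a x = (-1) ^ ℓ α * ∫ x, ψ x * w x) ∧
    ∫⁻ x, ‖w x‖ₑ ^ 2 = ∫⁻ ξ, ‖symb α ξ‖ₑ ^ 2 * ‖(𝓕 a : L2X) ξ‖ₑ ^ 2 := by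
  obtain ⟨hW, hn⟩ := memLp_symb_smul hfin
  have he : 𝓕 (finvL hW.toLp) = hW.toLp := fourL_finvL _
  refine ⟨finvL hW.toLp, int_schwD_mul_four ?_, ?_⟩
  · rw [he]; exact hW.coeFn_toLp
  · rw [← hn, ← en_sq_Lp, ← ofReal_norm, ← Lp.norm_fourier_eq, he, ofReal_norm]

lemma isWeakDerivX_schw [NormedSpace ℂ E] {α} {a w : Lp E 2 (volume)}
    (h : ∀ ψ, ∫ x, schwD α ψ x • a x = (-1 : ℂ) ^ ℓ α • ∫ x, ψ x • w x) :
    IsWeakDerivX α a w := ⟨(Lp.memLp a).locallyIntegrable one_le_two,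
  (Lp.memLp w).locallyIntegrable one_le_two, fun ψ hψ hc => by
    have := h (hc.toSchwartzMap hψ); rw [← md_schw] at this; exact this⟩

lemma dNormX_two_sq_le [NormedSpace ℂ E] {α} {a w : Lp E 2 (volume)} (h : IsWeakDerivX α a w) :
    derivNormX α 2 a ^ 2 ≤ ∫⁻ x, ‖w x‖ₑ ^ 2 := by
  have h1 : derivNormX α 2 a ≤ eLpNorm w (ofReal 2) volume := iInf₂_le _ h
  rw [ofReal_ofNat] at h1
  exact (pow_le_pow_left' h1 2).trans_eq (eLpNorm_two_sq _)

lemma dNormX_rho_le (α : MI) (a : L2X) :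
    derivNormX α 2 a ^ 2 ≤ ∫⁻ ξ, ‖symb α ξ‖ₑ ^ 2 * ‖(𝓕 a : L2X) ξ‖ₑ ^ 2 := by
  by_cases hfin : ∫⁻ ξ, ‖symb α ξ‖ₑ ^ 2 * ‖(𝓕 a) ξ‖ₑ ^ 2 = ⊤
  · rw [hfin]; exact le_top
  obtain ⟨w, h1, h2⟩ := ex_weakDeriv hfin
  rw [← h2]
  exact dNormX_two_sq_le (isWeakDerivX_schw h1)

lemma dNormX_u_le (α : MI) (u : Lx C3) :
    derivNormX α 2 u ^ 2 ≤ ∑ j, ∫⁻ ξ, ‖symb α ξ‖ₑ ^ 2 * ‖(𝓕 (cU j u) : L2X) ξ‖ₑ ^ 2 := by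
  by_cases hfin : ∀ j, ∫⁻ ξ, ‖symb α ξ‖ₑ ^ 2 * ‖(𝓕 (cU j u) : L2X) ξ‖ₑ ^ 2 ≠ ⊤
  swap
  · push Not at hfin
    rw [ENNReal.sum_eq_top.2 (by simpa using hfin)]
    exact le_top
  choose w h1 h2 using fun j => ex_weakDeriv (hfin j)
  set W : Lx C3 := ∑ j, singleU j (w j) with hW
  have hWj j : ∀ᵐ x, W x j = w j x := by
    have : cU j W = w j := by simp [hW, cU_singleU]
    filter_upwards [cU_ae j W] with x e; rw [← e, this]
  have hp j (θ : TX) (y : Lx C3) :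
      (∫ x, θ x • y x) j = ∫ x, θ x * y x j := ((proj (𝕜 := ℂ) j).integral_comp_comm
    (intg_smul_L2 (θ.memLp 2 volume) (Lp.memLp y))).symm
  have hd : IsWeakDerivX α u W := isWeakDerivX_schw fun ψ => by
    ext j; rw [PiLp.smul_apply, hp, hp, smul_eq_mul]; refine Eq.trans ?_ ((h1 j ψ).trans ?_)
    · refine integral_congr_ae ?_; filter_upwards [cU_ae j u] with x e
      rw [e]
    · congr 1; refine integral_congr_ae ?_; filter_upwards [hWj j] with x e
      rw [e]
  simp only [← h2]
  rw [← lintegral_finsetSum' _ fun j _ => (Lp.aestronglyMeasurable (w j)).enorm.pow_const 2]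
  refine (dNormX_two_sq_le hd).trans_eq (lintegral_congr_ae ?_)
  filter_upwards [ae_all_iff.2 hWj] with x e
  simp only [← e, ← ofReal_norm, ← ofReal_pow (norm_nonneg _)]
  rw [← ofReal_sum_of_nonneg fun _ _ => by positivity, norm_sq_eq]

lemma en_sq_toS (κ) (U : State) : ∀ᵐ ξ, ‖toS κ U ξ‖ₑ ^ 2 = ofReal (κ ^ 2) * ‖(𝓕 U.1 : L2X) ξ‖ₑ ^ 2 +
      ∑ j, ‖(𝓕 (cU j U.2.1) : L2X) ξ‖ₑ ^ 2 + ‖hermF U.2.2 ξ‖ₑ ^ 2 := by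
  have h0 := projL_none_toS κ U
  filter_upwards [projL_ae (inl none) (toS κ U),
    ae_all_iff.2 fun j => projL_ae (inl (some j)) (toS κ U), projF_ae (toS κ U),
    Lp.coeFn_smul (κ : ℂ) (𝓕 U.1)] with ξ h1 h2 h3 h4
  rw [projF_toS] at h3
  rw [h0, h4, Pi.smul_apply, fco_inl] at h1
  simp only [projL_some_toS, fco_inl] at h2
  rw [h3]
  simp only [h2, ← ofReal_norm, ← ofReal_pow (norm_nonneg _)]
  rw [← ofReal_mul (sq_nonneg _), ← ofReal_sum_of_nonneg fun _ _ => by positivity,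
    ← ofReal_add (by positivity) (by positivity),
    ← ofReal_add (by positivity) (by positivity), fib_nsq,
    norm_sq_eq (toS κ U ξ).fst, sum_option, ← h1, norm_smul,
    norm_real, mul_pow, norm_eq_abs, sq_abs]

lemma ex_dNorm_le (hκ : 0 < κ) (α : MI) : ∃ C : ℝ, 0 < C ∧ ∀ U : State,
    U.toFields.derivNorm α 2 ^ 2 ≤ ofReal C * ∫⁻ ξ, ‖symb α ξ‖ₑ ^ 2 * ‖toS κ U ξ‖ₑ ^ 2 := by
  have hC : 0 < 1 + (κ ^ 2)⁻¹ := by positivity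
  refine ⟨10 * (1 + (κ ^ 2)⁻¹), by positivity, fun U => ?_⟩
  set J := ∫⁻ ξ, ‖symb α ξ‖ₑ ^ 2 * ‖toS κ U ξ‖ₑ ^ 2
  have hsum {Φ : R3 → ℝ≥0∞} (h : ∀ᵐ ξ, Φ ξ ≤ ofReal (1 + (κ ^ 2)⁻¹) *
      ‖toS κ U ξ‖ₑ ^ 2) : ∫⁻ ξ, ‖symb α ξ‖ₑ ^ 2 * Φ ξ ≤ ofReal (1 + (κ ^ 2)⁻¹) * J := by
    rw [← lintegral_const_mul' _ _ ofReal_ne_top]; refine lintegral_mono_ae (h.mono fun ξ h => ?_)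
    rw [mul_left_comm]; gcongr
  have h1 : ofReal 1 ≤ ofReal (1 + (κ ^ 2)⁻¹) :=
    ofReal_le_ofReal (le_add_of_nonneg_right (by positivity))
  rw [ofReal_one] at h1
  have e1 : derivNormXV α 2 U.2.2 ^ 2 ≤ ofReal (1 + (κ ^ 2)⁻¹) * J := by
    refine (dNormXV_two_sq_le α U.2.2).trans (hsum ?_); filter_upwards [en_sq_toS κ U] with ξ h
    rw [h]; exact le_trans le_add_self (le_mul_of_one_le_left' h1)
  have e2 : derivNormX α 2 U.1 ^ 2 ≤ ofReal (1 + (κ ^ 2)⁻¹) * J := by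
    refine (dNormX_rho_le α U.1).trans (hsum ?_); filter_upwards [en_sq_toS κ U] with ξ h
    rw [h]
    refine le_trans ?_ (mul_le_mul_right (le_self_add.trans le_self_add) _)
    rw [← mul_assoc, ← ofReal_mul hC.le]; refine le_mul_of_one_le_left' (ENNReal.one_le_ofReal.2 ?_)
    rw [add_mul, inv_mul_cancel₀ (by positivity)]; nlinarith [sq_nonneg κ]
  have e3 : derivNormX α 2 U.2.1 ^ 2 ≤ ofReal (1 + (κ ^ 2)⁻¹) * J := by
    refine (dNormX_u_le α U.2.1).trans ?_; rw [← lintegral_finsetSum' _ fun j _ => ?_]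
    · simp only [← mul_sum]; refine hsum ?_; filter_upwards [en_sq_toS κ U] with ξ h
      rw [h]
      exact le_trans (le_add_self.trans le_self_add) (le_mul_of_one_le_left' h1)
    · exact ((cont_symb α).aestronglyMeasurable.enorm.pow_const 2).mul
        ((Lp.aestronglyMeasurable _).enorm.pow_const 2)
  have hsq (a b : ℝ≥0∞) : (a + b) ^ 2 ≤ 2 * (a ^ 2 + b ^ 2) := by
    simpa [show (2 : ℝ) - 1 = 1 by norm_num] using
      ENNReal.rpow_add_le_mul_rpow_add_rpow a b one_le_two
  change (derivNormXV α 2 U.2.2 + derivNormX α 2 U.1 + derivNormX α 2 U.2.1) ^ 2 ≤ _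
  rw [ofReal_mul (by norm_num), mul_assoc]
  set K := ofReal (1 + (κ ^ 2)⁻¹) * J with hK
  calc _ ≤ 2 * (2 * (K + K) + K) := by
        refine (hsq _ _).trans ?_; gcongr; refine (hsq _ _).trans ?_; gcongr
    _ = _ := by
        norm_num; ring

/-! ### Decay of the weighted frequency integrals -/

lemma norm_symb_le (α ξ) : ‖symb α ξ‖ ≤ ‖(2 * π) • ξ‖ ^ ℓ α := by
  rw [symb, norm_prod, multiLength, ← Finset.prod_pow_eq_pow_sum]
  refine Finset.prod_le_prod (fun _ _ => norm_nonneg _) fun i _ => ?_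
  rw [norm_pow]
  refine pow_le_pow_left₀ (norm_nonneg _) ?_ _
  rw [norm_smul]
  simp only [norm_mul, norm_real, Complex.norm_ofNat, norm_I, mul_one, Real.norm_ofNat]
  gcongr
  exact PiLp.norm_apply_le ξ i

lemma en_symb_sq_le (hα : α' ≤ α) (ξ) : ‖symb α ξ‖ₑ ^ 2 ≤
    ofReal ((‖(2 * π) • ξ‖ ^ 2) ^ ℓ (α - α')) * ‖symb α' ξ‖ₑ ^ 2 := by
  have h : symb α ξ = symb (α - α') ξ * symb α' ξ := by
    rw [symb, symb, symb, ← Finset.prod_mul_distrib]; refine prod_congr rfl fun i _ => ?_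
    rw [← pow_add, Pi.sub_apply, Nat.sub_add_cancel (hα i)]
  rw [h, enorm_mul, mul_pow, ← ofReal_norm (symb (α - α') ξ), ← ofReal_pow (norm_nonneg _),
    pow_right_comm]
  gcongr
  exact norm_symb_le _ ξ

lemma pow_le_mul_exp (hc : 0 < c) (hx : 0 ≤ x) (n) :
    x ^ n ≤ n.factorial * (c⁻¹) ^ n * exp (c * x) := by
  have h := Real.pow_div_factorial_le_exp (c * x) (by positivity) n
  rw [div_le_iff₀ (by positivity), mul_pow] at h
  calc x ^ n = (c⁻¹) ^ n * (c ^ n * x ^ n) := by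
        rw [← mul_assoc, ← mul_pow, inv_mul_cancel₀ hc.ne', one_pow, one_mul]
    _ ≤ (c⁻¹) ^ n * (exp (c * x) * n.factorial) := by gcongr
    _ = _ := by ring

lemma decayRate_sq (p m) (ht : 0 ≤ t) :
    decayRate p m t ^ 2 = (1 + t) ^ (-3 * (1 / p - 1 / 2) - m : ℝ) := by
  rw [decayRate, ← Real.rpow_natCast, ← Real.rpow_mul (by linarith)]
  congr 1
  push_cast
  ring

lemma ex_gaussian_decay (hp : 1 ≤ p) (m) (hc : 0 < c) :
    ∃ C : ℝ, 0 < C ∧ ∀ (α) (Φ : R3 → ℝ≥0∞) (D : ℝ≥0∞), SBd α p Φ D →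
      ∀ t : ℝ, 0 ≤ t → ∀ w : R3 → ℝ≥0∞, (∀ ξ, w ξ ≤ ofReal
        ((‖(2 * π) • ξ‖ ^ 2) ^ m * exp (-(c * ‖(2 * π) • ξ‖ ^ 2 * (1 + t))))) →
      ∫⁻ ξ, w ξ * (‖symb α ξ‖ₑ ^ 2 * Φ ξ) ≤ ofReal (C * decayRate p m t ^ 2) * D ^ 2 := by
  set C₀ : ℝ := m.factorial * ((c / 2)⁻¹) ^ m with hC₀
  have hC₀p : 0 < C₀ := by positivity
  set b₀ : ℝ := c / 2 * (2 * π) ^ 2 with hb₀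
  have hb₀p : 0 < b₀ := by positivity
  set C₁ : ℝ := C₀ * (π / b₀) ^ (3 / 2 : ℝ) with hC₁
  have hC₁p : 0 < C₁ := by positivity
  refine ⟨2 * (C₁ + C₀), by positivity, fun α Φ D hΦ t ht w hw => ?_⟩
  set T := 1 + t with hT
  have hTp : 0 < T := by linarith
  set g : R3 → ℝ := fun ξ => C₀ * T⁻¹ ^ m * exp (-(b₀ * T) * ‖ξ‖ ^ 2) with hg
  have hgp ξ : 0 ≤ g ξ := by positivity
  have hwg ξ : w ξ ≤ ofReal (g ξ) := by
    refine (hw ξ).trans (ofReal_le_ofReal ?_); set x := ‖(2 * π) • ξ‖ ^ 2 with hx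
    have h1 := pow_le_mul_exp (c := c / 2) (x := x * T) (by positivity) (by positivity) m
    have h2 : x = (2 * π) ^ 2 * ‖ξ‖ ^ 2 := by
      rw [hx, norm_smul, mul_pow, Real.norm_of_nonneg (by positivity)]
    have h3 : exp (c / 2 * (x * T)) * exp (-(c * x * T)) = exp (-(b₀ * T) * ‖ξ‖ ^ 2) := by
      rw [← exp_add, hb₀, h2]; congr 1; ring
    calc x ^ m * exp (-(c * x * T)) =
          T⁻¹ ^ m * ((x * T) ^ m * exp (-(c * x * T))) := by
          rw [mul_pow, inv_pow]; field_simp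
      _ ≤ T⁻¹ ^ m * (C₀ * exp (c / 2 * (x * T)) * exp (-(c * x * T))) := by gcongr
      _ = g ξ := by
          rw [mul_assoc C₀, h3, hg]; ring
  have hgle ξ : ofReal (g ξ) ≤ ofReal (C₀ * T⁻¹ ^ m) :=
    ofReal_le_ofReal (mul_le_of_le_one_right (by positivity)
      (Real.exp_le_one_iff.2 (by rw [neg_mul]; exact neg_nonpos.2 (by positivity))))
  have hbT : 0 < b₀ * T := by positivity
  have hint : ∫⁻ ξ, ofReal (g ξ) = ofReal (C₁ * T⁻¹ ^ m * T ^ (-(3 / 2) : ℝ)) := by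
    have e := GaussianFourier.integral_rexp_neg_mul_sq_norm (V := R3) hbT
    rw [finrank_euclideanSpace_fin] at e
    have hi : Integrable g := Integrable.const_mul (by
      by_contra h
      rw [integral_undef h] at e; exact absurd e (by positivity)) _
    rw [← ofReal_integral_eq_lintegral_ofReal hi (.of_forall hgp), hg,
      integral_const_mul, e, ← div_div, Real.div_rpow (by positivity) hTp.le, hC₁,
      Real.rpow_neg hTp.le]
    congr 1; push_cast; ring
  have hτ : 0 < T ^ (-3 / (2 * p)) := Real.rpow_pos_of_pos hTp _
  have hs : spC p (T ^ (-3 / (2 * p))) ^ 2 ≤ ofReal (T ^ (3 - 3 / p)) := by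
    rw [spC]; split_ifs
    · simp
    · rw [ENNReal.ofReal_rpow_of_pos hτ, ← ofReal_pow (Real.rpow_nonneg hτ.le _),
        ← Real.rpow_mul hTp.le, ← Real.rpow_natCast, ← Real.rpow_mul hTp.le]
      refine le_of_eq (congrArg _ (congrArg _ ?_)); push_cast; field_simp
      ring
  have hs2 : ofReal (T ^ (-3 / (2 * p))) ^ (2 - p) = ofReal (T ^ (3 / 2 - 3 / p)) := by
    rw [ENNReal.ofReal_rpow_of_pos hτ, ← Real.rpow_mul hTp.le]; refine congrArg _ (congrArg _ ?_)
    field_simp; ring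
  have hTm : T⁻¹ ^ m = T ^ (-m : ℝ) := by rw [Real.rpow_neg hTp.le, Real.rpow_natCast, inv_pow]
  have hd := decayRate_sq p m ht
  rw [← hT] at hd
  have main := hΦ _ _ _ hτ (by fun_prop : AEMeasurable fun ξ => ofReal (g ξ)) hgle
    ofReal_ne_top (mul_ne_top (pow_ne_top (spC_ne_top hτ)) (by rw [hint]; exact ofReal_ne_top))
  refine (lintegral_mono fun ξ => mul_le_mul_left (hwg ξ) _).trans (main.trans ?_)
  gcongr
  rw [hint, hs2, mul_assoc 2 (C₁ + C₀), ofReal_mul zero_le_two, ofReal_ofNat]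
  gcongr
  rw [← ofReal_mul (by positivity), add_mul, ofReal_add (by positivity) (by positivity)]
  refine add_le_add ((mul_le_mul_left hs _).trans_eq ?_) (le_of_eq ?_)
  · rw [← ofReal_mul (by positivity)]; congr 1
    rw [hd, mul_left_comm, mul_assoc, hTm, ← rpow_add hTp, ← rpow_add hTp]
    ring_nf
  · congr 1; rw [hd, hTm, mul_left_comm, ← rpow_add hTp]; ring_nf

section Decay

variable {p lam : ℝ} {α α' : MI}

lemma exists_low_decay (hp : 1 ≤ p) (hl : 0 < lam) (hα : α' ≤ α) :
    ∃ C : ℝ, 0 < C ∧ ∀ (Φ) (D), SBd α' p Φ D → ∀ t : ℝ, 0 ≤ t →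
      ∀ χ : R3 → ℝ≥0∞, (∀ ξ, χ ξ ≤ 1) → (∀ ξ, r < ‖(2 * π) • ξ‖ → χ ξ = 0) →
      ∫⁻ ξ, χ ξ * (‖symb α ξ‖ₑ ^ 2 * ofReal (exp (-(rate lam ((2 * π) • ξ) * t))) * Φ ξ) ≤
      ofReal (C * decayRate p (ℓ (α - α')) t ^ 2) * D ^ 2 := by
  have hr : 0 < 1 + r ^ 2 := by positivity
  set c := lam / (1 + r ^ 2) with hc
  obtain ⟨C, hC, h⟩ := ex_gaussian_decay hp (ℓ (α - α')) (c := c) (by positivity)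
  refine ⟨exp lam * C, by positivity, fun Φ D hΦ t ht χ hχ1 hχ0 => ?_⟩
  rw [mul_assoc, ofReal_mul (by positivity), mul_assoc]
  refine le_trans ?_ (mul_le_mul_right (h α' Φ D hΦ t ht (fun ξ => χ ξ * ofReal
    ((‖(2 * π) • ξ‖ ^ 2) ^ ℓ (α - α') * exp (-(c * ‖(2 * π) • ξ‖ ^ 2 * (1 + t)))))
    fun ξ => mul_le_of_le_one_left' (hχ1 ξ)) _)
  rw [← lintegral_const_mul' _ _ ofReal_ne_top]
  refine lintegral_mono fun ξ => ?_
  dsimp only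
  set x := ‖(2 * π) • ξ‖ with hx
  by_cases hxr : r < x
  · rw [hχ0 ξ hxr, zero_mul]; exact zero_le
  have hx2 := pow_le_pow_left₀ (norm_nonneg _) (not_lt.1 hxr) 2
  have h1 : exp (-(rate lam ((2 * π) • ξ) * t)) ≤ exp lam * exp (-(c * x ^ 2 * (1 + t))) := by
    rw [← exp_add, Real.exp_le_exp, rate, ← hx]
    have e1 : c * x ^ 2 ≤ lam * (x ^ 2 / (1 + x ^ 2)) := by
      rw [hc, div_mul_eq_mul_div, ← mul_div_assoc]; gcongr
    have e2 : c * x ^ 2 ≤ lam := by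
      rw [hc, div_mul_eq_mul_div, div_le_iff₀ hr]; nlinarith
    nlinarith
  calc _ ≤ χ ξ * ((ofReal ((x ^ 2) ^ ℓ (α - α')) * ‖symb α' ξ‖ₑ ^ 2) *
        ofReal (exp lam * exp (-(c * x ^ 2 * (1 + t)))) * Φ ξ) := by
        gcongr; exact en_symb_sq_le hα ξ
    _ = _ := by
        rw [ofReal_mul (Real.exp_nonneg _), ofReal_mul (by positivity)]
        ring

lemma ex_exp_le_decayRate (hp : 1 ≤ p) (m) (hl : 0 < lam) : ∃ C, 0 < C ∧
    ∀ t, 0 ≤ t → exp (-(lam * t)) ≤ C * decayRate p m t ^ 2 := by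
  refine ⟨(m + 3).factorial * (lam⁻¹) ^ (m + 3) * exp lam, by positivity, fun t ht => ?_⟩
  have hT : 0 < 1 + t := by linarith
  have h := pow_le_mul_exp hl hT.le (m + 3)
  rw [decayRate_sq p m ht]
  have h2 : (1 + t) ^ (-((m + 3 : ℕ) : ℝ)) ≤ (1 + t) ^ (-3 * (1 / p - 1 / 2) - m : ℝ) := by
    refine Real.rpow_le_rpow_of_exponent_le (by linarith) ?_
    have := (div_le_one (by linarith)).2 hp; push_cast; linarith
  rw [Real.rpow_neg hT.le, Real.rpow_natCast] at h2
  refine le_trans ?_ (mul_le_mul_of_nonneg_left h2 (by positivity))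
  rw [← div_eq_mul_inv, le_div_iff₀ (by positivity)]
  calc exp (-(lam * t)) * (1 + t) ^ (m + 3)
      ≤ exp (-(lam * t)) * ((m + 3).factorial * (lam⁻¹) ^ (m + 3) *
        exp (lam * (1 + t))) := by gcongr
    _ = _ := by
        rw [mul_left_comm, ← exp_add]; ring_nf

lemma exists_full_decay (hp : 1 ≤ p) (hl : 0 < lam) (hα : α' ≤ α) :
    ∃ C : ℝ, 0 < C ∧ ∀ (Φ) (D D₂), AEMeasurable Φ → SBd α' p Φ D →
      SBd α 2 Φ D₂ → ∀ t : ℝ, 0 ≤ t → ∫⁻ ξ, ‖symb α ξ‖ₑ ^ 2 *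
        ofReal (exp (-(rate lam ((2 * π) • ξ) * t))) * Φ ξ ≤
      ofReal (C * decayRate p (ℓ (α - α')) t ^ 2) * (D ^ 2 + D₂ ^ 2) := by
  obtain ⟨C₁, hC₁, h1⟩ := exists_low_decay hp hl hα (r := 1)
  obtain ⟨C₂, hC₂, h2⟩ := ex_exp_le_decayRate hp (ℓ (α - α')) (half_pos hl)
  refine ⟨C₁ + 2 * C₂, by positivity, fun Φ D D₂ hΦm hΦ hΦ₂ t ht => ?_⟩
  set S : Set R3 := {ξ | 1 < ‖(2 * π) • ξ‖}
  have hS : MeasurableSet S := measurableSet_lt measurable_const (by fun_prop)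
  set e : R3 → ℝ≥0∞ := fun ξ => ofReal (exp (-(rate lam ((2 * π) • ξ) * t))) with he
  have hem : Measurable e := by
    simp only [he, rate]; fun_prop
  have low := h1 Φ D hΦ t ht (Sᶜ.indicator 1) (fun ξ => indicator_le_self' (fun _ _ => zero_le) ξ)
    fun ξ hξ => indicator_of_notMem (s := Sᶜ) (notMem_compl_iff.2 hξ) _
  have high := hΦ₂ 1 (S.indicator e) (ofReal (exp (-(lam / 2 * t)))) one_pos
    (hem.indicator hS).aemeasurable (fun ξ => by
      by_cases hξ : ξ ∈ S
      · rw [indicator_of_mem hξ]; refine ofReal_le_ofReal (Real.exp_le_exp.2 (neg_le_neg ?_))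
        have h3 : 1 < ‖(2 * π) • ξ‖ := hξ
        have h4 : 1 / 2 ≤ ‖(2 * π) • ξ‖ ^ 2 / (1 + ‖(2 * π) • ξ‖ ^ 2) := by
          rw [div_le_div_iff₀ two_pos (by positivity)]; nlinarith
        rw [rate, div_eq_mul_one_div]; gcongr
      · rw [indicator_of_notMem hξ]; exact zero_le) ofReal_ne_top (by simp [spC])
  simp only [spC, if_true, ne_eq, OfNat.ofNat_ne_zero, not_false_eq_true, zero_pow, zero_mul,
    zero_add, sub_self, ENNReal.rpow_zero, one_mul] at high
  have hsplit : ∫⁻ ξ, ‖symb α ξ‖ₑ ^ 2 * e ξ * Φ ξ = (∫⁻ ξ, Sᶜ.indicator 1 ξ *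
      (‖symb α ξ‖ₑ ^ 2 * e ξ * Φ ξ)) + ∫⁻ ξ, S.indicator e ξ * (‖symb α ξ‖ₑ ^ 2 * Φ ξ) := by
    have hm : AEMeasurable fun ξ => S.indicator e ξ * (‖symb α ξ‖ₑ ^ 2 * Φ ξ) :=
      (hem.indicator hS).aemeasurable.mul
        (((cont_symb α).measurable.enorm.pow_const 2).aemeasurable.mul hΦm)
    rw [← lintegral_add_right' _ hm]; refine lintegral_congr fun ξ => ?_
    by_cases hξ : ξ ∈ S
    · simp only [indicator_of_mem hξ, indicator_of_notMem (notMem_compl_iff.2 hξ)]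
      ring
    · simp [indicator_of_notMem hξ, indicator_of_mem (mem_compl hξ)]
  rw [hsplit, add_mul, ofReal_add (by positivity) (by positivity), mul_assoc 2,
    ofReal_mul zero_le_two, ofReal_ofNat, add_mul]
  refine add_le_add (low.trans (mul_le_mul_right le_self_add _)) (high.trans ?_)
  gcongr
  · exact h2 t ht
  · exact le_add_self

end Decay

/-! ### Representation of the sources -/

lemma nu_pos (v) : 0 < nu v := by
  unfold nu
  positivity

def srcW (o : Option (Fin 3)) (v : R3) : ℝ := (o.elim 1 fun j => v j) * nu v ^ (-(1 / 2) : ℝ)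

def srcFun (G : R3 × R3 → C3) (h : R3 × R3 → ℂ) : SrcIdx → R3 × R3 → ℂ
  | inl i, z => G z i
  | inr o, z => srcW o z.2 * weighted h z

lemma nu_rpow_sq (v) : (nu v ^ (-(1 / 2) : ℝ)) ^ 2 = (nu v)⁻¹ := by
  rw [← Real.rpow_natCast, ← Real.rpow_mul (nu_pos v).le]
  norm_num [Real.rpow_neg_one]

lemma cd_srcW (o : Option (Fin 3)) : ContDiff ℝ ∞ (srcW o) := by
  have h : ContDiff ℝ ∞ nu := contDiff_const.add (contDiff_id.norm_sq ℝ)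
  refine ContDiff.mul ?_ (h.rpow_const_of_ne fun v => (nu_pos v).ne')
  cases o with
  | none => exact contDiff_const
  | some j => exact (proj (𝕜 := ℝ) j).contDiff

lemma abs_srcW_le (o : Option (Fin 3)) (v) : |srcW o v| ≤ 1 := by
  rw [← sq_le_one_iff_abs_le_one, srcW, mul_pow, nu_rpow_sq, ← div_eq_mul_inv,
    div_le_one (nu_pos v), nu]
  cases o with
  | none => exact (one_pow 2).le.trans (le_add_of_nonneg_right (by positivity))
  | some j =>
    have := pow_le_pow_left₀ (abs_nonneg _) (abs_le_norm v j) 2; rw [sq_abs] at this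
    exact this.trans (le_add_of_nonneg_left zero_le_one)

section Fixed

variable {G : R3 × R3 → C3} {h : R3 × R3 → ℂ}

lemma srcF_split (z) : h z = srcFun G h (inr none) z +
    ∑ j, z.2 j * srcFun G h (inr (some j)) z := by
  have hc : ((nu z.2 ^ (-(1 / 2) : ℝ) : ℝ) : ℂ) ^ 2 * (1 + ∑ j, (z.2 j : ℂ) ^ 2) = 1 := by
    have h1 := nu_rpow_sq z.2
    have h2 : nu z.2 = 1 + ∑ j, z.2 j ^ 2 := by
      rw [nu, norm_sq_eq]; simp
    have h3 : (nu z.2 ^ (-(1 / 2) : ℝ)) ^ 2 * (1 + ∑ j, z.2 j ^ 2) = 1 := by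
      rw [h1, ← h2, inv_mul_cancel₀ (nu_pos _).ne']
    exact_mod_cast congrArg Complex.ofReal h3
  simp only [srcFun, srcW, weighted, Option.elim, Fin.sum_univ_three, real_smul,
    Complex.ofReal_mul, Complex.ofReal_one] at hc ⊢
  linear_combination (-h z) * hc

lemma memLp_srcF (hG : MemLp G 2) (hh : MemLp (weighted h) 2) (r) : MemLp (srcFun G h r) 2 := by
  rcases r with i | o
  · exact hG.eval_piLp i
  · refine hh.of_le (((continuous_ofReal.comp (cd_srcW o).continuous).comp
      continuous_snd).aestronglyMeasurable.mul hh.1) (.of_forall fun z => ?_)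
    change ‖(srcW o z.2) * weighted h z‖ ≤ _; rw [norm_mul, norm_real]
    exact mul_le_of_le_one_left (norm_nonneg _) (abs_srcW_le o z.2)

def srcG (G : R3 × R3 → C3) (h : R3 × R3 → ℂ) (r : SrcIdx) : HL2 := hermF (cls (srcFun G h r))

lemma inner_hfS_cls {f} (hf : MemLp f 2) (g : TXV) :
    inner ℂ (hfS (cjS g)) (hermF (cls f)) = ∫ z, f z * g z := by
  rw [hfS, inner_hermF, inner_cjS]
  refine integral_congr_ae ?_
  filter_upwards [cls_ae hf] with z hz
  rw [hz]

lemma sourcePairing_cjS (hX : ∀ r, MemLp (srcFun G h r) 2) (q : TXV) :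
    sourcePairing G h (cjS q) = srcPair q (srcG G h) := by
  rw [← cjS_cjS q]
  generalize cjS q = g
  rw [cjS_cjS]
  have hi (r) (p : TXV) : Integrable fun z => srcFun G h r z * p z :=
    (hX r).integrable_mul (p.memLp 2 volume)
  have hs {ι : Type} [Fintype ι] (r : ι → SrcIdx) (p : ι → TXV) :
      Integrable fun z => ∑ i, srcFun G h (r i) z * p i z :=
    integrable_finsetSum _ fun i _ => hi _ _
  simp only [srcPair, annS_cjS, mV_cjS, srcG, inner_hfS_cls (hX _)]
  rw [← integral_finsetSum _ fun i _ => hi _ _, ← integral_finsetSum _ fun i _ => hi _ _,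
    ← integral_neg]
  erw [← integral_add (hs _ _).neg (hi _ _), ← integral_add ((hs _ _).neg.add (hi _ _)) (hs _ _)]
  refine integral_congr_ae (.of_forall fun z => ?_)
  have e := srcF_split (G := G) (h := h) z
  simp only [Pi.add_apply, Pi.neg_apply, annS_ap, mV_ap, dV_ap, Fin.sum_univ_three] at e ⊢
  rw [e]
  simp only [srcFun]
  ring

lemma memLp_slice {f : R3 × R3 → E} (hf : MemLp f 2) : ∀ᵐ x, MemLp (fun v => f (x, v)) 2 := by
  rw [Measure.volume_eq_prod] at hf
  have h := MemLp.lintegral_sq_lt_top hf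
  rw [lintegral_prod _ (hf.1.enorm.pow_const 2)] at h
  filter_upwards [hf.1.prodMk_left, ae_lt_top' (hf.1.enorm.pow_const 2).lintegral_prod_right' h.ne]
    with x h1 h2
  exact memLp_two_lint h1 h2

lemma hCoef_cls_ae {f : R3 × R3 → ℂ} (hf : MemLp f 2) (k : MI) :
    ∀ᵐ x, hCoef k (cls f) x = ∫ v, hermS k v * f (x, v) := by
  have h0 := cls_ae hf
  filter_upwards [hCoef_ae k (cls f), Measure.ae_ae_of_ae_prod h0] with x h1 h2
  rw [h1]
  refine integral_congr_ae ?_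
  filter_upwards [h2] with v hv
  rw [hv]

lemma sum_mul_four_eq_zero {ι : Type*} [Fintype ι] (c : ι → ℂ) (a : ι → L2X)
    (h : ∀ᵐ x, ∑ i, c i * a i x = 0) : ∀ᵐ ξ, ∑ i, c i * (𝓕 (a i) : L2X) ξ = 0 := by
  have hs (b : ι → L2X) : ∀ᵐ x, (∑ i, c i • b i) x = ∑ i, c i * b i x := by
    filter_upwards [Lp.coeFn_finsetSum Finset.univ fun i => c i • b i,
      ae_all_iff.2 fun i => Lp.coeFn_smul (c i) (b i)] with x h1 h2
    rw [h1, Finset.sum_apply]; simp only [h2, Pi.smul_apply, smul_eq_mul]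
  have h0 : ∑ i, c i • a i = 0 := by
    rw [Lp.eq_zero_iff_ae_eq_zero]; filter_upwards [h, hs a] with x h1 h2
    rw [h2, h1, Pi.zero_apply]
  have h1 : ∑ i, c i • fourL (a i) = 0 := by simp only [← map_smul, ← map_sum, h0, map_zero]
  filter_upwards [hs fun i => fourL (a i), Lp.coeFn_zero ℂ 2 vol] with ξ h2 h3
  rw [h1, h3] at h2
  exact h2.symm

lemma low_coef_eq_zero {x : R3} (hX : ∀ r, MemLp (fun v => srcFun G h r (x, v)) 2)
    (h0 : macroP0 (fun v => G (x, v)) = 0) (h1 : macroP (fun v => h (x, v)) = 0) {l : MI}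
    (hl : ℓ l < 2) :
    -(∑ i, (√(l i) : ℂ) * ∫ v, hermS (l - dir i) v * srcFun G h (inl i) (x, v)) +
      (∫ v, hermS l v * srcFun G h (inr none) (x, v)) +
      ∑ j, ((√(l j) : ℂ) * (∫ v, hermS (l - dir j) v * srcFun G h (inr (some j)) (x, v)) +
        (√(l j + 1 : ℝ) : ℂ) *
          ∫ v, hermS (l + dir j) v * srcFun G h (inr (some j)) (x, v)) = 0 := by
  have hs0 v : sqrtM v ≠ 0 := (sqrtM_pos v).ne'
  have hI (r k) : Integrable fun v => hermS k v * srcFun G h r (x, v) :=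
    (memLp_hS k).integrable_mul (hX r)
  have hG i : ∫ v, hermS 0 v * srcFun G h (inl i) (x, v) = 0 := by
    have e := congrFun h0 0
    rw [macroP0, Pi.zero_apply, smul_eq_zero, or_iff_right (hs0 0)] at e
    have e1 := congrArg (fun y : C3 => y i) e; dsimp only at e1
    rw [eval_integral_piLp fun j => ?_] at e1
    · refine Eq.trans (integral_congr_ae (.of_forall fun v => ?_)) e1
      simp [hermS_zero, srcFun]
    · refine (hI (inl j) 0).congr (.of_forall fun v => ?_); simp [hermS_zero, srcFun]
  have hh : ∫ v, hermS l v * h (x, v) = 0 := by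
    have e v := congrFun h1 v; simp only [macroP, macroP0, macroP1, Pi.zero_apply] at e
    have e0 : ∫ w, sqrtM w • h (x, w) = 0 := by simpa [hs0] using e 0
    rcases eq_zero_or_dir hl with rfl | ⟨i, rfl⟩
    · rw [← e0]; simp only [hermS_zero, real_smul]
    · have ei := e (single i 1)
      rw [e0, smul_zero, zero_add, Finset.sum_eq_single i (by simp_all) (by simp), smul_eq_zero]
        at ei
      rw [← ei.resolve_left (by simp [hs0])]; simp only [hermS_dir, real_smul, Complex.ofReal_mul]
  rw [sum_eq_zero, neg_zero, zero_add, ← hh]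
  · have hJ j : Integrable fun v => (√(l j) : ℂ) *
        (hermS (l - dir j) v * srcFun G h (inr (some j)) (x, v)) + (√(l j + 1) : ℂ) *
        (hermS (l + dir j) v * srcFun G h (inr (some j)) (x, v)) :=
      ((hI _ _).const_mul _).add ((hI _ _).const_mul _)
    simp only [← integral_const_mul]
    simp only [← integral_add ((hI _ _).const_mul _) ((hI _ _).const_mul _)]
    rw [← integral_finsetSum _ fun j _ => hJ j,
      ← integral_add (hI _ _) (integrable_finsetSum _ fun j _ => hJ j)]
    refine integral_congr_ae (.of_forall fun v => ?_); dsimp only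
    rw [srcF_split (G := G) (h := h) (x, v), mul_add, mul_sum]
    refine congrArg _ (sum_congr rfl fun j _ => ?_)
    linear_combination -srcFun G h (inr (some j)) (x, v) * cmul_hermS l j v
  · intro i _
    by_cases hi : l i = 0
    · simp [hi]
    · have := len_sub_dir hi; rw [zero_len (k := l - dir i) (by omega), hG, mul_zero]

lemma srcC_srcG (hX : ∀ r, MemLp (srcFun G h r) 2)
    (h0 : ∀ᵐ x, macroP0 (fun v => G (x, v)) = 0) (h1 : ∀ᵐ x, macroP (fun v => h (x, v)) = 0) :
    ∀ᵐ ξ, ∀ l, ℓ l < 2 → srcC (fun r => srcG G h r ξ) l = 0 := by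
  rw [ae_all_iff]
  intro l
  by_cases hl : ℓ l < 2
  · have key := sum_mul_four_eq_zero
      (Sum.elim (fun i : Fin 3 => -(√(l i) : ℂ)) (Sum.elim (fun _ : Unit => 1)
        (Sum.elim (fun j : Fin 3 => (√(l j) : ℂ)) fun j : Fin 3 => (√(l j + 1) : ℂ))))
      (Sum.elim (fun i => hCoef (l - dir i) (cls (srcFun G h (inl i))))
        (Sum.elim (fun _ => hCoef l (cls (srcFun G h (inr none))))
        (Sum.elim (fun j => hCoef (l - dir j) (cls (srcFun G h (inr (some j)))))
          fun j => hCoef (l + dir j) (cls (srcFun G h (inr (some j))))))) (by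
        filter_upwards [h0, h1, ae_all_iff.2 fun r => memLp_slice (hX r),
          ae_all_iff.2 fun r => ae_all_iff.2 fun k => hCoef_cls_ae (hX r) k]
          with x e0 e1 e2 e3
        rw [← low_coef_eq_zero e2 e0 e1 hl]
        simp only [sum_sum_type, Sum.elim_inl, Sum.elim_inr, e3, sum_add_distrib,
          Finset.univ_unique, Finset.sum_singleton, neg_mul, sum_neg_distrib, one_mul]
        ring)
    filter_upwards [key, ae_all_iff.2 fun r => ae_all_iff.2 fun k => coL_ae k (srcG G h r)]
      with ξ e1 e2 _
    simp only [srcG, coL_hermF] at e2; rw [srcC, ← e1]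
    simp only [sum_sum_type, Sum.elim_inl, Sum.elim_inr, sum_add_distrib, e2,
      srcG, Finset.univ_unique, Finset.sum_singleton, neg_mul, sum_neg_distrib, one_mul]
    ring
  · exact .of_forall fun _ h => absurd h hl

end Fixed

lemma ae_memLp_kNorm {F : ℝ → R3 × R3 → E}
    (hF : AEStronglyMeasurable (fun y : ℝ × (R3 × R3) => F y.1 y.2)
      ((volume.restrict (Ioi 0)).prod volume))
    (hfin : ∀ T : ℝ, ∫⁻ s in Ioc 0 T, kineticNorm 2 (F s) ^ 2 < ⊤) :
    ∀ᵐ s ∂(volume.restrict (Ioi (0 : ℝ))), MemLp (F s) 2 := by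
  have hs := hF.prodMk_left
  have hg := (hF.enorm.pow_const 2).lintegral_prod_right'
  have hU : Ioi 0 = ⋃ n : ℕ, Ioc (0 : ℝ) n := by
    ext s; simp only [mem_iUnion, mem_Ioc, mem_Ioi, exists_and_left]
    exact ⟨fun h => ⟨h, exists_nat_ge s⟩, fun h => h.1⟩
  have hn (n : ℕ) : ∀ᵐ s ∂(volume.restrict (Ioc (0 : ℝ) n)), MemLp (F s) 2 := by
    have hle : volume.restrict (Ioc (0 : ℝ) n) ≤ volume.restrict (Ioi 0) :=
      Measure.restrict_mono Ioc_subset_Ioi_self le_rfl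
    have hs' := ae_mono hle hs
    have h1 : ∫⁻ s in Ioc (0 : ℝ) n, ∫⁻ z, ‖F s z‖ₑ ^ 2 < ⊤ := by
      refine lt_of_eq_of_lt (lintegral_congr_ae ?_) (hfin n); filter_upwards [hs'] with s e
      exact (kNorm_two_sq e).symm
    filter_upwards [hs', ae_lt_top' (hg.mono_measure hle) h1.ne] with s e1 e2
    exact memLp_two_lint e1 e2
  rw [hU]
  exact (ae_restrict_iUnion_iff _ _).2 hn

section Time

variable {G : ℝ → R3 × R3 → C3} {h : ℝ → R3 × R3 → ℂ}

lemma IsSource.ae_memLp (hS : IsSource G h) :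
    ∀ᵐ s ∂(volume.restrict (Ioi (0 : ℝ))), MemLp (G s) 2 ∧ MemLp (weighted (h s)) 2 := by
  have hw : AEStronglyMeasurable (fun y : ℝ × (R3 × R3) => weighted (h y.1) y.2)
      ((volume.restrict (Ioi 0)).prod volume) :=
    ((cd_srcW none).continuous.comp (by fun_prop :
      Continuous fun y : ℝ × (R3 × R3) => y.2.2)).aestronglyMeasurable.smul hS.meash |>.congr
      (.of_forall fun y => by simp [srcW, weighted])
  filter_upwards [ae_memLp_kNorm hS.measG fun T => (lintegral_mono fun s =>
      pow_le_pow_left' le_self_add 2).trans_lt (hS.finite T),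
    ae_memLp_kNorm hw fun T => (lintegral_mono fun s =>
      pow_le_pow_left' le_add_self 2).trans_lt (hS.finite T)] with s h1 h2
  exact ⟨h1, h2⟩

lemma IsSource.aestronglyMeasurable_srcField (hS : IsSource G h) (r) :
    AEStronglyMeasurable (fun s => srcG (G s) (h s) r) (volume.restrict (Ioi 0)) := by
  refine hermF.continuous.comp_aestronglyMeasurable (aesm_cls ?_)
  rcases r with i | o
  · exact (proj (𝕜 := ℂ) i).continuous.comp_aestronglyMeasurable hS.measG
  · have hc := ((cd_srcW o).continuous.mul (cd_srcW none).continuous).comp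
        (by fun_prop : Continuous fun y : ℝ × (R3 × R3) => y.2.2)
    refine (hc.aestronglyMeasurable.smul hS.meash).congr (.of_forall fun y => ?_)
    simp [srcFun, srcW, weighted, mul_assoc]

lemma IsSource.lintegral_srcField_lt_top (hS : IsSource G h) (r : SrcIdx) (T : ℝ) :
    ∫⁻ s in Ioc 0 T, ‖srcG (G s) (h s) r‖ₑ ^ 2 < ⊤ := by
  refine (lintegral_mono_ae ?_).trans_lt (hS.finite T)
  filter_upwards [ae_restrict_of_ae_restrict_of_subset
    (show Ioc 0 T ⊆ Ioi 0 from Ioc_subset_Ioi_self) hS.ae_memLp] with s ⟨h1, h2⟩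
  have h3 := memLp_srcF h1 h2 r
  have h4 : ‖srcG (G s) (h s) r‖ₑ ^ 2 = ∫⁻ z, ‖srcFun (G s) (h s) r z‖ₑ ^ 2 := by
    rw [srcG, ← ofReal_norm, LinearIsometryEquiv.norm_map, ofReal_norm, en_sq_Lp]
    refine lintegral_congr_ae ?_; filter_upwards [cls_ae h3] with z hz
    rw [hz]
  rw [h4]
  rcases r with i | o
  · refine le_trans ?_ (pow_le_pow_left' le_self_add 2); rw [kNorm_two_sq h1.1]
    gcongr with z
    rw [← ofReal_norm, ← ofReal_norm]; exact ofReal_le_ofReal (PiLp.norm_apply_le (G s z) i)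
  · refine le_trans ?_ (pow_le_pow_left' le_add_self 2); rw [kNorm_two_sq h2.1]
    gcongr with z
    change ‖(srcW o z.2) * weighted (h s) z‖ₑ ≤ _
    rw [← ofReal_norm, ← ofReal_norm, norm_mul, norm_real]
    exact ofReal_le_ofReal (mul_le_of_le_one_left (norm_nonneg _) (abs_srcW_le o z.2))

lemma IsSource.hasSpecSource (hS : IsSource G h) {M : HL2 →L[ℂ] HL2} {m : R3 → ℂ}
    (hM : ∀ X, ∀ᵐ ξ, M X ξ = m ξ • X ξ) {G' : ℝ → R3 × R3 → C3} {h' : ℝ → R3 × R3 → ℂ}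
    (hG' : ∀ᵐ s ∂(volume.restrict (Ioi (0 : ℝ))), (∀ r, MemLp (srcFun (G' s) (h' s) r) 2) ∧
      ∀ r, srcG (G' s) (h' s) r = M (srcG (G s) (h s) r)) :
    HasSpecSource (fun s => sourcePairing (G' s) (h' s))
      fun s => srcS fun r => M (srcG (G s) (h s) r) := by
  refine hasSpecSource_srcS (X := fun s r => M (srcG (G s) (h s) r)) (fun r =>
    M.continuous.comp_aestronglyMeasurable (hS.aestronglyMeasurable_srcField r))
    (fun r T => ?_) ?_ ?_
  · have h1 s : ‖M (srcG (G s) (h s) r)‖ₑ ^ 2 ≤ ‖M‖ₑ ^ 2 * ‖srcG (G s) (h s) r‖ₑ ^ 2 := by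
      rw [← mul_pow]; exact pow_le_pow_left' (M.le_opENorm _) 2
    refine (lintegral_mono h1).trans_lt ?_; rw [lintegral_const_mul' _ _ (by simp)]
    exact mul_lt_top (by simp) (hS.lintegral_srcField_lt_top r T)
  · filter_upwards [hS.ae_memLp, hS.P0_G, hS.P_h] with s ⟨h1, h2⟩ h3 h4
    filter_upwards [srcC_srcG (memLp_srcF h1 h2) h3 h4,
      ae_all_iff.2 fun r => hM (srcG (G s) (h s) r)] with ξ h5 h6 l hl
    have h7 := h5 l hl
    simp only [srcC, h6, Fin.sum_univ_three, lp.coeFn_smul, Pi.smul_apply, smul_eq_mul] at h7 ⊢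
    linear_combination m ξ * h7
  · filter_upwards [hG'] with s ⟨h1, h2⟩ q; rw [sourcePairing_cjS h1]
    exact congrArg _ (funext h2)

end Time

/-! ### Low frequencies -/

lemma memLp_slice_right {f : R3 × R3 → E} (hf : MemLp f 2) : ∀ᵐ v, MemLp (fun x => f (x, v)) 2 :=
  memLp_slice (f := f ∘ Prod.swap) (hf.comp_measurePreserving (Measure.measurePreserving_swap :
    MeasurePreserving Prod.swap ((vol).prod vol) _))

lemma finv_ae {W : L2X} (hW : Integrable W) : ∀ᵐ x, (𝓕⁻ W : L2X) x = 𝓕⁻ (W : R3 → ℂ) x := by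
  have hc := VectorFourier.fourierIntegral_continuous (L := -innerₗ R3) Real.continuous_fourierChar
      continuous_inner.neg hW
  refine ae_eq_of_integral_contDiff_smul_eq (li_Lp_two (Lp.memLp (𝓕⁻ W)))
    hc.locallyIntegrable fun g hg hcs => ?_
  have hg' := ofRealCLM.contDiff.comp hg
  have hc' := hcs.comp_left ofReal_zero
  set ψ := hc'.toSchwartzMap hg'
  have h1 := int_four_mul_Lp (𝓕⁻ ψ) (𝓕⁻ W)
  rw [FourierTransform.fourier_fourierInv_eq, FourierTransform.fourier_fourierInv_eq] at h1
  have h2 := VectorFourier.integral_fourierIntegral_smul_eq_flip (L := -innerₗ R3) (f := ⇑ψ)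
    (g := W) (μ := volume) (ν := volume) Real.continuous_fourierChar
    continuous_inner.neg ψ.integrable hW
  have h3 : (-innerₗ R3).flip = -innerₗ R3 := by
    ext x y; simp [real_inner_comm]
  rw [h3] at h2
  simp
  refine h1.trans (Eq.trans ?_ h2)
  rw [fourierInv_coe]
  rfl

def loS (φ : R3 → ℝ) (ξ : R3) : ℝ := φ ((2 * π) • ξ)

section LowFreq

variable {r₀ : ℝ} {φ : R3 → ℝ} (hφ : IsLowFreqCutoff r₀ φ)

include hφ

lemma IsLowFreqCutoff.contDiff_lowSymb : ContDiff ℝ ∞ (loS φ) :=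
  hφ.smooth.comp (contDiff_id.const_smul _)

lemma IsLowFreqCutoff.abs_lowSymb_le (ξ) : |loS φ ξ| ≤ 1 := by
  rw [loS, abs_of_nonneg (hφ.nonneg _)]
  exact hφ.le_one _

lemma IsLowFreqCutoff.exists_schwartz (x) : ∃ θ : TX,
    (∀ ξ, θ ξ = Complex.exp ((2 * π * inner ℝ ξ x : ℝ) * I) * loS φ ξ) ∧
    ∀ y, (𝓕 θ : TX) y = lowFreqKernel φ (x - y) := by
  have h1 : HasCompactSupport (loS φ) := by
    have h2 := HasCompactSupport.intro (isCompact_closedBall 0 r₀)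
      fun ξ hξ => hφ.eq_zero ξ (by simpa using hξ)
    exact h2.comp_homeomorph (Homeomorph.smulOfNeZero (2 * π) (by positivity))
  have h2 : ContDiff ℝ (⊤ : ℕ∞) fun ξ : R3 =>
      Complex.exp ((2 * π * inner ℝ ξ x : ℝ) * I) * (loS φ ξ) :=
    (Complex.contDiff_exp.comp ((ofRealCLM.contDiff.comp (contDiff_const.mul
      (contDiff_id.inner ℝ contDiff_const))).mul contDiff_const)).mul
      (ofRealCLM.contDiff.comp hφ.contDiff_lowSymb)
  have h3 : HasCompactSupport fun ξ : R3 =>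
      Complex.exp ((2 * π * inner ℝ ξ x : ℝ) * I) * (loS φ ξ : ℂ) :=
    (h1.comp_left (g := fun r : ℝ => (r : ℂ)) ofReal_zero).mul_left
  refine ⟨h3.toSchwartzMap h2, fun ξ => rfl, fun y => ?_⟩
  have h4 := Measure.integral_comp_smul vol (fun ξ =>
    Complex.exp (I * (inner ℝ (x - y) ξ : ℝ)) * (φ ξ : ℂ)) (2 * π)
  rw [finrank_euclideanSpace_fin, abs_of_pos (by positivity)] at h4
  rw [SchwartzMap.fourier_coe, Real.fourier_eq', lowFreqKernel, ← h4]
  refine integral_congr_ae (.of_forall fun ξ => ?_)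
  change _ • (Complex.exp _ * (φ _ : ℂ)) = _
  dsimp only
  rw [smul_eq_mul, ← mul_assoc, ← Complex.exp_add, inner_smul_right, inner_sub_left,
    real_inner_comm ξ x, real_inner_comm ξ y]
  congr 2
  push_cast
  ring

lemma IsLowFreqCutoff.memLp_kernel (x : R3) : MemLp (fun y => lowFreqKernel φ (x - y)) 2 := by
  obtain ⟨θ, _, h⟩ := hφ.exists_schwartz x
  simp only [← h]
  exact (𝓕 θ).memLp 2 volume

lemma IsLowFreqCutoff.continuous_kernel : Continuous (lowFreqKernel φ) := by
  obtain ⟨θ, _, h⟩ := hφ.exists_schwartz 0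
  have h1 : lowFreqKernel φ = fun y => (𝓕 θ) (-y) := by
    funext y; rw [h, zero_sub, neg_neg]
  rw [h1]
  exact (𝓕 θ).continuous.comp continuous_neg

omit hφ in
/-- The low frequency cut-off in frequency variables. -/
def lowL {E : Type*} [NormedAddCommGroup E] [NormedSpace ℂ E] (hφ : IsLowFreqCutoff r₀ φ) :
    Lx E →L[ℂ] Lx E :=
  mulL (loS φ) hφ.contDiff_lowSymb.continuous.measurable 1 hφ.abs_lowSymb_le

lemma lowL_ae [NormedSpace ℂ E] (X : Lx E) : ∀ᵐ ξ, lowL hφ X ξ = (loS φ ξ : ℂ) • X ξ :=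
  mulL_ae _ _ X

lemma norm_lowL_le (X : L2X) : ‖lowL hφ X‖ ≤ ‖X‖ := by
  refine Lp.norm_le_norm_of_ae_le ?_
  filter_upwards [lowL_ae hφ X] with ξ h
  rw [h, norm_smul, norm_real]
  exact mul_le_of_le_one_left (norm_nonneg _) (hφ.abs_lowSymb_le ξ)

lemma lowX_ae (w : L2X) : ∀ᵐ x, lowFreqX φ w x = (𝓕⁻ (lowL hφ (𝓕 w)) : L2X) x := by
  have hW : Integrable (lowL hφ (𝓕 w)) := by
    obtain ⟨θ, h, _⟩ := hφ.exists_schwartz 0; refine (intg_schw_mul θ (𝓕 w)).congr ?_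
    filter_upwards [lowL_ae hφ (𝓕 w)] with ξ h1; rw [h, h1]; simp
  filter_upwards [finv_ae hW] with x hx
  obtain ⟨θ, h1, h2⟩ := hφ.exists_schwartz x
  rw [hx, lowFreqX, Real.fourierInv_eq']
  simp only [← h2, smul_eq_mul]
  rw [int_four_mul_Lp]
  refine integral_congr_ae ?_
  filter_upwards [lowL_ae hφ (𝓕 w)] with ξ h3
  rw [h1, h3, smul_eq_mul, mul_assoc]

lemma lowX_toLp_ae (hw : MemLp w 2) :
    ∀ᵐ x, lowFreqX φ w x = (𝓕⁻ (lowL hφ (𝓕 (hw.toLp w))) : L2X) x := by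
  filter_upwards [lowX_ae hφ (hw.toLp w)] with x hx
  rw [← hx]
  refine integral_congr_ae ?_
  filter_upwards [hw.coeFn_toLp] with y hy
  rw [hy]

lemma memLp_lowX {w : R3 → ℂ} (hw : MemLp w 2) : MemLp (lowFreqX φ w) 2 :=
  (Lp.memLp _).ae_eq (Eventually.mono (lowX_toLp_ae hφ hw) fun _ h => h.symm)

lemma four_lowX {w : R3 → ℂ} (hw : MemLp w 2) (h : MemLp (lowFreqX φ w) 2) :
    𝓕 (h.toLp _) = lowL hφ (𝓕 (hw.toLp w)) := by
  have h1 : h.toLp _ = 𝓕⁻ (lowL hφ (𝓕 (hw.toLp w))) := Lp.ext (by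
    filter_upwards [h.coeFn_toLp, lowX_toLp_ae hφ hw] with x e1 e2
    rw [e1, e2])
  rw [h1, FourierTransform.fourier_fourierInv_eq]

lemma lint_lowX_le {w : R3 → ℂ} (hw : MemLp w 2) :
    ∫⁻ x, ‖lowFreqX φ w x‖ₑ ^ 2 ≤ ∫⁻ x, ‖w x‖ₑ ^ 2 := by
  have h := memLp_lowX hφ hw
  rw [← eLpNorm_two_sq, ← eLpNorm_two_sq, ← Lp.enorm_toLp hw, ← Lp.enorm_toLp h,
    ← ofReal_norm, ← ofReal_norm, ← Lp.norm_fourier_eq (h.toLp _), ← Lp.norm_fourier_eq (hw.toLp w),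
    four_lowX hφ hw]
  exact pow_le_pow_left' (ofReal_le_ofReal (norm_lowL_le hφ _)) 2

omit hφ in
lemma aesm_lowXV {g : R3 × R3 → ℂ} (hk : Continuous (lowFreqKernel φ))
    (hg : AEStronglyMeasurable g) : AEStronglyMeasurable (lowFreqXV φ g) := by
  obtain ⟨g', h1, h0⟩ := hg
  have h2 : StronglyMeasurable fun p : (R3 × R3) × R3 =>
      lowFreqKernel φ (p.1.1 - p.2) • g' (p.2, p.1.2) :=
    (hk.measurable.comp (by fun_prop)).stronglyMeasurable.smul (h1.comp_measurable (by fun_prop))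
  rw [Measure.volume_eq_prod] at h0 ⊢
  have h3 : ∀ᵐ v, ∀ᵐ y, g (y, v) = g' (y, v) :=
    Measure.ae_ae_of_ae_prod (Measure.measurePreserving_swap.quasiMeasurePreserving.ae h0)
  refine ⟨_, h2.integral_prod_right' (ν := volume), ?_⟩
  filter_upwards [Measure.quasiMeasurePreserving_snd.ae h3] with z hz
  refine integral_congr_ae ?_
  filter_upwards [hz] with y hy
  rw [hy]

lemma memLp_lowXV {g : R3 × R3 → ℂ} (hg : MemLp g 2) : MemLp (lowFreqXV φ g) 2 := by
  have hm := aesm_lowXV hφ.continuous_kernel hg.1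
  have h1 : ∀ᵐ v, ∫⁻ x, ‖lowFreqXV φ g (x, v)‖ₑ ^ 2 ≤ ∫⁻ x, ‖g (x, v)‖ₑ ^ 2 := by
    filter_upwards [memLp_slice_right hg] with v hv; have := lint_lowX_le hφ hv
    simpa only [lowFreqXV] using this
  have hg1 := hg.1
  have hg2 := MemLp.lintegral_sq_lt_top hg
  rw [Measure.volume_eq_prod] at hm hg1 hg2 ⊢
  refine memLp_two_lint hm ?_
  rw [lintegral_prod_symm _ (hg1.enorm.pow_const 2)] at hg2
  rw [lintegral_prod_symm _ (hm.enorm.pow_const 2)]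
  exact (lintegral_mono_ae h1).trans_lt hg2

lemma hCoef_lowXV {g : R3 × R3 → ℂ} (hg : MemLp g 2) (k : MI) :
    hCoef k (cls (lowFreqXV φ g)) = 𝓕⁻ (lowL hφ (𝓕 (hCoef k (cls g)))) := by
  refine Lp.ext ?_
  filter_upwards [hCoef_cls_ae (memLp_lowXV hφ hg) k, lowX_ae hφ (hCoef k (cls g))] with x h1 h2
  rw [h1, ← h2, lowFreqX]
  have hi := (memLp_tens (hφ.memLp_kernel x) (memLp_hS k)).integrable_mul hg
  have h3 := int_tens_mul (hφ.memLp_kernel x) (memLp_hS k) hg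
  have h4 : ∫ y, lowFreqKernel φ (x - y) • hCoef k (cls g) y =
      ∫ y, lowFreqKernel φ (x - y) * ∫ v, hermS k v * g (y, v) := by
    refine integral_congr_ae ?_; filter_upwards [hCoef_cls_ae hg k] with y hy
    rw [hy, smul_eq_mul]
  rw [h4, ← h3]
  rw [Measure.volume_eq_prod] at hi ⊢
  refine Eq.trans ?_ (integral_prod_symm _ hi).symm
  refine integral_congr_ae (.of_forall fun v => ?_)
  dsimp only [lowFreqXV, lowFreqX]
  rw [← integral_const_mul]
  refine integral_congr_ae (.of_forall fun y => ?_)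
  simp
  ring

lemma hermF_lowXV (hg : MemLp g 2) : hermF (cls (lowFreqXV φ g)) = lowL hφ (hermF (cls g)) := by
  refine hermL2_ext fun k => ?_
  have h1 : coL k (lowL hφ (hermF (cls g))) = lowL hφ (coL k (hermF (cls g))) := by
    refine Lp.ext ?_
    filter_upwards [coL_ae k (lowL hφ (hermF (cls g))),
      lowL_ae hφ (hermF (cls g)), lowL_ae hφ (coL k (hermF (cls g))),
      coL_ae k (hermF (cls g))] with ξ e1 e2 e3 e4
    rw [e1, e2, e3, e4]; rfl
  rw [h1, coL_hermF, coL_hermF, hCoef_lowXV hφ hg, FourierTransform.fourier_fourierInv_eq]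

lemma lowX_coord {w : R3 → C3} (hw : MemLp w 2) (i : Fin 3) (x : R3) :
    lowFreqX φ w x i = lowFreqX φ (fun y => w y i) x :=
  eval_integral_piLp (fun j => (hφ.memLp_kernel x).integrable_mul (hw.eval_piLp j)) i

lemma Fields.IsL2.lowFreq {U : Fields} (hU : U.IsL2) : (U.lowFreq φ).IsL2 where
  rho := memLp_lowX hφ hU.rho
  u := MemLp.of_eval_piLp fun i => by
    simp only [Fields.lowFreq, lowX_coord hφ hU.u]
    exact memLp_lowX hφ (hU.u.eval_piLp i)
  f := memLp_lowXV hφ hU.f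

lemma srcFun_low {h : R3 × R3 → ℂ} (hG : MemLp G 2) (r : SrcIdx) :
    lowFreqXV φ (srcFun G h r) =ᵐ[volume] srcFun (lowFreqXV φ G) (lowFreqXV φ h) r := by
  rcases r with i | o
  · filter_upwards [Measure.quasiMeasurePreserving_snd.ae (memLp_slice_right hG)] with z hz
    exact (lowX_coord hφ hz i z.1).symm
  · refine .of_forall fun z => ?_; change ∫ y, _ = _ * (_ • ∫ y, _)
    rw [real_smul, ← integral_const_mul, ← integral_const_mul]
    refine integral_congr_ae (.of_forall fun y => ?_)
    simp only [srcFun, weighted, smul_eq_mul, real_smul]; ring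

lemma srcG_low {h : R3 × R3 → ℂ} (hG : MemLp G 2) (hh : MemLp (weighted h) 2) (r : SrcIdx) :
    MemLp (srcFun (lowFreqXV φ G) (lowFreqXV φ h) r) 2 ∧
      srcG (lowFreqXV φ G) (lowFreqXV φ h) r = lowL hφ (srcG G h r) := by
  have h1 := memLp_lowXV hφ (memLp_srcF hG hh r)
  have h2 := h1.ae_eq (srcFun_low hφ hG r)
  refine ⟨h2, ?_⟩
  rw [srcG, srcG, ← hermF_lowXV hφ (memLp_srcF hG hh r)]
  refine congrArg _ (Lp.ext ?_)
  filter_upwards [cls_ae h1, cls_ae h2, srcFun_low hφ hG r] with z e1 e2 e3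
  rw [e2, e1, e3]

end LowFreq

/-! ### The source as a square integrable function -/

lemma halfL_inclF_lvlL {K : ℕ} {k : MI} (hk : ℓ k ≤ K) (a : L2X) : halfL K (inclF (lvlL k a)) =
      (if 2 ≤ ℓ k then (√(ℓ k) : ℂ) else 0) • inclF (lvlL k a) := by
  refine Lp.ext ?_
  filter_upwards [halfL_ae K (inclF (lvlL k a)), inclF_ae (lvlL k a), lvlL_ae k a,
    Lp.coeFn_smul (if 2 ≤ ℓ k then (√(ℓ k) : ℂ) else 0) (inclF (lvlL k a))] with ξ h1 h2 h3 h4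
  rw [h1, h4, Pi.smul_apply, h2, h3]
  refine fib_ext ?_ fun l => ?_
  · rw [hFib_fst, WithLp.smul_fst]; exact (smul_zero _).symm
  · rw [halfFib_snd, hOp_ap]
    change (if _ then _ * (a ξ * (lp.single 2 k 1 : HSeq) l) else 0) =
      _ * (a ξ * (lp.single 2 k 1 : HSeq) l)
    by_cases hl : l = k
    · subst hl; simp only [hk, true_and]; split_ifs <;> simp
    · rw [lp.single_apply_ne _ _ _ hl]; simp

lemma coL_eq_inner_hfS {k : MI} {X Y : HL2} (h : ∀ φ : TX, inner ℂ (hfS (tnS φ (hermS k))) X =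
      inner ℂ (hfS (tnS φ (hermS k))) Y) : coL k X = coL k Y := by
  refine ext_inner_left ℂ fun a => ?_
  rw [← fourL_finvL a]
  generalize finvL a = b
  refine DenseRange.induction_on (SchwartzMap.denseRange_toLpCLM (p := 2) (by simp)) b
    (isClosed_eq ?_ ?_) fun φ => ?_
  · exact fourL.continuous.inner continuous_const
  · exact fourL.continuous.inner continuous_const
  · have := h φ
    rwa [hfS_tnS, inner_lvlL, inner_lvlL] at this

lemma halfL_srcS_eq {G : R3 × R3 → C3} {h : R3 × R3 → ℂ} (hX : ∀ r, MemLp (srcFun G h r) 2)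
    (hlow : ∀ᵐ ξ, ∀ l, ℓ l < 2 → srcC (fun r => srcG G h r ξ) l = 0) {F : L2XV}
    (hF : ∀ g : TXV, ∫ z, F z * g z = sourcePairing G h g) (K : ℕ) :
    halfL K (srcS (srcG G h)) = truncL K (inclF (hermF F)) := by
  set Z := srcS (srcG G h) with hZ
  have hk k : coL k (hermF F) = coL k ((if 2 ≤ ℓ k then (√(ℓ k) : ℂ) else 0) • projF Z) := by
    refine coL_eq_inner_hfS fun φ => ?_; set q := tnS φ (hermS k) with hq
    obtain ⟨Yh, h1, h2⟩ := ex_tt_halfL q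
    have h3 : Yh = (if 2 ≤ ℓ k then (√(ℓ k) : ℂ) else 0) • inclF (hfS q) := by
      refine tendsto_nhds_unique h1 (tendsto_const_nhds.congr' ?_)
      filter_upwards [eventually_ge_atTop (ℓ k)] with K hK; rw [hq, hfS_tnS, halfL_inclF_lvlL hK]
    have h4 : inner ℂ (hfS q) (hermF F) = ∫ z, F z * cjS q z := by
      rw [← inner_cjS, cjS_cjS, hfS, inner_hermF]
    rw [h4, hF, sourcePairing_cjS hX, h2 _ hlow, h3, inner_smul_left, inner_smul_right, inner_inclF]
    split_ifs <;> simp [hZ]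
  refine Lp.ext ?_
  filter_upwards [halfL_ae K Z, truncL_ae K (inclF (hermF F)), inclF_ae (hermF F),
    projF_ae Z, ae_all_iff.2 fun k => coL_ae k (hermF F),
    ae_all_iff.2 fun k => coL_ae k ((if 2 ≤ ℓ k then (√(ℓ k) : ℂ) else 0) •
      projF Z), ae_all_iff.2 fun k : MI => Lp.coeFn_smul
        (if 2 ≤ ℓ k then (√(ℓ k) : ℂ) else 0) (projF Z)]
    with ξ h1 h2 h3 h4 h5 h6 h7
  rw [h1, h2, h3]
  refine fib_ext rfl fun k => ?_
  have h8 := h5 k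
  rw [hk, h6, h7, Pi.smul_apply, lp.coeFn_smul, Pi.smul_apply, h4] at h8
  rw [halfFib_snd, hOp_ap, trF_snd_ap]
  change _ = if _ then hermF F ξ k else 0
  rw [← h8]
  split_ifs <;> first | rfl | omega | simp

/-! ### Solution formula -/

section Solve

variable {κ lam : ℝ} (hκ : 0 < κ) (hl : 0 < lam) (hd : HasDecay κ lam) {U₀ : Fields}
  (h₀ : U₀.IsL2) {G : ℝ → R3 × R3 → C3} {h : ℝ → R3 × R3 → ℂ} {Z : ℝ → Spec}
  (hQ : HasSpecSource (fun s => sourcePairing (G s) (h s)) Z)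

include hκ hl hd hQ

lemma isWeakSolution_ofSpec : IsWeakSolution (κ ^ 2) U₀ G h fun t => ofSpec κ
    (evol κ (2 * π) t (toS κ (st U₀ h₀)) + duhZ κ (2 * π) Z t) := by
  rw [isWeakSolution_iff hκ h₀]
  simp only [toS_ofSpec hκ]
  exact isSpecSol_evol_add_duhZ hl hd hQ _

lemma IsWeakSolution.eq_ofSpec (hU : IsWeakSolution (κ ^ 2) U₀ G h U)
    (ht : 0 ≤ t) : U t = ofSpec κ
      (evol κ (2 * π) t (toS κ (st U₀ h₀)) + duhZ κ (2 * π) Z t) := by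
  rw [← ofSpec_toS hκ (U t)]
  exact congrArg _ (IsSpecSol.unique (fun g _ => hQ.intervalIntegrable g) ((isWeakSolution_iff hκ h₀).1 hU)
    (isSpecSol_evol_add_duhZ hl hd hQ _) ht)

lemma solution_eq (ht : 0 ≤ t) : solution (κ ^ 2) U₀ G h t = ofSpec κ
    (evol κ (2 * π) t (toS κ (st U₀ h₀)) + duhZ κ (2 * π) Z t) := by
  have H : ∃ U, IsWeakSolution (κ ^ 2) U₀ G h U := ⟨_, isWeakSolution_ofSpec hκ hl hd h₀ hQ⟩
  rw [solution, dif_pos H]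
  exact H.choose_spec.eq_ofSpec hκ hl hd h₀ hQ ht

omit h₀ in
lemma duhamel_eq (ht : 0 ≤ t) : duhamel (κ ^ 2) G h t = ofSpec κ (duhZ κ (2 * π) Z t) := by
  have h0 : (⟨0, 0, 0⟩ : Fields).IsL2 := ⟨MemLp.zero, MemLp.zero, MemLp.zero⟩
  have h1 : st ⟨0, 0, 0⟩ h0 = 0 := rfl
  rw [duhamel, solution_eq hκ hl hd h0 hQ ht, h1, map_zero, map_zero, zero_add]

omit hQ in
lemma solutionOperator_eq (ht : 0 ≤ t) : solutionOperator (κ ^ 2) t U₀ =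
    ofSpec κ (evol κ (2 * π) t (toS κ (st U₀ h₀))) := by
  have hQ : HasSpecSource (fun s => sourcePairing ((0 : ℝ → R3 × R3 → C3) s)
      ((0 : ℝ → R3 × R3 → ℂ) s)) fun _ => 0 := by
    refine ⟨⟨aestronglyMeasurable_const, fun T => by simp⟩, fun q => ?_⟩
    obtain ⟨Yh, h1, _⟩ := ex_tt_halfL q; refine ⟨Yh, h1, .of_forall fun s => ?_⟩
    simp [sourcePairing]
  have hz : duhZ κ (2 * π) (fun _ => 0) t = 0 :=
    tendsto_nhds_unique (tt_duhZ hl hd hQ.l2Loc ht) (by simp [duh])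
  rw [solutionOperator, solution_eq hκ hl hd h₀ hQ ht, hz, add_zero]

end Solve

section Source

variable {G : ℝ → R3 × R3 → C3} {h : ℝ → R3 × R3 → ℂ}

lemma IsSource.hasSpecSource_self (hS : IsSource G h) :
    HasSpecSource (fun s => sourcePairing (G s) (h s)) fun s => srcS (srcG (G s) (h s)) :=
  hS.hasSpecSource (M := .id ℂ _) (m := 1) (fun _ => .of_forall fun _ => (one_smul ℂ _).symm)
    (hS.ae_memLp.mono fun _ hs => ⟨memLp_srcF hs.1 hs.2, fun _ => rfl⟩)

lemma IsSource.hasSpecSource_lowFreq (hS : IsSource G h) {r₀ : ℝ} {φ : R3 → ℝ}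
    (hφ : IsLowFreqCutoff r₀ φ) :
    HasSpecSource (fun s => sourcePairing (lowFreqXV φ (G s)) (lowFreqXV φ (h s)))
      fun s => srcS fun r => lowL hφ (srcG (G s) (h s) r) :=
  hS.hasSpecSource (G' := fun s => lowFreqXV φ (G s)) (h' := fun s => lowFreqXV φ (h s))
    (lowL_ae hφ) (hS.ae_memLp.mono fun _ hs =>
      ⟨fun r => (srcG_low hφ hs.1 hs.2 r).1, fun r => (srcG_low hφ hs.1 hs.2 r).2⟩)

lemma IsSource.duhamel_eq_integral {κ lam : ℝ} (hκ : 0 < κ) (hl : 0 < lam) (hd : HasDecay κ lam)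
    (hS : IsSource G h) {S : ℝ → L2XV}
    (hSi : ∀ T : ℝ, 0 ≤ T → IntervalIntegrable S volume 0 T)
    (hSG : ∀ᵐ s ∂(volume.restrict (Ioi (0 : ℝ))), ∀ g : TXV,
      ∫ z, S s z * g z = sourcePairing (G s) (h s) g) {t : ℝ} (ht : 0 ≤ t) :
    IntervalIntegrable (fun s => solutionOperator (κ ^ 2) (t - s) ⟨0, 0, S s⟩) volume 0 t ∧
      duhamel (κ ^ 2) G h t = ∫ s in (0)..t, solutionOperator (κ ^ 2) (t - s) ⟨0, 0, S s⟩ := by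
  set S' : ℝ → Spec := fun s => inclF (hermF (S s)) with hS'
  have hS'i : IsL1Loc S' := fun T hT => by
    have h1 := hSi T hT; rw [intervalIntegrable_iff] at h1 ⊢
    exact (inclF.comp hermF.toLinearIsometry.toContinuousLinearMap).integrable_comp h1
  have h1 : EqOn (fun s => ofSpec κ (evol κ (2 * π) (t - s) (S' s)))
      (fun s => solutionOperator (κ ^ 2) (t - s) ⟨0, 0, S s⟩) (uIoc 0 t) := fun s hs => by
    rw [uIoc_of_le ht] at hs
    have h2 : (⟨0, 0, S s⟩ : Fields).IsL2 := ⟨MemLp.zero, MemLp.zero, Lp.memLp _⟩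
    have h3 : st ⟨0, 0, S s⟩ h2 = (0, 0, S s) :=
      Prod.ext rfl (Prod.ext rfl (Lp.toLp_coeFn (S s) h2.f))
    have h4 : toS κ (0, 0, S s) = S' s := by
      rw [toS_ap]; simp [hS']
    dsimp only
    rw [solutionOperator_eq hκ hl hd h2 (sub_nonneg.2 hs.2), h3, h4]
  have h2 := ii_evol (κ := κ) (η := 2 * π) hS'i (fun s => t - s) (by fun_prop) ht
  have h3 : ∀ᵐ s ∂(volume.restrict (Ioi 0)), ∀ K, 1 ≤ K →
      halfL K (srcS (srcG (G s) (h s))) = truncL K (S' s) := by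
    filter_upwards [hSG, hS.ae_memLp, hS.P0_G, hS.P_h] with s h4 h5 h6 h7 K _
    exact halfL_srcS_eq (memLp_srcF h5.1 h5.2) (srcC_srcG (memLp_srcF h5.1 h5.2) h6 h7) h4 K
  refine ⟨IntervalIntegrable.congr h1 ?_, ?_⟩
  · rw [intervalIntegrable_iff] at h2 ⊢; exact (ofSpec κ).integrable_comp h2
  · rw [duhamel_eq hκ hl hd hS.hasSpecSource_self ht,
      duhZ_eq_duh hl hd hS.hasSpecSource_self.l2Loc hS'i h3 ht, duh,
      ← (ofSpec κ).intervalIntegral_comp_comm h2]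
    exact intervalIntegral.integral_congr_ae (.of_forall fun _ hs => h1 hs)

end Source

/-! ### Decay estimates -/

lemma SBd.of_le_sum {ι : Type*} [Fintype ι] {α p Ψ}
    {Φ : ι → R3 → ℝ≥0∞} {D A} (hm : ∀ i, AEMeasurable (Φ i))
    (h : ∀ i, SBd α p (Φ i) D) (hA : A ≠ ⊤) (hΨ : ∀ᵐ ξ, Ψ ξ ≤ A * ∑ i, Φ i ξ) :
    SBd α p Ψ ((A * card ι + 1) * D) := by
  intro τ m M hτ hmm hM hMt hmt
  have hs : AEMeasurable fun ξ => ‖symb α ξ‖ₑ ^ 2 :=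
    ((cont_symb α).measurable.enorm.pow_const 2).aemeasurable
  have hi i : AEMeasurable fun ξ => m ξ * (‖symb α ξ‖ₑ ^ 2 * Φ i ξ) := hmm.mul (hs.mul (hm i))
  calc ∫⁻ ξ, m ξ * (‖symb α ξ‖ₑ ^ 2 * Ψ ξ)
      ≤ ∫⁻ ξ, A * ∑ i, m ξ * (‖symb α ξ‖ₑ ^ 2 * Φ i ξ) := by
        refine lintegral_mono_ae (hΨ.mono fun ξ hξ => ?_); simp only [← mul_sum]
        rw [mul_left_comm A, mul_left_comm A]; gcongr
    _ = A * ∑ i, ∫⁻ ξ, m ξ * (‖symb α ξ‖ₑ ^ 2 * Φ i ξ) := by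
        rw [lintegral_const_mul' _ _ hA, lintegral_finsetSum' _ fun i _ => hi i]
    _ ≤ A * (card ι * (2 * (spC p τ ^ 2 * (∫⁻ ξ, m ξ) +
          ofReal τ ^ (2 - p) * M) * D ^ 2)) := by
        gcongr
        refine (Finset.sum_le_card_nsmul _ _ _ fun i _ => h i τ m M hτ hmm hM hMt hmt).trans_eq ?_
        rw [nsmul_eq_mul, card_univ]
    _ = A * card ι * (2 * (spC p τ ^ 2 * (∫⁻ ξ, m ξ) +
          ofReal τ ^ (2 - p) * M) * D ^ 2) := by ring
    _ ≤ (A * card ι + 1) ^ 2 * (2 * (spC p τ ^ 2 * (∫⁻ ξ, m ξ) +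
          ofReal τ ^ (2 - p) * M) * D ^ 2) := by
        gcongr
        exact le_self_add.trans (le_self_pow le_add_self two_ne_zero)
    _ = _ := by ring

section Bounds

variable {p : ℝ} (hp : 1 ≤ p) (hp2 : p ≤ 2) (α : MI)

include hp hp2

lemma sBd_st (κ) {U : Fields} (h : U.IsL2) : SBd α p (fun ξ => ‖toS κ (st U h) ξ‖ₑ ^ 2)
      (((ofReal (κ ^ 2) + 1) * 5 + 1) * U.derivNorm α p) := by
  set Φ : Option (Option (Fin 3)) → R3 → ℝ≥0∞ := fun o ξ => o.elim
    (‖hermF (cls U.f) ξ‖ₑ ^ 2) fun o => o.elim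
    (‖(𝓕 (h.rho.toLp _) : L2X) ξ‖ₑ ^ 2) fun j => ‖(𝓕 (cU j (h.u.toLp _)) : L2X) ξ‖ₑ ^ 2 with hΦ
  have hid y : ‖ContinuousLinearMap.id ℂ ℂ y‖ ≤ ‖y‖ := le_rfl
  have h1 := SBd.of_le_sum (D := U.derivNorm α p) (A := ofReal (κ ^ 2) + 1)
    (Ψ := fun ξ => ‖toS κ (st U h) ξ‖ₑ ^ 2) (Φ := Φ) (α := α) (p := p) ?_ ?_ (by simp) ?_
  · simpa using h1
  · rintro (_ | _ | j) <;> exact (Lp.aestronglyMeasurable _).enorm.pow_const 2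
  · rintro (_ | _ | j)
    · exact (sBd_dNormXV hp hp2 h.f hid (θ := fun _ => 1) contDiff_const (by simp) h.f
        (by simp)).mono (le_add_right le_self_add)
    · exact (sBd_dNormX hp hp2 h.rho hid h.rho.coeFn_toLp).mono (le_add_right le_add_self)
    · refine (sBd_dNormX hp hp2 h.u (L := proj j)
        (fun y => PiLp.norm_apply_le y j) ?_).mono le_add_self
      filter_upwards [cU_ae j (h.u.toLp _), h.u.coeFn_toLp] with x h2 h3
      rw [h2, h3]; rfl
  · filter_upwards [en_sq_toS κ (st U h)] with ξ hξ; rw [hξ, sum_option, sum_option]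
    have hc : cls U.f = (st U h).2.2 := dif_pos h.f
    simp only [hΦ, Option.elim, hc]; rw [mul_add, mul_add, add_comm]
    exact add_le_add (le_mul_of_one_le_left' le_add_self)
      (add_le_add (mul_le_mul_left le_self_add _) (le_mul_of_one_le_left' le_add_self))

lemma ex_sBd_srcS : ∃ A : ℝ≥0∞, A ≠ ⊤ ∧ ∀ (α : MI) (G : R3 × R3 → C3)
    (h : R3 × R3 → ℂ), MemLp G 2 → MemLp (weighted h) 2 →
    SBd α p (fun ξ => ‖srcS (srcG G h) ξ‖ₑ ^ 2) (A * sourceDerivNorm α p G h) := by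
  obtain ⟨C, _, hC⟩ := ex_srcS_le
  refine ⟨_, ?_, fun α G h hG hh => SBd.of_le_sum (A := ofReal C)
    (fun r => (Lp.aestronglyMeasurable (srcG G h r)).enorm.pow_const 2) (fun r => ?_)
    (by simp) (hC _)⟩
  · finiteness
  · rcases r with i | o
    · exact (sBd_dNormXV hp hp2 hG (L := proj i)
        (fun y => PiLp.norm_apply_le y i) (θ := fun _ => 1) contDiff_const (by simp)
        (memLp_srcF hG hh (inl i)) (by simp [srcFun])).mono le_self_add
    · exact (sBd_dNormXV hp hp2 hh (L := .id ℂ ℂ) (fun y => le_rfl) (cd_srcW o) (abs_srcW_le o)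
        (memLp_srcF hG hh (inr o)) (by simp [srcFun])).mono le_add_self

end Bounds

lemma le_sq_le_mul (hx : 0 ≤ x) (hd : 0 ≤ d)
    (h : N ^ 2 ≤ ofReal (x * d ^ 2) * S ^ 2) : N ≤ ofReal ((1 + x) * d) * S := by
  rw [← ENNReal.pow_le_pow_left_iff two_ne_zero, mul_pow, ← ofReal_pow (by positivity),
    mul_pow (1 + x)]
  refine h.trans ?_
  gcongr
  nlinarith

def FreqDecay (lam p : ℝ) (α α' : MI) (w : R3 → ℝ≥0∞) (δ : ℝ≥0∞) (C : ℝ) : Prop :=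
  ∀ (Φ : R3 → ℝ≥0∞) (D D₂ : ℝ≥0∞), AEMeasurable Φ → SBd α' p Φ D → SBd α 2 Φ D₂ →
    ∀ t : ℝ, 0 ≤ t → ∫⁻ ξ, w ξ * (‖symb α ξ‖ₑ ^ 2 *
      ofReal (exp (-(rate lam ((2 * π) • ξ) * t))) * Φ ξ) ≤
      ofReal (C * decayRate p (ℓ (α - α')) t ^ 2) * (D ^ 2 + δ * D₂ ^ 2)

section Estimates

variable {κ lam p : ℝ} {α α' : MI} {w : R3 → ℝ≥0∞} {δ : ℝ≥0∞} {C : ℝ} (hκ : 0 < κ) (hl : 0 < lam)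
  (hd : HasDecay κ lam) (hp : 1 ≤ p) (hp2 : p ≤ 2) (hC : 0 ≤ C)
  (hw : FreqDecay lam p α α' w δ C)

include hκ hl hd hp hp2 hC hw

lemma exists_solutionOperator_bound (hδ : δ ^ 2 = δ) : ∃ B : ℝ, 0 ≤ B ∧
    ∀ (U₀ V₀) (hU) (hV : V₀.IsL2),
    (∀ᵐ ξ, ‖toS κ (st V₀ hV) ξ‖ₑ ^ 2 ≤ w ξ * ‖toS κ (st U₀ hU) ξ‖ₑ ^ 2) →
    ∀ t : ℝ, 0 ≤ t → (solutionOperator (κ ^ 2) t V₀).toFields.derivNorm α 2 ≤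
      ofReal (B * decayRate p (ℓ (α - α')) t) * (U₀.derivNorm α' p + δ * U₀.derivNorm α 2) := by
  obtain ⟨C₁, hC₁, h1⟩ := ex_dNorm_le hκ α
  set a : ℝ := (κ ^ 2 + 1) * 5 + 1 with ha
  have ha' : (ofReal (κ ^ 2) + 1) * 5 + 1 = ofReal a := by
    rw [ha, ofReal_add (by positivity) one_pos.le, ofReal_mul (by positivity),
      ofReal_add (by positivity) one_pos.le, ofReal_one, ofReal_ofNat]
  have ha0 : 0 ≤ a := by positivity
  refine ⟨1 + C₁ * 3 * C * a ^ 2, by positivity, fun U₀ V₀ hU hV hVU t ht => ?_⟩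
  refine le_sq_le_mul (by positivity) (Real.rpow_nonneg (by linarith) _) ?_
  refine (h1 _).trans ?_
  rw [solutionOperator_eq hκ hl hd hV ht, toS_ofSpec hκ]
  have h2 := sBd_st hp hp2 α' κ hU
  have h3 := sBd_st one_le_two le_rfl α κ hU
  rw [ha'] at h2 h3
  have h4 := hw _ _ _ ((Lp.aestronglyMeasurable _).enorm.pow_const 2) h2 h3 t ht
  set d := decayRate p (ℓ (α - α')) t
  calc _ ≤ ofReal C₁ * ∫⁻ ξ, 3 * (w ξ * (‖symb α ξ‖ₑ ^ 2 *
        ofReal (exp (-(rate lam ((2 * π) • ξ) * t))) * ‖toS κ (st U₀ hU) ξ‖ₑ ^ 2)) := by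
        gcongr 1; refine lintegral_mono_ae ?_
        filter_upwards [hVU, evol_ae κ (2 * π) t (toS κ (st V₀ hV))] with ξ h5 h6
        have h7 := ofReal_le_ofReal (hd.norm_sq_le ((2 * π) • ξ) (toS κ (st V₀ hV) ξ) ht)
        rw [ofReal_mul (by positivity), ofReal_mul (by positivity),
          ofReal_pow (norm_nonneg _), ofReal_pow (norm_nonneg _), ofReal_norm,
          ofReal_norm, ofReal_ofNat] at h7
        rw [h6]
        refine (mul_le_mul_right (h7.trans (mul_le_mul_right h5 _)) _).trans_eq ?_
        ring
    _ ≤ ofReal C₁ * (3 * (ofReal (C * d ^ 2) *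
        ((ofReal a * U₀.derivNorm α' p) ^ 2 + δ * (ofReal a * U₀.derivNorm α 2) ^ 2))) := by
        rw [lintegral_const_mul' _ _ (by simp)]; gcongr
    _ = ofReal (C₁ * 3 * C * a ^ 2 * d ^ 2) *
        (U₀.derivNorm α' p ^ 2 + δ ^ 2 * U₀.derivNorm α 2 ^ 2) := by
        rw [show C₁ * 3 * C * a ^ 2 * d ^ 2 = C₁ * (3 * ((C * d ^ 2) * a ^ 2)) by ring,
          ofReal_mul hC₁.le, ofReal_mul (p := 3) (by positivity),
          ofReal_mul (p := C * d ^ 2) (by positivity), ofReal_pow ha0, ofReal_ofNat, hδ]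
        ring
    _ ≤ _ := by
        gcongr; rw [add_sq, mul_pow]; exact add_le_add_left le_self_add _

lemma exists_duhamel_bound : ∃ B : ℝ, 0 ≤ B ∧
    ∀ (G : ℝ → R3 × R3 → C3) (h : ℝ → R3 × R3 → ℂ), IsSource G h →
    ∀ (G' : ℝ → R3 × R3 → C3) (h' : ℝ → R3 × R3 → ℂ) (Z : ℝ → Spec),
    HasSpecSource (fun s => sourcePairing (G' s) (h' s)) Z →
    (∀ s, ∀ᵐ ξ, ‖Z s ξ‖ₑ ^ 2 ≤ w ξ * ‖srcS (srcG (G s) (h s)) ξ‖ₑ ^ 2) →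
    ∀ t : ℝ, 0 ≤ t → (duhamel (κ ^ 2) G' h' t).toFields.derivNorm α 2 ^ 2 ≤
      ofReal B * ∫⁻ s in Ioc 0 t, ofReal (decayRate p (ℓ (α - α')) (t - s) ^ 2) *
          (sourceDerivNorm α' p (G s) (h s) ^ 2 + δ * sourceDerivNorm α 2 (G s) (h s) ^ 2) := by
  obtain ⟨C₁, hC₁, h1⟩ := ex_dNorm_le hκ α
  obtain ⟨A, hA, h2⟩ := ex_sBd_srcS hp hp2
  obtain ⟨A', hA', h3⟩ := ex_sBd_srcS one_le_two le_rfl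
  set a : ℝ := (A + A').toReal
  have ha : ofReal a = A + A' := ENNReal.ofReal_toReal (by finiteness)
  refine ⟨C₁ * (3 * (C * a ^ 2)), by positivity, fun G h hS G' h' Z hZ hZw t ht => ?_⟩
  refine (h1 _).trans ?_
  rw [duhamel_eq hκ hl hd hZ ht, toS_ofSpec hκ, ofReal_mul hC₁.le, mul_assoc]
  refine mul_le_mul_right ?_ _
  have h4 := lint_duhZ_le (η := 2 * π) hl hd (m := fun ξ => ‖symb α ξ‖)
    (cont_symb α).norm.measurable hZ.l2Loc ht
  simp at h4
  refine h4.trans ?_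
  rw [ofReal_mul (by norm_num), ofReal_ofNat, mul_assoc]
  refine mul_le_mul_right ?_ _
  rw [← lintegral_const_mul' _ _ ofReal_ne_top]
  refine lintegral_mono_ae ?_
  filter_upwards [ae_restrict_of_ae_restrict_of_subset
    (show Ioc 0 t ⊆ Ioi 0 from Ioc_subset_Ioi_self) hS.ae_memLp,
    ae_restrict_mem measurableSet_Ioc] with s hs hst
  have h5 := hw _ _ _ ((Lp.aestronglyMeasurable _).enorm.pow_const 2)
    ((h2 α' _ _ hs.1 hs.2).mono (mul_le_mul_left (le_self_add.trans_eq ha.symm) _))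
    ((h3 α _ _ hs.1 hs.2).mono (mul_le_mul_left (le_add_self.trans_eq ha.symm) _))
    (t - s) (sub_nonneg.2 hst.2)
  refine le_trans (lintegral_mono_ae ?_) (h5.trans_eq ?_)
  · filter_upwards [hZw s] with ξ h6; refine (mul_le_mul_right h6 _).trans_eq ?_
    ring
  · rw [ofReal_mul hC, ofReal_mul hC, ofReal_pow (p := a) (by positivity)]
    ring

end Estimates

section LowFreq

variable {r₀ : ℝ} {φ : R3 → ℝ} (hφ : IsLowFreqCutoff r₀ φ)

include hφ

lemma en_sq_lowL [NormedSpace ℂ E] (X : Lx E) :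
    ∀ᵐ ξ, ‖lowL hφ X ξ‖ₑ ^ 2 = ‖loS φ ξ‖ₑ ^ 2 * ‖X ξ‖ₑ ^ 2 := by
  filter_upwards [lowL_ae hφ X] with ξ hξ
  rw [hξ, enorm_smul, mul_pow, ← ofReal_norm, norm_real, ofReal_norm]

lemma toS_lowFreq (κ : ℝ) {U : Fields} (hU : U.IsL2) (hV : (U.lowFreq φ).IsL2) :
    ∀ᵐ ξ, ‖toS κ (st (U.lowFreq φ) hV) ξ‖ₑ ^ 2 ≤ ‖loS φ ξ‖ₑ ^ 2 * ‖toS κ (st U hU) ξ‖ₑ ^ 2 := by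
  have hu j : (𝓕 (cU j (st (U.lowFreq φ) hV).2.1) : L2X) = lowL hφ (𝓕 (cU j (st U hU).2.1)) := by
    have h1 := hU.u.eval_piLp j
    have h2 : cU j (st U hU).2.1 = h1.toLp _ := by
      refine Lp.ext ?_
      filter_upwards [cU_ae j (st U hU).2.1, h1.coeFn_toLp, hU.u.coeFn_toLp] with x e1 e2 e3
      rw [e1, e2]; exact congrArg (fun y : C3 => y j) e3
    rw [h2, ← four_lowX hφ h1 (memLp_lowX hφ h1)]; congr 1; refine Lp.ext ?_
    filter_upwards [cU_ae j (st (U.lowFreq φ) hV).2.1, (memLp_lowX hφ h1).coeFn_toLp,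
      hV.u.coeFn_toLp] with x e1 e2 e3
    rw [e1, e2, ← lowX_coord hφ hU.u]; exact congrArg (fun y : C3 => y j) e3
  have hf : hermF (st (U.lowFreq φ) hV).2.2 = lowL hφ (hermF (st U hU).2.2) := by
    have h1 : (st U hU).2.2 = cls U.f := by
      rw [cls, dif_pos hU.f]; rfl
    rw [h1, ← hermF_lowXV hφ hU.f]; rw [cls, dif_pos (memLp_lowXV hφ hU.f)]
    rfl
  have hr : (𝓕 (st (U.lowFreq φ) hV).1 : L2X) = lowL hφ (𝓕 (st U hU).1) :=
    four_lowX hφ hU.rho hV.rho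
  filter_upwards [en_sq_toS κ (st (U.lowFreq φ) hV), en_sq_toS κ (st U hU),
    en_sq_lowL hφ (𝓕 (st U hU).1), en_sq_lowL hφ (hermF (st U hU).2.2),
    ae_all_iff.2 fun j => en_sq_lowL hφ (𝓕 (cU j (st U hU).2.1))] with ξ h1 h2 h3 h4 h5
  rw [h1, h2, hr, hf, h3, h4]
  simp only [hu, h5, ← mul_sum]
  exact le_of_eq (by ring)

lemma srcS_lowL (X : SrcIdx → HL2) : ∀ᵐ ξ, ‖srcS (fun r => lowL hφ (X r)) ξ‖ₑ ^ 2 ≤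
    ‖loS φ ξ‖ₑ ^ 2 * ‖srcS X ξ‖ₑ ^ 2 := by
  have h : srcS (fun r => lowL hφ (X r)) =ᵐ[volume] fun ξ => (loS φ ξ : ℂ) • srcS X ξ := by
    filter_upwards [srcS_ae X, srcS_ae fun r => lowL hφ (X r),
      ae_all_iff.2 fun r => lowL_ae hφ (X r)] with ξ h1 h2 h3
    rw [h1, h2]; simp only [h3, map_smul, ← smul_sum]
    rw [← WithLp.toLp_smul, Prod.smul_mk, smul_zero]
  filter_upwards [h] with ξ hξ
  rw [hξ, enorm_smul, mul_pow, ← ofReal_norm, norm_real, ofReal_norm]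

end LowFreq

end EulerVFP

end Development

theorem theorem5p1 (P : ℝ → ℝ) (hP : 0 < deriv P 1) :
    -- the Cauchy problem is well posed, so that the solution operator and the Duhamel term exist
    (∀ (U₀ : Fields) (G : ℝ → R3 × R3 → C3)
        (h : ℝ → R3 × R3 → ℂ), U₀.IsL2 → IsSource G h →
      ∃ U : ℝ → State, IsWeakSolution (deriv P 1) U₀ G h U ∧
        ∀ V : ℝ → State, IsWeakSolution (deriv P 1) U₀ G h V →
          ∀ t : ℝ, 0 ≤ t → V t = U t) ∧
    -- the Duhamel term is the Bochner integral whenever the source takes values in `L²`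
    (∀ (G : ℝ → R3 × R3 → C3)
        (h : ℝ → R3 × R3 → ℂ), IsSource G h →
      ∀ S : ℝ → Lp ℂ 2 (volume : Measure (R3 × R3)),
        (∀ T : ℝ, 0 ≤ T → IntervalIntegrable S volume 0 T) →
        (∀ᵐ s ∂(volume.restrict (Ioi (0 : ℝ))), ∀ g : 𝓢(R3 × R3, ℂ),
          ∫ z, S s z * g z = sourcePairing (G s) (h s) g) →
        ∀ t : ℝ, 0 ≤ t →
          IntervalIntegrable
            (fun s => solutionOperator (deriv P 1) (t - s) ⟨0, 0, S s⟩) volume 0 t ∧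
          duhamel (deriv P 1) G h t =
            ∫ s in (0 : ℝ)..t, solutionOperator (deriv P 1) (t - s) ⟨0, 0, S s⟩) ∧
    -- the decay estimates
    (∀ p : ℝ, 1 ≤ p → p ≤ 2 → ∀ α α' : Fin 3 → ℕ, α' ≤ α →
      (∃ C : ℝ, 0 < C ∧
        (∀ U₀ : Fields, U₀.IsL2 → ∀ t : ℝ, 0 ≤ t →
          (solutionOperator (deriv P 1) t U₀).toFields.derivNorm α 2 ≤
            ENNReal.ofReal (C * decayRate p (multiLength (α - α')) t) *
              (U₀.derivNorm α' p + U₀.derivNorm α 2)) ∧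
        (∀ (G : ℝ → R3 × R3 → C3)
            (h : ℝ → R3 × R3 → ℂ), IsSource G h →
          ∀ t : ℝ, 0 ≤ t →
          (duhamel (deriv P 1) G h t).toFields.derivNorm α 2 ^ 2 ≤
            ENNReal.ofReal C * ∫⁻ s in Ioc 0 t,
              ENNReal.ofReal
                (decayRate p (multiLength (α - α')) (t - s) ^ 2) *
              (sourceDerivNorm α' p (G s) (h s) ^ 2 +
                sourceDerivNorm α 2 (G s) (h s) ^ 2))) ∧
      -- the sharper estimates for low frequencies
      (∀ (r₀ : ℝ) (φ : R3 → ℝ), 0 < r₀ → IsLowFreqCutoff r₀ φ →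
        ∃ C : ℝ, 0 < C ∧
        (∀ U₀ : Fields, U₀.IsL2 → ∀ t : ℝ, 0 ≤ t →
          (solutionOperator (deriv P 1) t (U₀.lowFreq φ)).toFields.derivNorm α 2 ≤
            ENNReal.ofReal (C * decayRate p (multiLength (α - α')) t) *
              U₀.derivNorm α' p) ∧
        (∀ (G : ℝ → R3 × R3 → C3)
            (h : ℝ → R3 × R3 → ℂ), IsSource G h →
          ∀ t : ℝ, 0 ≤ t →
          (duhamel (deriv P 1) (fun s => lowFreqXV φ (G s))
              (fun s => lowFreqXV φ (h s)) t).toFields.derivNorm α 2 ^ 2 ≤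
            ENNReal.ofReal C * ∫⁻ s in Ioc 0 t,
              ENNReal.ofReal
                (decayRate p (multiLength (α - α')) (t - s) ^ 2) *
              sourceDerivNorm α' p (G s) (h s) ^ 2))) := by
  have hκ := Real.sqrt_pos.2 hP
  obtain ⟨lam, hl, hd⟩ := exists_semig_decay hκ
  have hd : HasDecay √(deriv P 1) lam := hd
  have hc := Real.sq_sqrt hP.le
  set κ := √(deriv P 1)
  rw [← hc]
  refine ⟨fun U₀ G h h₀ hS => ⟨_, isWeakSolution_ofSpec hκ hl hd h₀ hS.hasSpecSource_self,
    fun V hV t ht => hV.eq_ofSpec hκ hl hd h₀ hS.hasSpecSource_self ht⟩,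
    fun G h hS S hSi hSG t ht => hS.duhamel_eq_integral hκ hl hd hSi hSG ht,
    fun p hp hp2 α α' hα => ⟨?_, fun r₀ φ hr hφ => ?_⟩⟩
  · obtain ⟨C, hC, h1⟩ := exists_full_decay hp hl hα
    have hw : FreqDecay lam p α α' 1 1 C := fun Φ D D₂ hm h2 h3 t ht => by
      simpa only [Pi.one_apply, one_mul] using h1 Φ D D₂ hm h2 h3 t ht
    obtain ⟨B, hB, h2⟩ := exists_solutionOperator_bound hκ hl hd hp hp2 hC.le hw (one_pow 2)
    obtain ⟨B', hB', h3⟩ := exists_duhamel_bound hκ hl hd hp hp2 hC.le hw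
    refine ⟨1 + B + B', by positivity, fun U₀ hU t ht => ?_, fun G h hS t ht => ?_⟩
    · have h4 := h2 U₀ U₀ hU hU (Filter.Eventually.of_forall fun ξ => (one_mul _).ge) t ht
      rw [one_mul] at h4
      refine h4.trans (mul_le_mul_left (ENNReal.ofReal_le_ofReal (mul_le_mul_of_nonneg_right
        (by linarith) (Real.rpow_nonneg (by linarith) _))) _)
    · have h4 := h3 G h hS G h _ hS.hasSpecSource_self
        (fun s => Filter.Eventually.of_forall fun ξ => (one_mul _).ge) t ht
      simp only [one_mul] at h4
      exact h4.trans (mul_le_mul_left (ENNReal.ofReal_le_ofReal (by linarith)) _)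
  · obtain ⟨C, hC, h1⟩ := exists_low_decay hp hl hα (r := r₀)
    have hw : FreqDecay lam p α α' (fun ξ => ‖loS φ ξ‖ₑ ^ 2) 0 C :=
      fun Φ D D₂ hm h2 _ t ht => by
        rw [zero_mul, add_zero]
        refine h1 Φ D h2 t ht _ (fun ξ => pow_le_one' ?_ 2) fun ξ hξ => ?_
        · rw [← ofReal_norm]
          exact ENNReal.ofReal_le_one.2 (hφ.abs_lowSymb_le ξ)
        · rw [loS, hφ.eq_zero _ hξ, enorm_zero, zero_pow two_ne_zero]
    obtain ⟨B, hB, h2⟩ := exists_solutionOperator_bound hκ hl hd hp hp2 hC.le hw (by simp)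
    obtain ⟨B', hB', h3⟩ := exists_duhamel_bound hκ hl hd hp hp2 hC.le hw
    refine ⟨1 + B + B', by positivity, fun U₀ hU t ht => ?_, fun G h hS t ht => ?_⟩
    · have h4 := h2 U₀ _ hU (hU.lowFreq hφ) (toS_lowFreq hφ κ hU _) t ht
      rw [zero_mul, add_zero] at h4
      refine h4.trans (mul_le_mul_left (ENNReal.ofReal_le_ofReal (mul_le_mul_of_nonneg_right
        (by linarith) (Real.rpow_nonneg (by linarith) _))) _)
    · have h4 := h3 G h hS _ _ _ (hS.hasSpecSource_lowFreq hφ) (fun s => srcS_lowL hφ _) t ht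
      simp only [zero_mul, add_zero] at h4
      exact h4.trans (mul_le_mul_left (ENNReal.ofReal_le_ofReal (by linarith)) _)
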